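/- Let $P_1,\dots,P_m$, $m\ge 1$, be pairwise disjoint simple polygons (closed regions bounded by simple closed polygonal chains) in the interior of a square, called the frame. Assume that no side of the frame is horizontal or vertical, and that no two distinct vertices of the polygons lie on a common horizontal or vertical line (in particular, no edge is horizontal or vertical). Let $O$ be the union of the polygons with the frame and its exterior. An axis-parallel closed square centred at $p$ is *critical* if its interior misses $O$ and it touches $O$ in at least two points, its *contact points*. The $L_\infty$ medial axis $\mathcal M$ is the set of the centres of all critical squares. Then the closure of $\mathcal M$ is the union of a finite collection of segments, any two of which meet at most in common endpoints. Given any such collection, let $\mathcal M'$ be the *reduced* medial axis, obtained by repeatedly removing the vertices of degree one together with the segments ending there, and let $V$ be the set of vertices of degree at least three of $\mathcal M'$. The *spokes* are the segments that join each $p\in V$ with the contact points of its critical square. The *corridor decomposition* consists of the connected components of $\mathbb R^2\setminus O$ minus all the spokes. The corridor decomposition has $O(m)$ cells: there is an absolute constant $K$ such that it is finite and has at most $Km$ cells. Moreover, if $m\ge 2$ and the critical square of every $p\in V$ has at most as many contact points as $p$ has incident segments in $\mathcal M'$ (for example, if no critical square has more than three contact points), then it has at most $3m-3$ cells. -/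

import Mathlib

noncomputable section

namespace Corridor

/-- The plane. Its distance is the sup distance, so `Metric.closedBall p r` is the closed
axis-parallel square with centre `p` and side length `2 * r`, and `Metric.ball p r` its interior. -/
abbrev Plane : Type := ℝ × ℝ

/-! ### Polygons and the frame -/

/-- A closed polygonal chain is simple if it has at least three edges, its vertices are distinct,
and two distinct edges meet at most in common endpoints. -/
def IsSimple {n : ℕ} (P : Polygon Plane n) : Prop :=
  3 ≤ n ∧ Function.Injective P.vertices ∧
    ∀ i j : Fin n, i ≠ j →
      P.edgeSet ℝ i ∩ P.edgeSet ℝ j ⊆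
        {P i, P (finRotate n i)} ∩ {P j, P (finRotate n j)}

/-- The closed region of a polygon: its boundary chain and all the points enclosed by it, that is,
the points whose component in the complement of the chain is bounded. -/
def region {n : ℕ} (P : Polygon Plane n) : Set Plane :=
  {x | x ∈ P.boundary ℝ ∨ Bornology.IsBounded (connectedComponentIn (P.boundary ℝ)ᶜ x)}

/-- The open square with centre `c` whose sides are parallel to `d` and to `d` rotated by a right
angle, and have twice the Euclidean length of `d`. -/
def openSquare (c d : Plane) : Set Plane :=
  {x | ∃ s t : ℝ, |s| < 1 ∧ |t| < 1 ∧ x = c + s • d + t • ((-d.2, d.1) : Plane)}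

/-- The obstacles: the polygons, and the frame together with everything outside it. -/
def obstacles (c d : Plane) {m : ℕ} {n : Fin m → ℕ} (P : ∀ i, Polygon Plane (n i)) : Set Plane :=
  (openSquare c d)ᶜ ∪ ⋃ i, region (P i)

/-! ### The medial axis -/

/-- The axis-parallel square with centre `p` and side length `2 * r` is critical for the obstacle
set `O`: its interior misses `O`, and it touches `O` in two or more points. -/
def IsCriticalSquare (O : Set Plane) (p : Plane) (r : ℝ) : Prop :=
  0 < r ∧ Disjoint (Metric.ball p r) O ∧ (Metric.closedBall p r ∩ O).Nontrivial

/-- The sup-norm medial axis: the centres of the critical squares. -/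
def medialAxis (O : Set Plane) : Set Plane :=
  {p | ∃ r, IsCriticalSquare O p r}

/-- The points in which the critical square centred at `p` touches the obstacles. -/
def contacts (O : Set Plane) (p : Plane) : Set Plane :=
  {q | ∃ r, IsCriticalSquare O p r ∧ q ∈ Metric.closedBall p r ∩ O}

/-! ### Finite collections of interior disjoint segments -/

/-- A finite collection of nondegenerate segments (given by their endpoints), any two of which meet
at most in common endpoints. -/
def IsSegmentComplex (G : Finset (Plane × Plane)) : Prop :=
  (∀ s ∈ G, s.1 ≠ s.2) ∧
    ∀ s ∈ G, ∀ t ∈ G, s ≠ t →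
      segment ℝ s.1 s.2 ∩ segment ℝ t.1 t.2 ⊆ {s.1, s.2} ∩ {t.1, t.2}

/-- The union of the segments. -/
def carrier (G : Finset (Plane × Plane)) : Set Plane :=
  ⋃ s ∈ G, segment ℝ s.1 s.2

open Classical in
/-- The number of segments with endpoint `x`. -/
def degree (G : Finset (Plane × Plane)) (x : Plane) : ℕ :=
  (G.filter fun s => x = s.1 ∨ x = s.2).card

open Classical in
/-- Remove the vertices of degree one, and the segments ending there. -/
def prune (G : Finset (Plane × Plane)) : Finset (Plane × Plane) :=
  G.filter fun s => degree G s.1 ≠ 1 ∧ degree G s.2 ≠ 1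

/-- Repeat the removal until nothing changes: a round that changes something removes a segment, so
that as many rounds as there are segments suffice. -/
def reduce (G : Finset (Plane × Plane)) : Finset (Plane × Plane) :=
  prune^[G.card] G

theorem prune_subset (G : Finset (Plane × Plane)) : prune G ⊆ G :=
  Finset.filter_subset _ _

/-- The removal process has indeed stopped. -/
theorem prune_reduce (G : Finset (Plane × Plane)) : prune (reduce G) = reduce G := by
  have key : ∀ k (H : Finset (Plane × Plane)), H.card ≤ k →
      prune (prune^[k] H) = prune^[k] H := by
    intro k
    induction k with
    | zero =>
      intro H hH
      have : H = ∅ := Finset.card_eq_zero.1 (Nat.le_zero.1 hH)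
      subst this
      exact Finset.subset_empty.1 (prune_subset ∅)
    | succ k ih =>
      intro H hH
      by_cases h : prune H = H
      · have hk : prune^[k + 1] H = H := Function.iterate_fixed h (k + 1)
        rw [hk, h]
      · have hlt : (prune H).card < H.card :=
          Finset.card_lt_card ((prune_subset H).ssubset_of_ne h)
        rw [Function.iterate_succ_apply]
        exact ih _ (by omega)
  exact key _ G le_rfl

/-! ### The corridor decomposition

Below, `G` is a collection of segments that makes up the medial axis of the obstacles `O`. -/

/-- The vertices of degree at least three of the reduced medial axis. -/
def branchVertices (G : Finset (Plane × Plane)) : Set Plane :=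
  {p | 3 ≤ degree (reduce G) p}

/-- The union of the spokes: the segments joining a vertex of degree at least three of the reduced
medial axis with the contact points of its critical square. -/
def spokes (O : Set Plane) (G : Finset (Plane × Plane)) : Set Plane :=
  ⋃ p ∈ branchVertices G, ⋃ q ∈ contacts O p, segment ℝ p q

/-- The cells of the corridor decomposition: the components into which the spokes cut the
complement of the obstacles. -/
def corridors (O : Set Plane) (G : Finset (Plane × Plane)) : Set (Set Plane) :=
  {C | ∃ x ∈ Oᶜ \ spokes O G, C = connectedComponentIn (Oᶜ \ spokes O G) x}

end Corridor

end

/-! Write `O` for the obstacles and `H` for the reduced medial axis, regarded as a plane graph. Two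
facts about the largest free square at a point are used throughout. When its centre moves straight
towards a contact point, no new contact points appear (`foot_walk_subset`). In general position, it
touches the interior of an edge only with a corner (`Tame.corner`). Hence the radius is, near any
point, given by finitely many affine functions, and the axis lies on finitely many lines and is made
up of segments (`Tame.exists_complex`).

Size of `H`. A point off the axis has a single contact point, and the segment to it avoids the axis.
So if the winding function of a circulation on `H` vanishes on `O`, it vanishes everywhere off the
axis; since it jumps across each segment by a full turn times the flow, the circulation is zero. On
`O` the function is zero on the unbounded part and constant on each polygon, hence `H` has at most
`m` independent cycles (`Tame.card_add_one_le`). This requires that `H` does not meet `O`: the axis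
reaches a point of `O` in at most one direction, and pruning removes such ends
(`Tame.carrier_reduce_subset`). No vertex of `H` has degree one, so counting degrees gives at most
`2m - 2` branch points, the set `V`, with at most `6m - 6` half-edges (`card_le_of_cycles`).

The bound `K * m`. The free space is connected because the plane is unicoherent, so every cell has a
point of `V` in its closure (`IsStar.exists_mem_closure`). A square has at most eight contact
points: one vertex on each side line, and the four corners. So spokes leave a point in at most 16
directions, and at most 16 cells meet there.

The bound `3m - 3`. Near one of its points `p` the axis is a cone. Each sector between consecutive
branches is owned by one contact point of `p`, the one near which the nearby squares touch, and
different sectors have different owners. Hence there are at most as many branches as contact points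
(`LocalPicture.ncard_angles_le`), and the extra hypothesis forces equality at every point of `V`.
Equality excludes degenerate spokes: none runs through another point of `V`, and a point of the axis
on a spoke has only one contact point besides the end of the spoke (`IsBranchStar.unique_second`).
Therefore every point of the axis off `V` leads into exactly one cell: the cell that contains it or,
on a spoke, the cell on the side of the second contact point. This cell is locally constant, so
every segment of `H` is assigned to one cell, and every cell receives a segment that ends in `V`
(`exists_half_edge`). In the subgraph of a cell, vertices outside `V` have degree 0 or 2, so the
number of its half-edges at `V` is even and positive. Twice the number of cells is thus at most `6m
- 6`. -/

noncomputable section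
open Set Filter Topology
namespace Corridor

/-! ### Radius and contact points -/

/-- The half side length of the largest square centred at `p` whose interior misses `O`. -/
def rad (O : Set Plane) (p : Plane) : ℝ := Metric.infDist p O

/-- The points of `O` nearest to `p` in the sup distance. -/
def foot (O : Set Plane) (p : Plane) : Set Plane := Metric.closedBall p (rad O p) ∩ O

theorem rad_nonneg (O : Set Plane) (p : Plane) : 0 ≤ rad O p := Metric.infDist_nonneg

theorem rad_le_dist {O : Set Plane} {p q : Plane} (hq : q ∈ O) : rad O p ≤ dist p q :=
  Metric.infDist_le_dist_of_mem hq

theorem continuous_rad (O : Set Plane) : Continuous (rad O) := Metric.continuous_infDist_pt O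

theorem rad_le_add (O : Set Plane) (x y : Plane) : rad O x ≤ rad O y + dist x y :=
  Metric.infDist_le_infDist_add_dist

theorem rad_pos {O : Set Plane} (hO : IsClosed O) (hne : O.Nonempty) {p : Plane} (hp : p ∉ O) :
    0 < rad O p := (hO.notMem_iff_infDist_pos hne).1 hp

theorem mem_foot {O : Set Plane} {p q : Plane} : q ∈ foot O p ↔ dist p q = rad O p ∧ q ∈ O := by
  unfold foot
  constructor
  · rintro ⟨h1, h2⟩
    refine ⟨le_antisymm ?_ (rad_le_dist h2), h2⟩
    rw [dist_comm]; exact h1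
  · rintro ⟨h1, h2⟩
    refine ⟨?_, h2⟩
    rw [Metric.mem_closedBall, dist_comm, h1]

theorem mem_foot_of_le {O : Set Plane} {p q : Plane} (h : dist p q ≤ rad O p) (hq : q ∈ O) :
    q ∈ foot O p := mem_foot.2 ⟨le_antisymm h (rad_le_dist hq), hq⟩

theorem disjoint_ball_rad (O : Set Plane) (p : Plane) : Disjoint (Metric.ball p (rad O p)) O := by
  rw [Set.disjoint_left]
  intro x hx hxO
  have := rad_le_dist (p := p) hxO
  rw [Metric.mem_ball, dist_comm] at hx
  linarith

theorem foot_nonempty {O : Set Plane} (hO : IsClosed O) (hne : O.Nonempty) (p : Plane) :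
    (foot O p).Nonempty := by
  obtain ⟨q, hq, h⟩ := hO.exists_infDist_eq_dist hne p
  exact ⟨q, mem_foot.2 ⟨h.symm, hq⟩⟩

theorem foot_subset (O : Set Plane) (p : Plane) : foot O p ⊆ O := Set.inter_subset_right

/-- A free interior bounds the radius by the distance to `O`, and a contact point bounds it from
below. So the critical square at a point is unique, and `contacts` may be replaced by `foot`. -/
theorem IsCriticalSquare.rad_eq {O : Set Plane} {p : Plane} {r : ℝ} (h : IsCriticalSquare O p r) :
    r = rad O p := by
  obtain ⟨h0, hd, hn⟩ := h
  obtain ⟨q, hq1, hq2⟩ := hn.nonempty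
  apply le_antisymm
  · by_contra hlt
    push Not at hlt
    obtain ⟨x, hx, hxr⟩ := (Metric.infDist_lt_iff ⟨q, hq2⟩).1 hlt
    exact Set.disjoint_left.1 hd (by rwa [Metric.mem_ball, dist_comm]) hx
  · refine (rad_le_dist hq2).trans ?_
    rw [dist_comm]; exact hq1

theorem mem_medialAxis {O : Set Plane} (hO : IsClosed O) (hne : O.Nonempty) {p : Plane} :
    p ∈ medialAxis O ↔ p ∉ O ∧ (foot O p).Nontrivial := by
  constructor
  · rintro ⟨r, h⟩
    have hr := h.rad_eq
    have h' := h
    rw [hr] at h'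
    refine ⟨fun hp => ?_, h'.2.2⟩
    exact Set.disjoint_left.1 h'.2.1 (Metric.mem_ball_self h'.1) hp
  · rintro ⟨hp, hn⟩
    exact ⟨rad O p, rad_pos hO hne hp, disjoint_ball_rad O p, hn⟩

theorem contacts_eq_foot {O : Set Plane} {p : Plane} (hp : p ∈ medialAxis O) :
    contacts O p = foot O p := by
  obtain ⟨r, h⟩ := hp
  have hr := h.rad_eq
  subst hr
  ext q
  constructor
  · rintro ⟨r, h1, h2⟩
    rw [h1.rad_eq] at h2
    exact h2
  · intro hq
    exact ⟨_, h, hq⟩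

theorem notMem_medialAxis_of_subset_singleton {O : Set Plane} (hO : IsClosed O) (hne : O.Nonempty)
    {p c : Plane} (h : foot O p ⊆ {c}) : p ∉ medialAxis O := by
  intro hp
  obtain ⟨-, a, ha, b, hb, hab⟩ := (mem_medialAxis hO hne).1 hp
  exact hab ((h ha).trans (h hb).symm)

theorem exists_foot_eq_singleton {O : Set Plane} (hO : IsClosed O) (hne : O.Nonempty)
    {p : Plane} (hp : p ∉ O) (hM : p ∉ medialAxis O) : ∃ c, foot O p = {c} := by
  obtain ⟨c, hc⟩ := foot_nonempty hO hne p
  refine ⟨c, Set.Subset.antisymm (fun d hd => ?_) (by simpa using hc)⟩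
  by_contra h
  exact hM ((mem_medialAxis hO hne).2 ⟨hp, d, hd, c, hc, h⟩)

/-! ### Moving the centre towards a contact point -/

section Walk
variable {O : Set Plane} {p q : Plane} {t : ℝ}

theorem dist_walk_left (h0 : 0 ≤ t) : dist p (p + t • (q - p)) = t * dist p q := by
  rw [dist_eq_norm, dist_eq_norm, show p - (p + t • (q - p)) = t • (p - q) by
    rw [← neg_sub q p, smul_neg]; abel, norm_smul, Real.norm_of_nonneg h0]

theorem dist_walk_right (h1 : t ≤ 1) : dist (p + t • (q - p)) q = (1 - t) * dist p q := by
  rw [dist_eq_norm, dist_eq_norm, show p + t • (q - p) - q = (1 - t) • (p - q) by module,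
    norm_smul, Real.norm_of_nonneg (by linarith)]

/-- The point `q` is still a candidate for the distance to `O`, and the radius is 1-Lipschitz; both
bounds agree. -/
theorem rad_walk (hq : q ∈ foot O p) (h0 : 0 ≤ t) (h1 : t ≤ 1) :
    rad O (p + t • (q - p)) = (1 - t) * rad O p := by
  obtain ⟨hd, hqO⟩ := mem_foot.1 hq
  apply le_antisymm
  · exact (rad_le_dist hqO).trans (by rw [dist_walk_right h1, hd])
  · have := rad_le_add O p (p + t • (q - p))
    rw [dist_walk_left h0, hd] at this
    linarith

theorem mem_foot_walk (hq : q ∈ foot O p) (h0 : 0 ≤ t) (h1 : t ≤ 1) :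
    q ∈ foot O (p + t • (q - p)) := by
  obtain ⟨hd, hqO⟩ := mem_foot.1 hq
  exact mem_foot.2 ⟨by rw [rad_walk hq h0 h1, dist_walk_right h1, hd], hqO⟩

/-- By the triangle inequality the smaller square lies inside the old one. In particular, if `p` has
one contact point, so have all points on the way to it, and the segment avoids the medial axis. -/
theorem foot_walk_subset (hq : q ∈ foot O p) (h0 : 0 ≤ t) (h1 : t ≤ 1) :
    foot O (p + t • (q - p)) ⊆ foot O p := by
  intro x hx
  obtain ⟨hd, hxO⟩ := mem_foot.1 hx
  refine mem_foot_of_le ?_ hxO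
  have := dist_triangle p (p + t • (q - p)) x
  rw [hd, dist_walk_left h0, rad_walk hq h0 h1, (mem_foot.1 hq).1] at this
  linarith

theorem walk_notMem (hO : IsClosed O) (hp : p ∉ O) (hq : q ∈ foot O p) (h0 : 0 ≤ t) (h1 : t < 1) :
    p + t • (q - p) ∉ O := by
  have hne : O.Nonempty := ⟨q, foot_subset _ _ hq⟩
  rw [hO.notMem_iff_infDist_pos hne]
  change 0 < rad O _
  rw [rad_walk hq h0 h1.le]
  exact mul_pos (by linarith) (rad_pos hO hne hp)

end Walk

/-- The contact points depend upper semicontinuously on the centre. -/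
theorem eventually_foot_subset {O U : Set Plane} (hO : IsClosed O) {p : Plane} (hU : IsOpen U)
    (h : foot O p ⊆ U) : ∀ᶠ x in 𝓝 p, foot O x ⊆ U := by
  -- For `x` within distance 1 of `p`, the centre moves and the radius grows by less than 1 each, so
  -- the contact points of `x` stay in this ball.
  have hK : IsCompact ((Metric.closedBall p (rad O p + 2) ∩ O) \ U) :=
    ((isCompact_closedBall _ _).inter_right hO).diff hU
  have h1 : ∀ᶠ x in 𝓝 p, ∀ c ∈ (Metric.closedBall p (rad O p + 2) ∩ O) \ U,
      rad O x < dist x c := by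
    apply hK.eventually_forall_of_forall_eventually
    intro c hc
    have hlt : rad O p < dist p c := by
      by_contra hle
      exact hc.2 (h (mem_foot_of_le (not_lt.1 hle) hc.1.2))
    have := (((continuous_rad O).comp continuous_fst).tendsto (p, c)).eventually_lt
      ((continuous_fst.dist continuous_snd).tendsto (p, c)) hlt
    exact this
  filter_upwards [h1, Metric.ball_mem_nhds p one_pos] with x hx hx1 c hc
  by_contra hcU
  obtain ⟨hd, hcO⟩ := mem_foot.1 hc
  have h2 := rad_le_add O x p
  have h3 := dist_triangle p x c
  rw [Metric.mem_ball] at hx1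
  rw [dist_comm p x] at h3
  have := hx c ⟨⟨by rw [Metric.mem_closedBall, dist_comm]; linarith, hcO⟩, hcU⟩
  linarith

theorem medialAxis_subset_compl {O : Set Plane} : medialAxis O ⊆ Oᶜ := by
  rintro p ⟨r, h0, h1, -⟩ hp
  exact Set.disjoint_left.1 h1 (Metric.mem_ball_self h0) hp

end Corridor
end

/-! ### General position and the stability of contact points -/

noncomputable section
open Set Filter Topology
namespace Corridor

/-! ### Tame obstacles -/

/-- The point `x` lies on the line `l.1 * x + l.2.1 * y = l.2.2`. -/
def OnLine (l : ℝ × ℝ × ℝ) (x : Plane) : Prop := l.1 * x.1 + l.2.1 * x.2 = l.2.2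

/-- A closed set with bounded complement whose contact points are either among the finitely many
vertices `Vt`, no two of which share a coordinate, or in the interior of an edge on one of the
finitely many lines `L`, none of which is axis-parallel. -/
structure Tame (O : Set Plane) (Vt : Finset Plane) (L : Finset (ℝ × ℝ × ℝ)) : Prop where
  closed : IsClosed O
  nonempty : O.Nonempty
  bounded : Bornology.IsBounded Oᶜ
  inj_fst : Set.InjOn Prod.fst (Vt : Set Plane)
  inj_snd : Set.InjOn Prod.snd (Vt : Set Plane)
  lines : ∀ l ∈ L, l.1 ≠ 0 ∧ l.2.1 ≠ 0
  site : ∀ x c, x ∉ O → c ∈ foot O x → c ∈ Vt ∨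
    ∃ l ∈ L, OnLine l c ∧ ∀ᶠ c' in 𝓝 c, OnLine l c' → c' ∈ O

/-- The directions of the corners of an axis-parallel square, seen from its centre. -/
def diagDirs : Finset Plane := {1, -1} ×ˢ {1, -1}

theorem mem_diagDirs {κ : Plane} :
    κ ∈ diagDirs ↔ (κ.1 = 1 ∨ κ.1 = -1) ∧ (κ.2 = 1 ∨ κ.2 = -1) := by
  simp [diagDirs]

theorem card_diagDirs_le : diagDirs.card ≤ 4 := by
  unfold diagDirs
  rw [Finset.card_product]
  have : ({1, -1} : Finset ℝ).card ≤ 2 := Finset.card_le_two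
  nlinarith

theorem dist_eq_max (x y : Plane) : dist x y = max |x.1 - y.1| |x.2 - y.2| := rfl

theorem abs_fst_le (x y : Plane) : |x.1 - y.1| ≤ dist x y := le_max_left _ _
theorem abs_snd_le (x y : Plane) : |x.2 - y.2| ≤ dist x y := le_max_right _ _

theorem dist_add_diag {x κ : Plane} {r : ℝ} (hr : 0 ≤ r) (hκ : κ ∈ diagDirs) :
    dist x (x + r • κ) = r := by
  obtain ⟨h1, h2⟩ := mem_diagDirs.1 hκ
  rw [dist_eq_max]
  rcases h1 with h1 | h1 <;> rcases h2 with h2 | h2 <;> simp [h1, h2, abs_of_nonneg hr]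

/-- The displacement is opposite in sign to `a`: the sum is `a * (1 - τ * f ^ 2)`. -/
theorem eventually_abs_lt {a r f : ℝ} (hr : 0 < r) (ha : |a| = r) (hf : f ≠ 0) :
    ∀ᶠ τ in 𝓝[>] (0 : ℝ), |a + (-(τ * (a * f))) * f| < r := by
  have h2 : ∀ᶠ τ in 𝓝[>] (0 : ℝ), τ * f ^ 2 < 1 := by
    have : Tendsto (fun τ : ℝ => τ * f ^ 2) (𝓝[>] 0) (𝓝 (0 * f ^ 2)) :=
      ((continuous_id.mul continuous_const).tendsto 0).mono_left nhdsWithin_le_nhds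
    rw [zero_mul] at this
    exact this.eventually_lt_const one_pos
  filter_upwards [h2, self_mem_nhdsWithin] with τ h2 h3
  have h3 : 0 < τ := h3
  have hf2 : 0 < f ^ 2 := by positivity
  rw [show a + (-(τ * (a * f))) * f = a * (1 - τ * f ^ 2) by ring, abs_mul, ha,
    abs_of_pos (by linarith)]
  nlinarith [mul_pos h3 hf2]

variable {O : Set Plane} {Vt : Finset Plane} {L : Finset (ℝ × ℝ × ℝ)}

/-- Contact points in the interior of an edge are corners of the square. -/
theorem Tame.corner (T : Tame O Vt L) {x c : Plane} (hx : x ∉ O) (hc : c ∈ foot O x)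
    (hv : c ∉ Vt) : ∃ κ ∈ diagDirs, c = x + rad O x • κ ∧
      ∃ l ∈ L, OnLine l c ∧ (∀ᶠ c' in 𝓝 c, OnLine l c' → c' ∈ O) ∧
        l.1 * κ.1 + l.2.1 * κ.2 ≠ 0 := by
  obtain ⟨l, hl, hlc, hev⟩ := (T.site x c hx hc).resolve_left hv
  obtain ⟨hl1, hl2⟩ := T.lines l hl
  have hr := rad_pos T.closed T.nonempty hx
  obtain ⟨hd, hcO⟩ := mem_foot.1 hc
  set r := rad O x with hrdef
  -- A short move of `c` along its line stays in `O`, hence cannot enter the open square.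
  have key : ∀ᶠ t in 𝓝 (0 : ℝ), r ≤ max |c.1 - x.1 + t * (-l.2.1)| |c.2 - x.2 + t * l.1| := by
    have hcont : Tendsto (fun t : ℝ => ((c.1 + t * (-l.2.1), c.2 + t * l.1) : Plane)) (𝓝 0)
        (𝓝 c) := by
      have : Continuous (fun t : ℝ => ((c.1 + t * (-l.2.1), c.2 + t * l.1) : Plane)) := by fun_prop
      simpa using this.tendsto 0
    filter_upwards [hcont.eventually hev] with t ht
    have hO : ((c.1 + t * (-l.2.1), c.2 + t * l.1) : Plane) ∈ O := by
      apply ht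
      unfold OnLine at hlc ⊢
      simp only
      linarith
    have := rad_le_dist (p := x) hO
    rw [dist_comm, dist_eq_max] at this
    convert this using 3 <;> simp only <;> ring
  have hkey : ∀ k : ℝ, ∀ᶠ τ in 𝓝[>] (0 : ℝ),
      r ≤ max |c.1 - x.1 + (-(τ * k)) * (-l.2.1)| |c.2 - x.2 + (-(τ * k)) * l.1| := by
    intro k
    have : Tendsto (fun τ : ℝ => -(τ * k)) (𝓝[>] 0) (𝓝 0) := by
      have : Continuous (fun τ : ℝ => -(τ * k)) := by fun_prop
      have := (this.tendsto 0).mono_left (nhdsWithin_le_nhds (s := Set.Ioi 0))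
      simpa using this
    exact this.eventually key
  have hsmall : ∀ (b f k : ℝ), |b| < r → ∀ᶠ τ in 𝓝[>] (0 : ℝ), |b + (-(τ * k)) * f| < r := by
    intro b f k hb
    have : Continuous (fun τ : ℝ => |b + (-(τ * k)) * f|) := by fun_prop
    have := (this.tendsto 0).mono_left (nhdsWithin_le_nhds (s := Set.Ioi 0))
    exact this.eventually_lt_const (by simpa using hb)
  have hmax : max |c.1 - x.1| |c.2 - x.2| = r := by
    rw [← hd, dist_comm, dist_eq_max]
  -- If only one coordinate attained the distance `r`, a short move along the line, which is not
  -- axis-parallel, would decrease that one and keep the other below `r`.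
  have ha : |c.1 - x.1| = r := by
    by_contra hne
    have hlt : |c.1 - x.1| < r := lt_of_le_of_ne (hmax ▸ le_max_left _ _) hne
    have hb : |c.2 - x.2| = r := by
      rcases max_choice |c.1 - x.1| |c.2 - x.2| with h | h
      · exact absurd (h ▸ hmax) hne
      · rw [← hmax, h]
    obtain ⟨τ, h1, h2, h3⟩ := ((hkey _).and ((hsmall _ (-l.2.1) _ hlt).and
      (eventually_abs_lt hr hb hl1))).exists
    exact absurd (max_lt h2 h3) (not_lt.2 h1)
  have hb : |c.2 - x.2| = r := by
    by_contra hne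
    have hlt : |c.2 - x.2| < r := lt_of_le_of_ne (hmax ▸ le_max_right _ _) hne
    obtain ⟨τ, h1, h2, h3⟩ := ((hkey _).and ((hsmall _ l.1 _ hlt).and
      (eventually_abs_lt hr ha (neg_ne_zero.2 hl2)))).exists
    exact absurd (max_lt h3 h2) (not_lt.2 h1)
  have hcase : ∀ {a : ℝ}, |a| = r → a / r = 1 ∨ a / r = -1 := by
    intro a ha
    rcases abs_eq hr.le |>.1 ha with h | h
    · left; rw [h, div_self hr.ne']
    · right; rw [h, neg_div, div_self hr.ne']
  refine ⟨((c.1 - x.1) / r, (c.2 - x.2) / r), mem_diagDirs.2 ⟨hcase ha, hcase hb⟩, ?_, l, hl, hlc,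
    hev, ?_⟩
  · ext <;> simp <;> field_simp <;> ring
  -- Otherwise the line would run along the diagonal through the centre, and one and the same move
  -- would decrease both coordinates.
  · intro h0
    have h0' : l.1 * (c.1 - x.1) + l.2.1 * (c.2 - x.2) = 0 := by
      have := congrArg (fun z => z * r) h0
      simp only [zero_mul] at this
      rw [← this]
      field_simp
    set a := c.1 - x.1
    set b := c.2 - x.2
    have ha0 : a ≠ 0 := by intro h; rw [h, abs_zero] at ha; exact hr.ne ha
    have hb0 : b ≠ 0 := by intro h; rw [h, abs_zero] at hb; exact hr.ne hb
    have e1 := eventually_abs_lt hr ha (neg_ne_zero.2 hl2)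
    have e2 := eventually_abs_lt hr hb hl1
    have hab : a * (-l.2.1) = b * l.1 := by
      have h1 : a ^ 2 = b ^ 2 := by rw [← sq_abs, ha, ← hb, sq_abs]
      have h2 : (a * (-l.2.1) - b * l.1) * b = 0 := by
        have : l.2.1 * b = - (l.1 * a) := by linarith
        calc (a * (-l.2.1) - b * l.1) * b = -a * (l.2.1 * b) - b ^ 2 * l.1 := by ring
          _ = l.1 * (a ^ 2 - b ^ 2) := by rw [this]; ring
          _ = 0 := by rw [h1]; ring
      have := (mul_eq_zero.1 h2).resolve_right hb0
      linarith
    rw [← hab] at e2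
    obtain ⟨τ, h1, h2, h3⟩ := ((hkey _).and (e1.and e2)).exists
    exact absurd (max_lt h2 h3) (not_lt.2 h1)

/-- Each of the four side lines contains at most one vertex, and all other contact points are among
the four corners. -/
theorem Tame.encard_foot_le (T : Tame O Vt L) {x : Plane} (hx : x ∉ O) :
    (foot O x).encard ≤ 8 := by
  set r := rad O x
  set S : ℝ → Set Plane := fun a => {v | v ∈ Vt ∧ v.1 = a}
  set S' : ℝ → Set Plane := fun a => {v | v ∈ Vt ∧ v.2 = a}
  have hsub : foot O x ⊆ (((S (x.1 + r) ∪ S (x.1 - r)) ∪ (S' (x.2 + r) ∪ S' (x.2 - r)))) ∪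
      ((fun κ => x + r • κ) '' (diagDirs : Set Plane)) := by
    intro c hc
    by_cases hv : c ∈ Vt
    · left
      have hd := (mem_foot.1 hc).1
      rw [dist_comm, dist_eq_max] at hd
      rcases max_choice |c.1 - x.1| |c.2 - x.2| with h | h <;> rw [h] at hd
      · left
        rcases (abs_eq (rad_nonneg O x)).1 hd with h | h
        · left; exact ⟨hv, by simp only [r]; linarith⟩
        · right; exact ⟨hv, by simp only [r]; linarith⟩
      · right
        rcases (abs_eq (rad_nonneg O x)).1 hd with h | h
        · left; exact ⟨hv, by simp only [r]; linarith⟩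
        · right; exact ⟨hv, by simp only [r]; linarith⟩
    · right
      obtain ⟨κ, hκ, h, -⟩ := T.corner hx hc hv
      exact ⟨κ, hκ, h.symm⟩
  have hS : ∀ a, (S a).encard ≤ 1 := fun a => Set.encard_le_one_iff.2
    fun u v hu hv => T.inj_fst hu.1 hv.1 (hu.2.trans hv.2.symm)
  have hS' : ∀ a, (S' a).encard ≤ 1 := fun a => Set.encard_le_one_iff.2
    fun u v hu hv => T.inj_snd hu.1 hv.1 (hu.2.trans hv.2.symm)
  have hD : ((fun κ => x + r • κ) '' (diagDirs : Set Plane)).encard ≤ 4 := by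
    refine (Set.encard_image_le _ _).trans ?_
    rw [Set.encard_coe_eq_coe_finsetCard]
    exact_mod_cast card_diagDirs_le
  refine (Set.encard_le_encard hsub).trans ((Set.encard_union_le _ _).trans ?_)
  have h1 := (Set.encard_union_le (S (x.1 + r)) (S (x.1 - r))).trans (add_le_add (hS _) (hS _))
  have h2 := (Set.encard_union_le (S' (x.2 + r)) (S' (x.2 - r))).trans (add_le_add (hS' _) (hS' _))
  have h3 := (Set.encard_union_le _ _).trans (add_le_add h1 h2)
  refine (add_le_add h3 hD).trans ?_
  norm_num

theorem Tame.finite_foot (T : Tame O Vt L) {x : Plane} (hx : x ∉ O) : (foot O x).Finite :=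
  Set.finite_of_encard_le_coe (k := 8) (T.encard_foot_le hx)

/-- One coordinate of a square that shrinks towards a contact point with offset `a`: its centre
moves by `t * a`, so the side at `b = ±r` is kept only if the centre moves towards it at full speed.
-/
theorem eq_of_abs_sub_mul_le {a b t r : ℝ} (ht : 0 < t) (hb : |b| = r) (ha : |a| ≤ r)
    (h : |b - t * a| ≤ (1 - t) * r) : a = b := by
  have hr : 0 ≤ r := hb ▸ abs_nonneg b
  obtain ⟨h1, h2⟩ := abs_le.1 ha
  obtain ⟨h3, h4⟩ := abs_le.1 h
  rcases (abs_eq hr).1 hb with hb | hb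
  · have : t * r ≤ t * a := by rw [hb] at h4; linarith
    have := le_of_mul_le_mul_left this ht
    linarith
  · have : t * a ≤ t * (-r) := by rw [hb] at h3; linarith
    have := le_of_mul_le_mul_left this ht
    linarith

/-- A second contact point of a square centred on the way from `p` to a contact point `q` is a
vertex, while `q` is not. -/
theorem Tame.second_contact (T : Tame O Vt L) {p q q' : Plane} {t : ℝ} (hp : p ∉ O)
    (hq : q ∈ foot O p) (h0 : 0 < t) (h1 : t < 1) (hq' : q' ∈ foot O (p + t • (q - p)))
    (hne : q' ≠ q) : q' ∈ Vt ∧ q ∉ Vt := by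
  have hq'p := foot_walk_subset hq h0.le h1.le hq'
  have e1 : dist q p = rad O p := by rw [dist_comm]; exact (mem_foot.1 hq).1
  have e2 : dist q' p = rad O p := by rw [dist_comm]; exact (mem_foot.1 hq'p).1
  have e3 : dist q' (p + t • (q - p)) = (1 - t) * rad O p := by
    rw [dist_comm, (mem_foot.1 hq').1, rad_walk hq h0.le h1.le]
  -- If `q'` is on a vertical side of the square at `p` and still in the smaller square, then `q` is
  -- on that side as well.
  have k1 : |q'.1 - p.1| = rad O p → q.1 = q'.1 := by
    intro h
    have := eq_of_abs_sub_mul_le (a := q.1 - p.1) h0 h (e1 ▸ abs_fst_le q p) (by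
      rw [← e3]
      refine le_trans (le_of_eq ?_) (abs_fst_le _ _)
      simp only [Prod.fst_add, Prod.smul_fst, Prod.fst_sub, smul_eq_mul]
      ring_nf)
    linarith
  have k2 : |q'.2 - p.2| = rad O p → q.2 = q'.2 := by
    intro h
    have := eq_of_abs_sub_mul_le (a := q.2 - p.2) h0 h (e1 ▸ abs_snd_le q p) (by
      rw [← e3]
      refine le_trans (le_of_eq ?_) (abs_snd_le _ _)
      simp only [Prod.snd_add, Prod.smul_snd, Prod.snd_sub, smul_eq_mul]
      ring_nf)
    linarith
  -- Were `q'` a corner, `q` would share both coordinates with it.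
  have hv : q' ∈ Vt := by
    by_contra hv
    obtain ⟨κ, hκ, h, -⟩ := T.corner hp hq'p hv
    obtain ⟨g1, g2⟩ := mem_diagDirs.1 hκ
    apply hne
    have f1 : |q'.1 - p.1| = rad O p := by
      rw [h]; rcases g1 with g | g <;> simp [g, abs_of_nonneg (rad_nonneg O p)]
    have f2 : |q'.2 - p.2| = rad O p := by
      rw [h]; rcases g2 with g | g <;> simp [g, abs_of_nonneg (rad_nonneg O p)]
    exact Prod.ext (k1 f1).symm (k2 f2).symm
  refine ⟨hv, fun hqv => hne ?_⟩
  rw [dist_eq_max] at e2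
  rcases max_choice |q'.1 - p.1| |q'.2 - p.2| with h | h <;> rw [h] at e2
  · exact T.inj_fst hv hqv (k1 e2).symm
  · exact T.inj_snd hv hqv (k2 e2).symm

/-- The contact points of `x` are close to contact points of `p` and are obtained from them by a
parallel displacement of the corners of the square. -/
def NearContacts (O : Set Plane) (p : Plane) (δ : ℝ) (x : Plane) : Prop :=
  x ∉ O ∧ (∀ c ∈ foot O x, ∃ q ∈ foot O p, dist c q < δ) ∧
    ∀ q ∈ foot O p, ∀ c ∈ foot O x, dist c q < δ →
      (c = q ∨ ∃ μ : ℝ, 0 < μ ∧ c - x = μ • (q - p)) ∧ ∀ c' ∈ foot O x, dist c' q < δ → c' = c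

theorem exists_separation {s : Set Plane} (hs : s.Finite) :
    ∃ δ > 0, ∀ u ∈ s, ∀ v ∈ s, u ≠ v → 3 * δ ≤ dist u v := by
  have : ∀ᶠ δ in 𝓝[>] (0 : ℝ), ∀ u ∈ s, ∀ v ∈ s, u ≠ v → 3 * δ ≤ dist u v := by
    rw [eventually_all_finite hs]
    intro u _
    rw [eventually_all_finite hs]
    intro v _
    by_cases huv : u = v
    · exact Eventually.of_forall fun _ h => absurd huv h
    · have h0 : 0 < dist u v := dist_pos.2 huv
      have : Tendsto (fun δ : ℝ => 3 * δ) (𝓝[>] 0) (𝓝 (3 * 0)) :=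
        ((continuous_const.mul continuous_id).tendsto 0).mono_left nhdsWithin_le_nhds
      rw [mul_zero] at this
      filter_upwards [this.eventually_lt_const h0] with δ h _ using h.le
  obtain ⟨δ, h, h0⟩ := (this.and self_mem_nhdsWithin).exists
  exact ⟨δ, h0, h⟩

theorem OnLine.eq_of_fst {l : ℝ × ℝ × ℝ} (h2 : l.2.1 ≠ 0) {x y : Plane}
    (hx : OnLine l x) (hy : OnLine l y) (h : x.1 = y.1) : x = y := by
  unfold OnLine at hx hy
  refine Prod.ext h (mul_left_cancel₀ h2 ?_)
  rw [h] at hx; linarith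

theorem OnLine.eq_of_snd {l : ℝ × ℝ × ℝ} (h1 : l.1 ≠ 0) {x y : Plane}
    (hx : OnLine l x) (hy : OnLine l y) (h : x.2 = y.2) : x = y := by
  unfold OnLine at hx hy
  refine Prod.ext (mul_left_cancel₀ h1 ?_) h
  rw [h] at hx; linarith

theorem isClosed_onLine (l : ℝ × ℝ × ℝ) : IsClosed {x | OnLine l x} := by
  unfold OnLine
  exact isClosed_eq (by fun_prop) (by fun_prop)

/-- A vertex does not move, and a contact with an edge is a corner `x + rad O x • κ`, which depends
continuously on `x`. For `x` close to `p`, a contact point near `q` is therefore either `q` itself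
or the corner in the same direction `κ` as `q`, and then the displacement from the centre is scaled
by the ratio of the radii. It is unique by the case distinction vertex or corner. -/
theorem Tame.exists_nearContacts (T : Tame O Vt L) {p : Plane} (hp : p ∉ O) :
    ∃ δ > 0, (∀ q ∈ foot O p, ∀ q' ∈ foot O p, q ≠ q' → 3 * δ ≤ dist q q') ∧
      ∀ᶠ x in 𝓝 p, NearContacts O p δ x := by
  obtain ⟨δ, hδ, hsep⟩ := exists_separation ((T.finite_foot hp).union Vt.finite_toSet)
  refine ⟨δ, hδ, fun q hq q' hq' => hsep q (.inl hq) q' (.inl hq'), ?_⟩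
  have hrp := rad_pos T.closed T.nonempty hp
  have hc : ∀ κ : Plane, Continuous fun x => x + rad O x • κ := fun κ =>
    continuous_id.add ((continuous_rad O).smul continuous_const)
  have E0 : ∀ᶠ x in 𝓝 p, x ∉ O := T.closed.isOpen_compl.mem_nhds hp
  have E1 : ∀ᶠ x in 𝓝 p, foot O x ⊆ ⋃ q ∈ foot O p, Metric.ball q δ :=
    eventually_foot_subset T.closed (isOpen_biUnion fun _ _ => Metric.isOpen_ball)
      fun q hq => mem_biUnion hq (Metric.mem_ball_self hδ)
  have E2 : ∀ᶠ x in 𝓝 p, ∀ κ ∈ diagDirs, x + rad O x • κ ∈ O → p + rad O p • κ ∈ O := by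
    rw [Finset.eventually_all]
    intro κ _
    by_cases h : p + rad O p • κ ∈ O
    · exact Eventually.of_forall fun _ _ => h
    · filter_upwards [(hc κ).continuousAt.preimage_mem_nhds (T.closed.isOpen_compl.mem_nhds h)]
        with x hx hx' using absurd hx' hx
  have E3 : ∀ᶠ x in 𝓝 p, ∀ κ ∈ diagDirs, dist (x + rad O x • κ) (p + rad O p • κ) < δ := by
    rw [Finset.eventually_all]
    intro κ _
    exact (hc κ).continuousAt.eventually (Metric.ball_mem_nhds _ hδ)
  have E4 : ∀ᶠ x in 𝓝 p, ∀ κ ∈ diagDirs, ∀ l ∈ L, OnLine l (x + rad O x • κ) →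
      OnLine l (p + rad O p • κ) := by
    rw [Finset.eventually_all]
    intro κ _
    rw [Finset.eventually_all]
    intro l _
    by_cases h : OnLine l (p + rad O p • κ)
    · exact Eventually.of_forall fun _ _ => h
    · filter_upwards [(hc κ).continuousAt.preimage_mem_nhds
        ((isClosed_onLine l).isOpen_compl.mem_nhds h)] with x hx hx' using absurd hx' hx
  filter_upwards [E0, E1, E2, E3, E4, Metric.ball_mem_nhds p hrp] with x e0 e1 e2 e3 e4 e5
  have hW : ∀ q ∈ foot O p, ∀ c ∈ foot O x, dist c q < δ → c ∉ Vt →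
      ∃ κ ∈ diagDirs, c = x + rad O x • κ ∧ q = p + rad O p • κ ∧ ∃ l ∈ L, OnLine l c := by
    intro q hq c hc hcq hv
    obtain ⟨κ, hκ, h, l, hl, hlc, -⟩ := T.corner e0 hc hv
    refine ⟨κ, hκ, h, ?_, l, hl, hlc⟩
    have hO : p + rad O p • κ ∈ O := e2 κ hκ (h ▸ foot_subset _ _ hc)
    have hf : p + rad O p • κ ∈ foot O p := mem_foot_of_le (dist_add_diag hrp.le hκ).le hO
    by_contra hne
    have h1 := hsep q (.inl hq) _ (.inl hf) hne
    have h2 := e3 κ hκ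
    rw [← h] at h2
    have := dist_triangle_left q (p + rad O p • κ) c
    linarith
  have hV : ∀ q ∈ foot O p, ∀ c ∈ foot O x, dist c q < δ → c ∈ Vt → c = q := by
    intro q hq c hc hcq hv
    by_contra hne
    have := hsep c (.inr hv) q (.inl hq) hne
    linarith [dist_nonneg (x := c) (y := q)]
  -- The corner `c'` and the vertex `c` are on a common side of the square at `x`; as `x` is closer
  -- to `p` than the radius, this is the side of direction `κ`. So they share a coordinate. Both are
  -- on the edge line, which is not axis-parallel, hence they agree.
  have hmix : ∀ q ∈ foot O p, ∀ c ∈ foot O x, ∀ c' ∈ foot O x, dist c q < δ → dist c' q < δ →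
      c ∈ Vt → c' ∉ Vt → c' = c := by
    intro q hq c hc c' hc' hcq hcq' hv hv'
    have hcq := hV q hq c hc hcq hv
    subst hcq
    obtain ⟨κ, hκ, h, h', l, hl, hlc⟩ := hW c hq c' hc' hcq' hv'
    have hlq : OnLine l c := by rw [h']; exact e4 κ hκ l hl (h ▸ hlc)
    obtain ⟨n1, n2⟩ := T.lines l hl
    obtain ⟨g1, g2⟩ := mem_diagDirs.1 hκ
    have hd := (mem_foot.1 hc).1
    rw [dist_comm, dist_eq_max] at hd
    rw [Metric.mem_ball] at e5
    have a1 := abs_lt.1 ((abs_fst_le x p).trans_lt e5)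
    have a2 := abs_lt.1 ((abs_snd_le x p).trans_lt e5)
    have b1 : c.1 = p.1 + rad O p * κ.1 := by rw [h']; simp
    have b2 : c.2 = p.2 + rad O p * κ.2 := by rw [h']; simp
    have b1' : c'.1 = x.1 + rad O x * κ.1 := by rw [h]; simp
    have b2' : c'.2 = x.2 + rad O x * κ.2 := by rw [h]; simp
    rcases max_choice |c.1 - x.1| |c.2 - x.2| with hm | hm <;> rw [hm] at hd
    · refine hlc.eq_of_fst n2 hlq ?_
      rcases g1 with g | g <;> rw [g] at b1 b1'
      · rw [abs_of_pos (by linarith)] at hd; linarith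
      · rw [abs_of_neg (by linarith)] at hd; linarith
    · refine hlc.eq_of_snd n1 hlq ?_
      rcases g2 with g | g <;> rw [g] at b2 b2'
      · rw [abs_of_pos (by linarith)] at hd; linarith
      · rw [abs_of_neg (by linarith)] at hd; linarith
  refine ⟨e0, fun c hc => ?_, fun q hq c hc hcq => ⟨?_, fun c' hc' hcq' => ?_⟩⟩
  · obtain ⟨q, hq, h⟩ := mem_iUnion₂.1 (e1 hc)
    exact ⟨q, hq, h⟩
  · by_cases hv : c ∈ Vt
    · exact .inl (hV q hq c hc hcq hv)
    · right
      obtain ⟨κ, hκ, h, h', -⟩ := hW q hq c hc hcq hv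
      refine ⟨rad O x / rad O p, div_pos (rad_pos T.closed T.nonempty e0) hrp, ?_⟩
      rw [h, h', add_sub_cancel_left, add_sub_cancel_left, smul_smul, div_mul_cancel₀ _ hrp.ne']
  · by_cases hv : c ∈ Vt <;> by_cases hv' : c' ∈ Vt
    · rw [hV q hq c hc hcq hv, hV q hq c' hc' hcq' hv']
    · exact hmix q hq c hc c' hc' hcq hcq' hv hv'
    · exact (hmix q hq c' hc' c hc hcq' hcq hv' hv).symm
    · obtain ⟨κ, hκ, h, h1, -⟩ := hW q hq c hc hcq hv
      obtain ⟨κ', hκ', h', h2, -⟩ := hW q hq c' hc' hcq' hv'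
      have : rad O p • κ = rad O p • κ' := by
        have := h1.symm.trans h2
        simpa using this
      rw [h, h', smul_right_injective _ hrp.ne' this]

theorem Tame.mem_medialAxis (T : Tame O Vt L) {p : Plane} :
    p ∈ medialAxis O ↔ p ∉ O ∧ (foot O p).Nontrivial :=
  Corridor.mem_medialAxis T.closed T.nonempty

/-- The medial axis is closed in the complement of the obstacles. -/
theorem Tame.closure_medialAxis (T : Tame O Vt L) {p : Plane} (hp : p ∉ O)
    (h : p ∈ closure (medialAxis O)) : p ∈ medialAxis O := by
  by_contra hM
  obtain ⟨q, hq⟩ := exists_foot_eq_singleton T.closed T.nonempty hp hM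
  obtain ⟨δ, hδ, -, hev⟩ := T.exists_nearContacts hp
  obtain ⟨x, hx, hxM⟩ := (mem_closure_iff_frequently.1 h).and_eventually hev |>.exists
  obtain ⟨-, hx1, hx2⟩ := hxM
  obtain ⟨-, a, ha, b, hb, hab⟩ := T.mem_medialAxis.1 hx
  obtain ⟨q1, hq1, h1⟩ := hx1 a ha
  obtain ⟨q2, hq2, h2⟩ := hx1 b hb
  rw [hq] at hq1 hq2
  have e1 : q1 = q := hq1
  have e2 : q2 = q := hq2
  subst e1; subst e2
  exact hab ((hx2 q2 (hq ▸ rfl) b hb h2).2 a ha h1)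

theorem Tame.isBounded_medialAxis (T : Tame O Vt L) : Bornology.IsBounded (medialAxis O) :=
  T.bounded.subset medialAxis_subset_compl

end Corridor
end

/-! ### Ownership of nearby centres, and the line arrangement that carries the axis -/

noncomputable section
open Set Filter Topology
namespace Corridor

/-! ### Polar coordinates -/

/-- The unit vector of angle `θ`. -/
def unitVec (θ : ℝ) : Plane := (Real.cos θ, Real.sin θ)

theorem continuous_unitVec : Continuous unitVec := by unfold unitVec; fun_prop

/-- Polar coordinates are Euclidean, while the distance is the sup distance; so `ρ` only bounds the
distance from above. The converse, up to a factor 2, is `half_le_norm_unitVec`. -/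
theorem norm_unitVec_le (θ : ℝ) : ‖unitVec θ‖ ≤ 1 := by
  unfold unitVec
  rw [Prod.norm_def]
  exact max_le (Real.abs_cos_le_one θ) (Real.abs_sin_le_one θ)

theorem unitVec_ne_zero (θ : ℝ) : unitVec θ ≠ 0 := by
  intro h
  have h1 : Real.cos θ = 0 := congrArg Prod.fst h
  have h2 : Real.sin θ = 0 := congrArg Prod.snd h
  have := Real.sin_sq_add_cos_sq θ
  rw [h1, h2] at this
  norm_num at this

theorem exists_polar {w : Plane} (hw : w ≠ 0) : ∃ ρ : ℝ, 0 < ρ ∧ ∃ θ, w = ρ • unitVec θ := by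
  set z : ℂ := ⟨w.1, w.2⟩
  have hz : z ≠ 0 := by
    intro h
    apply hw
    have h1 := congrArg Complex.re h
    have h2 := congrArg Complex.im h
    exact Prod.ext h1 h2
  refine ⟨‖z‖, norm_pos_iff.2 hz, z.arg, ?_⟩
  unfold unitVec
  refine Prod.ext ?_ ?_
  · simp [Complex.norm_mul_cos_arg, z]
  · simp [Complex.norm_mul_sin_arg, z]

theorem dist_add_unitVec_lt {p : Plane} {ρ ε θ : ℝ} (h0 : 0 ≤ ρ) (h : ρ < ε) :
    p + ρ • unitVec θ ∈ Metric.ball p ε := by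
  rw [Metric.mem_ball, dist_eq_norm, add_sub_cancel_left, norm_smul, Real.norm_of_nonneg h0]
  nlinarith [norm_unitVec_le θ]

/-- A sector of a punctured disc. -/
def sector (p : Plane) (ε : ℝ) (J : Set ℝ) : Set Plane :=
  (fun z : ℝ × ℝ => p + z.1 • unitVec z.2) '' (Ioo 0 ε ×ˢ J)

theorem isPreconnected_sector (p : Plane) (ε : ℝ) {J : Set ℝ} (hJ : IsPreconnected J) :
    IsPreconnected (sector p ε J) := by
  refine (isPreconnected_Ioo.prod hJ).image _ (Continuous.continuousOn ?_)
  have := continuous_unitVec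
  fun_prop

theorem mem_sector {p : Plane} {ε ρ θ : ℝ} {J : Set ℝ} (h0 : 0 < ρ) (h1 : ρ < ε) (hθ : θ ∈ J) :
    p + ρ • unitVec θ ∈ sector p ε J := ⟨(ρ, θ), ⟨⟨h0, h1⟩, hθ⟩, rfl⟩

theorem add_unitVec_ne {p : Plane} {ρ θ : ℝ} (h0 : 0 < ρ) : p + ρ • unitVec θ ≠ p := by
  intro h
  have : ρ • unitVec θ = 0 := by simpa using h
  exact (smul_ne_zero h0.ne' (unitVec_ne_zero θ)) this

/-! ### Owners: the contact point of `p` close to which the contact points of `x` are -/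

variable {O : Set Plane} {Vt : Finset Plane} {L : Finset (ℝ × ℝ × ℝ)}

/-- The square at `x` touches the obstacles near `q`. -/
def Owns (O : Set Plane) (δ : ℝ) (x q : Plane) : Prop := ∃ c ∈ foot O x, dist c q < δ

/-- On a connected set of points that are close to `p` and off the medial axis, the owner is
constant. -/
theorem owns_of_isPreconnected (hO : IsClosed O) (hne : O.Nonempty) {p : Plane} {δ : ℝ}
    (hsep : ∀ q ∈ foot O p, ∀ q' ∈ foot O p, q ≠ q' → 3 * δ ≤ dist q q')
    {S : Set Plane} (hS : IsPreconnected S) (hnear : ∀ x ∈ S, NearContacts O p δ x)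
    (hM : ∀ x ∈ S, x ∉ medialAxis O) {x y q : Plane} (hx : x ∈ S) (hy : y ∈ S)
    (hq : q ∈ foot O p) (h : Owns O δ x q) : Owns O δ y q := by
  -- Two disjoint open sets that cover `S`: all contact points are near `q`, or all are near other
  -- contact points of `p`.
  set U : Set Plane := {x | ∀ᶠ z in 𝓝 x, foot O z ⊆ Metric.ball q δ}
  set U' : Set Plane := {x | ∀ᶠ z in 𝓝 x,
    foot O z ⊆ ⋃ q' ∈ foot O p \ {q}, Metric.ball q' δ}
  have hU : IsOpen U := isOpen_setOfPred_eventually_nhds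
  have hU' : IsOpen U' := isOpen_setOfPred_eventually_nhds
  have hcov : S ⊆ U ∪ U' := by
    intro z hz
    obtain ⟨hzO, h1, -⟩ := hnear z hz
    obtain ⟨c, hc⟩ := exists_foot_eq_singleton hO hne hzO (hM z hz)
    obtain ⟨q', hq', hd⟩ := h1 c (hc ▸ rfl)
    by_cases hqq : q' = q
    · subst hqq
      left
      exact eventually_foot_subset hO Metric.isOpen_ball (by rw [hc]; simpa using hd)
    · right
      refine eventually_foot_subset hO (isOpen_biUnion fun _ _ => Metric.isOpen_ball) ?_
      rw [hc]
      simp only [singleton_subset_iff]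
      exact mem_biUnion (show q' ∈ foot O p \ {q} from ⟨hq', hqq⟩) hd
  have hdisj : ∀ z, z ∈ U → z ∈ U' → False := by
    intro z h1 h2
    obtain ⟨c, hc⟩ := foot_nonempty hO hne z
    have g1 : dist c q < δ := h1.self_of_nhds hc
    obtain ⟨q', hq', g2⟩ := mem_iUnion₂.1 (h2.self_of_nhds hc)
    rw [Metric.mem_ball] at g2
    have := hsep q hq q' hq'.1 (fun h => hq'.2 h.symm)
    have := dist_triangle_left q q' c
    linarith [dist_nonneg (x := c) (y := q)]
  have hxU : x ∈ U := by
    rcases hcov hx with h1 | h1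
    · exact h1
    · exfalso
      obtain ⟨c, hc, hd⟩ := h
      obtain ⟨q', hq', g2⟩ := mem_iUnion₂.1 (h1.self_of_nhds hc)
      rw [Metric.mem_ball] at g2
      have := hsep q hq q' hq'.1 (fun h => hq'.2 h.symm)
      have := dist_triangle_left q q' c
      linarith [dist_nonneg (x := c) (y := q)]
  have hSU : S ⊆ U := hS.subset_left_of_subset_union hU hU'
    (Set.disjoint_left.2 fun z h1 h2 => hdisj z h1 h2) hcov ⟨x, hx, hxU⟩
  obtain ⟨c, hc⟩ := foot_nonempty hO hne y
  exact ⟨c, hc, (hSU hy).self_of_nhds hc⟩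

theorem owns_unique {p : Plane} {δ : ℝ}
    (hsep : ∀ q ∈ foot O p, ∀ q' ∈ foot O p, q ≠ q' → 3 * δ ≤ dist q q') {x q q' c : Plane}
    (hx : foot O x ⊆ {c}) (hq : q ∈ foot O p) (hq' : q' ∈ foot O p) (h : Owns O δ x q)
    (h' : Owns O δ x q') : q = q' := by
  by_contra hne
  obtain ⟨a, ha, h1⟩ := h
  obtain ⟨b, hb, h2⟩ := h'
  rw [hx ha] at h1
  rw [hx hb] at h2
  have := hsep q hq q' hq' hne
  have := dist_triangle_left q q' c
  linarith [dist_nonneg (x := c) (y := q)]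

/-- The medial axis has no isolated points. -/
theorem Tame.not_isolated (T : Tame O Vt L) {p : Plane} (hp : p ∈ medialAxis O) :
    p ∈ closure (medialAxis O \ {p}) := by
  by_contra hcl
  obtain ⟨hpO, q, hq, q', hq', hne⟩ := T.mem_medialAxis.1 hp
  obtain ⟨δ, hδ, hsep, hev⟩ := T.exists_nearContacts hpO
  rw [mem_closure_iff_frequently, not_frequently] at hcl
  obtain ⟨ε, hε, hball⟩ := Metric.eventually_nhds_iff_ball.1 (hcl.and hev)
  -- If `p` were isolated, a punctured neighbourhood (the sector over all angles) would be connected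
  -- and off the axis, hence have one owner; but points on the way to `q` and to `q'` have different
  -- ones.
  have hS : ∀ x ∈ sector p ε univ, x ∈ Metric.ball p ε ∧ x ≠ p := by
    rintro _ ⟨⟨ρ, θ⟩, ⟨hρ, -⟩, rfl⟩
    exact ⟨dist_add_unitVec_lt hρ.1.le hρ.2, add_unitVec_ne hρ.1⟩
  have hMS : ∀ x ∈ sector p ε univ, x ∉ medialAxis O := fun x hx hM =>
    (hball x (hS x hx).1).1 ⟨hM, (hS x hx).2⟩
  have hpt : ∀ c ∈ foot O p, ∃ x ∈ sector p ε univ, c ∈ foot O x := by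
    intro c hc
    have hcp : c - p ≠ 0 := by
      intro h
      rw [sub_eq_zero] at h
      exact hpO (h ▸ foot_subset _ _ hc)
    obtain ⟨R, hR, θ, hθ⟩ := exists_polar hcp
    set t := min (1 / 2) (ε / (2 * R))
    have ht : 0 < t := by positivity
    refine ⟨p + t • (c - p), ?_, mem_foot_walk hc ht.le ((min_le_left _ _).trans (by norm_num))⟩
    rw [hθ, smul_smul]
    refine mem_sector (by positivity) ?_ (mem_univ _)
    have : t * R ≤ ε / (2 * R) * R := mul_le_mul_of_nonneg_right (min_le_right _ _) hR.le
    have h2 : ε / (2 * R) * R = ε / 2 := by field_simp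
    linarith
  obtain ⟨x, hx, hxq⟩ := hpt q hq
  obtain ⟨y, hy, hyq⟩ := hpt q' hq'
  have hown := owns_of_isPreconnected T.closed T.nonempty hsep
    (isPreconnected_sector p ε isPreconnected_univ) (fun x hx => (hball x (hS x hx).1).2) hMS
    hx hy hq ⟨q, hxq, by simpa using hδ⟩
  have hyO := (hball y (hS y hy).1).2.1
  obtain ⟨c, hc⟩ := exists_foot_eq_singleton T.closed T.nonempty hyO (hMS y hy)
  exact hne (owns_unique hsep hc.le hq hq' hown ⟨q', hyq, by simpa using hδ⟩)

/-! ### The lines carrying the medial axis -/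

/-- The directions of the sides of an axis-parallel square, seen from its centre. -/
def axisDirs : Finset Plane := {(1, 0), (-1, 0), (0, 1), (0, -1)}

/-- The ways in which a square can touch the obstacles: a vertex on a side in a given direction, or
an edge on a given line at a corner in a given direction. -/
abbrev Site : Type := (Plane × Plane) ⊕ ((ℝ × ℝ × ℝ) × Plane)

-- The filter removes corners that move along the line when the radius changes: they do not
-- determine the radius. By `Tame.corner` no contact is of this kind.
open Classical in
def sites (Vt : Finset Plane) (L : Finset (ℝ × ℝ × ℝ)) : Finset Site :=
  (Vt ×ˢ axisDirs).disjSum ((L ×ˢ diagDirs).filter fun s => s.1.1 * s.2.1 + s.1.2.1 * s.2.2 ≠ 0)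

/-- The coefficients of the radius as an affine function of the centre. -/
def radCoeff : Site → ℝ × ℝ × ℝ
  | .inl (v, f) => (-f.1, -f.2, f.1 * v.1 + f.2 * v.2)
  | .inr (l, κ) => (-l.1 / (l.1 * κ.1 + l.2.1 * κ.2), -l.2.1 / (l.1 * κ.1 + l.2.1 * κ.2),
      l.2.2 / (l.1 * κ.1 + l.2.1 * κ.2))

def evalAffine (a : ℝ × ℝ × ℝ) (x : Plane) : ℝ := a.1 * x.1 + a.2.1 * x.2 + a.2.2

/-- Only closed conditions are imposed, so that a site active at points arbitrarily close to `x` is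
active at `x`. -/
def Active (O : Set Plane) (x : Plane) : Site → Prop
  | .inl (v, f) => dist x v = rad O x ∧ f.1 * (v.1 - x.1) + f.2 * (v.2 - x.2) = rad O x
  | .inr (l, κ) => OnLine l (x + rad O x • κ) ∧ x + rad O x • κ ∈ O

theorem isClosed_active (hO : IsClosed O) (s : Site) : IsClosed {x | Active O x s} := by
  have := continuous_rad O
  rcases s with ⟨v, f⟩ | ⟨l, κ⟩
  · exact (isClosed_eq (by fun_prop) (by fun_prop)).inter (isClosed_eq (by fun_prop) (by fun_prop))
  · have hc : Continuous fun x => x + rad O x • κ := by fun_prop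
    exact ((isClosed_onLine l).preimage hc).inter (hO.preimage hc)

theorem Active.rad_eq {s : Site} (hs : s ∈ sites Vt L) {x : Plane} (h : Active O x s) :
    rad O x = evalAffine (radCoeff s) x := by
  rcases s with ⟨v, f⟩ | ⟨l, κ⟩
  · rw [← h.2]; simp only [radCoeff, evalAffine]; ring
  · have hk : l.1 * κ.1 + l.2.1 * κ.2 ≠ 0 := by
      simpa [sites] using And.right (by simpa [sites] using hs)
    have h1 := h.1
    unfold OnLine at h1
    simp only [Prod.fst_add, Prod.snd_add, Prod.smul_fst, Prod.smul_snd, smul_eq_mul] at h1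
    simp only [radCoeff, evalAffine]
    field_simp
    linarith

theorem onLine_corner_of_rad_eq {l : ℝ × ℝ × ℝ} {κ : Plane}
    (hk : l.1 * κ.1 + l.2.1 * κ.2 ≠ 0) {x : Plane} {r : ℝ}
    (h : r = evalAffine (radCoeff (.inr (l, κ))) x) : OnLine l (x + r • κ) := by
  unfold OnLine
  simp only [Prod.fst_add, Prod.snd_add, Prod.smul_fst, Prod.smul_snd, smul_eq_mul]
  simp only [radCoeff, evalAffine] at h
  field_simp at h
  linarith

theorem exists_active_vertex {x c : Plane} (hc : c ∈ foot O x)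
    (hv : c ∈ Vt) : ∃ f ∈ axisDirs, Active O x (.inl (c, f)) ∧
      (.inl (c, f) : Site) ∈ sites Vt L := by
  have hd := (mem_foot.1 hc).1
  have h2 := hd
  rw [dist_comm, dist_eq_max] at h2
  have key : ∃ f ∈ axisDirs, f.1 * (c.1 - x.1) + f.2 * (c.2 - x.2) = rad O x := by
    rcases max_choice |c.1 - x.1| |c.2 - x.2| with hm | hm <;> rw [hm] at h2 <;>
      rcases (abs_eq (rad_nonneg O x)).1 h2 with h | h
    · exact ⟨(1, 0), by simp [axisDirs], by simpa using h⟩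
    · exact ⟨(-1, 0), by simp [axisDirs], by simp only; linarith⟩
    · exact ⟨(0, 1), by simp [axisDirs], by simpa using h⟩
    · exact ⟨(0, -1), by simp [axisDirs], by simp only; linarith⟩
  obtain ⟨f, hf, h⟩ := key
  refine ⟨f, hf, ⟨hd, h⟩, ?_⟩
  simp [sites, hv, hf]

theorem mem_sites_inr {l : ℝ × ℝ × ℝ} {κ : Plane} (hl : l ∈ L) (hκ : κ ∈ diagDirs)
    (hk : l.1 * κ.1 + l.2.1 * κ.2 ≠ 0) : (.inr (l, κ) : Site) ∈ sites Vt L := by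
  simp [sites, hl, hκ, hk]

/-- Every contact point comes from an active site. -/
theorem Tame.exists_active (T : Tame O Vt L) {x c : Plane} (hx : x ∉ O) (hc : c ∈ foot O x) :
    ∃ s ∈ sites Vt L, Active O x s ∧
      match s with
      | .inl (v, _) => c = v
      | .inr (_, κ) => c = x + rad O x • κ := by
  by_cases hv : c ∈ Vt
  · obtain ⟨f, -, h1, h2⟩ := exists_active_vertex (L := L) hc hv
    exact ⟨_, h2, h1, rfl⟩
  · obtain ⟨κ, hκ, h, l, hl, hlc, -, hk⟩ := T.corner hx hc hv
    exact ⟨.inr (l, κ), mem_sites_inr hl hκ hk, ⟨h ▸ hlc, h ▸ foot_subset _ _ hc⟩, h⟩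

/-- The line on which two affine functions agree. -/
def diffLine (a b : ℝ × ℝ × ℝ) : ℝ × ℝ × ℝ := (a.1 - b.1, a.2.1 - b.2.1, b.2.2 - a.2.2)

theorem onLine_diffLine {a b : ℝ × ℝ × ℝ} {x : Plane} :
    OnLine (diffLine a b) x ↔ evalAffine a x = evalAffine b x := by
  unfold OnLine diffLine evalAffine
  constructor <;> intro h <;> linarith

open Classical in
/-- The lines equidistant from two sites, and the lines of the edges. -/
def arrangement (Vt : Finset Plane) (L : Finset (ℝ × ℝ × ℝ)) : Finset (ℝ × ℝ × ℝ) :=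
  (((sites Vt L ×ˢ sites Vt L).image fun s => diffLine (radCoeff s.1) (radCoeff s.2)).filter
    fun l => l.1 ≠ 0 ∨ l.2.1 ≠ 0) ∪ L

open Classical in
/-- The vertices of the arrangement of lines (and possibly the origin), and the vertices. -/
def nodes (Vt : Finset Plane) (L : Finset (ℝ × ℝ × ℝ)) : Finset Plane :=
  ((arrangement Vt L ×ˢ arrangement Vt L).image fun s =>
    ((s.1.2.2 * s.2.2.1 - s.2.2.2 * s.1.2.1) / (s.1.1 * s.2.2.1 - s.2.1 * s.1.2.1),
     (s.1.1 * s.2.2.2 - s.2.1 * s.1.2.2) / (s.1.1 * s.2.2.1 - s.2.1 * s.1.2.1))) ∪ Vt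

theorem Tame.arrangement_ne (T : Tame O Vt L) {l : ℝ × ℝ × ℝ} (hl : l ∈ arrangement Vt L) :
    l.1 ≠ 0 ∨ l.2.1 ≠ 0 := by
  unfold arrangement at hl
  rcases Finset.mem_union.1 hl with h | h
  · exact (Finset.mem_filter.1 h).2
  · exact .inl (T.lines l h).1

/-- Two lines of the arrangement that meet off the nodes coincide. -/
theorem Tame.onLine_iff (T : Tame O Vt L) {l l' : ℝ × ℝ × ℝ} (hl : l ∈ arrangement Vt L)
    (hl' : l' ∈ arrangement Vt L) {x : Plane} (hx : x ∉ nodes Vt L) (h : OnLine l x)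
    (h' : OnLine l' x) (z : Plane) : OnLine l z → OnLine l' z := by
  -- With a nonzero determinant, Cramer's rule would make `x` a node.
  have hdet : l.1 * l'.2.1 - l'.1 * l.2.1 = 0 := by
    by_contra hdet
    apply hx
    unfold nodes
    refine Finset.mem_union_left _ (Finset.mem_image.2 ⟨(l, l'), by simp [hl, hl'], ?_⟩)
    unfold OnLine at h h'
    refine Prod.ext ?_ ?_
    · simp only
      rw [div_eq_iff hdet, ← h, ← h']; ring
    · simp only
      rw [div_eq_iff hdet, ← h, ← h']; ring
  unfold OnLine at h h' ⊢
  intro hz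
  have e1 : l.1 * (z.1 - x.1) + l.2.1 * (z.2 - x.2) = 0 := by linarith
  have e2 : l'.1 * (z.1 - x.1) + l'.2.1 * (z.2 - x.2) = 0 := by
    rcases T.arrangement_ne hl with g | g
    · refine (mul_eq_zero.1 (?_ : l.1 * _ = 0)).resolve_left g
      calc l.1 * (l'.1 * (z.1 - x.1) + l'.2.1 * (z.2 - x.2))
          = l'.1 * (l.1 * (z.1 - x.1) + l.2.1 * (z.2 - x.2)) +
            (l.1 * l'.2.1 - l'.1 * l.2.1) * (z.2 - x.2) := by ring
        _ = 0 := by rw [e1, hdet]; ring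
    · refine (mul_eq_zero.1 (?_ : l.2.1 * _ = 0)).resolve_left g
      calc l.2.1 * (l'.1 * (z.1 - x.1) + l'.2.1 * (z.2 - x.2))
          = l'.2.1 * (l.1 * (z.1 - x.1) + l.2.1 * (z.2 - x.2)) -
            (l.1 * l'.2.1 - l'.1 * l.2.1) * (z.1 - x.1) := by ring
        _ = 0 := by rw [e1, hdet]; ring
  linarith

theorem mem_arrangement_of_ne {s s' : Site} (hs : s ∈ sites Vt L) (hs' : s' ∈ sites Vt L)
    (h : (radCoeff s).1 ≠ (radCoeff s').1 ∨ (radCoeff s).2.1 ≠ (radCoeff s').2.1) :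
    diffLine (radCoeff s) (radCoeff s') ∈ arrangement Vt L := by
  unfold arrangement
  refine Finset.mem_union_left _ (Finset.mem_filter.2 ⟨Finset.mem_image.2 ⟨(s, s'), by simp [hs, hs'],
    rfl⟩, ?_⟩)
  simpa [diffLine, sub_ne_zero] using h

/-- The medial axis lies on the lines of the arrangement. -/
theorem Tame.exists_onLine (T : Tame O Vt L) {x : Plane} (hx : x ∈ medialAxis O) :
    ∃ l ∈ arrangement Vt L, OnLine l x := by
  obtain ⟨hxO, c, hc, c', hc', hne⟩ := T.mem_medialAxis.1 hx
  have hr := rad_pos T.closed T.nonempty hxO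
  obtain ⟨s, hs, ha, hm⟩ := T.exists_active hxO hc
  obtain ⟨s', hs', ha', hm'⟩ := T.exists_active hxO hc'
  have hon : OnLine (diffLine (radCoeff s) (radCoeff s')) x :=
    onLine_diffLine.2 ((ha.rad_eq hs).symm.trans (ha'.rad_eq hs'))
  refine ⟨_, mem_arrangement_of_ne hs hs' ?_, hon⟩
  -- Two active sites whose radius functions have the same gradient give the same contact point:
  -- vertices on one side line share a coordinate; the gradients of edges have no zero component,
  -- unlike those of vertices; and parallel edges with equal gradients touch the same corner.
  by_contra hcon
  push Not at hcon
  obtain ⟨h1, h2⟩ := hcon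
  apply hne
  rcases s with ⟨v, f⟩ | ⟨l, κ⟩ <;> rcases s' with ⟨v', f'⟩ | ⟨l', κ'⟩
  · simp only [radCoeff, neg_inj] at h1 h2
    have hff : f = f' := Prod.ext h1 h2
    subst hff
    simp only [sites, Finset.inl_mem_disjSum, Finset.mem_product] at hs hs'
    rw [hm, hm']
    have e := ha.2.trans ha'.2.symm
    have hf := hs.2
    simp only [axisDirs, Finset.mem_insert, Finset.mem_singleton] at hf
    rcases hf with rfl | rfl | rfl | rfl <;> simp only at e
    · exact T.inj_fst hs.1 hs'.1 (by linarith)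
    · exact T.inj_fst hs.1 hs'.1 (by linarith)
    · exact T.inj_snd hs.1 hs'.1 (by linarith)
    · exact T.inj_snd hs.1 hs'.1 (by linarith)
  · exfalso
    simp only [sites, Finset.inl_mem_disjSum, Finset.inr_mem_disjSum, Finset.mem_product,
      Finset.mem_filter] at hs hs'
    obtain ⟨n1, n2⟩ := T.lines _ hs'.1.1
    simp only [radCoeff] at h1 h2
    have hf := hs.2
    simp only [axisDirs, Finset.mem_insert, Finset.mem_singleton] at hf
    have hk := hs'.2
    rcases hf with rfl | rfl | rfl | rfl <;> simp [n1, n2, hk, eq_comm, div_eq_zero_iff] at h1 h2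
  · exfalso
    simp only [sites, Finset.inl_mem_disjSum, Finset.inr_mem_disjSum, Finset.mem_product,
      Finset.mem_filter] at hs hs'
    obtain ⟨n1, n2⟩ := T.lines _ hs.1.1
    simp only [radCoeff] at h1 h2
    have hf := hs'.2
    simp only [axisDirs, Finset.mem_insert, Finset.mem_singleton] at hf
    have hk := hs.2
    rcases hf with rfl | rfl | rfl | rfl <;> simp [n1, n2, hk, div_eq_zero_iff] at h1 h2
  · simp only [sites, Finset.inr_mem_disjSum, Finset.mem_product, Finset.mem_filter] at hs hs'
    obtain ⟨n1, n2⟩ := T.lines _ hs.1.1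
    have hk := hs.2
    have hk' := hs'.2
    simp only [radCoeff] at h1 h2
    rw [div_eq_div_iff hk hk'] at h1 h2
    suffices hκ : κ = κ' by rw [hm, hm', hκ]
    obtain ⟨g1, g2⟩ := mem_diagDirs.1 hs.1.2
    obtain ⟨g1', g2'⟩ := mem_diagDirs.1 hs'.1.2
    -- the two normals are proportional, and both corners have the same height over the line
    have e : (l.1 * κ'.1 + l.2.1 * κ'.2) * (l.1 * κ.1 + l.2.1 * κ.2) =
        (l.1 * κ.1 + l.2.1 * κ.2) * (l.1 * κ.1 + l.2.1 * κ.2) := by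
      have : (l.1 * κ'.1 + l.2.1 * κ'.2) * (l'.1 * κ'.1 + l'.2.1 * κ'.2) =
        (l.1 * κ.1 + l.2.1 * κ.2) * (l'.1 * κ'.1 + l'.2.1 * κ'.2) := by
        linear_combination (-κ'.1) * h1 - κ'.2 * h2
      rw [mul_right_cancel₀ hk' this]
    have e' := mul_right_cancel₀ hk e
    have z : l.1 * (κ'.1 - κ.1) + l.2.1 * (κ'.2 - κ.2) = 0 := by linarith
    rcases g1 with g1 | g1 <;> rcases g2 with g2 | g2 <;> rcases g1' with g1' | g1' <;>
      rcases g2' with g2' | g2' <;> rw [g1, g2] at hk <;> rw [g1, g2, g1', g2'] at z <;>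
      first
      | exact Prod.ext (g1.trans g1'.symm) (g2.trans g2'.symm)
      | (exfalso; apply n1; linarith)
      | (exfalso; apply n2; linarith)
      | (exfalso; apply hk; linarith)

/-- Along a line of the arrangement, the medial axis is open away from the nodes. -/
theorem Tame.eventually_mem_medialAxis (T : Tame O Vt L) {x : Plane} (hx : x ∈ medialAxis O)
    (hxN : x ∉ nodes Vt L) {l : ℝ × ℝ × ℝ} (hl : l ∈ arrangement Vt L) (hxl : OnLine l x) :
    ∀ᶠ y in 𝓝 x, OnLine l y → y ∈ medialAxis O := by
  obtain ⟨hxO, c, hc, c', hc', hne⟩ := T.mem_medialAxis.1 hx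
  have hcr := continuous_rad O
  have hO : ∀ᶠ y in 𝓝 x, y ∉ O := T.closed.isOpen_compl.mem_nhds hxO
  have hact : ∀ᶠ y in 𝓝 x, ∀ s ∈ sites Vt L, Active O y s → Active O x s := by
    rw [Finset.eventually_all]
    intro s _
    by_cases h : Active O x s
    · exact Eventually.of_forall fun _ _ => h
    · filter_upwards [(isClosed_active T.closed s).isOpen_compl.mem_nhds h] with y hy hy'
        using absurd hy' hy
  -- Some site `s'` determines the radius at `y`, and it is active at `x` too. The line on which
  -- `s'` and `s` agree meets `l` in `x`, which is not a node, so it contains `l`. Hence every site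
  -- active at `x` still gives the radius along `l`.
  have hrad : ∀ᶠ y in 𝓝 x, OnLine l y → ∀ s ∈ sites Vt L, Active O x s →
      rad O y = evalAffine (radCoeff s) y := by
    filter_upwards [hO, hact] with y hyO hy hyl s hs has
    obtain ⟨d, hd⟩ := foot_nonempty T.closed T.nonempty y
    obtain ⟨s', hs', has', -⟩ := T.exists_active hyO hd
    rw [has'.rad_eq hs']
    have hx' := hy s' hs' has'
    by_cases heq : (radCoeff s').1 ≠ (radCoeff s).1 ∨ (radCoeff s').2.1 ≠ (radCoeff s).2.1
    · have hon : OnLine (diffLine (radCoeff s') (radCoeff s)) x :=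
        onLine_diffLine.2 ((hx'.rad_eq hs').symm.trans (has.rad_eq hs))
      exact onLine_diffLine.1 (T.onLine_iff hl (mem_arrangement_of_ne hs' hs heq) hxN hxl hon y hyl)
    · push Not at heq
      have := (hx'.rad_eq hs').symm.trans (has.rad_eq hs)
      unfold evalAffine at this ⊢
      rw [heq.1, heq.2] at this ⊢
      linarith
  -- Consequently each contact point of `x` persists, slightly moved, along `l`; applied to two of
  -- them, this keeps `y` on the axis.
  have hpers : ∀ a ∈ foot O x, ∀ U : Set Plane, IsOpen U → a ∈ U →
      ∀ᶠ y in 𝓝 x, OnLine l y → ∃ b ∈ foot O y, b ∈ U := by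
    intro a ha U hU haU
    by_cases hv : a ∈ Vt
    · have hcoord : ∀ (f : Plane) (u : Plane → ℝ), f ∈ axisDirs → (-f) ∈ axisDirs → Continuous u →
          (∀ y, u y = f.1 * (a.1 - y.1) + f.2 * (a.2 - y.2)) → |u x| ≤ rad O x →
          ∀ᶠ y in 𝓝 x, OnLine l y → |u y| ≤ rad O y := by
        intro f u hf hf' hu hfu hle
        rcases hle.lt_or_eq with h | h
        · filter_upwards [hu.abs.continuousAt.eventually_lt hcr.continuousAt h] with y hy _
            using hy.le
        · filter_upwards [hrad] with y hy hyl
          rcases (abs_eq (rad_nonneg O x)).1 h with h | h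
          · have := hy hyl (.inl (a, f)) (by simp [sites, hv, hf])
              ⟨(mem_foot.1 ha).1, by rw [← hfu]; exact h⟩
            have e : u y = rad O y := by rw [this, hfu]; simp only [radCoeff, evalAffine]; ring
            rw [e, abs_of_nonneg (rad_nonneg O y)]
          · have := hy hyl (.inl (a, -f)) (by simp [sites, hv, hf'])
              ⟨(mem_foot.1 ha).1, by
                rw [hfu] at h; simp only [Prod.fst_neg, Prod.snd_neg]; linarith⟩
            have e : u y = -rad O y := by
              rw [this, hfu]; simp only [radCoeff, evalAffine, Prod.fst_neg, Prod.snd_neg]; ring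
            rw [e, abs_neg, abs_of_nonneg (rad_nonneg O y)]
      have hda : dist a x = rad O x := by rw [dist_comm]; exact (mem_foot.1 ha).1
      have h1 := hcoord (1, 0) (fun y => a.1 - y.1) (by simp [axisDirs]) (by simp [axisDirs])
        (by fun_prop) (fun y => by simp) (hda ▸ abs_fst_le a x)
      have h2 := hcoord (0, 1) (fun y => a.2 - y.2) (by simp [axisDirs]) (by simp [axisDirs])
        (by fun_prop) (fun y => by simp) (hda ▸ abs_snd_le a x)
      filter_upwards [h1, h2] with y h1 h2 hyl
      refine ⟨a, mem_foot_of_le ?_ (foot_subset _ _ ha), haU⟩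
      rw [dist_comm, dist_eq_max]
      exact max_le (h1 hyl) (h2 hyl)
    · obtain ⟨κ, hκ, h, l', hl', hlc, hev, hk⟩ := T.corner hxO ha hv
      have hcont : Continuous fun y => y + rad O y • κ := by fun_prop
      have ht : Tendsto (fun y => y + rad O y • κ) (𝓝 x) (𝓝 a) := by
        have := hcont.tendsto x
        rwa [← h] at this
      filter_upwards [ht.eventually hev, ht.eventually (hU.mem_nhds haU), hrad] with y g1 g2 g3 hyl
      have hon := onLine_corner_of_rad_eq hk (g3 hyl (.inr (l', κ)) (mem_sites_inr hl' hκ hk)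
        ⟨h ▸ hlc, h ▸ foot_subset _ _ ha⟩)
      exact ⟨_, mem_foot_of_le (dist_add_diag (rad_nonneg O y) hκ).le (g1 hon), g2⟩
  obtain ⟨U, U', hU, hU', hcU, hcU', hdis⟩ := t2_separation hne
  filter_upwards [hO, hpers c hc U hU hcU, hpers c' hc' U' hU' hcU'] with y h0 h1 h2 hyl
  obtain ⟨b, hb, hbU⟩ := h1 hyl
  obtain ⟨b', hb', hbU'⟩ := h2 hyl
  exact T.mem_medialAxis.2 ⟨h0, b, hb, b', hb', fun h =>
    Set.disjoint_left.1 hdis hbU (h ▸ hbU')⟩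

/-- Along a line of the arrangement, the medial axis is closed away from the nodes. -/
theorem Tame.mem_medialAxis_of_frequently (T : Tame O Vt L) {x : Plane}
    (hxN : x ∉ nodes Vt L) {l : ℝ × ℝ × ℝ} (hl : l ∈ arrangement Vt L) (hxl : OnLine l x)
    (h : ∃ᶠ y in 𝓝 x, OnLine l y ∧ y ∈ medialAxis O) : x ∈ medialAxis O := by
  by_cases hxO : x ∈ O
  -- A limit in `O` that is not a vertex: the contact points of nearby axis points `y` are corners
  -- on an edge line through `x`. This line belongs to the arrangement, so it contains `l` and hence
  -- `y`, which contradicts a positive radius.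
  · exfalso
    have hxv : x ∉ Vt := fun hv => hxN (Finset.mem_union_right _ hv)
    have hcr := continuous_rad O
    have hr0 : rad O x = 0 := Metric.infDist_zero_of_mem hxO
    have hV : ∀ᶠ y in 𝓝 x, ∀ v ∈ Vt, rad O y < dist y v := by
      rw [Finset.eventually_all]
      intro v hv
      refine hcr.continuousAt.eventually_lt (continuous_id.dist continuous_const).continuousAt ?_
      rw [hr0]
      exact dist_pos.2 (fun h => hxv (by simpa using h ▸ hv))
    have hLn : ∀ᶠ y in 𝓝 x, ∀ l' ∈ L, ∀ κ ∈ diagDirs, OnLine l' (y + rad O y • κ) →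
        OnLine l' x := by
      rw [Finset.eventually_all]
      intro l' _
      rw [Finset.eventually_all]
      intro κ _
      by_cases hh : OnLine l' x
      · exact Eventually.of_forall fun _ _ => hh
      · have hcont : Continuous fun y => y + rad O y • κ := by fun_prop
        have : Tendsto (fun y => y + rad O y • κ) (𝓝 x) (𝓝 x) := by
          have := hcont.tendsto x
          rwa [hr0, zero_smul, add_zero] at this
        filter_upwards [this.eventually ((isClosed_onLine l').isOpen_compl.mem_nhds hh)]
          with y hy hy' using absurd hy' hy
    obtain ⟨y, ⟨hyl, hyM⟩, h1, h2⟩ := (h.and_eventually (hV.and hLn)).exists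
    obtain ⟨hyO, c, hc, -⟩ := T.mem_medialAxis.1 hyM
    have hcv : c ∉ Vt := fun hv => absurd (mem_foot.1 hc).1 (h1 c hv).ne'
    obtain ⟨κ, hκ, hcκ, l', hl', hlc, -, hk⟩ := T.corner hyO hc hcv
    have hl'x := h2 l' hl' κ hκ (hcκ ▸ hlc)
    have hyl' := T.onLine_iff hl (Finset.mem_union_right _ hl') hxN hxl hl'x y hyl
    rw [hcκ] at hlc
    unfold OnLine at hlc hyl'
    simp only [Prod.fst_add, Prod.snd_add, Prod.smul_fst, Prod.smul_snd, smul_eq_mul] at hlc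
    have : rad O y * (l'.1 * κ.1 + l'.2.1 * κ.2) = 0 := by linarith
    exact (mul_ne_zero (rad_pos T.closed T.nonempty hyO).ne' hk) this
  · exact T.closure_medialAxis hxO (mem_closure_iff_frequently.2 (h.mono fun y hy => hy.2))

end Corridor
end

noncomputable section
open Set Filter Topology
namespace Corridor

/-! ### The medial axis is a union of interior disjoint segments -/

variable {O : Set Plane} {Vt : Finset Plane} {L : Finset (ℝ × ℝ × ℝ)}

def lineDir (l : ℝ × ℝ × ℝ) : Plane := (-l.2.1, l.1)

theorem onLine_add_lineDir {l : ℝ × ℝ × ℝ} {x : Plane} (h : OnLine l x) (t : ℝ) :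
    OnLine l (x + t • lineDir l) := by
  unfold OnLine lineDir at *
  simp only [Prod.fst_add, Prod.snd_add, Prod.smul_fst, Prod.smul_snd, smul_eq_mul]
  linarith

theorem Tame.lineDir_ne (T : Tame O Vt L) {l : ℝ × ℝ × ℝ} (hl : l ∈ arrangement Vt L) :
    lineDir l ≠ 0 := by
  intro h
  have h1 : -l.2.1 = 0 := congrArg Prod.fst h
  have h2 : l.1 = 0 := congrArg Prod.snd h
  rcases T.arrangement_ne hl with g | g
  · exact g h2
  · exact g (by linarith)

/-- The part of a line between two nodes is contained in the medial axis or disjoint from it. -/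
theorem Tame.subset_medialAxis (T : Tame O Vt L) {x : Plane} (hx : x ∈ medialAxis O)
    {l : ℝ × ℝ × ℝ} (hl : l ∈ arrangement Vt L) (hxl : OnLine l x) {J : Set ℝ}
    (hJ : IsPreconnected J) (h0 : (0 : ℝ) ∈ J) (hN : ∀ t ∈ J, x + t • lineDir l ∉ nodes Vt L) :
    ∀ t ∈ J, x + t • lineDir l ∈ medialAxis O := by
  have hc : ∀ t, Tendsto (fun s : ℝ => x + s • lineDir l) (𝓝 t) (𝓝 (x + t • lineDir l)) :=
    fun t => (by fun_prop : Continuous fun s : ℝ => x + s • lineDir l).tendsto t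
  set P : ℝ → Prop := fun t => x + t • lineDir l ∈ medialAxis O
  have hopen : ∀ t ∈ J, P t → ∀ᶠ s in 𝓝 t, P s := fun t ht hP =>
    ((hc t).eventually (T.eventually_mem_medialAxis hP (hN t ht) hl
      (onLine_add_lineDir hxl t))).mono fun s hs => hs (onLine_add_lineDir hxl s)
  have hclosed : ∀ t ∈ J, (∃ᶠ s in 𝓝 t, P s) → P t := fun t ht hP =>
    T.mem_medialAxis_of_frequently (hN t ht) hl (onLine_add_lineDir hxl t)
      ((hc t).frequently (hP.mono fun s hs => ⟨onLine_add_lineDir hxl s, hs⟩))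
  have hx0 : P 0 := by simpa [P] using hx
  have := hJ.subset_of_closure_inter_subset (u := {t | ∀ᶠ s in 𝓝 t, P s})
    isOpen_setOfPred_eventually_nhds ⟨0, h0, hopen 0 h0 hx0⟩ (by
      rintro t ⟨ht, htJ⟩
      refine hopen t htJ (hclosed t htJ ?_)
      exact (mem_closure_iff_frequently.1 ht).mono fun s hs => hs.self_of_nhds)
  exact fun t ht => (this ht).self_of_nhds

/-- Without a node the axis would contain a whole ray, but it is bounded. There are finitely many
nodes, so one of them is met first. -/
theorem Tame.exists_node (T : Tame O Vt L) {x : Plane} (hx : x ∈ medialAxis O)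
    (hxN : x ∉ nodes Vt L) {l : ℝ × ℝ × ℝ} (hl : l ∈ arrangement Vt L) (hxl : OnLine l x) {σ : ℝ}
    (hσ : σ ≠ 0) :
    ∃ t > 0, x + (σ * t) • lineDir l ∈ nodes Vt L ∧
      ∀ s, 0 ≤ s → s < t → x + (σ * s) • lineDir l ∉ nodes Vt L := by
  have hinj : Function.Injective fun t : ℝ => x + (σ * t) • lineDir l := by
    intro s t hst
    have := smul_left_injective ℝ (T.lineDir_ne hl) (add_left_cancel hst)
    exact mul_left_cancel₀ hσ this
  have hfin : {t : ℝ | 0 < t ∧ x + (σ * t) • lineDir l ∈ nodes Vt L}.Finite :=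
    ((nodes Vt L).finite_toSet.preimage hinj.injOn).subset fun t ht => ht.2
  have hne : {t : ℝ | 0 < t ∧ x + (σ * t) • lineDir l ∈ nodes Vt L}.Nonempty := by
    by_contra hemp
    rw [not_nonempty_iff_eq_empty] at hemp
    have hno : ∀ t : ℝ, 0 ≤ t → x + (σ * t) • lineDir l ∉ nodes Vt L := by
      intro t ht h
      rcases ht.eq_or_lt with rfl | ht
      · simp at h; exact hxN h
      · exact (hemp ▸ (show t ∈ {t : ℝ | 0 < t ∧ _} from ⟨ht, h⟩) : t ∈ (∅ : Set ℝ))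
    have hJ : IsPreconnected ((fun t => σ * t) '' Ici (0 : ℝ)) :=
      isPreconnected_Ici.image _ (by fun_prop)
    have hall := T.subset_medialAxis hx hl hxl hJ ⟨0, by simp, by simp⟩ (by
      rintro _ ⟨t, ht, rfl⟩
      exact hno t ht)
    obtain ⟨R, hR⟩ := T.isBounded_medialAxis.exists_norm_le
    have hpos : 0 < ‖lineDir l‖ := norm_pos_iff.2 (T.lineDir_ne hl)
    have hσ' : 0 < |σ| := abs_pos.2 hσ
    have hR0 : 0 ≤ R := (norm_nonneg x).trans (hR x hx)
    set t := (R + ‖x‖ + 1) / (|σ| * ‖lineDir l‖)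
    have ht : 0 ≤ t := by positivity
    have h1 := hR _ (hall (σ * t) ⟨t, ht, rfl⟩)
    have h2 : ‖(σ * t) • lineDir l‖ = R + ‖x‖ + 1 := by
      rw [norm_smul, Real.norm_eq_abs, abs_mul, abs_of_nonneg ht]
      simp only [t]; field_simp
    have h3 := norm_sub_le (x + (σ * t) • lineDir l) x
    rw [add_sub_cancel_left, h2] at h3
    linarith
  obtain ⟨t, ht, hmin⟩ := Set.exists_min_image _ id hfin hne
  refine ⟨t, ht.1, ht.2, fun s h0 hs h => ?_⟩
  rcases h0.eq_or_lt with rfl | h0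
  · simp at h; exact hxN h
  · exact absurd (hmin s ⟨h0, h⟩) (not_le.2 hs)

/-- The segments between consecutive nodes. -/
def IsLink (O : Set Plane) (N : Finset Plane) (s : Plane × Plane) : Prop :=
  s.1 ∈ N ∧ s.2 ∈ N ∧ toLex s.1 < toLex s.2 ∧ openSegment ℝ s.1 s.2 ⊆ medialAxis O ∧
    ∀ z ∈ openSegment ℝ s.1 s.2, z ∉ N

theorem Tame.exists_link (T : Tame O Vt L) {x : Plane} (hx : x ∈ medialAxis O)
    (hxN : x ∉ nodes Vt L) : ∃ s, IsLink O (nodes Vt L) s ∧ x ∈ openSegment ℝ s.1 s.2 := by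
  obtain ⟨l, hl, hxl⟩ := T.exists_onLine hx
  obtain ⟨t, ht, htN, htm⟩ := T.exists_node hx hxN hl hxl (σ := 1) one_ne_zero
  obtain ⟨t', ht', htN', htm'⟩ := T.exists_node hx hxN hl hxl (σ := -1) (by norm_num)
  set f := lineDir l
  have hf := T.lineDir_ne hl
  have hIoo : ∀ s ∈ Ioo (-t') t, x + s • f ∉ nodes Vt L := by
    intro s hs
    rcases le_total 0 s with h | h
    · have := htm s h hs.2
      rwa [one_mul] at this
    · have := htm' (-s) (by linarith) (by linarith [hs.1])
      rwa [neg_mul_neg, one_mul] at this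
  have hM := T.subset_medialAxis hx hl hxl isPreconnected_Ioo (J := Ioo (-t') t)
    ⟨by linarith, ht⟩ hIoo
  rw [one_mul] at htN
  rw [neg_mul, one_mul] at htN'
  have hseg : openSegment ℝ (x + (-t') • f) (x + t • f) = (fun s : ℝ => x + s • f) '' Ioo (-t') t := by
    rw [← openSegment_eq_Ioo (by linarith : -t' < t)]
    have e : ∀ s : ℝ, (AffineMap.lineMap x (x + f) : ℝ →ᵃ[ℝ] Plane) s = x + s • f := fun s => by
      simp [AffineMap.lineMap_apply, add_comm]
    rw [← e, ← e, ← image_openSegment]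
    exact image_congr fun s _ => e s
  have hxs : x ∈ openSegment ℝ (x + (-t') • f) (x + t • f) := by
    rw [hseg]; exact ⟨0, ⟨by linarith, ht⟩, by simp⟩
  have hA : openSegment ℝ (x + (-t') • f) (x + t • f) ⊆ medialAxis O := by
    rw [hseg]; rintro _ ⟨s, hs, rfl⟩; exact hM s hs
  have hB : ∀ z ∈ openSegment ℝ (x + (-t') • f) (x + t • f), z ∉ nodes Vt L := by
    rw [hseg]; rintro _ ⟨s, hs, rfl⟩; exact hIoo s hs
  have hne : x + (-t') • f ≠ x + t • f := by
    intro h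
    have := smul_left_injective ℝ hf (add_left_cancel h)
    linarith
  -- The lexicographic order selects one of the two orientations of the segment.
  rcases lt_or_gt_of_ne (fun h => hne (toLex.injective h)) with h | h
  · exact ⟨(_, _), ⟨htN', htN, h, hA, hB⟩, hxs⟩
  · rw [openSegment_symm] at hA hB hxs
    exact ⟨(_, _), ⟨htN, htN', h, hA, hB⟩, hxs⟩

/-- A link lies on every line of the arrangement that meets its interior. -/
theorem Tame.onLine_of_link (T : Tame O Vt L) {s : Plane × Plane} (hs : IsLink O (nodes Vt L) s)
    {z : Plane} (hz : z ∈ openSegment ℝ s.1 s.2) {l : ℝ × ℝ × ℝ} (hl : l ∈ arrangement Vt L)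
    (hzl : OnLine l z) : OnLine l s.1 ∧ OnLine l s.2 := by
  obtain ⟨-, -, -, hM, hN⟩ := hs
  set A : Set Plane := {x | OnLine l x}
  set B : Set Plane := ⋃ l' ∈ {l' | l' ∈ arrangement Vt L ∧ ¬ OnLine l' z}, {x | OnLine l' x}
  have hA : IsClosed A := isClosed_onLine l
  have hB : IsClosed B := (((arrangement Vt L).finite_toSet).subset fun l' h => h.1).isClosed_biUnion
    fun l' _ => isClosed_onLine l'
  have hpre : IsPreconnected (openSegment ℝ s.1 s.2) := (convex_openSegment _ _).isPreconnected
  have hsub : openSegment ℝ s.1 s.2 ⊆ A := by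
    have hcov : openSegment ℝ s.1 s.2 ⊆ A ∪ B := by
      intro w hw
      obtain ⟨l', hl', hwl'⟩ := T.exists_onLine (hM hw)
      by_cases h : OnLine l' z
      · exact .inl (T.onLine_iff hl' hl (hN z hz) h hzl w hwl')
      · exact .inr (mem_biUnion (show l' ∈ {l' | _} from ⟨hl', h⟩) hwl')
    have hdis : ∀ w ∈ openSegment ℝ s.1 s.2, w ∈ A → w ∉ B := by
      intro w hw hwA hwB
      obtain ⟨l', hl', hwl'⟩ := mem_iUnion₂.1 hwB
      exact hl'.2 (T.onLine_iff hl hl'.1 (hN w hw) hwA hwl' z hzl)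
    intro w hw
    by_contra hwA
    have hwB := (hcov hw).resolve_left hwA
    obtain ⟨v, hv, hvA, hvB⟩ := isPreconnected_closed_iff.1 hpre A B hA hB hcov ⟨z, hz, hzl⟩
      ⟨w, hw, hwB⟩
    exact hdis v hv hvA hvB
  have hcl : closure (openSegment ℝ s.1 s.2) ⊆ A := closure_minimal hsub hA
  rw [closure_openSegment] at hcl
  exact ⟨hcl (left_mem_segment ℝ _ _), hcl (right_mem_segment ℝ _ _)⟩

theorem Tame.exists_param (T : Tame O Vt L) {l : ℝ × ℝ × ℝ} (hl : l ∈ arrangement Vt L) {z a : Plane}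
    (hz : OnLine l z) (ha : OnLine l a) : ∃ t : ℝ, a = z + t • lineDir l := by
  unfold OnLine at hz ha
  have e : l.1 * (a.1 - z.1) + l.2.1 * (a.2 - z.2) = 0 := by linarith
  by_cases h : l.1 = 0
  · have h2 := (T.arrangement_ne hl).resolve_left (not_not.2 h)
    refine ⟨(a.1 - z.1) / (-l.2.1), ?_⟩
    rw [h, zero_mul, zero_add] at e
    have e' := (mul_eq_zero.1 e).resolve_left h2
    ext <;> simp [lineDir]
    · field_simp; ring
    · rw [h]; linarith
  · refine ⟨(a.2 - z.2) / l.1, ?_⟩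
    ext <;> simp [lineDir]
    · field_simp; linarith
    · field_simp; ring

theorem Tame.link_param (T : Tame O Vt L) {s : Plane × Plane} (hs : IsLink O (nodes Vt L) s)
    {z : Plane} (hz : z ∈ openSegment ℝ s.1 s.2) {l : ℝ × ℝ × ℝ} (hl : l ∈ arrangement Vt L)
    (hzl : OnLine l z) : ∃ a b : ℝ, s.1 = z + a • lineDir l ∧ s.2 = z + b • lineDir l ∧
      ((a < 0 ∧ 0 < b) ∨ (b < 0 ∧ 0 < a)) := by
  obtain ⟨h1, h2⟩ := T.onLine_of_link hs hz hl hzl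
  obtain ⟨a, ha⟩ := T.exists_param hl hzl h1
  obtain ⟨b, hb⟩ := T.exists_param hl hzl h2
  refine ⟨a, b, ha, hb, ?_⟩
  obtain ⟨u, v, hu, hv, huv, hzz⟩ := hz
  have hab : u * a + v * b = 0 := by
    have : (u * a + v * b) • lineDir l = 0 := by
      have h3 : u • (z + a • lineDir l) + v • (z + b • lineDir l) =
          (u + v) • z + (u * a + v * b) • lineDir l := by module
      rw [ha, hb, h3, huv, one_smul] at hzz
      simpa using hzz
    exact (smul_eq_zero.1 this).resolve_right (T.lineDir_ne hl)
  have hne : a ≠ 0 := by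
    rintro rfl
    have : b = 0 := by
      have h4 : v * b = 0 := by linarith
      exact (mul_eq_zero.1 h4).resolve_left hv.ne'
    have h5 := hs.2.2.1
    rw [ha, hb, this] at h5
    exact lt_irrefl _ h5
  rcases lt_or_gt_of_ne hne with h | h
  · left; refine ⟨h, ?_⟩; by_contra hb0; push Not at hb0; nlinarith
  · right; refine ⟨?_, h⟩; by_contra hb0; push Not at hb0; nlinarith

theorem mem_openSegment_param {z f : Plane} {a b t : ℝ} (h1 : a < t) (h2 : t < b) :
    z + t • f ∈ openSegment ℝ (z + a • f) (z + b • f) := by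
  have hab : 0 < b - a := by linarith
  refine ⟨(b - t) / (b - a), (t - a) / (b - a), div_pos (by linarith) hab,
    div_pos (by linarith) hab, by field_simp; ring, ?_⟩
  have e : (b - t) / (b - a) + (t - a) / (b - a) = 1 := by field_simp; ring
  have e2 : (b - t) / (b - a) * a + (t - a) / (b - a) * b = t := by field_simp; ring
  calc _ = ((b - t) / (b - a) + (t - a) / (b - a)) • z +
      ((b - t) / (b - a) * a + (t - a) / (b - a) * b) • f := by module
    _ = _ := by rw [e, e2, one_smul]

/-- Both links lie on the line through `z`, and neither has a node in its interior, so no endpoint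
of one is strictly inside the other. The lexicographic orientation rules out the reversed segment.
-/
theorem Tame.link_unique (T : Tame O Vt L) {s s' : Plane × Plane} (hs : IsLink O (nodes Vt L) s)
    (hs' : IsLink O (nodes Vt L) s') {z : Plane} (hz : z ∈ openSegment ℝ s.1 s.2)
    (hz' : z ∈ openSegment ℝ s'.1 s'.2) : s = s' := by
  obtain ⟨l, hl, hzl⟩ := T.exists_onLine (hs.2.2.2.1 hz)
  have key : ∀ {s s' : Plane × Plane}, IsLink O (nodes Vt L) s → IsLink O (nodes Vt L) s' →
      z ∈ openSegment ℝ s.1 s.2 → z ∈ openSegment ℝ s'.1 s'.2 →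
      ∀ a b a' b' : ℝ, s.1 = z + a • lineDir l → s.2 = z + b • lineDir l →
        s'.1 = z + a' • lineDir l → s'.2 = z + b' • lineDir l →
        (a < 0 → a' < 0 → 0 < b → 0 < b' → a ≤ a' ∧ b' ≤ b) ∧
        (b < 0 → b' < 0 → 0 < a → 0 < a' → b ≤ b' ∧ a' ≤ a) ∧
        (a < 0 → b' < 0 → 0 < b → 0 < a' → a ≤ b' ∧ a' ≤ b) ∧
        (b < 0 → a' < 0 → 0 < a → 0 < b' → b ≤ a' ∧ b' ≤ a) := by
    intro s s' hs hs' hz hz' a b a' b' e1 e2 e3 e4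
    have n1 := hs.1
    have n2 := hs.2.1
    have hN := hs'.2.2.2.2
    rw [e1] at n1
    rw [e2] at n2
    rw [e3, e4] at hN
    have hN2 := hN
    rw [openSegment_symm] at hN2
    refine ⟨fun _ _ _ _ => ⟨?_, ?_⟩, fun _ _ _ _ => ⟨?_, ?_⟩, fun _ _ _ _ => ⟨?_, ?_⟩,
      fun _ _ _ _ => ⟨?_, ?_⟩⟩ <;> by_contra hcon <;> push Not at hcon
    · exact hN _ (mem_openSegment_param (by linarith) (by linarith)) n1
    · exact hN _ (mem_openSegment_param (by linarith) (by linarith)) n2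
    · exact hN2 _ (mem_openSegment_param (by linarith) (by linarith)) n2
    · exact hN2 _ (mem_openSegment_param (by linarith) (by linarith)) n1
    · exact hN2 _ (mem_openSegment_param (by linarith) (by linarith)) n1
    · exact hN2 _ (mem_openSegment_param (by linarith) (by linarith)) n2
    · exact hN _ (mem_openSegment_param (by linarith) (by linarith)) n2
    · exact hN _ (mem_openSegment_param (by linarith) (by linarith)) n1
  obtain ⟨a, b, e1, e2, hab⟩ := T.link_param hs hz hl hzl
  obtain ⟨a', b', e3, e4, hab'⟩ := T.link_param hs' hz' hl hzl
  obtain ⟨k1, k2, k3, k4⟩ := key hs hs' hz hz' a b a' b' e1 e2 e3 e4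
  obtain ⟨m1, m2, m3, m4⟩ := key hs' hs hz' hz a' b' a b e3 e4 e1 e2
  rcases hab with ⟨g1, g2⟩ | ⟨g1, g2⟩ <;> rcases hab' with ⟨g3, g4⟩ | ⟨g3, g4⟩
  · have ea := le_antisymm (k1 g1 g3 g2 g4).1 (m1 g3 g1 g4 g2).1
    have eb := le_antisymm (m1 g3 g1 g4 g2).2 (k1 g1 g3 g2 g4).2
    exact Prod.ext (by rw [e1, e3, ea]) (by rw [e2, e4, eb])
  · have ea := le_antisymm (k3 g1 g3 g2 g4).1 (m4 g3 g1 g4 g2).1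
    have eb := le_antisymm (m4 g3 g1 g4 g2).2 (k3 g1 g3 g2 g4).2
    have l1 := hs.2.2.1
    have l2 := hs'.2.2.1
    rw [e1, e2, ea, eb, ← e3, ← e4] at l1
    exact absurd l1 (lt_asymm l2)
  · have ea := le_antisymm (k4 g1 g3 g2 g4).1 (m3 g3 g1 g4 g2).1
    have eb := le_antisymm (m3 g3 g1 g4 g2).2 (k4 g1 g3 g2 g4).2
    have l1 := hs.2.2.1
    have l2 := hs'.2.2.1
    rw [e1, e2, ea, eb, ← e3, ← e4] at l1
    exact absurd l1 (lt_asymm l2)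
  · have ea := le_antisymm (k2 g1 g3 g2 g4).1 (m2 g3 g1 g4 g2).1
    have eb := le_antisymm (m2 g3 g1 g4 g2).2 (k2 g1 g3 g2 g4).2
    exact Prod.ext (by rw [e1, e3, eb]) (by rw [e2, e4, ea])

open Classical in
/-- The closure of the medial axis is a union of interior disjoint segments. -/
theorem Tame.exists_complex (T : Tame O Vt L) :
    ∃ G : Finset (Plane × Plane), IsSegmentComplex G ∧ carrier G = closure (medialAxis O) ∧
      ∀ s ∈ G, openSegment ℝ s.1 s.2 ⊆ medialAxis O := by
  set N := nodes Vt L with hNdef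
  set G := (N ×ˢ N).filter (IsLink O N) with hG
  have hmem : ∀ s, s ∈ G ↔ IsLink O N s := by
    intro s
    rw [hG, Finset.mem_filter, Finset.mem_product]
    exact ⟨fun h => h.2, fun h => ⟨⟨h.1, h.2.1⟩, h⟩⟩
  have hne : ∀ s, IsLink O N s → s.1 ≠ s.2 := fun s h he => by
    have := h.2.2.1
    rw [he] at this
    exact lt_irrefl _ this
  refine ⟨G, ⟨fun s hs => hne s ((hmem s).1 hs), ?_⟩, ?_, fun s hs => ((hmem s).1 hs).2.2.2.1⟩
  · intro s hs t ht hst z hz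
    have hs' := (hmem s).1 hs
    have ht' := (hmem t).1 ht
    have hcase : ∀ u : Plane × Plane, z ∈ segment ℝ u.1 u.2 →
        z ∈ ({u.1, u.2} : Set Plane) ∨ z ∈ openSegment ℝ u.1 u.2 := by
      intro u hu
      by_cases h1 : u.1 = z
      · left; simp [h1]
      by_cases h2 : u.2 = z
      · left; simp [h2]
      right
      exact mem_openSegment_of_ne_left_right h1 h2 hu
    have hnode : ∀ u : Plane × Plane, IsLink O N u → z ∈ ({u.1, u.2} : Set Plane) → z ∈ N := by
      rintro u hu (h | h)
      · exact h ▸ hu.1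
      · exact h ▸ hu.2.1
    rcases hcase s hz.1 with h1 | h1 <;> rcases hcase t hz.2 with h2 | h2
    · exact ⟨h1, h2⟩
    · exact absurd (hnode s hs' h1) (ht'.2.2.2.2 z h2)
    · exact absurd (hnode t ht' h2) (hs'.2.2.2.2 z h1)
    · exact absurd (T.link_unique hs' ht' h1 h2) hst
  · have hcl : IsClosed (carrier G) := by
      unfold carrier
      refine G.finite_toSet.isClosed_biUnion fun s _ => ?_
      rw [← closure_openSegment]
      exact isClosed_closure
    apply Set.Subset.antisymm
    · unfold carrier
      refine iUnion₂_subset fun s hs => ?_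
      rw [← closure_openSegment]
      exact closure_mono ((hmem s).1 hs).2.2.2.1
    · have hMN : medialAxis O \ N ⊆ carrier G := by
        rintro x ⟨hx, hxN⟩
        obtain ⟨s, hs, hxs⟩ := T.exists_link hx hxN
        exact mem_biUnion ((hmem s).2 hs) (openSegment_subset_segment _ _ _ hxs)
      refine closure_minimal (fun x hx => ?_) hcl
      by_cases hxN : x ∈ N
      -- A node on the axis is a limit of other points of the axis, and the finitely many other
      -- nodes do not accumulate at it; so it is a limit of points inside links.
      · have h1 := T.not_isolated hx
        have h2 : x ∉ closure ((N : Set Plane) \ {x}) := by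
          rw [(N.finite_toSet.subset sdiff_subset).isClosed.closure_eq]
          simp
        have h3 : medialAxis O \ {x} ⊆ (medialAxis O \ N) ∪ ((N : Set Plane) \ {x}) := by
          rintro y ⟨hy, hyx⟩
          by_cases hyN : y ∈ N
          · exact .inr ⟨hyN, hyx⟩
          · exact .inl ⟨hy, hyN⟩
        have h4 := closure_mono h3 h1
        rw [closure_union] at h4
        exact closure_minimal hMN hcl (h4.resolve_right h2)
      · exact hMN ⟨hx, hxN⟩

end Corridor
end

/-! ### Cones and their angles modulo full turns -/

noncomputable section
open Set Filter Topology Real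
namespace Corridor

/-! ### Directions in which a set leaves a point -/

theorem unitVec_eq_iff {θ ψ : ℝ} : unitVec θ = unitVec ψ ↔ ∃ k : ℤ, θ = ψ + k * (2 * π) := by
  constructor
  · intro h
    have h1 : cos θ = cos ψ := congrArg Prod.fst h
    have h2 : sin θ = sin ψ := congrArg Prod.snd h
    obtain ⟨k, hk⟩ := Real.Angle.angle_eq_iff_two_pi_dvd_sub.1 (Real.Angle.cos_sin_inj h1 h2)
    exact ⟨k, by linarith⟩
  · rintro ⟨k, rfl⟩
    unfold unitVec
    rw [cos_add_int_mul_two_pi, sin_add_int_mul_two_pi]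

theorem unitVec_add_pi (θ : ℝ) : unitVec (θ + π) = -unitVec θ := by
  unfold unitVec
  rw [cos_add_pi, sin_add_pi]; rfl

theorem unitVec_eq_of_smul {θ ψ c : ℝ} (hc : 0 < c) (h : unitVec θ = c • unitVec ψ) :
    c = 1 ∧ unitVec θ = unitVec ψ := by
  have h1 : cos θ = c * cos ψ := congrArg Prod.fst h
  have h2 : sin θ = c * sin ψ := congrArg Prod.snd h
  have e : c ^ 2 = 1 := by
    have e1 := sin_sq_add_cos_sq θ
    have e2 := sin_sq_add_cos_sq ψ
    rw [h1, h2] at e1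
    nlinarith
  have hc1 : c = 1 := by nlinarith
  exact ⟨hc1, by rw [h, hc1, one_smul]⟩

/-- A vector between two others, as a combination with positive coefficients. -/
theorem unitVec_combination {θ φ ψ : ℝ} :
    sin (φ - θ) • unitVec ψ = sin (φ - ψ) • unitVec θ + sin (ψ - θ) • unitVec φ := by
  unfold unitVec
  simp only [sin_sub]
  have a1 := sin_sq_add_cos_sq θ
  ext <;> simp <;> ring

/-- A set of angles that is periodic and finite modulo `2 * π`. -/
structure PerFin (A : Set ℝ) : Prop where
  per : ∀ θ, θ + 2 * π ∈ A ↔ θ ∈ A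
  fin : (A ∩ Ico 0 (2 * π)).Finite

namespace PerFin
variable {A B : Set ℝ}

theorem add_int (h : PerFin A) (θ : ℝ) (k : ℤ) : θ + k * (2 * π) ∈ A ↔ θ ∈ A := by
  induction k using Int.induction_on with
  | zero => simp
  | succ n ih => rw [← ih, ← h.per (θ + ((n : ℤ) : ℝ) * (2 * π))]; push_cast; ring_nf
  | pred n ih =>
    rw [← ih, ← h.per (θ + ((-(n : ℤ) - 1 : ℤ) : ℝ) * (2 * π))]; push_cast; ring_nf

theorem union (hA : PerFin A) (hB : PerFin B) : PerFin (A ∪ B) :=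
  ⟨fun θ => or_congr (hA.per θ) (hB.per θ), by
    rw [union_inter_distrib_right]; exact hA.fin.union hB.fin⟩

theorem exists_rep (h : PerFin A) {θ : ℝ} (hθ : θ ∈ A) :
    ∃ k : ℤ, θ + k * (2 * π) ∈ A ∩ Ico 0 (2 * π) := by
  have hp : (0 : ℝ) < 2 * π := by positivity
  refine ⟨-toIcoDiv hp 0 θ, (h.add_int _ _).2 hθ, ?_⟩
  have := toIcoMod_mem_Ico hp 0 θ
  rw [zero_add] at this
  have e := self_sub_toIcoDiv_zsmul hp 0 θ
  rw [zsmul_eq_mul] at e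
  rw [← e] at this
  convert this using 1
  push_cast; ring

theorem finite_inter_Icc (h : PerFin A) (u v : ℝ) : (A ∩ Icc u v).Finite := by
  have hp : (0 : ℝ) < 2 * π := by positivity
  have hsub : A ∩ Icc u v ⊆ ⋃ k ∈ Icc (-⌈(|u| + |v|) / (2 * π)⌉ - 1) (⌈(|u| + |v|) / (2 * π)⌉ + 1),
      (fun θ : ℝ => θ - (k : ℤ) * (2 * π)) '' (A ∩ Ico 0 (2 * π)) := by
    rintro θ ⟨hθ, h1, h2⟩
    obtain ⟨k, hk⟩ := h.exists_rep hθ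
    have hθ' : |θ| ≤ |u| + |v| := by
      rw [abs_le]
      constructor
      · have := neg_abs_le u; have := abs_nonneg v; linarith
      · have := le_abs_self v; have := abs_nonneg u; linarith
    have hc := Int.le_ceil ((|u| + |v|) / (2 * π))
    have hq : |θ| / (2 * π) ≤ ⌈(|u| + |v|) / (2 * π)⌉ := by
      refine le_trans ?_ hc
      gcongr
    rw [div_le_iff₀ hp] at hq
    obtain ⟨g1, g2⟩ := abs_le.1 hq
    obtain ⟨-, g3, g4⟩ := id hk
    refine mem_biUnion (x := k) ⟨?_, ?_⟩ ⟨θ + k * (2 * π), hk, by simp⟩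
    · have : (-⌈(|u| + |v|) / (2 * π)⌉ - 1 : ℝ) * (2 * π) < (k : ℝ) * (2 * π) + 1 * (2 * π) := by
        nlinarith
      have h5 : (-⌈(|u| + |v|) / (2 * π)⌉ - 1 : ℝ) < (k : ℝ) + 1 := by nlinarith
      have : -⌈(|u| + |v|) / (2 * π)⌉ - 1 < k + 1 := by exact_mod_cast h5
      omega
    · have h5 : (k : ℝ) < ⌈(|u| + |v|) / (2 * π)⌉ + 1 := by nlinarith
      have : k < ⌈(|u| + |v|) / (2 * π)⌉ + 1 := by exact_mod_cast h5
      omega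
  exact ((Set.finite_Icc _ _).biUnion fun k _ => h.fin.image _).subset hsub

/-- A half-open interval of length `2 * π` contains a representative of every angle. The bound `θ +
2 * π` is attained if `θ` is the only angle of `A` modulo full turns. -/
theorem exists_succ (h : PerFin A) (hne : A.Nonempty) (θ : ℝ) :
    ∃ b ∈ A, θ < b ∧ b ≤ θ + 2 * π ∧ ∀ ψ, θ < ψ → ψ < b → ψ ∉ A := by
  have hp : (0 : ℝ) < 2 * π := by positivity
  obtain ⟨a, ha⟩ := hne
  have hfin : (A ∩ Ioc θ (θ + 2 * π)).Finite :=
    (h.finite_inter_Icc θ (θ + 2 * π)).subset (inter_subset_inter_right _ Ioc_subset_Icc_self)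
  have hex : (A ∩ Ioc θ (θ + 2 * π)).Nonempty := by
    refine ⟨_, ?_, toIocMod_mem_Ioc hp θ a⟩
    have e := self_sub_toIocDiv_zsmul hp θ a
    rw [← e, zsmul_eq_mul, sub_eq_add_neg, ← neg_mul, ← Int.cast_neg]
    exact (h.add_int _ _).2 ha
  obtain ⟨b, hb, hmin⟩ := Set.exists_min_image _ id hfin hex
  refine ⟨b, hb.1, hb.2.1, hb.2.2, fun ψ h1 h2 h3 => ?_⟩
  exact absurd (hmin ψ ⟨h3, h1, h2.le.trans hb.2.2⟩) (not_le.2 h2)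

theorem exists_pred (h : PerFin A) (hne : A.Nonempty) (θ : ℝ) :
    ∃ b ∈ A, b < θ ∧ θ - 2 * π ≤ b ∧ ∀ ψ, b < ψ → ψ < θ → ψ ∉ A := by
  have hp : (0 : ℝ) < 2 * π := by positivity
  obtain ⟨a, ha⟩ := hne
  have hfin : (A ∩ Ico (θ - 2 * π) θ).Finite :=
    (h.finite_inter_Icc (θ - 2 * π) θ).subset (inter_subset_inter_right _ Ico_subset_Icc_self)
  have hex : (A ∩ Ico (θ - 2 * π) θ).Nonempty := by
    have hm := toIcoMod_mem_Ico hp (θ - 2 * π) a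
    rw [sub_add_cancel] at hm
    refine ⟨_, ?_, hm⟩
    have e := self_sub_toIcoDiv_zsmul hp (θ - 2 * π) a
    rw [← e, zsmul_eq_mul, sub_eq_add_neg, ← neg_mul, ← Int.cast_neg]
    exact (h.add_int _ _).2 ha
  obtain ⟨b, hb, hmax⟩ := Set.exists_max_image _ id hfin hex
  refine ⟨b, hb.1, hb.2.2, hb.2.1, fun ψ h1 h2 h3 => ?_⟩
  exact absurd (hmax ψ ⟨h3, hb.2.1.trans h1.le, h2⟩) (not_le.2 h1)

theorem eventually_notMem (h : PerFin A) (a : ℝ) {s : ℝ} (hs : s = 1 ∨ s = -1) :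
    ∀ᶠ τ in 𝓝[>] (0 : ℝ), a + s * τ ∉ A := by
  rcases A.eq_empty_or_nonempty with rfl | hne
  · exact Eventually.of_forall fun _ h => h
  rcases hs with rfl | rfl
  · obtain ⟨b, -, h1, -, h2⟩ := h.exists_succ hne a
    filter_upwards [Ioo_mem_nhdsGT (show (0 : ℝ) < b - a by linarith)] with τ hτ
    exact h2 _ (by linarith [hτ.1]) (by linarith [hτ.2])
  · obtain ⟨b, -, h1, -, h2⟩ := h.exists_pred hne a
    filter_upwards [Ioo_mem_nhdsGT (show (0 : ℝ) < a - b by linarith)] with τ hτ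
    exact h2 _ (by linarith [hτ.2]) (by linarith [hτ.1])

end PerFin

/-- The angles under which `X` leaves `p`. -/
def angles (X : Set Plane) (p : Plane) : Set ℝ :=
  {θ | ∀ᶠ ρ in 𝓝[>] (0 : ℝ), p + ρ • unitVec θ ∈ X}

theorem mem_angles {X : Set Plane} {p : Plane} {θ : ℝ} :
    θ ∈ angles X p ↔ ∀ᶠ ρ in 𝓝[>] (0 : ℝ), p + ρ • unitVec θ ∈ X := Iff.rfl

/-- Within distance `ε`, the set `X` is a cone with apex `p`. -/
def ConicAt (X : Set Plane) (p : Plane) (ε : ℝ) : Prop :=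
  ∀ ρ, 0 < ρ → ρ < ε → ∀ θ, p + ρ • unitVec θ ∈ X ↔ θ ∈ angles X p

theorem conicAt_of_forall {X : Set Plane} {p : Plane} {ε : ℝ} (hε : 0 < ε)
    (h : ∀ ρ, 0 < ρ → ρ < ε → ∀ ρ', 0 < ρ' → ρ' < ε → ∀ θ,
      p + ρ • unitVec θ ∈ X → p + ρ' • unitVec θ ∈ X) : ConicAt X p ε := by
  intro ρ h0 h1 θ
  constructor
  · intro hX
    filter_upwards [Ioo_mem_nhdsGT hε] with ρ' hρ'
    exact h ρ h0 h1 ρ' hρ'.1 hρ'.2 θ hX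
  · intro hX
    obtain ⟨ρ', h2, h3⟩ := ((mem_angles.1 hX).and (Ioo_mem_nhdsGT hε)).exists
    exact h ρ' h3.1 h3.2 ρ h0 h1 θ h2

theorem ConicAt.mono {X : Set Plane} {p : Plane} {ε ε' : ℝ} (h : ConicAt X p ε) (hle : ε' ≤ ε) :
    ConicAt X p ε' := fun ρ h0 h1 => h ρ h0 (h1.trans_le hle)

theorem ConicAt.union {X Y : Set Plane} {p : Plane} {ε : ℝ} (hε : 0 < ε) (hX : ConicAt X p ε)
    (hY : ConicAt Y p ε) : ConicAt (X ∪ Y) p ε := by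
  refine conicAt_of_forall hε fun ρ h0 h1 ρ' h0' h1' θ h => ?_
  rcases h with h | h
  · exact .inl ((hX ρ' h0' h1' θ).2 ((hX ρ h0 h1 θ).1 h))
  · exact .inr ((hY ρ' h0' h1' θ).2 ((hY ρ h0 h1 θ).1 h))

theorem angles_union {X Y : Set Plane} {p : Plane} {ε : ℝ} (hε : 0 < ε) (hX : ConicAt X p ε)
    (hY : ConicAt Y p ε) : angles (X ∪ Y) p = angles X p ∪ angles Y p := by
  ext θ
  have h1 : 0 < ε / 2 := by positivity
  have h2 : ε / 2 < ε := by linarith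
  rw [← hX.union hε hY _ h1 h2, mem_union, mem_union, hX _ h1 h2, hY _ h1 h2]

theorem exists_conicAt_segment (a b p : Plane) : ∃ ε > 0, ConicAt (segment ℝ a b) p ε := by
  have hcl : IsClosed (segment ℝ a b) := by rw [← closure_openSegment]; exact isClosed_closure
  by_cases hp : p ∈ segment ℝ a b
  · rw [segment_eq_image'] at hp
    obtain ⟨τ, ⟨h0, h1⟩, rfl⟩ := hp
    dsimp only
    by_cases hab : b - a = 0
    · refine ⟨1, one_pos, conicAt_of_forall one_pos fun ρ hρ _ ρ' _ _ θ h => ?_⟩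
      rw [sub_eq_zero] at hab
      subst hab
      simp only [sub_self, smul_zero, add_zero, segment_same, mem_singleton_iff] at h
      exact absurd h (add_unitVec_ne hρ)
    have hn : 0 < ‖b - a‖ := norm_pos_iff.2 hab
    -- The distances from `p` to the two ends; 1 stands in for an end that coincides with `p`.
    refine ⟨min (if τ < 1 then (1 - τ) * ‖b - a‖ else 1) (if 0 < τ then τ * ‖b - a‖ else 1),
      ?_, conicAt_of_forall ?_ fun ρ hρ _ ρ' hρ' hε θ h => ?_⟩
    · refine lt_min ?_ ?_ <;> split_ifs with h
      · exact mul_pos (by linarith) hn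
      · exact one_pos
      · exact mul_pos h hn
      · exact one_pos
    · refine lt_min ?_ ?_ <;> split_ifs with h
      · exact mul_pos (by linarith) hn
      · exact one_pos
      · exact mul_pos h hn
      · exact one_pos
    · rw [segment_eq_image'] at h ⊢
      obtain ⟨τ', ⟨h0', h1'⟩, h⟩ := h
      dsimp only at h
      set c := (τ' - τ) / ρ
      have hw : unitVec θ = c • (b - a) := by
        have : ρ • unitVec θ = (τ' - τ) • (b - a) := by
          rw [sub_smul, eq_sub_iff_add_eq, add_comm]
          have := h
          rw [add_assoc] at this
          exact (add_left_cancel this).symm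
        have e : unitVec θ = ρ⁻¹ • ρ • unitVec θ := by rw [smul_smul, inv_mul_cancel₀ hρ.ne', one_smul]
        rw [e, this, smul_smul]
        congr 1
        simp only [c]; field_simp
      refine ⟨τ + ρ' * c, ?_, by simp only [hw, smul_smul, add_smul, add_assoc]⟩
      have hcn : |c| * ‖b - a‖ ≤ 1 := by
        rw [← Real.norm_eq_abs, ← norm_smul, ← hw]; exact norm_unitVec_le θ
      have hb : ρ' * |c| * ‖b - a‖ ≤ ρ' := by
        rw [mul_assoc]; exact mul_le_of_le_one_right hρ'.le hcn
      have h3 := hε.trans_le (min_le_left _ _)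
      have h4 := hε.trans_le (min_le_right _ _)
      rcases lt_trichotomy τ' τ with g | g | g
      · have hc : c < 0 := div_neg_of_neg_of_pos (by linarith) hρ
        rw [if_pos (by linarith)] at h4
        rw [abs_of_neg hc] at hb
        have : ρ' * -c < τ := lt_of_mul_lt_mul_right (hb.trans_lt h4) hn.le
        constructor <;> nlinarith
      · have hc : c = 0 := by simp [c, g]
        rw [hc, mul_zero, add_zero]; exact ⟨h0, h1⟩
      · have hc : 0 < c := div_pos (by linarith) hρ
        rw [if_pos (by linarith)] at h3
        rw [abs_of_pos hc] at hb
        have : ρ' * c < 1 - τ := lt_of_mul_lt_mul_right (hb.trans_lt h3) hn.le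
        constructor <;> nlinarith
  · obtain ⟨ε, hε, hball⟩ := Metric.isOpen_iff.1 hcl.isOpen_compl p hp
    exact ⟨ε, hε, conicAt_of_forall hε fun ρ h0 h1 ρ' _ _ θ h =>
      absurd h (hball (dist_add_unitVec_lt h0.le h1))⟩

/-- A segment leaves a point at most in the two directions `±(b - a)`. -/
theorem perFin_angles_segment (a b p : Plane) : PerFin (angles (segment ℝ a b) p) := by
  have hper : ∀ θ, unitVec (θ + 2 * π) = unitVec θ := fun θ =>
    unitVec_eq_iff.2 ⟨1, by push_cast; ring⟩
  refine ⟨fun θ => by unfold angles; simp only [mem_ofPred_eq, hper], ?_⟩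
  have hdir : ∀ θ ∈ angles (segment ℝ a b) p, ∃ c : ℝ, c ≠ 0 ∧ unitVec θ = c • (b - a) := by
    intro θ hθ
    -- Comparing the points at distances `ρ` and `ρ / 2` shows that the direction is a multiple of
    -- `b - a`.
    have h2 : ∀ᶠ ρ in 𝓝[>] (0 : ℝ), p + (ρ / 2) • unitVec θ ∈ segment ℝ a b := by
      have : Tendsto (fun ρ : ℝ => ρ / 2) (𝓝[>] 0) (𝓝[>] 0) := by
        refine tendsto_nhdsWithin_iff.2 ⟨?_, ?_⟩
        · have := ((continuous_id.div_const (2 : ℝ)).tendsto 0).mono_left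
            (nhdsWithin_le_nhds (s := Ioi (0 : ℝ)))
          simpa using this
        · filter_upwards [self_mem_nhdsWithin] with x hx
          exact half_pos (show (0 : ℝ) < x from hx)
      exact this.eventually (mem_angles.1 hθ)
    obtain ⟨ρ, ⟨h1, h2⟩, hρ⟩ := (((mem_angles.1 hθ).and h2).and self_mem_nhdsWithin).exists
    have hρ : 0 < ρ := hρ
    rw [segment_eq_image'] at h1 h2
    obtain ⟨s, -, hs⟩ := h1
    obtain ⟨t, -, ht⟩ := h2
    dsimp only at hs ht
    have e : (ρ / 2) • unitVec θ = (s - t) • (b - a) := by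
      have : p + ρ • unitVec θ - (p + (ρ / 2) • unitVec θ) = (ρ / 2) • unitVec θ := by module
      rw [← this, ← hs, ← ht]; module
    have e2 : unitVec θ = ((s - t) / (ρ / 2)) • (b - a) := by
      have e' : unitVec θ = (ρ / 2)⁻¹ • (ρ / 2) • unitVec θ := by
        rw [smul_smul, inv_mul_cancel₀ (by positivity), one_smul]
      rw [e', e, smul_smul]; congr 1; field_simp
    refine ⟨_, fun h => ?_, e2⟩
    rw [h, zero_smul] at e2
    exact unitVec_ne_zero θ e2
  have hinj : ∀ θ ∈ Ico 0 (2 * π), ∀ ψ ∈ Ico 0 (2 * π), ∀ c d : ℝ, 0 < c * d →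
      unitVec θ = c • (b - a) → unitVec ψ = d • (b - a) → θ = ψ := by
    intro θ hθ ψ hψ c d hcd h1 h2
    have hd : d ≠ 0 := by rintro rfl; simp at hcd
    have h3 : unitVec θ = (c / d) • unitVec ψ := by
      rw [h1, h2, smul_smul, div_mul_cancel₀ _ hd]
    have hpos : 0 < c / d := by
      rw [show c / d = c * d / d ^ 2 by field_simp]; positivity
    obtain ⟨k, hk⟩ := unitVec_eq_iff.1 (unitVec_eq_of_smul hpos h3).2
    have hp : (0 : ℝ) < 2 * π := by positivity
    have hk1 : (k : ℝ) < 1 := by by_contra h; push Not at h; nlinarith [hθ.2, hψ.1]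
    have hk2 : (-1 : ℝ) < k := by by_contra h; push Not at h; nlinarith [hθ.1, hψ.2]
    have : k = 0 := by
      have a1 : k < 1 := by exact_mod_cast hk1
      have a2 : -1 < k := by exact_mod_cast hk2
      omega
    simpa [this] using hk
  have hfin : ∀ s : ℝ, {θ ∈ Ico 0 (2 * π) | ∃ c : ℝ, 0 < c * s ∧ unitVec θ = c • (b - a)}.Finite := by
    intro s
    refine Set.Subsingleton.finite ?_
    rintro θ ⟨h1, c, hc, h2⟩ ψ ⟨h3, d, hd, h4⟩
    refine hinj θ h1 ψ h3 c d ?_ h2 h4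
    have hs : s ≠ 0 := by rintro rfl; simp at hc
    have : 0 < (c * d) * s ^ 2 := by nlinarith
    exact pos_of_mul_pos_left this (sq_nonneg s)
  refine ((hfin 1).union (hfin (-1))).subset ?_
  rintro θ ⟨hθ, hI⟩
  obtain ⟨c, hc, h⟩ := hdir θ hθ
  rcases lt_or_gt_of_ne hc with g | g
  · exact .inr ⟨hI, c, by linarith, h⟩
  · exact .inl ⟨hI, c, by linarith, h⟩

theorem angles_empty (p : Plane) : angles ∅ p = ∅ := by
  ext θ
  simp only [angles, mem_empty_iff_false, mem_ofPred_eq, iff_false]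
  intro h
  exact h.exists.elim fun _ h => h

/-- Finite unions of segments are locally conic. -/
theorem exists_conicAt_biUnion {ι : Type*} (s : Finset ι) (f : ι → Plane × Plane) (p : Plane) :
    (∃ ε > 0, ConicAt (⋃ i ∈ s, segment ℝ (f i).1 (f i).2) p ε) ∧
      PerFin (angles (⋃ i ∈ s, segment ℝ (f i).1 (f i).2) p) := by
  classical
  induction s using Finset.induction_on with
  | empty =>
    simp only [Finset.notMem_empty, iUnion_of_empty, iUnion_empty]
    exact ⟨⟨1, one_pos, conicAt_of_forall one_pos fun _ _ _ _ _ _ _ h => h⟩, by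
      rw [angles_empty]; exact ⟨by simp, by simp⟩⟩
  | insert i s _ ih =>
    obtain ⟨⟨ε, hε, hc⟩, hper⟩ := ih
    obtain ⟨ε', hε', hc'⟩ := exists_conicAt_segment (f i).1 (f i).2 p
    rw [Finset.set_biUnion_insert]
    have h0 : 0 < min ε ε' := lt_min hε hε'
    have k1 := hc'.mono (min_le_right ε ε')
    have k2 := hc.mono (min_le_left ε ε')
    refine ⟨⟨min ε ε', h0, k1.union h0 k2⟩, ?_⟩
    rw [angles_union h0 k1 k2]
    exact (perFin_angles_segment _ _ _).union hper

theorem angles_congr {X Y : Set Plane} {p : Plane} {ε : ℝ} (hε : 0 < ε)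
    (h : ∀ x ∈ Metric.ball p ε, x ∈ X ↔ x ∈ Y) : angles X p = angles Y p := by
  ext θ
  rw [mem_angles, mem_angles]
  refine eventually_congr ?_
  filter_upwards [Ioo_mem_nhdsGT hε] with ρ hρ
  exact h _ (dist_add_unitVec_lt hρ.1.le hρ.2)

theorem ConicAt.congr {X Y : Set Plane} {p : Plane} {ε : ℝ} (hε : 0 < ε)
    (h : ∀ x ∈ Metric.ball p ε, x ∈ X ↔ x ∈ Y) (hX : ConicAt X p ε) : ConicAt Y p ε := by
  intro ρ h0 h1 θ
  rw [← h _ (dist_add_unitVec_lt h0.le h1), hX ρ h0 h1, angles_congr hε h]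

end Corridor
end

/-! ### Sectors between branches and their owners -/

noncomputable section
open Set Filter Topology Real
namespace Corridor

/-! ### The medial axis near one of its points -/

variable {O : Set Plane} {Vt : Finset Plane} {L : Finset (ℝ × ℝ × ℝ)}

/-- Near its point `p`, the medial axis is a cone, and the contact points of the points within
distance `ε` of `p` are within distance `δ` of contact points of `p`. -/
structure LocalPicture (O : Set Plane) (p : Plane) (δ ε : ℝ) : Prop where
  closed : IsClosed O
  mem : p ∈ medialAxis O
  δ_pos : 0 < δ
  ε_pos : 0 < ε
  sep : ∀ q ∈ foot O p, ∀ q' ∈ foot O p, q ≠ q' → 3 * δ ≤ dist q q'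
  near : ∀ x ∈ Metric.ball p ε, NearContacts O p δ x
  conic : ConicAt (medialAxis O) p ε
  per : PerFin (angles (medialAxis O) p)

theorem Tame.medialAxis_inter_ball (T : Tame O Vt L) {G : Finset (Plane × Plane)}
    (hG : carrier G = closure (medialAxis O)) {p : Plane} (hp : p ∉ O) :
    ∃ ε > 0, ∀ x ∈ Metric.ball p ε, x ∈ carrier G ↔ x ∈ medialAxis O := by
  obtain ⟨ε, hε, h⟩ := Metric.isOpen_iff.1 T.closed.isOpen_compl p hp
  refine ⟨ε, hε, fun x hx => ?_⟩
  rw [hG]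
  exact ⟨T.closure_medialAxis (h hx), fun h => subset_closure h⟩

theorem Tame.exists_localPicture (T : Tame O Vt L) {G : Finset (Plane × Plane)}
    (hG : carrier G = closure (medialAxis O)) {p : Plane} (hp : p ∈ medialAxis O) :
    ∃ δ ε, LocalPicture O p δ ε := by
  have hpO := medialAxis_subset_compl hp
  obtain ⟨δ, hδ, hsep, hev⟩ := T.exists_nearContacts hpO
  obtain ⟨ε₁, hε₁, h1⟩ := Metric.eventually_nhds_iff_ball.1 hev
  obtain ⟨ε₂, hε₂, h2⟩ := T.medialAxis_inter_ball hG hpO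
  obtain ⟨⟨ε₃, hε₃, h3⟩, h4⟩ := exists_conicAt_biUnion G id p
  have hm : 0 < min ε₁ (min ε₂ ε₃) := by positivity
  have hcong : ∀ x ∈ Metric.ball p (min ε₁ (min ε₂ ε₃)), x ∈ carrier G ↔ x ∈ medialAxis O :=
    fun x hx => h2 x (Metric.ball_subset_ball ((min_le_right _ _).trans (min_le_left _ _)) hx)
  refine ⟨δ, min ε₁ (min ε₂ ε₃), T.closed, hp, hδ, hm, hsep,
    fun x hx => h1 x (Metric.ball_subset_ball (min_le_left _ _) hx), ?_, ?_⟩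
  · exact ConicAt.congr hm hcong (h3.mono ((min_le_right _ _).trans (min_le_right _ _)))
  · rw [← angles_congr hm hcong]; exact h4

/-- Points in direction `θ` from `p` are owned by the contact point `q` of `p`. -/
def OwnsDir (O : Set Plane) (p : Plane) (δ ε θ : ℝ) (q : Plane) : Prop :=
  q ∈ foot O p ∧ ∀ ρ, 0 < ρ → ρ < ε → Owns O δ (p + ρ • unitVec θ) q

/-- Points in directions next to `a`, on the side given by the sign `s`, are owned by `q`. -/
def OwnsSide (O : Set Plane) (p : Plane) (δ ε s a : ℝ) (q : Plane) : Prop :=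
  ∀ᶠ τ in 𝓝[>] (0 : ℝ), OwnsDir O p δ ε (a + s * τ) q

theorem OwnsDir.add_int {p : Plane} {δ ε θ : ℝ} {q : Plane} (h : OwnsDir O p δ ε θ q) (k : ℤ) :
    OwnsDir O p δ ε (θ + k * (2 * π)) q := by
  unfold OwnsDir
  rwa [unitVec_eq_iff.2 ⟨k, rfl⟩]

theorem OwnsSide.add_int {p : Plane} {δ ε s a : ℝ} {q : Plane} (h : OwnsSide O p δ ε s a q)
    (k : ℤ) : OwnsSide O p δ ε s (a + k * (2 * π)) q := by
  filter_upwards [h] with τ hτ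
  have := hτ.add_int k
  rwa [add_right_comm] at this

theorem eventually_mul_lt (k : ℝ) {c : ℝ} (hc : 0 < c) : ∀ᶠ σ in 𝓝[>] (0 : ℝ), σ * k < c := by
  have : Tendsto (fun σ : ℝ => σ * k) (𝓝[>] 0) (𝓝 (0 * k)) :=
    ((continuous_id.mul continuous_const).tendsto 0).mono_left nhdsWithin_le_nhds
  rw [zero_mul] at this
  exact this.eventually_lt_const hc

namespace LocalPicture
variable {p : Plane} {δ ε : ℝ} (P : LocalPicture O p δ ε)
include P

theorem nonempty : O.Nonempty := by
  obtain ⟨r, h⟩ := P.mem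
  obtain ⟨q, hq⟩ := h.2.2.nonempty
  exact ⟨q, hq.2⟩

theorem notMem : p ∉ O := medialAxis_subset_compl P.mem

theorem notMem_medialAxis {ρ θ : ℝ} (h0 : 0 < ρ) (h1 : ρ < ε)
    (hθ : θ ∉ angles (medialAxis O) p) : p + ρ • unitVec θ ∉ medialAxis O :=
  fun h => hθ ((P.conic ρ h0 h1 θ).1 h)

theorem exists_foot {ρ θ : ℝ} (h0 : 0 < ρ) (h1 : ρ < ε) (hθ : θ ∉ angles (medialAxis O) p) :
    ∃ c, foot O (p + ρ • unitVec θ) = {c} :=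
  exists_foot_eq_singleton P.closed P.nonempty (P.near _ (dist_add_unitVec_lt h0.le h1)).1
    (P.notMem_medialAxis h0 h1 hθ)

theorem sector_near {J : Set ℝ} : ∀ x ∈ sector p ε J, NearContacts O p δ x := by
  rintro _ ⟨⟨ρ, θ⟩, ⟨hρ, -⟩, rfl⟩
  exact P.near _ (dist_add_unitVec_lt hρ.1.le hρ.2)

theorem sector_notMem {J : Set ℝ} (hJ : ∀ θ ∈ J, θ ∉ angles (medialAxis O) p) :
    ∀ x ∈ sector p ε J, x ∉ medialAxis O := by
  rintro _ ⟨⟨ρ, θ⟩, ⟨hρ, hθ⟩, rfl⟩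
  exact P.notMem_medialAxis hρ.1 hρ.2 (hJ θ hθ)

/-- The sector over `J` is connected and off the axis, so the owner changes neither with the
direction nor with the distance from `p`. -/
theorem ownsDir_of_owns {J : Set ℝ} (hJ : IsPreconnected J)
    (hJM : ∀ θ ∈ J, θ ∉ angles (medialAxis O) p) {θ ψ ρ : ℝ} (hθ : θ ∈ J) (hψ : ψ ∈ J)
    (h0 : 0 < ρ) (h1 : ρ < ε) {q : Plane} (hq : q ∈ foot O p)
    (h : Owns O δ (p + ρ • unitVec θ) q) : OwnsDir O p δ ε ψ q :=
  ⟨hq, fun _ g0 g1 => owns_of_isPreconnected P.closed P.nonempty P.sep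
    (isPreconnected_sector p ε hJ) P.sector_near (P.sector_notMem hJM) (mem_sector h0 h1 hθ)
    (mem_sector g0 g1 hψ) hq h⟩

theorem ownsDir_of_one {θ ρ : ℝ} (hθ : θ ∉ angles (medialAxis O) p) (h0 : 0 < ρ) (h1 : ρ < ε)
    {q : Plane} (hq : q ∈ foot O p) (h : Owns O δ (p + ρ • unitVec θ) q) :
    OwnsDir O p δ ε θ q :=
  P.ownsDir_of_owns (J := {θ}) isPreconnected_singleton (by simpa using hθ) rfl rfl h0 h1 hq h

theorem ownsDir_interval {J : Set ℝ} (hJ : IsPreconnected J)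
    (hJM : ∀ θ ∈ J, θ ∉ angles (medialAxis O) p) {θ ψ : ℝ} (hθ : θ ∈ J) (hψ : ψ ∈ J)
    {q : Plane} (h : OwnsDir O p δ ε θ q) : OwnsDir O p δ ε ψ q :=
  P.ownsDir_of_owns hJ hJM hθ hψ (half_pos P.ε_pos) (half_lt_self P.ε_pos) h.1
    (h.2 _ (half_pos P.ε_pos) (half_lt_self P.ε_pos))

theorem exists_ownsDir {θ : ℝ} (hθ : θ ∉ angles (medialAxis O) p) :
    ∃ q, OwnsDir O p δ ε θ q := by
  have h0 := half_pos P.ε_pos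
  have h1 := half_lt_self P.ε_pos
  obtain ⟨c, hc⟩ := P.exists_foot h0 h1 hθ
  obtain ⟨q, hq, hd⟩ := (P.near _ (dist_add_unitVec_lt (θ := θ) h0.le h1)).2.1 c (hc ▸ rfl)
  exact ⟨q, P.ownsDir_of_one hθ h0 h1 hq ⟨c, hc ▸ rfl, hd⟩⟩

theorem ownsDir_unique {θ : ℝ} (hθ : θ ∉ angles (medialAxis O) p) {q q' : Plane}
    (h : OwnsDir O p δ ε θ q) (h' : OwnsDir O p δ ε θ q') : q = q' := by
  have h0 := half_pos P.ε_pos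
  have h1 := half_lt_self P.ε_pos
  obtain ⟨c, hc⟩ := P.exists_foot h0 h1 hθ
  exact owns_unique P.sep hc.le h.1 h'.1 (h.2 _ h0 h1) (h'.2 _ h0 h1)

theorem ownsSide_unique {s a : ℝ} (hs : s = 1 ∨ s = -1) {q q' : Plane}
    (h : OwnsSide O p δ ε s a q) (h' : OwnsSide O p δ ε s a q') : q = q' := by
  obtain ⟨τ, ⟨h1, h2⟩, h3⟩ := ((Eventually.and h h').and (P.per.eventually_notMem a hs)).exists
  exact P.ownsDir_unique h3 h1 h2

/-- If the points in direction `θ` are owned by `q`, the same holds for all directions between `θ`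
and that of `q`. -/
theorem ownsDir_between {θ φ R : ℝ} {q : Plane} (hθ : θ ∉ angles (medialAxis O) p)
    (h : OwnsDir O p δ ε θ q) (hR : 0 < R) (hq : q - p = R • unitVec φ) (hφ : |φ - θ| < π)
    {ψ : ℝ} (hψ : (θ < ψ ∧ ψ < φ) ∨ (φ < ψ ∧ ψ < θ)) :
    ψ ∉ angles (medialAxis O) p ∧ OwnsDir O p δ ε ψ q := by
  obtain ⟨hφ1, hφ2⟩ := abs_lt.1 hφ
  -- Since the angle between `θ` and `φ` is less than `π`, a direction between them is a positive
  -- combination. So a segment from the ray `θ` towards `q` crosses the ray `ψ`.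
  have hcoef : ∃ α : ℝ, 0 < α ∧ ∃ β : ℝ, 0 < β ∧ unitVec ψ = α • unitVec θ + β • unitVec φ := by
    have key := unitVec_combination (θ := θ) (φ := φ) (ψ := ψ)
    have hpos : 0 < sin (φ - ψ) / sin (φ - θ) ∧ 0 < sin (ψ - θ) / sin (φ - θ) ∧
        sin (φ - θ) ≠ 0 := by
      rcases hψ with ⟨h1, h2⟩ | ⟨h1, h2⟩
      · have a := sin_pos_of_pos_of_lt_pi (x := φ - ψ) (by linarith) (by linarith)
        have b := sin_pos_of_pos_of_lt_pi (x := ψ - θ) (by linarith) (by linarith)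
        have c := sin_pos_of_pos_of_lt_pi (x := φ - θ) (by linarith) (by linarith)
        exact ⟨div_pos a c, div_pos b c, c.ne'⟩
      · have a := sin_neg_of_neg_of_neg_pi_lt (x := φ - ψ) (by linarith) (by linarith)
        have b := sin_neg_of_neg_of_neg_pi_lt (x := ψ - θ) (by linarith) (by linarith)
        have c := sin_neg_of_neg_of_neg_pi_lt (x := φ - θ) (by linarith) (by linarith)
        exact ⟨div_pos_of_neg_of_neg a c, div_pos_of_neg_of_neg b c, c.ne⟩
    refine ⟨_, hpos.1, _, hpos.2.1, ?_⟩
    have h3 : unitVec ψ = (sin (φ - θ))⁻¹ • (sin (φ - θ) • unitVec ψ) := by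
      rw [smul_smul, inv_mul_cancel₀ hpos.2.2, one_smul]
    rw [h3, key, smul_add, smul_smul, smul_smul, div_eq_inv_mul, div_eq_inv_mul]
  obtain ⟨α, hα, β, hβ, hc⟩ := hcoef
  have hrp := rad_pos P.closed P.nonempty P.notMem
  -- The bounds make `ρ < ε` and the crossing point closer than `ε`, keep `ρ` at most half the
  -- radius, and keep the crossing before the end of the segment.
  obtain ⟨σ, ⟨⟨s1, s2⟩, ⟨s3, s4⟩⟩, s0⟩ :=
    ((((eventually_mul_lt 2 P.ε_pos).and (eventually_mul_lt (2 * α) P.ε_pos)).and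
      ((eventually_mul_lt (4 * α) hrp).and (eventually_mul_lt (4 * β / R) one_pos))).and
      self_mem_nhdsWithin).exists
  have s0 : 0 < σ := s0
  set t := σ * β / R with ht
  have ht0 : 0 < t := by positivity
  have ht4 : 4 * t < 1 := by
    have : 4 * t = σ * (4 * β / R) := by rw [ht]; ring
    linarith
  set ρ := σ * α / (1 - t) with hρ
  have hρ0 : 0 < ρ := div_pos (by positivity) (by linarith)
  have hρ2 : ρ ≤ 2 * (σ * α) := by
    rw [hρ, div_le_iff₀ (by linarith)]
    have : 0 < σ * α := by positivity
    nlinarith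
  have hρε : ρ < ε := by nlinarith
  set x := p + ρ • unitVec θ with hx
  obtain ⟨c, hfx⟩ := P.exists_foot hρ0 hρε hθ
  have hnear := P.near x (dist_add_unitVec_lt hρ0.le hρε)
  have hcx : c ∈ foot O x := by rw [hfx]; rfl
  have hcq : dist c q < δ := by
    obtain ⟨c', hc', hd⟩ := h.2 ρ hρ0 hρε
    rw [hfx] at hc'
    rwa [← show c' = c from hc']
  -- On the segment from `x` to its only contact point `c`, every point has only this contact point.
  -- So the crossing with the ray `ψ` is off the axis and is owned by `q`.
  have fin : ∀ s σ' : ℝ, 0 ≤ s → s ≤ 1 → 0 < σ' → σ' < ε → x + s • (c - x) = p + σ' • unitVec ψ →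
      ψ ∉ angles (medialAxis O) p ∧ OwnsDir O p δ ε ψ q := by
    intro s σ' g0 g1 g2 g3 g4
    have hsub := foot_walk_subset hcx g0 g1
    have hmem := mem_foot_walk hcx g0 g1
    rw [g4] at hsub hmem
    rw [hfx] at hsub
    have hn : ψ ∉ angles (medialAxis O) p := fun hA =>
      notMem_medialAxis_of_subset_singleton P.closed P.nonempty hsub ((P.conic σ' g2 g3 ψ).2 hA)
    exact ⟨hn, P.ownsDir_of_one hn g2 g3 h.1 ⟨c, hmem, hcq⟩⟩
  -- If `c = q`, the values of `t` and `ρ` put the crossing at distance `σ`. If the corner moved,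
  -- the segment is parallel to `q - p` and the crossing is at distance `ρ / α`.
  rcases (hnear.2.2 q h.1 c hcx hcq).1 with hcase | ⟨μ, hμ, hcase⟩
  · refine fin t σ ht0.le (by linarith) s0 (by linarith) ?_
    have e1 : x + t • (c - x) = p + ((1 - t) * ρ) • unitVec θ + t • (c - p) := by
      rw [hx]; module
    rw [e1, hcase, hq, hc, smul_smul, smul_add, smul_smul, smul_smul, add_assoc]
    have h1t : 1 - t ≠ 0 := by linarith
    congr 3
    · rw [hρ, mul_div_cancel₀ _ h1t]
    · rw [ht]; field_simp
  -- `μ` is the ratio of the radii at `x` and `p`, and `ρ` is at most half the latter.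
  · have hμ2 : 1 / 2 ≤ μ := by
      have n1 : ‖c - x‖ = rad O x := by
        rw [← (mem_foot.1 hcx).1, dist_comm, dist_eq_norm]
      have n2 : ‖q - p‖ = rad O p := by
        rw [← (mem_foot.1 h.1).1, dist_comm, dist_eq_norm]
      rw [hcase, norm_smul, n2, Real.norm_of_nonneg hμ.le] at n1
      have n3 := rad_le_add O p x
      have n4 : dist p x ≤ ρ := by
        rw [hx, dist_eq_norm, sub_add_cancel_left, norm_neg, norm_smul,
          Real.norm_of_nonneg hρ0.le]
        nlinarith [norm_unitVec_le θ]
      have : (1 / 2) * rad O p ≤ μ * rad O p := by nlinarith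
      exact le_of_mul_le_mul_right this hrp
    have hσ' : ρ / α ≤ 2 * σ := by rw [div_le_iff₀ hα]; linarith
    refine fin (ρ / α * β / (μ * R)) (ρ / α) (by positivity) ?_ (by positivity) (by linarith) ?_
    · rw [div_le_one (by positivity)]
      have a1 : ρ / α * β ≤ 2 * σ * β := mul_le_mul_of_nonneg_right hσ' hβ.le
      have a2 : 4 * (σ * β) < R := by
        have : 4 * (σ * β / R) < 1 := ht4
        rw [← mul_div_assoc, div_lt_one hR] at this
        exact this
      nlinarith
    · rw [hcase, hq, hc, hx, smul_smul, smul_smul, smul_add, smul_smul, smul_smul, add_assoc]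
      congr 3
      · field_simp
      · field_simp

/-- The contact point owning a direction is not opposite to it. -/
theorem not_opposite {θ R : ℝ} {q : Plane} (hθ : θ ∉ angles (medialAxis O) p)
    (h : OwnsDir O p δ ε θ q) (hR : 0 < R) : q - p ≠ -(R • unitVec θ) := by
  intro hq
  have hrp := rad_pos P.closed P.nonempty P.notMem
  obtain ⟨ρ, ⟨s1, s2, s3⟩, s0⟩ := (((eventually_mul_lt 1 P.ε_pos).and
    ((eventually_mul_lt 2 hrp).and (eventually_mul_lt (2 / R) one_pos))).and
      self_mem_nhdsWithin).exists
  have s0 : 0 < ρ := s0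
  rw [mul_one] at s1
  have s3' : ρ * 2 < R := by
    rw [← mul_div_assoc, div_lt_one hR] at s3; exact s3
  set x := p + ρ • unitVec θ with hx
  obtain ⟨c, hfx⟩ := P.exists_foot s0 s1 hθ
  have hnear := P.near x (dist_add_unitVec_lt s0.le s1)
  have hcx : c ∈ foot O x := by rw [hfx]; rfl
  have hcq : dist c q < δ := by
    obtain ⟨c', hc', hd⟩ := h.2 ρ s0 s1
    rw [hfx] at hc'
    rwa [← show c' = c from hc']
  -- If the owner were opposite, the segment from `x` to its contact point would pass through `p`,
  -- which would then have only one contact point.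
  have fin : ∀ s : ℝ, 0 ≤ s → s ≤ 1 → x + s • (c - x) = p → False := by
    intro s g0 g1 g2
    have hsub := foot_walk_subset hcx g0 g1
    rw [g2, hfx] at hsub
    exact notMem_medialAxis_of_subset_singleton P.closed P.nonempty hsub P.mem
  rcases (hnear.2.2 q h.1 c hcx hcq).1 with hcase | ⟨μ, hμ, hcase⟩
  · refine fin (ρ / (R + ρ)) (by positivity) ((div_le_one (by positivity)).2 (by linarith)) ?_
    have : c - x = -((R + ρ) • unitVec θ) := by
      rw [hcase, hx, show q - (p + ρ • unitVec θ) = (q - p) - ρ • unitVec θ by abel, hq]; module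
    rw [this, smul_neg, smul_smul, div_mul_cancel₀ _ (by positivity), hx]
    abel
  · have hμ2 : 1 / 2 ≤ μ := by
      have n1 : ‖c - x‖ = rad O x := by
        rw [← (mem_foot.1 hcx).1, dist_comm, dist_eq_norm]
      have n2 : ‖q - p‖ = rad O p := by
        rw [← (mem_foot.1 h.1).1, dist_comm, dist_eq_norm]
      rw [hcase, norm_smul, n2, Real.norm_of_nonneg hμ.le] at n1
      have n3 := rad_le_add O p x
      have n4 : dist p x ≤ ρ := by
        rw [hx, dist_eq_norm, sub_add_cancel_left, norm_neg, norm_smul, Real.norm_of_nonneg s0.le]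
        nlinarith [norm_unitVec_le θ]
      have : (1 / 2) * rad O p ≤ μ * rad O p := by nlinarith
      exact le_of_mul_le_mul_right this hrp
    refine fin (ρ / (μ * R)) (by positivity) ((div_le_one (by positivity)).2 (by nlinarith)) ?_
    rw [hcase, hq, hx, smul_neg, smul_neg, smul_smul, smul_smul]
    have : ρ / (μ * R) * μ * R = ρ := by field_simp
    rw [this]; abel

/-- The direction of the owner, as an angle less than a right angle turn away. -/
theorem exists_angle_of_owner {θ : ℝ} {q : Plane} (hθ : θ ∉ angles (medialAxis O) p)
    (h : OwnsDir O p δ ε θ q) : ∃ φ R : ℝ, 0 < R ∧ q - p = R • unitVec φ ∧ |φ - θ| < π ∧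
      ∀ ψ, (θ < ψ ∧ ψ < φ) ∨ (φ < ψ ∧ ψ < θ) →
        ψ ∉ angles (medialAxis O) p ∧ OwnsDir O p δ ε ψ q := by
  have hqp : q - p ≠ 0 := by
    intro h0
    rw [sub_eq_zero] at h0
    exact P.notMem (h0 ▸ foot_subset _ _ h.1)
  obtain ⟨R, hR, φ₀, hφ₀⟩ := exists_polar hqp
  have hp : (0 : ℝ) < 2 * π := by positivity
  set φ := toIocMod hp (θ - π) φ₀
  have hmem : φ ∈ Ioc (θ - π) (θ - π + 2 * π) := toIocMod_mem_Ioc hp _ _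
  have he : unitVec φ₀ = unitVec φ := by
    have e := self_sub_toIocDiv_zsmul hp (θ - π) φ₀
    rw [zsmul_eq_mul] at e
    exact unitVec_eq_iff.2 ⟨toIocDiv hp (θ - π) φ₀, by simp only [φ]; linarith⟩
  rw [he] at hφ₀
  have hne : φ ≠ θ + π := by
    intro h1
    refine P.not_opposite hθ h hR ?_
    rw [hφ₀, h1, unitVec_add_pi, smul_neg]
  have hlt : |φ - θ| < π := by
    rw [abs_lt]
    refine ⟨by linarith [hmem.1], ?_⟩
    have := lt_of_le_of_ne (show φ ≤ θ + π by linarith [hmem.2]) hne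
    linarith
  exact ⟨φ, R, hR, hφ₀, hlt, fun ψ hψ => P.ownsDir_between hθ h hR hφ₀ hlt hψ⟩

/-- In a gap between consecutive angles of the medial axis, the owner lies in the closed gap. -/
theorem exists_angle_mem_Icc {a b θ : ℝ} {q : Plane} (ha : a ∈ angles (medialAxis O) p)
    (hb : b ∈ angles (medialAxis O) p) (hab : ∀ ψ, a < ψ → ψ < b → ψ ∉ angles (medialAxis O) p)
    (haθ : a < θ) (hθb : θ < b) (h : OwnsDir O p δ ε θ q) :
    ∃ φ R : ℝ, 0 < R ∧ q - p = R • unitVec φ ∧ |φ - θ| < π ∧ a ≤ φ ∧ φ ≤ b := by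
  obtain ⟨φ, R, hR, hq, hlt, hbet⟩ := P.exists_angle_of_owner (hab θ haθ hθb) h
  refine ⟨φ, R, hR, hq, hlt, ?_, ?_⟩
  · by_contra hcon
    exact (hbet a (.inr ⟨not_le.1 hcon, haθ⟩)).1 ha
  · by_contra hcon
    exact (hbet b (.inl ⟨hθb, not_le.1 hcon⟩)).1 hb

theorem ownsSide_of_gap {a b θ : ℝ} {q : Plane}
    (hab : ∀ ψ, a < ψ → ψ < b → ψ ∉ angles (medialAxis O) p)
    (haθ : a < θ) (hθb : θ < b) (h : OwnsDir O p δ ε θ q) :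
    OwnsSide O p δ ε 1 a q ∧ OwnsSide O p δ ε (-1) b q := by
  have hI : ∀ ψ ∈ Ioo a b, OwnsDir O p δ ε ψ q := fun ψ hψ =>
    P.ownsDir_interval isPreconnected_Ioo (fun ψ hψ => hab ψ hψ.1 hψ.2) ⟨haθ, hθb⟩ hψ h
  constructor
  · filter_upwards [Ioo_mem_nhdsGT (show (0 : ℝ) < b - a by linarith)] with τ hτ
    exact hI _ ⟨by linarith [hτ.1], by linarith [hτ.2]⟩
  · filter_upwards [Ioo_mem_nhdsGT (show (0 : ℝ) < b - a by linarith)] with τ hτ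
    exact hI _ ⟨by linarith [hτ.2], by linarith [hτ.1]⟩

/-- Where the medial axis runs along a spoke, each second contact point owns the directions on one
side. -/
theorem ownsSide_of_second_contact {φ R ρ : ℝ} {q q' : Plane} (hq : q ∈ foot O p) (hR : 0 < R)
    (hφ : q - p = R • unitVec φ) (h0 : 0 < ρ) (h1 : ρ < ε) (h2 : ρ < R)
    (hq' : q' ∈ foot O (p + ρ • unitVec φ)) (hne : q' ≠ q) :
    ∃ s α R' : ℝ, (s = 1 ∨ s = -1) ∧ 0 < α ∧ α < π ∧ 0 < R' ∧
      q' - p = R' • unitVec (φ + s * α) ∧ OwnsSide O p δ ε s φ q' := by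
  have hrp := rad_pos P.closed P.nonempty P.notMem
  have ht0 : 0 < ρ / R := by positivity
  have ht1 : ρ / R < 1 := (div_lt_one hR).2 h2
  have hy : p + ρ • unitVec φ = p + (ρ / R) • (q - p) := by
    rw [hφ, smul_smul, div_mul_cancel₀ _ hR.ne']
  have hq'y := hq'
  rw [hy] at hq'
  have hq'p := foot_walk_subset hq ht0.le ht1.le hq'
  have hn : ‖q - p‖ = rad O p := by rw [← (mem_foot.1 hq).1, dist_comm, dist_eq_norm]
  have hn' : ‖q' - p‖ = rad O p := by rw [← (mem_foot.1 hq'p).1, dist_comm, dist_eq_norm]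
  have hqp : q' - p ≠ 0 := by
    intro h0
    rw [h0, norm_zero] at hn'
    exact hrp.ne hn'
  obtain ⟨R', hR', ψ₀, hψ₀⟩ := exists_polar hqp
  have hp : (0 : ℝ) < 2 * π := by positivity
  set ψ := toIocMod hp (φ - π) ψ₀
  have hmem : ψ ∈ Ioc (φ - π) (φ - π + 2 * π) := toIocMod_mem_Ioc hp _ _
  have he : unitVec ψ₀ = unitVec ψ := by
    have e := self_sub_toIocDiv_zsmul hp (φ - π) ψ₀
    rw [zsmul_eq_mul] at e
    exact unitVec_eq_iff.2 ⟨toIocDiv hp (φ - π) ψ₀, by simp only [ψ]; linarith⟩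
  rw [he] at hψ₀
  have hprop : ∀ c : ℝ, q' - p = c • (q - p) → |c| = 1 := by
    intro c hc
    rw [hc, norm_smul, hn, Real.norm_eq_abs] at hn'
    exact mul_right_cancel₀ hrp.ne' (by rw [hn', one_mul])
  have hψφ : ψ ≠ φ := by
    intro h
    have hc : q' - p = (R' / R) • (q - p) := by
      rw [hψ₀, h, hφ, smul_smul, div_mul_cancel₀ _ hR.ne']
    have := hprop _ hc
    rw [abs_of_pos (by positivity)] at this
    rw [this, one_smul] at hc
    exact hne (sub_left_inj.1 hc)
  -- The opposite point moves away when the centre moves towards `q`, whereas a contact point must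
  -- come closer.
  have hψπ : ψ ≠ φ + π := by
    intro h
    have hc : q' - p = (-(R' / R)) • (q - p) := by
      rw [hψ₀, h, unitVec_add_pi, hφ, smul_smul, neg_mul, div_mul_cancel₀ _ hR.ne', neg_smul,
        smul_neg]
    have := hprop _ hc
    rw [abs_neg, abs_of_pos (by positivity)] at this
    rw [this] at hc
    have hd := (mem_foot.1 hq').1
    rw [rad_walk hq ht0.le ht1.le, dist_comm, dist_eq_norm,
      show q' - (p + (ρ / R) • (q - p)) = (q' - p) - (ρ / R) • (q - p) by abel, hc,
      ← sub_smul, norm_smul, hn] at hd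
    have hd' := mul_right_cancel₀ hrp.ne' hd
    rw [Real.norm_eq_abs, abs_of_neg (by linarith)] at hd'
    linarith
  have hmain : ∀ s α : ℝ, (s = 1 ∨ s = -1) → 0 < α → α < π → ψ = φ + s * α →
      OwnsSide O p δ ε s φ q' := by
    intro s α hs hα hαπ hψs
    have hsα : 0 < sin α := sin_pos_of_pos_of_lt_pi hα hαπ
    have hlim : ∀ᶠ τ in 𝓝[>] (0 : ℝ), ρ * sin α < ε * sin (α - τ) := by
      have : Tendsto (fun τ : ℝ => ε * sin (α - τ)) (𝓝[>] 0) (𝓝 (ε * sin (α - 0))) :=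
        ((by fun_prop : Continuous fun τ : ℝ => ε * sin (α - τ)).tendsto 0).mono_left
          nhdsWithin_le_nhds
      refine this.eventually_const_lt ?_
      rw [sub_zero]; nlinarith
    filter_upwards [hlim, Ioo_mem_nhdsGT hα, P.per.eventually_notMem φ hs] with τ k1 k2 k3
    have b1 : 0 < sin (α - τ) := sin_pos_of_pos_of_lt_pi (by linarith [k2.2]) (by linarith [k2.1])
    have b2 : 0 < sin τ := sin_pos_of_pos_of_lt_pi k2.1 (by linarith [k2.2])
    have comb : sin α • unitVec (φ + s * τ) =
        sin (α - τ) • unitVec φ + sin τ • unitVec ψ := by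
      have := unitVec_combination (θ := φ) (φ := ψ) (ψ := φ + s * τ)
      rcases hs with rfl | rfl
      · rw [hψs] at this ⊢
        convert this using 3 <;> ring_nf
      · rw [hψs] at this ⊢
        have e1 : sin (φ + -1 * α - φ) = - sin α := by rw [← sin_neg]; ring_nf
        have e2 : sin (φ + -1 * α - (φ + -1 * τ)) = - sin (α - τ) := by
          rw [← sin_neg]; ring_nf
        have e3 : sin (φ + -1 * τ - φ) = - sin τ := by rw [← sin_neg]; ring_nf
        rw [e1, e2, e3, neg_smul, neg_smul, neg_smul, ← neg_add] at this
        exact neg_injective this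
    -- The segment from `p + ρ • unitVec φ` to `q'`, all of whose points keep `q'` as a contact
    -- point, crosses the ray `φ + s * τ` at distance `k * sin α` from `p`, with parameter `η`.
    set k := (sin (α - τ) / ρ + sin τ / R')⁻¹ with hk
    have hkpos : 0 < sin (α - τ) / ρ + sin τ / R' := by positivity
    have hk0 : 0 < k := inv_pos.2 hkpos
    have hk1 : k * (sin (α - τ) / ρ + sin τ / R') = 1 := inv_mul_cancel₀ hkpos.ne'
    set η := k * sin τ / R' with hη
    have hη0 : 0 < η := by positivity
    have hη1 : 1 - η = k * sin (α - τ) / ρ := by rw [hη, ← hk1]; ring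
    have hη1' : η ≤ 1 := by
      have : 0 < k * sin (α - τ) / ρ := by positivity
      linarith
    have hkρ : k * sin (α - τ) ≤ ρ := by
      have : k * sin (α - τ) / ρ ≤ 1 := by linarith
      rwa [div_le_one h0] at this
    have hz : p + ρ • unitVec φ + η • (q' - (p + ρ • unitVec φ)) =
        p + (k * sin α) • unitVec (φ + s * τ) := by
      have e1 : p + ρ • unitVec φ + η • (q' - (p + ρ • unitVec φ)) =
          p + (((1 - η) * ρ) • unitVec φ + η • (q' - p)) := by module
      rw [e1, mul_smul k, comb, smul_add, smul_smul, smul_smul, hψ₀, smul_smul]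
      congr 3
      · rw [hη1]; field_simp
      · rw [hη]; field_simp
    have hfz := mem_foot_walk hq'y hη0.le hη1'
    rw [hz] at hfz
    have hkε : k * sin α < ε := by
      have : k * sin α * sin (α - τ) < ε * sin (α - τ) := by
        calc k * sin α * sin (α - τ) = (k * sin (α - τ)) * sin α := by ring
          _ ≤ ρ * sin α := mul_le_mul_of_nonneg_right hkρ hsα.le
          _ < _ := k1
      exact lt_of_mul_lt_mul_right this b1.le
    exact P.ownsDir_of_one k3 (by positivity) hkε hq'p ⟨q', hfz, by simpa using P.δ_pos⟩
  rcases lt_or_gt_of_ne hψφ with hlt | hlt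
  · refine ⟨-1, φ - ψ, R', .inr rfl, by linarith, by linarith [hmem.1], hR', ?_, ?_⟩
    · rw [hψ₀]; congr 2; ring
    · exact hmain _ (φ - ψ) (.inr rfl) (by linarith) (by linarith [hmem.1]) (by ring)
  · have hlt2 := lt_of_le_of_ne (show ψ ≤ φ + π by linarith [hmem.2]) hψπ
    refine ⟨1, ψ - φ, R', .inl rfl, by linarith, by linarith, hR', ?_, ?_⟩
    · rw [hψ₀]; congr 2; ring
    · exact hmain _ (ψ - φ) (.inl rfl) (by linarith) (by linarith) (by ring)

end LocalPicture
end Corridor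
end

/-! ### Branches inject into contact points -/

noncomputable section
open Set Filter Topology Real
namespace Corridor

/-! ### There are at most as many branches as contact points -/

variable {O : Set Plane}

namespace LocalPicture
variable {p : Plane} {δ ε : ℝ} (P : LocalPicture O p δ ε)
include P

/-- Points on the branch towards `q` have a second contact point, which owns one of the two sides.
-/
theorem not_ownsSide_both {φ R : ℝ} {q : Plane} (hq : q ∈ foot O p) (hR : 0 < R)
    (hφ : q - p = R • unitVec φ) (hA : φ ∈ angles (medialAxis O) p)
    (h1 : OwnsSide O p δ ε 1 φ q) (h2 : OwnsSide O p δ ε (-1) φ q) : False := by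
  obtain ⟨ρ, h0, h3⟩ := exists_between (lt_min P.ε_pos hR)
  have hM : p + ρ • unitVec φ ∈ medialAxis O :=
    (P.conic ρ h0 (h3.trans_le (min_le_left _ _)) φ).2 hA
  obtain ⟨-, hn⟩ := (mem_medialAxis P.closed P.nonempty).1 hM
  obtain ⟨q', hq', hne⟩ := hn.exists_ne q
  obtain ⟨s, α, R', hs, -, -, -, -, hown⟩ := P.ownsSide_of_second_contact hq hR hφ h0
    (h3.trans_le (min_le_left _ _)) (h3.trans_le (min_le_right _ _)) hq' hne
  rcases hs with rfl | rfl
  · exact hne (P.ownsSide_unique (.inl rfl) hown h1)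
  · exact hne (P.ownsSide_unique (.inr rfl) hown h2)

/-- The direction of `q` is in both closed gaps, so these meet in their common end, a branch with
`q` on both sides. -/
theorem gap_owner_unique {a b c d θ θ' φ R : ℝ} {q : Plane}
    (hb : b ∈ angles (medialAxis O) p) (hc : c ∈ angles (medialAxis O) p)
    (hab : ∀ ψ, a < ψ → ψ < b → ψ ∉ angles (medialAxis O) p)
    (hcd : ∀ ψ, c < ψ → ψ < d → ψ ∉ angles (medialAxis O) p)
    (h1 : a < θ) (h2 : θ < b) (h3 : c < θ') (h4 : θ' < d)
    (hθ : OwnsDir O p δ ε θ q) (hθ' : OwnsDir O p δ ε θ' q) (hR : 0 < R)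
    (hφ : q - p = R • unitVec φ) (h6 : φ ≤ b) (h7 : c ≤ φ) (hac : a < c) :
    False := by
  have hbc : b ≤ c := by
    by_contra hcon
    exact hab c hac (not_le.1 hcon) hc
  have e1 : φ = b := le_antisymm h6 (hbc.trans h7)
  have e2 : φ = c := le_antisymm (h6.trans hbc) h7
  refine P.not_ownsSide_both hθ.1 hR hφ (e1 ▸ hb) ?_ ?_
  · rw [e2]; exact (P.ownsSide_of_gap hcd h3 h4 hθ').1
  · rw [e1]; exact (P.ownsSide_of_gap hab h1 h2 hθ).2

/-- The gap following an angle of the medial axis. -/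
theorem exists_gap {a : ℝ} (ha : a ∈ angles (medialAxis O) p) :
    ∃ b ∈ angles (medialAxis O) p, a < b ∧ b ≤ a + 2 * π ∧
      ∀ ψ, a < ψ → ψ < b → ψ ∉ angles (medialAxis O) p := P.per.exists_succ ⟨a, ha⟩ a

theorem ownsDir_gap {a b θ : ℝ} {q : Plane}
    (hgap : ∀ ψ, a < ψ → ψ < b → ψ ∉ angles (medialAxis O) p)
    (h : OwnsSide O p δ ε 1 a q) (h1 : a < θ) (h2 : θ < b) : OwnsDir O p δ ε θ q := by
  obtain ⟨τ, hτ, h3⟩ := (Eventually.and h (Ioo_mem_nhdsGT (show 0 < b - a by linarith))).exists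
  exact P.ownsDir_interval isPreconnected_Ioo (fun ψ hψ => hgap ψ hψ.1 hψ.2)
    (θ := a + 1 * τ) ⟨by linarith [h3.1], by linarith [h3.2]⟩ ⟨h1, h2⟩ hτ

/-- The owner of a gap lies in the closed gap. If two gaps have the same owner, full turns bring
both closed gaps to the same angle `φ`, and then `gap_owner_unique` applies unless the gaps
coincide. -/
theorem ownsSide_injective {a a' : ℝ} {q : Plane} (ha : a ∈ angles (medialAxis O) p)
    (ha' : a' ∈ angles (medialAxis O) p) (h : OwnsSide O p δ ε 1 a q)
    (h' : OwnsSide O p δ ε 1 a' q) : ∃ k : ℤ, a' = a + k * (2 * π) := by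
  obtain ⟨b, hb, hab, -, hgap⟩ := P.exists_gap ha
  obtain ⟨θ, h1, h2⟩ := exists_between hab
  have hθ := P.ownsDir_gap hgap h h1 h2
  obtain ⟨φ, R, hR, hφ, -, h3, h4⟩ := P.exists_angle_mem_Icc ha hb hgap h1 h2 hθ
  obtain ⟨b', hb', hab', -, hgap'⟩ := P.exists_gap ha'
  obtain ⟨θ', h1', h2'⟩ := exists_between hab'
  have hθ' := P.ownsDir_gap hgap' h' h1' h2'
  obtain ⟨φ', R', hR', hφ', -, h3', h4'⟩ := P.exists_angle_mem_Icc ha' hb' hgap' h1' h2' hθ'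
  have hk : ∃ k : ℤ, φ' = φ + k * (2 * π) := by
    refine unitVec_eq_iff.1 (unitVec_eq_of_smul (c := R / R') (by positivity) ?_).2
    have : R' • unitVec φ' = R • unitVec φ := hφ'.symm.trans hφ
    rw [div_eq_inv_mul, mul_smul, ← this, smul_smul, inv_mul_cancel₀ hR'.ne', one_smul]
  obtain ⟨k, rfl⟩ := hk
  refine ⟨k, ?_⟩
  by_contra hne
  have hper : ∀ ψ : ℝ, ψ - k * (2 * π) ∈ angles (medialAxis O) p ↔
      ψ ∈ angles (medialAxis O) p := fun ψ => by
    have := P.per.add_int (ψ - k * (2 * π)) k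
    rw [sub_add_cancel] at this
    exact this.symm
  have hgap'' : ∀ ψ, a' - k * (2 * π) < ψ → ψ < b' - k * (2 * π) →
      ψ ∉ angles (medialAxis O) p := fun ψ g1 g2 => by
    rw [← P.per.add_int ψ k]
    exact hgap' _ (by linarith) (by linarith)
  have hθ'' : OwnsDir O p δ ε (θ' - k * (2 * π)) q := by
    have := hθ'.add_int (-k)
    push_cast at this
    rwa [neg_mul, ← sub_eq_add_neg] at this
  rcases lt_trichotomy a (a' - k * (2 * π)) with g | g | g
  · exact P.gap_owner_unique hb ((hper a').2 ha') hgap hgap'' h1 h2 (θ' := θ' - k * (2 * π))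
      (by linarith) (by linarith) hθ hθ'' hR hφ h4 (by linarith) g
  · exact hne (by linarith)
  · exact P.gap_owner_unique ((hper b').2 hb') ha hgap'' hgap (θ := θ' - k * (2 * π))
      (by linarith) (by linarith) h1 h2 hθ'' hθ hR hφ (by linarith) h3 g

theorem exists_ownsSide {a : ℝ} (ha : a ∈ angles (medialAxis O) p) :
    ∃ q ∈ foot O p, OwnsSide O p δ ε 1 a q := by
  obtain ⟨b, hb, hab, -, hgap⟩ := P.exists_gap ha
  obtain ⟨θ, h1, h2⟩ := exists_between hab
  obtain ⟨q, hq⟩ := P.exists_ownsDir (hgap θ h1 h2)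
  exact ⟨q, hq.1, (P.ownsSide_of_gap hgap h1 h2 hq).1⟩

/-- The injection sends a branch to the owner of the gap that follows it. -/
theorem ncard_angles_le_owners (hfin : (foot O p).Finite) :
    (angles (medialAxis O) p ∩ Ico 0 (2 * π)).ncard ≤
      {q ∈ foot O p | ∃ a ∈ angles (medialAxis O) p, OwnsSide O p δ ε 1 a q}.ncard := by
  have h : ∀ a : ℝ, ∃ q, a ∈ angles (medialAxis O) p →
      q ∈ foot O p ∧ OwnsSide O p δ ε 1 a q := by
    intro a
    by_cases ha : a ∈ angles (medialAxis O) p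
    · obtain ⟨q, hq⟩ := P.exists_ownsSide ha
      exact ⟨q, fun _ => hq⟩
    · exact ⟨0, fun h => absurd h ha⟩
  choose f hf using h
  refine Set.ncard_le_ncard_of_injOn f (fun a ha => ⟨(hf a ha.1).1, a, ha.1, (hf a ha.1).2⟩) ?_
    (hfin.subset fun q hq => hq.1)
  intro a ha a' ha' heq
  obtain ⟨k, hk⟩ := P.ownsSide_injective ha.1 ha'.1 (hf a ha.1).2 (heq ▸ (hf a' ha'.1).2)
  have hp : (0 : ℝ) < 2 * π := by positivity
  have hk1 : (k : ℝ) < 1 := by by_contra h; push Not at h; nlinarith [ha.2.1, ha'.2.2]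
  have hk2 : (-1 : ℝ) < k := by by_contra h; push Not at h; nlinarith [ha.2.2, ha'.2.1]
  have : k = 0 := by
    have a1 : k < 1 := by exact_mod_cast hk1
    have a2 : -1 < k := by exact_mod_cast hk2
    omega
  rw [hk, this]; simp

theorem ncard_angles_le (hfin : (foot O p).Finite) :
    (angles (medialAxis O) p ∩ Ico 0 (2 * π)).ncard ≤ (foot O p).ncard :=
  (P.ncard_angles_le_owners hfin).trans (Set.ncard_le_ncard (fun _ h => h.1) hfin)

/-- A contact point that owns neither side of its direction, along which the medial axis runs, owns
nothing. -/
theorem ncard_angles_lt (hfin : (foot O p).Finite) {φ R : ℝ} {q : Plane} (hq : q ∈ foot O p)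
    (hR : 0 < R) (hφ : q - p = R • unitVec φ) (hA : φ ∈ angles (medialAxis O) p)
    (h1 : ¬ OwnsSide O p δ ε 1 φ q) (h2 : ¬ OwnsSide O p δ ε (-1) φ q) :
    (angles (medialAxis O) p ∩ Ico 0 (2 * π)).ncard < (foot O p).ncard := by
  refine (P.ncard_angles_le_owners hfin).trans_lt (Set.ncard_lt_ncard ⟨fun _ h => h.1, ?_⟩ hfin)
  intro hsub
  obtain ⟨-, a, ha, hown⟩ := hsub hq
  obtain ⟨b, hb, hab, -, hgap⟩ := P.exists_gap ha
  obtain ⟨θ, g1, g2⟩ := exists_between hab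
  have hθ := P.ownsDir_gap hgap hown g1 g2
  obtain ⟨φ', R', hR', hφ', -, h3, h4⟩ := P.exists_angle_mem_Icc ha hb hgap g1 g2 hθ
  have hk : ∃ k : ℤ, φ = φ' + k * (2 * π) := by
    refine unitVec_eq_iff.1 (unitVec_eq_of_smul (c := R' / R) (by positivity) ?_).2
    have : R • unitVec φ = R' • unitVec φ' := hφ.symm.trans hφ'
    rw [div_eq_inv_mul, mul_smul, ← this, smul_smul, inv_mul_cancel₀ hR.ne', one_smul]
  obtain ⟨k, rfl⟩ := hk
  have hA' : φ' ∈ angles (medialAxis O) p := (P.per.add_int φ' k).1 hA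
  -- A gap owned by `q` has the branch `φ'` in its closure but not in its interior; at either end
  -- `q` would own a side.
  rcases h3.lt_or_eq with h3 | rfl
  · rcases h4.lt_or_eq with h4 | rfl
    · exact hgap φ' h3 h4 hA'
    · exact h2 ((P.ownsSide_of_gap hgap g1 g2 hθ).2.add_int k)
  · exact h1 (hown.add_int k)

/-- Three contact points in a row, the middle one on the medial axis: fewer branches than contact
points. -/
theorem ncard_angles_lt_of_two (hfin : (foot O p).Finite) {φ R ρ : ℝ} {q q₁ q₂ : Plane}
    (hq : q ∈ foot O p) (hR : 0 < R) (hφ : q - p = R • unitVec φ) (h0 : 0 < ρ) (h1 : ρ < ε)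
    (h2 : ρ < R) (hq₁ : q₁ ∈ foot O (p + ρ • unitVec φ)) (hq₂ : q₂ ∈ foot O (p + ρ • unitVec φ))
    (hne₁ : q₁ ≠ q) (hne₂ : q₂ ≠ q) (hne : q₁ ≠ q₂) :
    (angles (medialAxis O) p ∩ Ico 0 (2 * π)).ncard < (foot O p).ncard := by
  have hnO := (P.near _ (dist_add_unitVec_lt (θ := φ) h0.le h1)).1
  have hA : φ ∈ angles (medialAxis O) p := (P.conic ρ h0 h1 φ).1
    ((mem_medialAxis P.closed P.nonempty).2 ⟨hnO, q₁, hq₁, q₂, hq₂, hne⟩)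
  obtain ⟨s, -, -, hs, -, -, -, -, ho⟩ := P.ownsSide_of_second_contact hq hR hφ h0 h1 h2 hq₁ hne₁
  obtain ⟨s', -, -, hs', -, -, -, -, ho'⟩ := P.ownsSide_of_second_contact hq hR hφ h0 h1 h2 hq₂ hne₂
  -- A side has one owner, so the two extra contact points own opposite sides and leave none to `q`.
  have hss : s ≠ s' := by
    rintro rfl
    exact hne (P.ownsSide_unique hs ho ho')
  have key : ∀ {t : ℝ} {q' : Plane}, (t = 1 ∨ t = -1) → OwnsSide O p δ ε t φ q' → q' ≠ q →
      ¬ OwnsSide O p δ ε t φ q := fun ht h hn h' => hn (P.ownsSide_unique ht h h')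
  rcases hs with rfl | rfl <;> rcases hs' with rfl | rfl
  · exact absurd rfl hss
  · exact P.ncard_angles_lt hfin hq hR hφ hA (key (.inl rfl) ho hne₁) (key (.inr rfl) ho' hne₂)
  · exact P.ncard_angles_lt hfin hq hR hφ hA (key (.inl rfl) ho' hne₂) (key (.inr rfl) ho hne₁)
  · exact absurd rfl hss

end LocalPicture
end Corridor
end

noncomputable section
open Set Filter Topology Real
namespace Corridor

/-! ### Degrees and directions -/

variable {G H : Finset (Plane × Plane)}

theorem IsSegmentComplex.mono (h : IsSegmentComplex G) (hHG : H ⊆ G) : IsSegmentComplex H :=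
  ⟨fun s hs => h.1 s (hHG hs), fun s hs t ht => h.2 s (hHG hs) t (hHG ht)⟩

theorem reduce_subset (G : Finset (Plane × Plane)) : reduce G ⊆ G := by
  unfold reduce
  generalize G.card = k
  induction k with
  | zero => exact subset_rfl
  | succ k ih => rw [Function.iterate_succ_apply']; exact (prune_subset _).trans ih

theorem carrier_mono (hHG : H ⊆ G) : carrier H ⊆ carrier G :=
  biUnion_subset_biUnion_left hHG

theorem isClosed_segment (a b : Plane) : IsClosed (segment ℝ a b) := by
  rw [← closure_openSegment]; exact isClosed_closure

theorem isClosed_carrier (G : Finset (Plane × Plane)) : IsClosed (carrier G) :=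
  G.finite_toSet.isClosed_biUnion fun s _ => isClosed_segment s.1 s.2

theorem exists_direction {s : Plane × Plane} (hs : s.1 ≠ s.2) {p : Plane}
    (hp : p = s.1 ∨ p = s.2) :
    ∃ θ ∈ Ico 0 (2 * π), ∃ R : ℝ, 0 < R ∧ segment ℝ s.1 s.2 = segment ℝ p (p + R • unitVec θ) ∧
      ({s.1, s.2} : Set Plane) = {p, p + R • unitVec θ} := by
  have key : ∀ b : Plane, b ≠ p → ∃ θ ∈ Ico 0 (2 * π), ∃ R : ℝ, 0 < R ∧ b = p + R • unitVec θ := by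
    intro b hb
    obtain ⟨R, hR, θ, h⟩ := exists_polar (sub_ne_zero.2 hb)
    have hp : (0 : ℝ) < 2 * π := by positivity
    have hm := toIcoMod_mem_Ico hp 0 θ
    rw [zero_add] at hm
    refine ⟨toIcoMod hp 0 θ, hm, R, hR, ?_⟩
    have e := toIcoMod_add_toIcoDiv_zsmul hp 0 θ
    rw [zsmul_eq_mul] at e
    rw [← unitVec_eq_iff.2 ⟨toIcoDiv hp 0 θ, e.symm⟩, ← h]
    abel
  rcases hp with rfl | rfl
  · obtain ⟨θ, hθ, R, hR, h⟩ := key s.2 hs.symm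
    exact ⟨θ, hθ, R, hR, by rw [← h], by rw [← h]⟩
  · obtain ⟨θ, hθ, R, hR, h⟩ := key s.1 hs
    exact ⟨θ, hθ, R, hR, by rw [← h, segment_symm], by rw [← h, pair_comm]⟩

theorem add_smul_mem_segment {p v : Plane} {ρ R : ℝ} (h0 : 0 ≤ ρ) (hR : 0 < R) (h1 : ρ ≤ R) :
    p + ρ • v ∈ segment ℝ p (p + R • v) := by
  rw [segment_eq_image']
  refine ⟨ρ / R, ⟨by positivity, (div_le_one hR).2 h1⟩, ?_⟩
  simp only [add_sub_cancel_left, smul_smul]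
  rw [div_mul_cancel₀ _ hR.ne']

theorem mem_angles_segment {p : Plane} {θ R : ℝ} (hR : 0 < R) :
    θ ∈ angles (segment ℝ p (p + R • unitVec θ)) p := by
  rw [mem_angles]
  filter_upwards [Ioo_mem_nhdsGT hR] with ρ hρ
  exact add_smul_mem_segment hρ.1.le hR hρ.2.le

theorem angles_mono {X Y : Set Plane} (h : X ⊆ Y) (p : Plane) : angles X p ⊆ angles Y p :=
  fun _ hθ => (mem_angles.1 hθ).mono fun _ hx => h hx

theorem perFin_angles_carrier (G : Finset (Plane × Plane)) (p : Plane) :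
    PerFin (angles (carrier G) p) := (exists_conicAt_biUnion G id p).2

/-- Two segments that leave `p` in the same direction would overlap. -/
theorem degree_le_ncard_angles (hG : IsSegmentComplex G) (p : Plane) :
    degree G p ≤ (angles (carrier G) p ∩ Ico 0 (2 * π)).ncard := by
  classical
  have h : ∀ s : Plane × Plane, ∃ θ : ℝ, s ∈ G → (p = s.1 ∨ p = s.2) → θ ∈ Ico 0 (2 * π) ∧
      ∃ R : ℝ, 0 < R ∧ segment ℝ s.1 s.2 = segment ℝ p (p + R • unitVec θ) ∧
      ({s.1, s.2} : Set Plane) = {p, p + R • unitVec θ} := by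
    intro s
    by_cases hs : s ∈ G ∧ (p = s.1 ∨ p = s.2)
    · obtain ⟨θ, h1, h2⟩ := exists_direction (hG.1 s hs.1) hs.2
      exact ⟨θ, fun _ _ => ⟨h1, h2⟩⟩
    · exact ⟨0, fun h1 h2 => absurd ⟨h1, h2⟩ hs⟩
  choose f hf using h
  unfold degree
  rw [← Set.ncard_coe_finset]
  refine Set.ncard_le_ncard_of_injOn f ?_ ?_ (perFin_angles_carrier G p).fin
  · intro s hs
    obtain ⟨hs, hp⟩ := Finset.mem_filter.1 (Finset.mem_coe.1 hs)
    obtain ⟨h1, R, hR, h2, -⟩ := hf s hs hp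
    refine ⟨angles_mono ?_ p (mem_angles_segment hR), h1⟩
    rw [← h2]
    exact subset_biUnion_of_mem (u := fun s : Plane × Plane => segment ℝ s.1 s.2) hs
  · intro s hs t ht hst
    obtain ⟨hs, hps⟩ := Finset.mem_filter.1 (Finset.mem_coe.1 hs)
    obtain ⟨ht, hpt⟩ := Finset.mem_filter.1 (Finset.mem_coe.1 ht)
    obtain ⟨-, R, hR, h2, h3⟩ := hf s hs hps
    obtain ⟨-, R', hR', h2', h3'⟩ := hf t ht hpt
    rw [← hst] at h2' h3'
    by_contra hne
    obtain ⟨ρ, h0, h1⟩ := exists_between (lt_min hR hR')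
    have hmem := hG.2 s hs t ht hne ⟨h2 ▸ add_smul_mem_segment h0.le hR (h1.trans_le
      (min_le_left _ _)).le, h2' ▸ add_smul_mem_segment h0.le hR' (h1.trans_le
      (min_le_right _ _)).le⟩
    rw [h3] at hmem
    rcases hmem.1 with h | h
    · exact add_unitVec_ne h0 h
    · have := smul_left_injective ℝ (unitVec_ne_zero (f s)) (add_left_cancel h)
      exact absurd this (h1.trans_le (min_le_left _ _)).ne

theorem degree_mono (hHG : H ⊆ G) (p : Plane) : degree H p ≤ degree G p :=
  Finset.card_le_card (Finset.filter_subset_filter _ hHG)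

theorem exists_segment_of_mem_angles {p : Plane} {θ : ℝ} (hθ : θ ∈ angles (carrier G) p) :
    ∃ s ∈ G, p ∈ segment ℝ s.1 s.2 ∧ ∀ η > (0 : ℝ), ∃ ρ : ℝ, 0 < ρ ∧ ρ < η ∧
      p + ρ • unitVec θ ∈ segment ℝ s.1 s.2 := by
  have h1 : ∃ᶠ ρ in 𝓝[>] (0 : ℝ), ∃ s ∈ G, p + ρ • unitVec θ ∈ segment ℝ s.1 s.2 := by
    refine ((mem_angles.1 hθ).mono fun ρ hρ => ?_).frequently
    obtain ⟨s, hs, h⟩ := mem_iUnion₂.1 hρ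
    exact ⟨s, hs, h⟩
  have h2 : ∃ s ∈ G, ∃ᶠ ρ in 𝓝[>] (0 : ℝ), p + ρ • unitVec θ ∈ segment ℝ s.1 s.2 := by
    by_contra hcon
    push Not at hcon
    refine h1 ?_
    have := (G.eventually_all (l := 𝓝[>] (0 : ℝ))).2 hcon
    filter_upwards [this] with ρ hρ
    rintro ⟨s, hs, h⟩
    exact hρ s hs h
  obtain ⟨s, hs, h⟩ := h2
  refine ⟨s, hs, ?_, fun η hη => ?_⟩
  · refine (isClosed_segment s.1 s.2).mem_of_frequently_of_tendsto h ?_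
    have : Tendsto (fun ρ : ℝ => p + ρ • unitVec θ) (𝓝 0) (𝓝 (p + (0 : ℝ) • unitVec θ)) :=
      (by fun_prop : Continuous fun ρ : ℝ => p + ρ • unitVec θ).tendsto 0
    rw [zero_smul, add_zero] at this
    exact this.mono_left nhdsWithin_le_nhds
  · obtain ⟨ρ, h1, h2⟩ := (h.and_eventually (Ioo_mem_nhdsGT (show (0 : ℝ) < η from hη))).exists
    exact ⟨ρ, h2.1, h2.2, h1⟩

theorem IsSegmentComplex.eq_endpoint (hG : IsSegmentComplex G) {p : Plane} (hp : degree G p ≠ 0)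
    {s : Plane × Plane} (hs : s ∈ G) (h : p ∈ segment ℝ s.1 s.2) : p = s.1 ∨ p = s.2 := by
  classical
  unfold degree at hp
  obtain ⟨t, ht⟩ := Finset.card_ne_zero.1 hp
  obtain ⟨ht, hpt⟩ := Finset.mem_filter.1 ht
  by_cases hst : s = t
  · exact hst ▸ hpt
  · refine (hG.2 s hs t ht hst ⟨h, ?_⟩).1
    rcases hpt with rfl | rfl
    exacts [left_mem_segment _ _ _, right_mem_segment _ _ _]

variable {O : Set Plane} {Vt : Finset Plane} {L : Finset (ℝ × ℝ × ℝ)}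

theorem Tame.angles_carrier (T : Tame O Vt L) (hG : carrier G = closure (medialAxis O)) {p : Plane}
    (hp : p ∉ O) : angles (carrier G) p = angles (medialAxis O) p := by
  obtain ⟨ε, hε, h⟩ := T.medialAxis_inter_ball hG hp
  exact angles_congr hε h

/-- If a point has at least as many branches in `H` as contact points, then all branches of the
medial axis belong to `H`, and there are as many as contact points. -/
theorem Tame.angles_eq_of_encard_le (T : Tame O Vt L) (hGc : IsSegmentComplex G)
    (hG : carrier G = closure (medialAxis O)) (hHG : H ⊆ G) {p : Plane} (hp : p ∈ medialAxis O)
    (hd : (contacts O p).encard ≤ degree H p) :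
    angles (carrier H) p = angles (medialAxis O) p ∧
      degree H p = (angles (medialAxis O) p ∩ Ico 0 (2 * π)).ncard ∧
      (angles (medialAxis O) p ∩ Ico 0 (2 * π)).ncard = (foot O p).ncard := by
  have hpO := medialAxis_subset_compl hp
  obtain ⟨δ, ε, P⟩ := T.exists_localPicture hG hp
  have hfin := T.finite_foot hpO
  rw [contacts_eq_foot hp, ← hfin.cast_ncard_eq, Nat.cast_le] at hd
  have h1 := P.ncard_angles_le hfin
  have h2 := degree_le_ncard_angles (hGc.mono hHG) p
  have hsub : angles (carrier H) p ⊆ angles (medialAxis O) p :=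
    T.angles_carrier hG hpO ▸ angles_mono (carrier_mono hHG) p
  have h3 := ncard_le_ncard (inter_subset_inter_left (Ico 0 (2 * π)) hsub) P.per.fin
  have heq := eq_of_subset_of_ncard_le (inter_subset_inter_left (Ico 0 (2 * π)) hsub)
    (by omega) P.per.fin
  refine ⟨hsub.antisymm fun θ hθ => ?_, by omega, by omega⟩
  obtain ⟨k, hk⟩ := P.per.exists_rep hθ
  rw [← heq] at hk
  exact ((perFin_angles_carrier H p).add_int θ k).1 hk.1

end Corridor
end

/-! ### Cells cut out by spokes, and the linear bound -/

noncomputable section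
open Set Filter Topology Real
namespace Corridor

/-! ### Cells of an open set -/

/-- `C` is a connected component of `W`. -/
def IsCell (W C : Set Plane) : Prop := ∃ x ∈ W, C = connectedComponentIn W x

namespace IsCell
variable {W C C' : Set Plane}

theorem subset (h : IsCell W C) : C ⊆ W := by
  obtain ⟨x, -, rfl⟩ := h
  exact connectedComponentIn_subset W x

theorem nonempty (h : IsCell W C) : C.Nonempty := by
  obtain ⟨x, hx, rfl⟩ := h
  exact ⟨x, mem_connectedComponentIn hx⟩

theorem isOpen (h : IsCell W C) (hW : IsOpen W) : IsOpen C := by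
  obtain ⟨x, -, rfl⟩ := h
  exact hW.connectedComponentIn

theorem subset_of_isPreconnected (h : IsCell W C) {A : Set Plane} (hA : IsPreconnected A)
    (hAW : A ⊆ W) (hAC : (A ∩ C).Nonempty) : A ⊆ C := by
  obtain ⟨x, -, rfl⟩ := h
  obtain ⟨y, hy, hyC⟩ := hAC
  rw [connectedComponentIn_eq hyC]
  exact hA.subset_connectedComponentIn hy hAW

theorem eq_of_mem (h : IsCell W C) (h' : IsCell W C') {x : Plane} (hx : x ∈ C) (hx' : x ∈ C') :
    C = C' := by
  obtain ⟨y, -, rfl⟩ := h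
  obtain ⟨y', -, rfl⟩ := h'
  rw [connectedComponentIn_eq hx, connectedComponentIn_eq hx']

end IsCell

theorem isCell_connectedComponentIn {W : Set Plane} {x : Plane} (hx : x ∈ W) :
    IsCell W (connectedComponentIn W x) := ⟨x, hx, rfl⟩

theorem exists_isCell {W : Set Plane} {x : Plane} (hx : x ∈ W) : ∃ C, IsCell W C ∧ x ∈ C :=
  ⟨_, isCell_connectedComponentIn hx, mem_connectedComponentIn hx⟩

/-! ### Half balls -/

/-- The determinant of two vectors. -/
def cross (v w : Plane) : ℝ := v.1 * w.2 - v.2 * w.1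

@[simp] theorem cross_smul_left (a : ℝ) (v w : Plane) : cross (a • v) w = a * cross v w := by
  simp [cross]; ring

@[simp] theorem cross_smul_right (a : ℝ) (v w : Plane) : cross v (a • w) = a * cross v w := by
  simp [cross]; ring

@[simp] theorem cross_add_left (u v w : Plane) : cross (u + v) w = cross u w + cross v w := by
  simp [cross]; ring

@[simp] theorem cross_sub_left (u v w : Plane) : cross (u - v) w = cross u w - cross v w := by
  simp [cross]; ring

@[simp] theorem cross_neg_left (v w : Plane) : cross (-v) w = -cross v w := by
  simp [cross]; ring

@[simp] theorem cross_neg_right (v w : Plane) : cross v (-w) = -cross v w := by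
  simp [cross]; ring

@[simp] theorem cross_self (v : Plane) : cross v v = 0 := by
  simp [cross]; ring

theorem exists_cross_pos {w : Plane} (hw : w ≠ 0) : ∃ n, 0 < cross n w := by
  refine ⟨(w.2, -w.1), ?_⟩
  simp only [cross]
  rcases Prod.ext_iff.not.1 hw |> not_and_or.1 with h | h <;>
  · have h : _ ≠ (0 : ℝ) := h
    have := sq_pos_of_ne_zero h
    nlinarith [sq_nonneg w.1, sq_nonneg w.2]

/-- The part of a ball on one side of the line through its centre with direction `w`. -/
def halfBall (y : Plane) (ε : ℝ) (w : Plane) : Set Plane :=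
  {x | x ∈ Metric.ball y ε ∧ 0 < cross (x - y) w}

theorem isPreconnected_halfBall (y : Plane) (ε : ℝ) (w : Plane) :
    IsPreconnected (halfBall y ε w) := by
  have : Convex ℝ {x : Plane | 0 < cross (x - y) w} := by
    intro x hx x' hx' a b ha hb hab
    have hx : 0 < cross (x - y) w := hx
    have hx' : 0 < cross (x' - y) w := hx'
    change 0 < cross (a • x + b • x' - y) w
    rw [show a • x + b • x' - y = a • (x - y) + b • (x' - y) by
      rw [show b = 1 - a by linarith]; module]
    rw [cross_add_left, cross_smul_left, cross_smul_left]
    rcases ha.lt_or_eq with ha | rfl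
    · exact add_pos_of_pos_of_nonneg (mul_pos ha hx) (mul_nonneg hb hx'.le)
    · rw [zero_add] at hab; subst hab; simpa using hx'
  exact ((convex_ball y ε).inter this).isPreconnected

theorem mem_closure_halfBall {y z w : Plane} {ε : ℝ} (hw : w ≠ 0) (hz : z ∈ Metric.ball y ε)
    (h : cross (z - y) w = 0) : z ∈ closure (halfBall y ε w) := by
  obtain ⟨n, hn⟩ := exists_cross_pos hw
  have ht : Tendsto (fun κ : ℝ => z + κ • n) (𝓝[>] 0) (𝓝 z) := by
    have : Tendsto (fun κ : ℝ => z + κ • n) (𝓝 0) (𝓝 (z + (0 : ℝ) • n)) :=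
      (by fun_prop : Continuous fun κ : ℝ => z + κ • n).tendsto 0
    rw [zero_smul, add_zero] at this
    exact this.mono_left nhdsWithin_le_nhds
  refine mem_closure_of_tendsto ht ?_
  filter_upwards [ht.eventually (Metric.isOpen_ball.mem_nhds hz), self_mem_nhdsWithin] with κ h1 h2
  refine ⟨h1, ?_⟩
  have h2 : 0 < κ := h2
  rw [show z + κ • n - y = (z - y) + κ • n by abel, cross_add_left, h, cross_smul_left, zero_add]
  positivity

/-- An open set contains points off any given line. -/
theorem exists_cross_ne {U : Set Plane} (hU : IsOpen U) {x y w : Plane} (hx : x ∈ U) (hw : w ≠ 0) :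
    ∃ x' ∈ U, cross (x' - y) w ≠ 0 := by
  by_cases h : cross (x - y) w = 0
  · obtain ⟨ε, hε, hsub⟩ := Metric.isOpen_iff.1 hU x hx
    have h1 : x ∈ closure (halfBall x ε w) :=
      mem_closure_halfBall hw (Metric.mem_ball_self hε) (by simp [cross])
    obtain ⟨x', h2⟩ := closure_nonempty_iff.1 ⟨x, h1⟩
    refine ⟨x', hsub h2.1, ?_⟩
    rw [show x' - y = (x' - x) + (x - y) by abel, cross_add_left, h, add_zero]
    exact h2.2.ne'
  · exact ⟨x, hx, h⟩

/-! ### Stars of spokes -/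

variable {O : Set Plane} {Vt : Finset Plane} {L : Finset (ℝ × ℝ × ℝ)}
  {V : Finset Plane} {S : Finset (Plane × Plane)}

/-- `S` consists of the spokes at the points of `V`. -/
structure IsStar (O : Set Plane) (V : Finset Plane) (S : Finset (Plane × Plane)) : Prop where
  mem_iff : ∀ s : Plane × Plane, s ∈ S ↔ s.1 ∈ V ∧ s.2 ∈ foot O s.1
  notMem : ∀ p ∈ V, p ∉ O

theorem Tame.exists_isStar (T : Tame O Vt L) (hV : ∀ p ∈ V, p ∉ O) : ∃ S, IsStar O V S := by
  have hfin : {s : Plane × Plane | s.1 ∈ V ∧ s.2 ∈ foot O s.1}.Finite := by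
    refine (V.finite_toSet.biUnion fun p hp =>
      (T.finite_foot (hV p hp)).image fun q => (p, q)).subset ?_
    rintro ⟨p, q⟩ ⟨h1, h2⟩
    exact mem_iUnion₂.2 ⟨p, h1, q, h2, rfl⟩
  exact ⟨hfin.toFinset, fun s => by simp, hV⟩

theorem isOpen_compl_carrier (T : Tame O Vt L) : IsOpen (Oᶜ \ carrier S) :=
  T.closed.isOpen_compl.sdiff (isClosed_carrier S)

namespace IsStar
variable (St : IsStar O V S) (T : Tame O Vt L)
include St

theorem exists_param {s : Plane × Plane} (hs : s ∈ S) {y : Plane} (hy : y ∈ segment ℝ s.1 s.2)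
    (hyO : y ∉ O) : ∃ t : ℝ, 0 ≤ t ∧ t < 1 ∧ y = s.1 + t • (s.2 - s.1) ∧ s.2 ∈ foot O y := by
  rw [segment_eq_image'] at hy
  obtain ⟨t, ⟨h0, h1⟩, rfl⟩ := hy
  obtain ⟨-, hq⟩ := (St.mem_iff s).1 hs
  refine ⟨t, h0, h1.lt_of_ne ?_, rfl, mem_foot_walk hq h0 h1⟩
  rintro rfl
  refine hyO (foot_subset O s.1 ?_)
  simpa using hq

theorem mem_carrier {p q : Plane} (hp : p ∈ V) (hq : q ∈ foot O p) {t : ℝ} (h0 : 0 ≤ t)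
    (h1 : t ≤ 1) : p + t • (q - p) ∈ carrier S := by
  refine mem_iUnion₂.2 ⟨(p, q), (St.mem_iff _).2 ⟨hp, hq⟩, ?_⟩
  rw [segment_eq_image']
  exact ⟨t, ⟨h0, h1⟩, rfl⟩

include T

/-- A crossing of spokes with different ends would have both ends as contact points. By
`second_contact` along the first spoke, its own end is not a vertex and the other one is; the second
spoke gives the opposite. -/
theorem eq_of_cross {s s' : Plane × Plane} (hs : s ∈ S) (hs' : s' ∈ S) {t t' : ℝ} (h0 : 0 < t)
    (h1 : t < 1) (h0' : 0 < t') (h1' : t' < 1)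
    (h : s.1 + t • (s.2 - s.1) = s'.1 + t' • (s'.2 - s'.1)) : s'.2 = s.2 := by
  obtain ⟨hp, hq⟩ := (St.mem_iff s).1 hs
  obtain ⟨hp', hq'⟩ := (St.mem_iff s').1 hs'
  by_contra hne
  have a1 := (T.second_contact (St.notMem _ hp) hq h0 h1
    (h ▸ mem_foot_walk hq' h0'.le h1'.le) hne).1
  exact (T.second_contact (St.notMem _ hp') hq' h0' h1'
    (h ▸ mem_foot_walk hq h0.le h1.le) (Ne.symm hne)).2 a1

/-- Near a point of a spoke, all spokes run along the same line. -/
theorem exists_ball {s : Plane × Plane} (hs : s ∈ S) {y : Plane} (hy : y ∈ segment ℝ s.1 s.2)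
    (hyO : y ∉ O) (hyV : y ∉ V) : ∃ ε > 0, Metric.ball y ε ⊆ Oᶜ ∧
      ∀ x ∈ Metric.ball y ε, x ∈ carrier S → cross (x - y) (s.2 - y) = 0 := by
  obtain ⟨t, h0, h1, hyt, -⟩ := St.exists_param hs hy hyO
  have h0 : 0 < t := h0.lt_of_ne (by
    rintro rfl
    rw [zero_smul, add_zero] at hyt
    exact hyV (hyt ▸ ((St.mem_iff s).1 hs).1))
  have hev : ∀ s' ∈ S, ∀ᶠ x in 𝓝 y, x ∈ segment ℝ s'.1 s'.2 → cross (x - y) (s.2 - y) = 0 := by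
    intro s' hs'
    by_cases hy' : y ∈ segment ℝ s'.1 s'.2
    · obtain ⟨t', h0', h1', hyt', -⟩ := St.exists_param hs' hy' hyO
      have h0' : 0 < t' := h0'.lt_of_ne (by
        rintro rfl
        rw [zero_smul, add_zero] at hyt'
        exact hyV (hyt' ▸ ((St.mem_iff s').1 hs').1))
      have heq := St.eq_of_cross T hs hs' h0 h1 h0' h1' (hyt.symm.trans hyt')
      refine Eventually.of_forall fun x hx => ?_
      rw [segment_eq_image'] at hx
      obtain ⟨τ, -, rfl⟩ := hx
      rw [← heq, hyt']
      dsimp only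
      rw [show s'.1 + τ • (s'.2 - s'.1) - (s'.1 + t' • (s'.2 - s'.1)) = (τ - t') • (s'.2 - s'.1) by
        module, show s'.2 - (s'.1 + t' • (s'.2 - s'.1)) = (1 - t') • (s'.2 - s'.1) by module]
      simp
    · filter_upwards [(isClosed_segment s'.1 s'.2).isOpen_compl.mem_nhds hy'] with x hx h
      exact absurd h hx
  have hev' := (S.eventually_all (l := 𝓝 y)).2 hev
  obtain ⟨ε, hε, h⟩ := Metric.eventually_nhds_iff_ball.1
    (hev'.and (T.closed.isOpen_compl.mem_nhds hyO))
  refine ⟨ε, hε, fun x hx => (h x hx).2, fun x hx hxS => ?_⟩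
  obtain ⟨s', hs', hx'⟩ := mem_iUnion₂.1 hxS
  exact (h x hx).1 s' hs' hx'

omit St T in
theorem halfBall_subset {y w : Plane} {ε : ℝ} (h1 : Metric.ball y ε ⊆ Oᶜ)
    (h2 : ∀ x ∈ Metric.ball y ε, x ∈ carrier S → cross (x - y) w = 0) :
    halfBall y ε w ⊆ Oᶜ \ carrier S :=
  fun x hx => ⟨h1 hx.1, fun h => hx.2.ne' (h2 x hx.1 h)⟩

/-- A cell that has a point of a spoke in its closure has a point of `V` in its closure. -/
theorem exists_mem_closure_of_spoke {C : Set Plane} (hC : IsCell (Oᶜ \ carrier S) C)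
    {s : Plane × Plane} (hs : s ∈ S) {z : Plane} (hz : z ∈ segment ℝ s.1 s.2) (hzO : z ∉ O)
    (hzC : z ∈ closure C) : ∃ p ∈ V, p ∈ closure C := by
  obtain ⟨t₁, g0, g1, rfl, -⟩ := St.exists_param hs hz hzO
  obtain ⟨hp, hq⟩ := (St.mem_iff s).1 hs
  set f : ℝ → Plane := fun t => s.1 + t • (s.2 - s.1) with hf
  have hfc : Continuous f := by fun_prop
  -- The first point of the spoke in the closure of `C`. Unless it belongs to `V`, the argument
  -- below finds an earlier one.
  have hK : IsCompact (Icc 0 t₁ ∩ f ⁻¹' closure C) :=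
    isCompact_Icc.inter_right (isClosed_closure.preimage hfc)
  obtain ⟨t, ⟨⟨h0, h1⟩, htC⟩, hmin⟩ := hK.exists_isLeast ⟨t₁, ⟨g0, le_rfl⟩, hzC⟩
  have h1' : t < 1 := h1.trans_lt g1
  have hyO : f t ∉ O := walk_notMem T.closed (St.notMem _ hp) hq h0 h1'
  by_cases hyV : f t ∈ V
  · exact ⟨_, hyV, htC⟩
  exfalso
  have h0 : 0 < t := h0.lt_of_ne (by
    rintro rfl
    apply hyV
    rw [hf]
    simpa using hp)
  have hys : f t ∈ segment ℝ s.1 s.2 := by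
    rw [segment_eq_image']; exact ⟨t, ⟨h0.le, h1'.le⟩, rfl⟩
  obtain ⟨ε, hε, hb, hl⟩ := St.exists_ball T hs hys hyO hyV
  have hw : s.2 - f t ≠ 0 := by
    intro h
    rw [sub_eq_zero] at h
    exact hyO (h ▸ foot_subset _ _ hq)
  have hCo := hC.isOpen (isOpen_compl_carrier T)
  obtain ⟨x₀, hx₀⟩ := mem_closure_iff.1 htC _ Metric.isOpen_ball (Metric.mem_ball_self hε)
  obtain ⟨x, hx, hne⟩ := exists_cross_ne (y := f t) (Metric.isOpen_ball.inter hCo) hx₀ hw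
  obtain ⟨w, hw0, hwx, hwl⟩ : ∃ w : Plane, w ≠ 0 ∧ 0 < cross (x - f t) w ∧
      ∀ v, cross v (s.2 - f t) = 0 → cross v w = 0 := by
    rcases hne.lt_or_gt with h | h
    · exact ⟨-(s.2 - f t), neg_ne_zero.2 hw, by rw [cross_neg_right]; linarith,
        fun v hv => by rw [cross_neg_right, hv, neg_zero]⟩
    · exact ⟨_, hw, h, fun v hv => hv⟩
  -- All spokes near the point are on one line, so the half ball on the side where `C` has a point
  -- is entirely in `C`; its closure contains an earlier part of the spoke.
  have hsub : halfBall (f t) ε w ⊆ C := hC.subset_of_isPreconnected (isPreconnected_halfBall _ _ _)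
    (halfBall_subset hb fun x hx hxS => hwl _ (hl x hx hxS)) ⟨x, ⟨hx.1, hwx⟩, hx.2⟩
  obtain ⟨η, hη, hηb⟩ := Metric.eventually_nhds_iff_ball.1
    (hfc.tendsto t (Metric.ball_mem_nhds _ hε))
  obtain ⟨t', h2, h3⟩ := exists_between (max_lt h0 (show t - η < t by linarith))
  have h4 : t' ∈ Metric.ball t η := by
    rw [Metric.mem_ball, Real.dist_eq, abs_lt]
    constructor <;> linarith [le_max_right 0 (t - η)]
  have h5 : f t' ∈ closure C := by
    refine closure_mono hsub (mem_closure_halfBall hw0 (hηb t' h4) (hwl _ ?_))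
    rw [hf]
    dsimp only
    rw [show s.1 + t' • (s.2 - s.1) - (s.1 + t • (s.2 - s.1)) = (t' - t) • (s.2 - s.1) by
        module, show s.2 - (s.1 + t • (s.2 - s.1)) = (1 - t) • (s.2 - s.1) by module]
    simp
  have := hmin ⟨⟨(le_max_left _ _).trans h2.le, h3.le.trans h1⟩, h5⟩
  linarith

/-- Otherwise the closure of `C` meets no spoke in the free space, so `C` is open and closed there
and is everything, although the points of `V` are on spokes. -/
theorem exists_mem_closure (hF : IsPreconnected Oᶜ) (hV : V.Nonempty) {C : Set Plane}
    (hC : IsCell (Oᶜ \ carrier S) C) : ∃ p ∈ V, p ∈ closure C := by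
  have hCo := hC.isOpen (isOpen_compl_carrier T)
  obtain ⟨p, hp⟩ := hV
  obtain ⟨q, hq⟩ := foot_nonempty T.closed T.nonempty p
  by_contra hcon
  have hsub : Oᶜ ⊆ C := by
    refine hF.subset_of_closure_inter_subset hCo ?_ ?_
    · obtain ⟨x, hx⟩ := hC.nonempty
      exact ⟨x, (hC.subset hx).1, hx⟩
    · rintro z ⟨hz, hzO⟩
      by_cases hzS : z ∈ carrier S
      · obtain ⟨s, hs, hzs⟩ := mem_iUnion₂.1 hzS
        exact absurd (St.exists_mem_closure_of_spoke T hC hs hzs hzO hz) hcon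
      · obtain ⟨C', hC', hzC'⟩ := exists_isCell (W := Oᶜ \ carrier S) ⟨hzO, hzS⟩
        obtain ⟨x, h1, h2⟩ := mem_closure_iff.1 hz _ (hC'.isOpen (isOpen_compl_carrier T)) hzC'
        rwa [hC.eq_of_mem hC' h2 h1]
  refine (hC.subset (hsub (St.notMem p hp))).2 ?_
  have := St.mem_carrier hp hq le_rfl zero_le_one
  rwa [zero_smul, add_zero] at this

omit T in
/-- The directions of the spokes at a point. -/
theorem exists_of_mem_angles {y : Plane} (hyO : y ∉ O) {θ : ℝ} (hθ : θ ∈ angles (carrier S) y) :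
    ∃ s ∈ S, y ∈ segment ℝ s.1 s.2 ∧ s.2 ∈ foot O y ∧ ∃ c : ℝ, c ≠ 0 ∧ s.2 - y = c • unitVec θ ∧
      (y = s.1 → 0 < c) := by
  obtain ⟨s, hs, hy, hnear⟩ := exists_segment_of_mem_angles hθ
  obtain ⟨t, h0, h1, hyt, hq⟩ := St.exists_param hs hy hyO
  obtain ⟨ρ, hρ, -, hρs⟩ := hnear 1 one_pos
  refine ⟨s, hs, hy, hq, ?_⟩
  rw [segment_eq_image'] at hρs
  obtain ⟨τ, ⟨hτ0, -⟩, hτ⟩ := hρs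
  dsimp only at hτ
  have e1 : ρ • unitVec θ = (τ - t) • (s.2 - s.1) := by
    have : ρ • unitVec θ = s.1 + τ • (s.2 - s.1) - y := by rw [hτ]; abel
    rw [this, hyt]; module
  have hne : τ - t ≠ 0 := by
    intro h
    rw [h, zero_smul] at e1
    exact smul_ne_zero hρ.ne' (unitVec_ne_zero θ) e1
  have e2 : s.2 - s.1 = (ρ / (τ - t)) • unitVec θ := by
    rw [div_eq_inv_mul, mul_smul, e1, smul_smul, inv_mul_cancel₀ hne, one_smul]
  refine ⟨(1 - t) * (ρ / (τ - t)), mul_ne_zero (by linarith) (div_ne_zero hρ.ne' hne), ?_, ?_⟩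
  · rw [mul_smul, ← e2, hyt]; module
  · intro h
    have ht : t • (s.2 - s.1) = 0 := by rw [← h] at hyt ⊢; simpa using hyt
    rcases smul_eq_zero.1 ht with rfl | h'
    · rw [sub_zero] at hne ⊢
      have := hτ0.lt_of_ne hne.symm
      positivity
    · rw [h'] at e2
      exact absurd e2.symm (smul_ne_zero (div_ne_zero hρ.ne' hne) (unitVec_ne_zero θ))

end IsStar

theorem eq_of_unitVec_eq {θ θ' : ℝ} (h : θ ∈ Ico 0 (2 * π)) (h' : θ' ∈ Ico 0 (2 * π))
    (heq : unitVec θ = unitVec θ') : θ = θ' := by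
  obtain ⟨k, hk⟩ := unitVec_eq_iff.1 heq
  have hp : (0 : ℝ) < 2 * π := by positivity
  have hk1 : (k : ℝ) < 1 := by by_contra hc; push Not at hc; nlinarith [h.2, h'.1]
  have hk2 : (-1 : ℝ) < k := by by_contra hc; push Not at hc; nlinarith [h.1, h'.2]
  have : k = 0 := by
    have a1 : k < 1 := by exact_mod_cast hk1
    have a2 : -1 < k := by exact_mod_cast hk2
    omega
  rw [hk, this]; simp

/-- The sign `σ = 1` counts directions towards points of `X`, and `σ = -1` directions away from
them; a point accounts for one of each. -/
theorem ncard_directions_le {X : Set Plane} (hX : X.Finite) (p : Plane) {σ : ℝ} (hσ : σ ≠ 0) :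
    {θ : ℝ | θ ∈ Ico 0 (2 * π) ∧ ∃ q ∈ X, ∃ c : ℝ, 0 < c ∧ q - p = (σ * c) • unitVec θ}.Finite ∧
    {θ : ℝ | θ ∈ Ico 0 (2 * π) ∧ ∃ q ∈ X, ∃ c : ℝ, 0 < c ∧ q - p = (σ * c) • unitVec θ}.ncard
      ≤ X.ncard := by
  have h : ∀ θ : ℝ, ∃ q : Plane, (∃ q ∈ X, ∃ c : ℝ, 0 < c ∧ q - p = (σ * c) • unitVec θ) →
      q ∈ X ∧ ∃ c : ℝ, 0 < c ∧ q - p = (σ * c) • unitVec θ := by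
    intro θ
    by_cases h : ∃ q ∈ X, ∃ c : ℝ, 0 < c ∧ q - p = (σ * c) • unitVec θ
    · obtain ⟨q, hq⟩ := h
      exact ⟨q, fun _ => hq⟩
    · exact ⟨0, fun h' => absurd h' h⟩
  choose f hf using h
  suffices hinj : InjOn f {θ : ℝ | θ ∈ Ico 0 (2 * π) ∧
      ∃ q ∈ X, ∃ c : ℝ, 0 < c ∧ q - p = (σ * c) • unitVec θ} from
    ⟨Set.Finite.of_injOn (fun θ hθ => (hf θ hθ.2).1) hinj hX,
      Set.ncard_le_ncard_of_injOn f (fun θ hθ => (hf θ hθ.2).1) hinj hX⟩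
  intro θ hθ θ' hθ' heq
  obtain ⟨-, c, hc, h1⟩ := hf θ hθ.2
  obtain ⟨-, c', hc', h2⟩ := hf θ' hθ'.2
  rw [← heq, h1, mul_smul, mul_smul] at h2
  have h3 := smul_right_injective Plane hσ h2
  refine eq_of_unitVec_eq hθ.1 hθ'.1 (unitVec_eq_of_smul (c := c' / c) (by positivity) ?_).2
  rw [div_eq_inv_mul, mul_smul, ← h3, smul_smul, inv_mul_cancel₀ hc.ne', one_smul]

theorem half_le_norm_unitVec (θ : ℝ) : 1 / 2 ≤ ‖unitVec θ‖ := by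
  by_contra hcon
  push Not at hcon
  unfold unitVec at hcon
  rw [Prod.norm_def, max_lt_iff] at hcon
  obtain ⟨h1, h2⟩ := hcon
  rw [Real.norm_eq_abs, abs_lt] at h1 h2
  dsimp only at h1 h2
  nlinarith [sin_sq_add_cos_sq θ]

theorem exists_polar_ball {p x : Plane} {ε : ℝ} (hx : x ∈ Metric.ball p (ε / 2)) (hne : x ≠ p) :
    ∃ ρ θ : ℝ, 0 < ρ ∧ ρ < ε ∧ x = p + ρ • unitVec θ := by
  obtain ⟨ρ, hρ, θ, h⟩ := exists_polar (sub_ne_zero.2 hne)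
  refine ⟨ρ, θ, hρ, ?_, by rw [← h]; abel⟩
  rw [Metric.mem_ball, dist_eq_norm, h, norm_smul, Real.norm_of_nonneg hρ.le] at hx
  nlinarith [half_le_norm_unitVec θ]

namespace IsStar
variable (St : IsStar O V S) (T : Tame O Vt L)
include St T

/-- A spoke through `p` ends in one of at most eight contact points of `p`, and leaves `p` towards
it or away from it. -/
theorem ncard_angles_le {p : Plane} (hp : p ∉ O) :
    (angles (carrier S) p ∩ Ico 0 (2 * π)).ncard ≤ 16 := by
  have hfin := T.finite_foot hp
  have h8 : (foot O p).ncard ≤ 8 := by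
    have := T.encard_foot_le hp
    rw [← hfin.cast_ncard_eq] at this
    exact_mod_cast this
  have hsub : angles (carrier S) p ∩ Ico 0 (2 * π) ⊆ {θ : ℝ | θ ∈ Ico 0 (2 * π) ∧
        ∃ q ∈ foot O p, ∃ c : ℝ, 0 < c ∧ q - p = ((1 : ℝ) * c) • unitVec θ} ∪
      {θ : ℝ | θ ∈ Ico 0 (2 * π) ∧
        ∃ q ∈ foot O p, ∃ c : ℝ, 0 < c ∧ q - p = ((-1 : ℝ) * c) • unitVec θ} := by
    rintro θ ⟨hθ, hI⟩
    obtain ⟨s, -, -, hq, c, hc, h, -⟩ := St.exists_of_mem_angles hp hθ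
    rcases hc.lt_or_gt with hc | hc
    · exact .inr ⟨hI, s.2, hq, -c, by linarith, by rw [h]; simp⟩
    · exact .inl ⟨hI, s.2, hq, c, hc, by rw [h]; simp⟩
  obtain ⟨f1, h1⟩ := ncard_directions_le hfin p (σ := 1) one_ne_zero
  obtain ⟨f2, h2⟩ := ncard_directions_le hfin p (σ := -1) (by norm_num)
  have := (ncard_le_ncard hsub (f1.union f2)).trans (ncard_union_le _ _)
  omega

omit St T in
theorem sector_subset_compl {p : Plane} {ε : ℝ} (hc : ConicAt (carrier S) p ε)
    (hb : Metric.ball p ε ⊆ Oᶜ) {J : Set ℝ} (hJ : ∀ θ ∈ J, θ ∉ angles (carrier S) p) :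
    sector p ε J ⊆ Oᶜ \ carrier S := by
  rintro _ ⟨⟨ρ, θ⟩, ⟨hρ, hθ⟩, rfl⟩
  exact ⟨hb (dist_add_unitVec_lt hρ.1.le hρ.2), fun h => hJ θ hθ ((hc ρ hρ.1 hρ.2 θ).1 h)⟩

theorem mem_carrier_self {p : Plane} (hp : p ∈ V) : p ∈ carrier S := by
  obtain ⟨q, hq⟩ := foot_nonempty T.closed T.nonempty p
  have := St.mem_carrier hp hq le_rfl zero_le_one
  rwa [zero_smul, add_zero] at this

omit T in
theorem mem_angles_of_foot {p q : Plane} (hp : p ∈ V) (hq : q ∈ foot O p) {R θ : ℝ} (hR : 0 < R)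
    (h : q - p = R • unitVec θ) : θ ∈ angles (carrier S) p := by
  rw [mem_angles]
  filter_upwards [Ioo_mem_nhdsGT hR] with ρ hρ
  have := St.mem_carrier hp hq (t := ρ / R) (div_nonneg hρ.1.le hR.le)
    ((div_le_one hR).2 hρ.2.le)
  rwa [h, smul_smul, div_mul_cancel₀ _ hR.ne'] at this

theorem angles_nonempty {p : Plane} (hp : p ∈ V) : (angles (carrier S) p).Nonempty := by
  obtain ⟨q, hq⟩ := foot_nonempty T.closed T.nonempty p
  have hne : q - p ≠ 0 := by
    intro h
    rw [sub_eq_zero] at h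
    exact St.notMem p hp (h ▸ foot_subset _ _ hq)
  obtain ⟨R, hR, θ, h⟩ := exists_polar hne
  exact ⟨θ, St.mem_angles_of_foot hp hq hR h⟩

/-- A cell with `p` in its closure contains a sector between consecutive spoke directions. The end
`b` of this sector determines the cell, which contains the points just before `b`. -/
theorem finite_cells_at {p : Plane} (hp : p ∈ V) :
    {C | IsCell (Oᶜ \ carrier S) C ∧ p ∈ closure C}.Finite ∧
      {C | IsCell (Oᶜ \ carrier S) C ∧ p ∈ closure C}.ncard ≤ 16 := by
  have hpO := St.notMem p hp
  obtain ⟨⟨ε₁, hε₁, hc⟩, hper⟩ := exists_conicAt_biUnion S id p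
  obtain ⟨ε₂, hε₂, hb⟩ := Metric.isOpen_iff.1 T.closed.isOpen_compl p hpO
  set ε := min ε₁ ε₂
  have hε : 0 < ε := lt_min hε₁ hε₂
  have hc : ConicAt (carrier S) p ε := ConicAt.mono hc (min_le_left _ _)
  have hb : Metric.ball p ε ⊆ Oᶜ := (Metric.ball_subset_ball (min_le_right _ _)).trans hb
  have h : ∀ C : Set Plane, ∃ b : ℝ, IsCell (Oᶜ \ carrier S) C ∧ p ∈ closure C →
      b ∈ angles (carrier S) p ∩ Ico 0 (2 * π) ∧
      ∀ᶠ τ in 𝓝[>] (0 : ℝ), p + (ε / 2) • unitVec (b - τ) ∈ C := by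
    intro C
    by_cases hC : IsCell (Oᶜ \ carrier S) C ∧ p ∈ closure C
    swap
    · exact ⟨0, fun h => absurd h hC⟩
    obtain ⟨hC, hpC⟩ := hC
    obtain ⟨x, hx, hxC⟩ := mem_closure_iff.1 hpC _ Metric.isOpen_ball
      (Metric.mem_ball_self (half_pos hε))
    obtain ⟨ρ, ψ, h0, h1, rfl⟩ := exists_polar_ball hx (by
      rintro rfl
      exact (hC.subset hxC).2 (St.mem_carrier_self T hp))
    have hψ : ψ ∉ angles (carrier S) p := fun h => (hC.subset hxC).2 ((hc ρ h0 h1 ψ).2 h)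
    obtain ⟨b, hbA, hψb, -, hgap⟩ := (perFin_angles_carrier S p).exists_succ
      (St.angles_nonempty T hp) ψ
    have hsub : sector p ε (Ico ψ b) ⊆ C := by
      refine hC.subset_of_isPreconnected (isPreconnected_sector _ _ isPreconnected_Ico)
        (sector_subset_compl hc hb fun θ hθ => ?_) ⟨_, mem_sector h0 h1 ⟨le_rfl, hψb⟩, hxC⟩
      rcases hθ.1.eq_or_lt with rfl | h
      exacts [hψ, hgap θ h hθ.2]
    obtain ⟨k, hk⟩ := (perFin_angles_carrier S p).exists_rep hbA
    refine ⟨_, fun _ => ⟨hk, ?_⟩⟩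
    filter_upwards [Ioo_mem_nhdsGT (show (0 : ℝ) < b - ψ by linarith)] with τ hτ
    rw [unitVec_eq_iff.2 ⟨k, show b + k * (2 * π) - τ = b - τ + k * (2 * π) by ring⟩]
    exact hsub (mem_sector (half_pos hε) (half_lt_self hε) ⟨by linarith [hτ.2], by linarith [hτ.1]⟩)
  choose f hf using h
  have hinj : InjOn f {C | IsCell (Oᶜ \ carrier S) C ∧ p ∈ closure C} := by
    intro C hC C' hC' heq
    have h1 := (hf C hC).2
    have h2 := (hf C' hC').2
    rw [← heq] at h2
    obtain ⟨τ, g1, g2⟩ := (Eventually.and h1 h2).exists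
    exact hC.1.eq_of_mem hC'.1 g1 g2
  have hfin := (perFin_angles_carrier S p).fin
  exact ⟨Set.Finite.of_injOn (fun C hC => (hf C hC).1) hinj hfin,
    (Set.ncard_le_ncard_of_injOn f (fun C hC => (hf C hC).1) hinj hfin).trans
      (St.ncard_angles_le T hpO)⟩

theorem finite_cells (hF : IsPreconnected Oᶜ) (hV : V.Nonempty) :
    {C | IsCell (Oᶜ \ carrier S) C}.Finite ∧
      {C | IsCell (Oᶜ \ carrier S) C}.ncard ≤ 16 * V.card := by
  classical
  have hfin : ∀ p, {C | p ∈ V ∧ IsCell (Oᶜ \ carrier S) C ∧ p ∈ closure C}.Finite := by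
    intro p
    by_cases hp : p ∈ V
    · exact (St.finite_cells_at T hp).1.subset fun C hC => hC.2
    · exact Set.finite_empty.subset fun C hC => hp hC.1
  have hsub : {C | IsCell (Oᶜ \ carrier S) C} ⊆
      ((V.biUnion fun p => (hfin p).toFinset : Finset (Set Plane)) : Set (Set Plane)) := by
    intro C hC
    obtain ⟨p, hp, hpC⟩ := St.exists_mem_closure T hF hV hC
    rw [Finset.mem_coe, Finset.mem_biUnion]
    exact ⟨p, hp, (hfin p).mem_toFinset.2 ⟨hp, hC, hpC⟩⟩
  refine ⟨(Finset.finite_toSet _).subset hsub, (ncard_le_ncard hsub (Finset.finite_toSet _)).trans ?_⟩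
  rw [Set.ncard_coe_finset, mul_comm]
  refine Finset.card_biUnion_le_card_mul _ _ _ fun p hp => ?_
  rw [← Set.ncard_eq_toFinset_card _ (hfin p)]
  exact (ncard_le_ncard (fun C hC => hC.2) (St.finite_cells_at T hp).1).trans
    (St.finite_cells_at T hp).2

end IsStar

/-- Without spokes there is at most one cell. -/
theorem finite_cells_of_isPreconnected {W : Set Plane} (hW : IsPreconnected W) :
    {C | IsCell W C}.Finite ∧ {C | IsCell W C}.ncard ≤ 1 := by
  have hsub : {C | IsCell W C} ⊆ {W} := by
    intro C hC
    have hC : IsCell W C := hC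
    obtain ⟨x, hx⟩ := hC.nonempty
    exact hC.subset.antisymm (hC.subset_of_isPreconnected hW subset_rfl ⟨x, hC.subset hx, hx⟩)
  exact ⟨(finite_singleton W).subset hsub,
    (ncard_le_ncard hsub (finite_singleton W)).trans_eq (ncard_singleton W)⟩

end Corridor
end

/-! ### The cell into which a point of the axis leads -/

noncomputable section
open Set Filter Topology Real
namespace Corridor

/-! ### The cell on the side of a contact point -/

variable {O : Set Plane} {Vt : Finset Plane} {L : Finset (ℝ × ℝ × ℝ)}
  {V : Finset Plane} {S G : Finset (Plane × Plane)}

theorem foot_walk_anti {p q : Plane} (hq : q ∈ foot O p) {t t' : ℝ} (h0 : 0 ≤ t) (h1 : t ≤ t')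
    (h2 : t' ≤ 1) : foot O (p + t' • (q - p)) ⊆ foot O (p + t • (q - p)) := by
  rcases h1.eq_or_lt with rfl | h1
  · rfl
  have h3 : 0 < 1 - t := by linarith
  have h4 := foot_walk_subset (mem_foot_walk hq h0 (by linarith)) (t := (t' - t) / (1 - t))
    (div_nonneg (by linarith) h3.le) ((div_le_one h3).2 (by linarith))
  rwa [show p + t • (q - p) + ((t' - t) / (1 - t)) • (q - (p + t • (q - p))) =
      p + t' • (q - p) by
    rw [show q - (p + t • (q - p)) = (1 - t) • (q - p) by module, smul_smul,
      div_mul_cancel₀ _ h3.ne']; module] at h4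

theorem exists_smul_of_cross_eq_zero {v w : Plane} (hw : w ≠ 0) (h : cross v w = 0) :
    ∃ c : ℝ, v = c • w := by
  unfold cross at h
  by_cases h1 : w.1 = 0
  · have h2 : w.2 ≠ 0 := fun h2 => hw (Prod.ext h1 h2)
    refine ⟨v.2 / w.2, Prod.ext ?_ ?_⟩
    · rw [h1, mul_zero, sub_zero] at h
      simp [h1, (mul_eq_zero.1 h).resolve_right h2]
    · simp [h2]
  · refine ⟨v.1 / w.1, Prod.ext ?_ ?_⟩
    · simp [h1]
    · simp only [Prod.smul_snd, smul_eq_mul]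
      field_simp
      linarith

/-- A second contact point of a point on a spoke is not on the line of the spoke. -/
theorem cross_ne_zero_of_second_contact {p q q' : Plane} (hp : 0 < rad O p) (hq : q ∈ foot O p)
    {t : ℝ} (h0 : 0 < t) (h1 : t < 1) (hq' : q' ∈ foot O (p + t • (q - p))) (hne : q' ≠ q) :
    cross (q' - (p + t • (q - p))) (q - p) ≠ 0 := by
  intro hc
  have hd : dist p q = rad O p := (mem_foot.1 hq).1
  have hqp : q - p ≠ 0 := by
    intro h
    rw [sub_eq_zero] at h
    rw [h, dist_self] at hd
    linarith
  obtain ⟨c, hc⟩ := exists_smul_of_cross_eq_zero hqp hc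
  have hn : ‖q - p‖ = rad O p := by rw [← dist_eq_norm, dist_comm, hd]
  have e1 : dist (p + t • (q - p)) q' = (1 - t) * rad O p := by
    rw [(mem_foot.1 hq').1, rad_walk hq h0.le h1.le]
  have e2 := (mem_foot.1 (foot_walk_subset hq h0.le h1.le hq')).1
  rw [dist_comm, dist_eq_norm, hc, norm_smul, hn, Real.norm_eq_abs] at e1
  rw [dist_comm, dist_eq_norm, show q' - p = (c + t) • (q - p) by
    rw [add_smul, ← hc]; abel, norm_smul, hn, Real.norm_eq_abs] at e2
  have e1 := mul_right_cancel₀ hp.ne' e1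
  have e2 : |c + t| = 1 := mul_right_cancel₀ hp.ne' (e2.trans (one_mul _).symm)
  rcases abs_cases c with ⟨g, g'⟩ | ⟨g, g'⟩
  · apply hne
    rw [show q' = q' - (p + t • (q - p)) + (p + t • (q - p)) by abel, hc,
      show c = 1 - t by linarith]
    module
  · rcases abs_cases (c + t) with ⟨k, k'⟩ | ⟨k, k'⟩ <;> linarith

/-- The square at `y` has a contact point in whose direction the cell `C` begins. -/
def Leads (O C : Set Plane) (y : Plane) : Prop :=
  ∃ q ∈ foot O y, ∀ᶠ η in 𝓝[>] (0 : ℝ), y + η • (q - y) ∈ C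

theorem tendsto_add_smul (y v : Plane) :
    Tendsto (fun η : ℝ => y + η • v) (𝓝[>] 0) (𝓝 y) := by
  have : Tendsto (fun η : ℝ => y + η • v) (𝓝 0) (𝓝 (y + (0 : ℝ) • v)) :=
    (by fun_prop : Continuous fun η : ℝ => y + η • v).tendsto 0
  rw [zero_smul, add_zero] at this
  exact this.mono_left nhdsWithin_le_nhds

theorem leads_of_mem (T : Tame O Vt L) {C : Set Plane} (hC : IsOpen C) {y : Plane} (hy : y ∈ C) :
    Leads O C y := by
  obtain ⟨q, hq⟩ := foot_nonempty T.closed T.nonempty y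
  exact ⟨q, hq, (tendsto_add_smul y _).eventually (hC.mem_nhds hy)⟩

theorem eventually_mem_halfBall {y z v w : Plane} {ε : ℝ} (hz : z ∈ Metric.ball y ε)
    (h0 : cross (z - y) w = 0) (h : 0 < cross v w) :
    ∀ᶠ η in 𝓝[>] (0 : ℝ), z + η • v ∈ halfBall y ε w := by
  filter_upwards [(tendsto_add_smul z v).eventually (Metric.isOpen_ball.mem_nhds hz),
    self_mem_nhdsWithin] with η h1 h2
  refine ⟨h1, ?_⟩
  have h2 : 0 < η := h2
  rw [show z + η • v - y = (z - y) + η • v by abel, cross_add_left, h0, cross_smul_left, zero_add]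
  positivity

theorem PerFin.three_le {A : Set ℝ} (hA : PerFin A) {θ₁ θ₂ θ₃ : ℝ} (h1 : θ₁ ∈ A) (h2 : θ₂ ∈ A)
    (h3 : θ₃ ∈ A) (h12 : unitVec θ₁ ≠ unitVec θ₂) (h13 : unitVec θ₁ ≠ unitVec θ₃)
    (h23 : unitVec θ₂ ≠ unitVec θ₃) : 3 ≤ (A ∩ Ico 0 (2 * π)).ncard := by
  obtain ⟨k₁, g1⟩ := hA.exists_rep h1
  obtain ⟨k₂, g2⟩ := hA.exists_rep h2
  obtain ⟨k₃, g3⟩ := hA.exists_rep h3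
  have hne : ∀ {θ θ' : ℝ} {k k' : ℤ}, unitVec θ ≠ unitVec θ' →
      θ + k * (2 * π) ≠ θ' + k' * (2 * π) := by
    intro θ θ' k k' h heq
    apply h
    rw [← unitVec_eq_iff.2 ⟨k, rfl⟩, heq, unitVec_eq_iff.2 ⟨k', rfl⟩]
  rw [← Set.ncard_eq_three.2 ⟨_, _, _, hne (k := k₁) (k' := k₂) h12, hne (k := k₁) (k' := k₃) h13,
    hne (k := k₂) (k' := k₃) h23, rfl⟩]
  refine ncard_le_ncard ?_ hA.fin
  rintro _ (rfl | rfl | rfl)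
  exacts [g1, g2, g3]

/-- A star at whose centres there are as many branches of the medial axis as contact points. -/
structure IsBranchStar (O : Set Plane) (V : Finset Plane) (S : Finset (Plane × Plane)) : Prop
    extends IsStar O V S where
  three_le : ∀ p ∈ V, 3 ≤ (foot O p).ncard
  ncard_eq : ∀ p ∈ V, (angles (medialAxis O) p ∩ Ico 0 (2 * π)).ncard = (foot O p).ncard

namespace IsBranchStar
variable (St : IsBranchStar O V S) (T : Tame O Vt L) (hG : carrier G = closure (medialAxis O))
include St T

theorem mem_medialAxis {p : Plane} (hp : p ∈ V) : p ∈ medialAxis O := by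
  refine (Corridor.mem_medialAxis T.closed T.nonempty).2 ⟨St.notMem p hp, ?_⟩
  have := St.three_le p hp
  rw [← Set.one_lt_encard_iff_nontrivial, ← (T.finite_foot (St.notMem p hp)).cast_ncard_eq]
  exact_mod_cast (by omega : 1 < (foot O p).ncard)

include hG

/-- Second contact points persist along the spoke back to `p`. Two of them would own both sides of
the direction of `q` at `p`, so `q` would own no sector, and `p` would have fewer branches than
contact points. -/
theorem unique_second {p q q₁ q₂ : Plane} (hp : p ∈ V) (hq : q ∈ foot O p) {t : ℝ} (h0 : 0 < t)
    (h1 : t < 1) (hq₁ : q₁ ∈ foot O (p + t • (q - p))) (hq₂ : q₂ ∈ foot O (p + t • (q - p)))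
    (hne₁ : q₁ ≠ q) (hne₂ : q₂ ≠ q) : q₁ = q₂ := by
  by_contra hne
  have hpO := St.notMem p hp
  obtain ⟨δ, ε, P⟩ := T.exists_localPicture hG (St.mem_medialAxis T hp)
  have hqp : q - p ≠ 0 := by
    intro h
    rw [sub_eq_zero] at h
    exact hpO (h ▸ foot_subset _ _ hq)
  obtain ⟨R, hR, φ, hφ⟩ := exists_polar hqp
  obtain ⟨ρ, g0, g1⟩ := exists_between (lt_min P.ε_pos (mul_pos h0 hR))
  have g2 : ρ < t * R := g1.trans_le (min_le_right _ _)
  have hsub := foot_walk_anti hq (t := ρ / R) (t' := t) (by positivity)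
    ((div_le_iff₀ hR).2 g2.le) h1.le
  have he : p + (ρ / R) • (q - p) = p + ρ • unitVec φ := by
    rw [hφ, smul_smul, div_mul_cancel₀ _ hR.ne']
  rw [he] at hsub
  have := P.ncard_angles_lt_of_two (T.finite_foot hpO) hq hR hφ g0
    (g1.trans_le (min_le_left _ _)) (g2.trans (by nlinarith)) (hsub hq₁) (hsub hq₂) hne₁ hne₂ hne
  exact this.ne (St.ncard_eq p hp)

/-- No spoke runs through a point of `V`. -/
theorem eq_of_mem_segment {s : Plane × Plane} (hs : s ∈ S) {p : Plane} (hp : p ∈ V)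
    (hps : p ∈ segment ℝ s.1 s.2) : p = s.1 := by
  by_contra hne
  obtain ⟨t, h0, h1, hpt, hq⟩ := St.exists_param hs hps (St.notMem p hp)
  have h0 : 0 < t := h0.lt_of_ne (by
    rintro rfl
    rw [zero_smul, add_zero] at hpt
    exact hne hpt)
  obtain ⟨hp1, hq1⟩ := (St.mem_iff s).1 hs
  -- At least two contact points of `p` differ from the end of the spoke, contrary to the uniqueness
  -- of the second one.
  have h3 := St.three_le p hp
  obtain ⟨q₁, hq₁, hne₁⟩ := Set.exists_ne_of_one_lt_ncard (show 1 < (foot O p).ncard by omega) s.2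
  have h4 : ¬ foot O p ⊆ {s.2, q₁} := fun hsub => by
    have := (ncard_le_ncard hsub (by simp)).trans (ncard_insert_le _ _)
    rw [ncard_singleton] at this
    omega
  obtain ⟨q₂, hq₂, h5⟩ := not_subset.1 h4
  simp only [mem_insert_iff, mem_singleton_iff, not_or] at h5
  exact h5.2 (St.unique_second T hG hp1 hq1 h0 h1 (hpt ▸ hq₂) (hpt ▸ hq₁) h5.1 hne₁)

/-- The contact points of a point of the medial axis on a spoke. -/
theorem exists_second {s : Plane × Plane} (hs : s ∈ S) {y : Plane} (hys : y ∈ segment ℝ s.1 s.2)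
    (hy : y ∈ medialAxis O) (hyV : y ∉ V) : ∃ t : ℝ, ∃ q, 0 < t ∧ t < 1 ∧
      y = s.1 + t • (s.2 - s.1) ∧ s.2 ∈ foot O y ∧ q ∈ foot O y ∧ q ≠ s.2 ∧
      (∀ q' ∈ foot O y, q' ≠ s.2 → q' = q) ∧ cross (q - y) (s.2 - y) ≠ 0 := by
  obtain ⟨hyO, hnt⟩ := (Corridor.mem_medialAxis T.closed T.nonempty).1 hy
  obtain ⟨t, h0, h1, hyt, hq⟩ := St.exists_param hs hys hyO
  obtain ⟨hp1, hq1⟩ := (St.mem_iff s).1 hs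
  have h0 : 0 < t := h0.lt_of_ne (by
    rintro rfl
    rw [zero_smul, add_zero] at hyt
    exact hyV (hyt ▸ hp1))
  obtain ⟨q, hq', hne⟩ := hnt.exists_ne s.2
  refine ⟨t, q, h0, h1, hyt, hq, hq', hne, fun q' h h' => ?_, ?_⟩
  · exact St.unique_second T hG hp1 hq1 h0 h1 (hyt ▸ h) (hyt ▸ hq') h' hne
  · have := cross_ne_zero_of_second_contact (rad_pos T.closed T.nonempty (St.notMem _ hp1)) hq1
      h0 h1 (hyt ▸ hq') hne
    rw [← hyt] at this
    rw [show s.2 - y = (1 - t) • (s.2 - s.1) by rw [hyt]; module, cross_smul_right]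
    exact mul_ne_zero (by linarith) this

omit St T hG in
theorem exists_oriented {v w : Plane} (h : cross v w ≠ 0) :
    ∃ σ : ℝ, (σ = 1 ∨ σ = -1) ∧ 0 < cross v (σ • w) := by
  rcases h.lt_or_gt with h | h
  · exact ⟨-1, .inr rfl, by rw [cross_smul_right]; linarith⟩
  · exact ⟨1, .inl rfl, by rw [cross_smul_right]; linarith⟩

/-- On a spoke the second contact point is off the line of the spoke, and the half ball on its side
avoids all spokes. Off the spokes the cell of `y` itself will do. -/
theorem exists_leads {y : Plane} (hy : y ∈ medialAxis O) (hyV : y ∉ V) :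
    ∃ C, IsCell (Oᶜ \ carrier S) C ∧ Leads O C y := by
  have hyO := medialAxis_subset_compl hy
  by_cases hyS : y ∈ carrier S
  · obtain ⟨s, hs, hys⟩ := mem_iUnion₂.1 hyS
    obtain ⟨t, q, h0, h1, hyt, -, hq, -, -, hc⟩ := St.exists_second T hG hs hys hy hyV
    obtain ⟨ε, hε, hb, hl⟩ := St.exists_ball T hs hys hyO hyV
    obtain ⟨σ, -, hσ⟩ := exists_oriented hc
    have hsub : halfBall y ε (σ • (s.2 - y)) ⊆ Oᶜ \ carrier S :=
      IsStar.halfBall_subset hb fun x hx hxS => by rw [cross_smul_right, hl x hx hxS, mul_zero]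
    have hev := eventually_mem_halfBall (y := y) (z := y) (Metric.mem_ball_self hε) (by simp [cross]) hσ
    obtain ⟨η, hη⟩ := hev.exists
    obtain ⟨C, hC, hCη⟩ := exists_isCell (hsub hη)
    have := hC.subset_of_isPreconnected (isPreconnected_halfBall _ _ _) hsub ⟨_, hη, hCη⟩
    exact ⟨C, hC, q, hq, hev.mono fun η h => this h⟩
  · obtain ⟨C, hC, hyC⟩ := exists_isCell (W := Oᶜ \ carrier S) ⟨hyO, hyS⟩
    exact ⟨C, hC, leads_of_mem T (hC.isOpen (isOpen_compl_carrier T)) hyC⟩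

-- The direction towards the end of the spoke runs along the spoke, not into a cell. So on a spoke
-- only the second contact point can lead into a cell.
omit T hG in
theorem ne_of_leads {C : Set Plane} (hC : IsCell (Oᶜ \ carrier S) C) {s : Plane × Plane}
    (hs : s ∈ S) {t : ℝ} {y q : Plane} (h0 : 0 ≤ t) (h1 : t < 1)
    (hy : y = s.1 + t • (s.2 - s.1))
    (h : ∀ᶠ η in 𝓝[>] (0 : ℝ), y + η • (q - y) ∈ C) : q ≠ s.2 := by
  rintro rfl
  obtain ⟨hp, hq⟩ := (St.mem_iff s).1 hs
  obtain ⟨η, hη, hη1⟩ := (h.and (Ioo_mem_nhdsGT (one_pos (α := ℝ)))).exists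
  refine (hC.subset hη).2 ?_
  have := St.mem_carrier hp hq (t := t + η * (1 - t)) (by nlinarith [hη1.1]) (by
    nlinarith [hη1.2])
  rwa [show y + η • (s.2 - y) = s.1 + (t + η * (1 - t)) • (s.2 - s.1) by rw [hy]; module]

theorem leads_unique {y : Plane} (hy : y ∈ medialAxis O) (hyV : y ∉ V) {C C' : Set Plane}
    (hC : IsCell (Oᶜ \ carrier S) C) (hC' : IsCell (Oᶜ \ carrier S) C') (h : Leads O C y)
    (h' : Leads O C' y) : C = C' := by
  have hyO := medialAxis_subset_compl hy
  obtain ⟨q, hq, hev⟩ := h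
  obtain ⟨q', hq', hev'⟩ := h'
  by_cases hyS : y ∈ carrier S
  · obtain ⟨s, hs, hys⟩ := mem_iUnion₂.1 hyS
    obtain ⟨t, q₀, h0, h1, hyt, -, -, -, hun, -⟩ := St.exists_second T hG hs hys hy hyV
    have e1 := hun q hq (St.ne_of_leads hC hs h0.le h1 hyt hev)
    have e2 := hun q' hq' (St.ne_of_leads hC' hs h0.le h1 hyt hev')
    rw [e1] at hev
    rw [e2] at hev'
    obtain ⟨η, g1, g2⟩ := (hev.and hev').exists
    exact hC.eq_of_mem hC' g1 g2
  · obtain ⟨C₀, hC₀, hyC₀⟩ := exists_isCell (W := Oᶜ \ carrier S) ⟨hyO, hyS⟩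
    have key : ∀ {C : Set Plane} {q : Plane}, IsCell (Oᶜ \ carrier S) C →
        (∀ᶠ η in 𝓝[>] (0 : ℝ), y + η • (q - y) ∈ C) → C = C₀ := by
      intro C q hC hev
      obtain ⟨η, g1, g2⟩ := (hev.and ((tendsto_add_smul y (q - y)).eventually
        ((hC₀.isOpen (isOpen_compl_carrier T)).mem_nhds hyC₀))).exists
      exact hC.eq_of_mem hC₀ g1 g2
    rw [key hC hev, key hC' hev']

/-- Near a point of a spoke, there are no branches on the side opposite to the second contact
point. -/
theorem eventually_cross_nonneg {s : Plane × Plane} (hs : s ∈ S) {y q : Plane} {t : ℝ} (h0 : 0 < t)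
    (h1 : t < 1) (hyt : y = s.1 + t • (s.2 - s.1)) (hy : y ∈ medialAxis O)
    (hs2 : s.2 ∈ foot O y) (hq : q ∈ foot O y) (hne : q ≠ s.2)
    (hun : ∀ q' ∈ foot O y, q' ≠ s.2 → q' = q) {w : Plane} {σ : ℝ}
    (hw : w = σ • (s.2 - y)) (hcw : 0 < cross (q - y) w) :
    ∀ᶠ y' in 𝓝 y, y' ∈ medialAxis O → 0 ≤ cross (y' - y) w := by
  obtain ⟨hp1, hq1⟩ := (St.mem_iff s).1 hs
  have hyO := medialAxis_subset_compl hy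
  obtain ⟨δ, ε, P⟩ := T.exists_localPicture hG hy
  refine Metric.eventually_nhds_iff_ball.2 ⟨ε / 2, half_pos P.ε_pos, fun y' hy' hyM => ?_⟩
  by_contra hcon
  push Not at hcon
  have hyne : y' ≠ y := by
    rintro rfl
    simp [cross] at hcon
  obtain ⟨ρ, ψ, g0, g1, rfl⟩ := exists_polar_ball hy' hyne
  have hψA := (P.conic ρ g0 g1 ψ).1 hyM
  rw [add_sub_cancel_left, cross_smul_left] at hcon
  have hψ : cross (unitVec ψ) w < 0 := by
    by_contra h
    push Not at h
    nlinarith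
  have hwne : s.2 - y ≠ 0 := by
    intro h
    rw [sub_eq_zero] at h
    exact hyO (h ▸ foot_subset _ _ hs2)
  obtain ⟨R, hR, φ, hφ⟩ := exists_polar hwne
  -- the spoke, backwards
  have hφA : φ + π ∈ angles (medialAxis O) y := by
    rw [mem_angles]
    filter_upwards [Ioo_mem_nhdsGT (show 0 < t * R / (1 - t) from
      div_pos (mul_pos h0 hR) (by linarith))] with κ hκ
    have hk0 : 0 < κ := hκ.1
    have h3 : κ * (1 - t) / R < t := by
      rw [div_lt_iff₀ hR]
      have := hκ.2
      rwa [lt_div_iff₀ (by linarith)] at this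
    have h4 : 0 < κ * (1 - t) / R := div_pos (mul_pos hk0 (by linarith)) hR
    have he : y + κ • unitVec (φ + π) = s.1 + (t - κ * (1 - t) / R) • (s.2 - s.1) := by
      have : unitVec φ = ((1 - t) / R) • (s.2 - s.1) := by
        rw [div_eq_inv_mul, mul_smul, show (1 - t) • (s.2 - s.1) = s.2 - y by rw [hyt]; module,
          hφ, smul_smul, inv_mul_cancel₀ hR.ne', one_smul]
      rw [unitVec_add_pi, this, hyt]
      module
    rw [he]
    have hsub := foot_walk_anti hq1 (t := t - κ * (1 - t) / R) (t' := t) (by linarith)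
      (by linarith) h1.le
    rw [← hyt] at hsub
    exact (Corridor.mem_medialAxis T.closed T.nonempty).2
      ⟨walk_notMem T.closed (St.notMem _ hp1) hq1 (by linarith) (by linarith),
        s.2, hsub hs2, q, hsub hq, hne.symm⟩
  have hcφ : cross (unitVec φ) w = 0 := by
    rw [hw, hφ]; simp
  have hfin := T.finite_foot hyO
  -- The only contact points of `y` are `s.2` and `q`, so `ψ` and the backward spoke are all the
  -- branches.
  have hcard : (angles (medialAxis O) y ∩ Ico 0 (2 * π)).ncard ≤ 2 := by
    refine (P.ncard_angles_le hfin).trans ?_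
    have hsub : foot O y ⊆ {s.2, q} := fun x hx => by
      by_cases h : x = s.2
      · exact .inl h
      · exact .inr (hun x hx h)
    exact (ncard_le_ncard hsub (by simp)).trans ((ncard_insert_le _ _).trans
      (by rw [ncard_singleton]))
  obtain ⟨κ, k0, k1⟩ := exists_between (show (0 : ℝ) < min 1 (ε / 2 / (rad O y + 1)) from
    lt_min one_pos (div_pos (half_pos P.ε_pos) (by linarith [rad_nonneg O y])))
  have k2 : κ < 1 := k1.trans_le (min_le_left _ _)
  have k3 : κ * rad O y < ε / 2 := by
    have := k1.trans_le (min_le_right _ _)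
    rw [lt_div_iff₀ (by linarith [rad_nonneg O y])] at this
    linarith
  have hball : ∀ x ∈ foot O y, y + κ • (x - y) ∈ Metric.ball y (ε / 2) := by
    intro x hx
    rw [Metric.mem_ball, dist_comm, dist_walk_left k0.le, (mem_foot.1 hx).1]
    exact k3
  have hball2 := Metric.ball_subset_ball (x := y) (half_le_self P.ε_pos.le)
  have hKb := (convex_ball y (ε / 2)).segment_subset (hball _ hs2) (hball _ hq)
  -- A point of the axis on this segment, between the directions of `s.2` and `q`, would yield a
  -- third branch.
  have hKM : ∀ x ∈ segment ℝ (y + κ • (s.2 - y)) (y + κ • (q - y)), x ∉ medialAxis O := by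
    intro x hx hxM
    have hxb := hKb hx
    obtain ⟨a, b, ha, hb, hab, rfl⟩ := hx
    have hxe : a • (y + κ • (s.2 - y)) + b • (y + κ • (q - y)) =
        y + ((a * κ) • (s.2 - y) + (b * κ) • (q - y)) := by
      rw [show b = 1 - a by linarith]; module
    rw [hxe] at hxM hxb
    have hcx : cross ((a * κ) • (s.2 - y) + (b * κ) • (q - y)) w = b * κ * cross (q - y) w := by
      rw [cross_add_left, cross_smul_left, cross_smul_left, hw]; simp
    have hne0 : (a * κ) • (s.2 - y) + (b * κ) • (q - y) ≠ 0 := by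
      intro h0
      rw [h0] at hcx
      have hz : b = 0 := by
        have : b * κ * cross (q - y) w = 0 := by rw [← hcx]; simp [cross]
        rcases mul_eq_zero.1 this with h | h
        · exact (mul_eq_zero.1 h).resolve_right k0.ne'
        · exact absurd h hcw.ne'
      rw [hz, show a = 1 by linarith] at h0
      simp only [one_mul, zero_mul, zero_smul, add_zero] at h0
      exact smul_ne_zero k0.ne' hwne h0
    obtain ⟨ρ', θ, hρ', hρε, hθ⟩ := exists_polar_ball hxb (by simpa using hne0)
    have hθA : θ ∈ angles (medialAxis O) y := by
      rw [hθ] at hxM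
      exact (P.conic ρ' hρ' hρε θ).1 hxM
    have hθ := add_left_cancel hθ
    have c1 : 0 ≤ cross (unitVec θ) w := by
      rw [hθ, cross_smul_left] at hcx
      have : 0 ≤ b * κ * cross (q - y) w := by positivity
      by_contra h
      push Not at h
      nlinarith
    refine absurd (P.per.three_le hψA hφA hθA ?_ ?_ ?_) (by omega)
    · intro h
      rw [h, unitVec_add_pi, cross_neg_left, hcφ] at hψ
      simp at hψ
    · intro h
      rw [h] at hψ
      linarith
    · intro h
      rw [← h, unitVec_add_pi] at hθ
      have hc2 := congrArg (fun v => cross v w) hθ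
      rw [hcx, cross_smul_left, cross_neg_left, hcφ, neg_zero, mul_zero] at hc2
      have hz : b = 0 := by
        rcases mul_eq_zero.1 hc2 with h | h
        · exact (mul_eq_zero.1 h).resolve_right k0.ne'
        · exact absurd h hcw.ne'
      rw [hz, show a = 1 by linarith, hφ] at hθ
      have : (κ * R + ρ') • unitVec φ = 0 := by
        have h4 : κ • R • unitVec φ = ρ' • -unitVec φ := by simpa using hθ
        rw [add_smul, mul_smul, h4]; simp
      exact smul_ne_zero (by positivity) (unitVec_ne_zero φ) this
  -- The segment would have a single owner, but its ends are owned by `s.2` and `q`.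
  have hown : Owns O δ (y + κ • (q - y)) s.2 := owns_of_isPreconnected P.closed P.nonempty P.sep
    (convex_segment _ _).isPreconnected (fun x hx => P.near x (hball2 (hKb hx))) hKM
    (left_mem_segment _ _ _) (right_mem_segment _ _ _) hs2
    ⟨s.2, mem_foot_walk hs2 k0.le k2.le, by rw [dist_self]; exact P.δ_pos⟩
  obtain ⟨c, hc⟩ := exists_foot_eq_singleton P.closed P.nonempty
    (P.near _ (hball2 (hball _ hq))).1 (hKM _ (right_mem_segment _ _ _))
  exact hne.symm (owns_unique P.sep hc.le hs2 hq hown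
    ⟨q, mem_foot_walk hq k0.le k2.le, by rw [dist_self]; exact P.δ_pos⟩)

/-- At a point of a spoke, `C` contains the half ball on the side of the second contact point `q`.
Nearby points of the axis are either in it or on the line of the spoke, since none is on the other
side; on the line, `q` remains a contact point and leads into the half ball. -/
theorem eventually_leads {y : Plane} (hy : y ∈ medialAxis O) (hyV : y ∉ V) {C : Set Plane}
    (hC : IsCell (Oᶜ \ carrier S) C) (h : Leads O C y) :
    ∀ᶠ y' in 𝓝 y, y' ∈ medialAxis O → Leads O C y' := by
  have hyO := medialAxis_subset_compl hy
  have hCo := hC.isOpen (isOpen_compl_carrier T)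
  by_cases hyS : y ∈ carrier S
  swap
  · have hyC : y ∈ C := by
      obtain ⟨C', hC', hyC'⟩ := exists_isCell (W := Oᶜ \ carrier S) ⟨hyO, hyS⟩
      rwa [St.leads_unique T hG hy hyV hC hC' h
        (leads_of_mem T (hC'.isOpen (isOpen_compl_carrier T)) hyC')]
    filter_upwards [hCo.mem_nhds hyC] with y' hy' _
    exact leads_of_mem T hCo hy'
  obtain ⟨s, hs, hys⟩ := mem_iUnion₂.1 hyS
  obtain ⟨t, q, h0, h1, hyt, hs2, hq, hne, hun, hc⟩ := St.exists_second T hG hs hys hy hyV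
  obtain ⟨hp1, hq1⟩ := (St.mem_iff s).1 hs
  obtain ⟨ε, hε, hb, hl⟩ := St.exists_ball T hs hys hyO hyV
  obtain ⟨σ, hσ1, hσ⟩ := exists_oriented hc
  set w := σ • (s.2 - y) with hw
  have hsub : halfBall y ε w ⊆ C := by
    refine hC.subset_of_isPreconnected (isPreconnected_halfBall _ _ _)
      (IsStar.halfBall_subset hb fun x hx hxS => by
        rw [hw, cross_smul_right, hl x hx hxS, mul_zero]) ?_
    obtain ⟨q', hq', hev⟩ := h
    rw [hun q' hq' (St.ne_of_leads hC hs h0.le h1 hyt hev)] at hev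
    obtain ⟨η, g1, g2⟩ := (hev.and (eventually_mem_halfBall (y := y) (z := y) (Metric.mem_ball_self hε)
      (by simp [cross]) hσ)).exists
    exact ⟨_, g2, g1⟩
  have hwne : s.2 - s.1 ≠ 0 := by
    intro h
    rw [sub_eq_zero] at h
    exact St.notMem _ hp1 (h ▸ foot_subset _ _ hq1)
  have hwe : w = (σ * (1 - t)) • (s.2 - s.1) := by
    rw [hw, mul_smul]; congr 1; rw [hyt]; module
  have hw0 : σ * (1 - t) ≠ 0 := by
    rcases hσ1 with rfl | rfl
    · linarith
    · intro h; linarith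
  -- parameters of nearby points on the line
  have hpar : ∀ᶠ y' in 𝓝 y, ∀ t' : ℝ, y' = s.1 + t' • (s.2 - s.1) → 0 < t' ∧ t' < 1 := by
    have hm : 0 < min t (1 - t) * ‖s.2 - s.1‖ :=
      mul_pos (lt_min h0 (by linarith)) (norm_pos_iff.2 hwne)
    filter_upwards [Metric.ball_mem_nhds y hm] with y' hy' t' ht'
    rw [Metric.mem_ball, dist_eq_norm, ht', hyt, show s.1 + t' • (s.2 - s.1) -
      (s.1 + t • (s.2 - s.1)) = (t' - t) • (s.2 - s.1) by module, norm_smul,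
      Real.norm_eq_abs] at hy'
    have := lt_of_mul_lt_mul_right hy' (norm_nonneg _)
    obtain ⟨g1, g2⟩ := abs_lt.1 this
    constructor
    · linarith [min_le_left t (1 - t)]
    · linarith [min_le_right t (1 - t)]
  filter_upwards [Metric.ball_mem_nhds y hε, hpar, St.eventually_cross_nonneg T hG hs h0 h1 hyt hy
    hs2 hq hne hun hw hσ] with y' hy'b hy'p hy'c hy'M
  rcases (hy'c hy'M).eq_or_lt with h2 | h2
  swap
  · exact leads_of_mem T hCo (hsub ⟨hy'b, h2⟩)
  have hline : cross (y' - y) (s.2 - s.1) = 0 := by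
    rw [hwe, cross_smul_right] at h2
    exact (mul_eq_zero.1 h2.symm).resolve_left hw0
  obtain ⟨c, hc'⟩ := exists_smul_of_cross_eq_zero hwne hline
  have hy't : y' = s.1 + (t + c) • (s.2 - s.1) := by
    rw [add_smul, ← hc', ← add_assoc, ← hyt]; abel
  obtain ⟨g0, g1⟩ := hy'p _ hy't
  -- Towards the centre of the star contact points persist. In the other direction no new ones
  -- appear, and the second one that is required can only be `q`.
  have hqy : q ∈ foot O y' := by
    rcases le_total (t + c) t with hle | hle
    · have := foot_walk_anti hq1 g0.le hle h1.le
      rw [← hyt, ← hy't] at this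
      exact this hq
    · have := foot_walk_anti hq1 h0.le hle g1.le
      rw [← hyt, ← hy't] at this
      obtain ⟨q', hq', hne'⟩ := ((Corridor.mem_medialAxis T.closed T.nonempty).1
        hy'M).2.exists_ne s.2
      rwa [← hun q' (this hq') hne']
  refine ⟨q, hqy, (eventually_mem_halfBall hy'b h2.symm ?_).mono fun η hη => hsub hη⟩
  rw [show q - y' = (q - y) - (y' - y) by abel, cross_sub_left, ← h2, sub_zero]
  exact hσ

end IsBranchStar
end Corridor
end

/-! ### Cells near a branch point contain the beginning of a branch -/

noncomputable section
open Set Filter Topology Real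
namespace Corridor

/-! ### Every cell begins at a branch -/

variable {O : Set Plane} {Vt : Finset Plane} {L : Finset (ℝ × ℝ × ℝ)}
  {V : Finset Plane} {S G : Finset (Plane × Plane)}

theorem eq_of_unitVec_add_eq {ψ s t t' : ℝ} (hs : s = 1 ∨ s = -1) (ht : |t - t'| < 2 * π)
    (h : unitVec (ψ + s * t) = unitVec (ψ + s * t')) : t = t' := by
  obtain ⟨k, hk⟩ := unitVec_eq_iff.1 h
  obtain ⟨g1, g2⟩ := abs_lt.1 ht
  have hp : (0 : ℝ) < 2 * π := by positivity
  have hk' : s * (t - t') = k * (2 * π) := by linarith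
  have hk1 : (k : ℝ) < 1 := by
    by_contra hc
    push Not at hc
    rcases hs with rfl | rfl <;> nlinarith
  have hk2 : (-1 : ℝ) < k := by
    by_contra hc
    push Not at hc
    rcases hs with rfl | rfl <;> nlinarith
  have h0 : k = 0 := by
    have a1 : k < 1 := by exact_mod_cast hk1
    have a2 : -1 < k := by exact_mod_cast hk2
    omega
  rw [h0] at hk'
  rcases hs with rfl | rfl <;> simp at hk' <;> linarith

theorem eq_of_smul_unitVec {c c' θ θ' : ℝ} (hc : 0 < c) (hc' : 0 < c')
    (h : c • unitVec θ = c' • unitVec θ') : unitVec θ = unitVec θ' := by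
  refine (unitVec_eq_of_smul (c := c' / c) (by positivity) ?_).2
  rw [div_eq_inv_mul, mul_smul, ← h, smul_smul, inv_mul_cancel₀ hc.ne', one_smul]

theorem cross_unitVec (θ φ : ℝ) : cross (unitVec θ) (unitVec φ) = sin (φ - θ) := by
  rw [sin_sub]; simp [cross, unitVec]; ring

theorem LocalPicture.ownsDir_of_direction {p : Plane} {δ ε : ℝ} (P : LocalPicture O p δ ε)
    {θ c : ℝ} {q : Plane} (hθ : θ ∉ angles (medialAxis O) p) (hq : q ∈ foot O p) (hc : 0 < c)
    (h : q - p = c • unitVec θ) : OwnsDir O p δ ε θ q := by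
  obtain ⟨ρ, h0, h1⟩ := exists_between (lt_min P.ε_pos hc)
  refine P.ownsDir_of_one hθ h0 (h1.trans_le (min_le_left _ _)) hq
    ⟨q, ?_, by rw [dist_self]; exact P.δ_pos⟩
  have := mem_foot_walk hq (t := ρ / c) (by positivity)
    ((div_le_one hc).2 (h1.trans_le (min_le_right _ _)).le)
  rwa [h, smul_smul, div_mul_cancel₀ _ hc.ne'] at this

/-- A contact point that owns directions arbitrarily close to that of another contact point is also
a contact point of the points in that direction. -/
theorem LocalPicture.mem_foot_of_ownsSide {p : Plane} {δ ε : ℝ} (P : LocalPicture O p δ ε)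
    {s a c ρ : ℝ} {q q' : Plane} (h : OwnsSide O p δ ε s a q) (hq' : q' ∈ foot O p) (hc : 0 < c)
    (h' : q' - p = c • unitVec a) (h0 : 0 < ρ) (h1 : ρ < ε) (h2 : ρ < c) (hqp : q ∈ foot O p) :
    q ∈ foot O (p + ρ • unitVec a) := by
  have hsub := foot_walk_subset hq' (t := ρ / c) (by positivity) ((div_le_one hc).2 h2.le)
  rw [h', smul_smul, div_mul_cancel₀ _ hc.ne'] at hsub
  have hU : IsOpen (⋃ f ∈ foot O (p + ρ • unitVec a), Metric.ball f δ) :=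
    isOpen_biUnion fun _ _ => Metric.isOpen_ball
  have hev := eventually_foot_subset P.closed hU (p := p + ρ • unitVec a)
    fun f hf => mem_iUnion₂.2 ⟨f, hf, Metric.mem_ball_self P.δ_pos⟩
  have ht : Tendsto (fun τ : ℝ => p + ρ • unitVec (a + s * τ)) (𝓝[>] 0)
      (𝓝 (p + ρ • unitVec a)) := by
    have hcont : Continuous fun τ : ℝ => p + ρ • unitVec (a + s * τ) := by
      have := continuous_unitVec
      fun_prop
    have := hcont.tendsto 0
    rw [mul_zero, add_zero] at this
    exact this.mono_left nhdsWithin_le_nhds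
  obtain ⟨τ, ⟨-, g1⟩, g2⟩ := (Eventually.and h (ht.eventually hev)).exists
  obtain ⟨x, hx, hxq⟩ := g1 ρ h0 h1
  obtain ⟨f, hf, hxf⟩ := mem_iUnion₂.1 (g2 hx)
  by_contra hcon
  have hne : f ≠ q := by
    rintro rfl
    exact hcon hf
  have h3 := P.sep f (hsub hf) q hqp hne
  have h4 := dist_triangle_left f q x
  rw [Metric.mem_ball] at hxf
  linarith [P.δ_pos]

namespace IsBranchStar
variable (St : IsBranchStar O V S) (T : Tame O Vt L) (hG : carrier G = closure (medialAxis O))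
include St T hG

theorem exists_contact_of_mem_angles {p : Plane} (hp : p ∈ V) {θ : ℝ}
    (hθ : θ ∈ angles (carrier S) p) :
    ∃ q ∈ foot O p, ∃ c : ℝ, 0 < c ∧ q - p = c • unitVec θ := by
  obtain ⟨s, hs, hps, hq, c, -, h, h'⟩ := St.exists_of_mem_angles (St.notMem p hp) hθ
  exact ⟨s.2, hq, c, h' (St.eq_of_mem_segment T hG hs hp hps), h⟩

omit T hG in
/-- A gap between branches is less than a full turn. -/
theorem gap_lt {p : Plane} (hp : p ∈ V) {δ ε : ℝ} (P : LocalPicture O p δ ε) {s x y ψ : ℝ}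
    (hs : s = 1 ∨ s = -1)
    (hgap : ∀ t, -x < t → t < y → ψ + s * t ∉ angles (medialAxis O) p) : x + y < 2 * π := by
  by_contra hcon
  push Not at hcon
  have hp2 : (0 : ℝ) < 2 * π := by positivity
  have h3 := St.three_le p hp
  rw [← St.ncard_eq p hp] at h3
  -- Among at least three branches, one is not congruent to the beginning of the gap; a
  -- representative of it would be inside a gap of a full turn.
  obtain ⟨θ, ⟨hθ, hI⟩, hne⟩ : ∃ θ ∈ angles (medialAxis O) p ∩ Ico 0 (2 * π),
      unitVec θ ≠ unitVec (ψ + s * (-x)) := by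
    by_contra hall
    push Not at hall
    have hsub : (angles (medialAxis O) p ∩ Ico 0 (2 * π)).ncard ≤ 1 := by
      rw [Set.ncard_le_one_iff P.per.fin]
      intro a b ha hb
      exact eq_of_unitVec_eq ha.2 hb.2 ((hall a ha).trans (hall b hb).symm)
    omega
  set t := toIocMod hp2 (-x) (s * (θ - ψ)) with htd
  have ht := toIocMod_mem_Ioc hp2 (-x) (s * (θ - ψ))
  rw [← htd] at ht
  have he := toIocMod_add_toIocDiv_zsmul hp2 (-x) (s * (θ - ψ))
  rw [← htd, zsmul_eq_mul] at he
  have hu : ∃ k : ℤ, ψ + s * t = θ + k * (2 * π) := by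
    rcases hs with rfl | rfl
    · exact ⟨-toIocDiv hp2 (-x) (1 * (θ - ψ)), by push_cast; linarith⟩
    · exact ⟨toIocDiv hp2 (-x) (-1 * (θ - ψ)), by linarith⟩
  obtain ⟨k, hk⟩ := hu
  rcases ht.2.lt_or_eq with h | h
  · refine hgap t ht.1 (by linarith) ?_
    rw [hk, P.per.add_int]
    exact hθ
  · apply hne
    rw [← unitVec_eq_iff.2 ⟨k, rfl⟩, ← hk, h]
    rcases hs with rfl | rfl
    · exact unitVec_eq_iff.2 ⟨1, by push_cast; ring⟩
    · exact unitVec_eq_iff.2 ⟨-1, by push_cast; ring⟩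

/-- The variable `t` measures the angle from `ψ`, and the sign `s` turns the owner `q` to the
positive side. The direction of `q` carries a spoke, so it is not inside the gap. It is not beyond
the end `y` either: this end would not be a branch, and a spoke there would end in a contact point
that owns its direction, which `q` does. So `q` is in the direction of the end `y`. At the other end
a branch must leave, as a mere spoke would lead to a second owner. If that branch runs along a
spoke, `q` is a contact point of its points, and it lies on the side of `C`. -/
theorem exists_leading_angle_of_gap {p : Plane} (hp : p ∈ V) {δ ε : ℝ} (P : LocalPicture O p δ ε)
    {e : ℝ} (he0 : 0 < e) (heε : e ≤ ε) (hcS : ConicAt (carrier S) p e)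
    (hVe : ∀ x ∈ Metric.ball p e, x ∈ V → x = p) {C : Set Plane}
    (hC : IsCell (Oᶜ \ carrier S) C) {s x y z ψ ρ₀ R : ℝ} {q : Plane} (hs : s = 1 ∨ s = -1)
    (hx : 0 < x) (hy : 0 < y)
    (hgap : ∀ t, -x < t → t < y → ψ + s * t ∉ angles (medialAxis O) p)
    (hgap' : ∀ t, -x < t → t < y → ψ + s * t ∉ angles (carrier S) p)
    (hx' : ψ + s * (-x) ∈ angles (medialAxis O) p ∪ angles (carrier S) p)
    (hy' : ψ + s * y ∈ angles (medialAxis O) p ∪ angles (carrier S) p)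
    (hown : OwnsDir O p δ ε ψ q) (hR : 0 < R) (hq : q - p = R • unitVec (ψ + s * z)) (hz0 : 0 < z)
    (hzπ : z < π)
    (hbet : ∀ t, 0 < t → t < z → ψ + s * t ∉ angles (medialAxis O) p ∧
      OwnsDir O p δ ε (ψ + s * t) q)
    (h0 : 0 < ρ₀) (h1 : ρ₀ < e) (hρC : p + ρ₀ • unitVec ψ ∈ C) :
    ∃ a ∈ angles (medialAxis O) p, ∀ᶠ ρ in 𝓝[>] (0 : ℝ), Leads O C (p + ρ • unitVec a) := by
  have hπ := pi_pos
  have hpO := St.notMem p hp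
  have hxy := St.gap_lt hp P hs hgap
  have hb : Metric.ball p e ⊆ Oᶜ := fun x hx => (P.near x (Metric.ball_subset_ball heε hx)).1
  have hCo := hC.isOpen (isOpen_compl_carrier T)
  have hcont : Continuous fun t : ℝ => ψ + s * t := by fun_prop
  have hψ0 : ψ + s * 0 = ψ := by ring
  -- the contact point lies in the direction of one end of the gap
  have hzy : z = y := by
    have hzB := St.mem_angles_of_foot hp hown.1 hR hq
    have hyz : y ≤ z := by
      by_contra hcon
      exact hgap' z (by linarith) (not_le.1 hcon) hzB
    refine (hyz.eq_or_lt).elim Eq.symm fun hlt => ?_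
    obtain ⟨h2, h3⟩ := hbet y hy hlt
    obtain ⟨q', hq', c, hc, h4⟩ := St.exists_contact_of_mem_angles T hG hp (hy'.resolve_left h2)
    have h5 := P.ownsDir_unique h2 h3 (P.ownsDir_of_direction h2 hq' hc h4)
    rw [← h5, hq] at h4
    exact eq_of_unitVec_add_eq hs (by rw [abs_lt]; constructor <;> linarith)
      (eq_of_smul_unitVec hR hc h4)
  subst hzy
  have hne : ∀ {q' : Plane} {c : ℝ}, 0 < c → q' - p = c • unitVec (ψ + s * (-x)) → q' ≠ q := by
    rintro q' c hc h rfl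
    rw [hq] at h
    have := eq_of_unitVec_add_eq hs (by rw [abs_lt]; constructor <;> linarith)
      (eq_of_smul_unitVec hR hc h)
    linarith
  -- a branch leaves at the other end
  have hxA : ψ + s * (-x) ∈ angles (medialAxis O) p := by
    by_contra hcon
    obtain ⟨q', hq', c, hc, h4⟩ := St.exists_contact_of_mem_angles T hG hp (hx'.resolve_left hcon)
    have h5 := P.ownsDir_interval (J := (fun t => ψ + s * t) '' Ico (-x) z)
      (isPreconnected_Ico.image _ hcont.continuousOn) (by
        rintro _ ⟨t, ht, rfl⟩
        rcases ht.1.eq_or_lt with rfl | h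
        exacts [hcon, hgap t h ht.2])
      (θ := ψ) (ψ := ψ + s * (-x)) ⟨0, ⟨by linarith, by linarith⟩, hψ0⟩
      ⟨-x, ⟨le_rfl, by linarith⟩, rfl⟩ hown
    exact hne hc h4 (P.ownsDir_unique hcon (P.ownsDir_of_direction hcon hq' hc h4) h5)
  have hsector : sector p e ((fun t => ψ + s * t) '' Ioo (-x) z) ⊆ C := by
    refine hC.subset_of_isPreconnected (isPreconnected_sector _ _
      (isPreconnected_Ioo.image _ hcont.continuousOn))
      (IsStar.sector_subset_compl hcS hb ?_)
      ⟨_, mem_sector h0 h1 ⟨0, ⟨by linarith, by linarith⟩, hψ0⟩, hρC⟩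
    rintro _ ⟨t, ht, rfl⟩
    exact hgap' t ht.1 ht.2
  refine ⟨_, hxA, ?_⟩
  by_cases hxB : ψ + s * (-x) ∈ angles (carrier S) p
  swap
  · have hsub : sector p e ((fun t => ψ + s * t) '' Ico (-x) z) ⊆ C := by
      refine hC.subset_of_isPreconnected (isPreconnected_sector _ _
        (isPreconnected_Ico.image _ hcont.continuousOn))
        (IsStar.sector_subset_compl hcS hb ?_)
        ⟨_, mem_sector h0 h1 ⟨0, ⟨by linarith, by linarith⟩, hψ0⟩, hρC⟩
      rintro _ ⟨t, ht, rfl⟩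
      rcases ht.1.eq_or_lt with rfl | h
      exacts [hxB, hgap' t h ht.2]
    filter_upwards [Ioo_mem_nhdsGT he0] with ρ hρ
    exact leads_of_mem T hCo (hsub (mem_sector hρ.1 hρ.2 ⟨-x, ⟨le_rfl, by linarith⟩, rfl⟩))
  obtain ⟨q', hq', c, hc, hq'c⟩ := St.exists_contact_of_mem_angles T hG hp hxB
  have hownI : ∀ t ∈ Ioo (-x) z, OwnsDir O p δ ε (ψ + s * t) q := fun t ht =>
    P.ownsDir_interval (J := (fun t => ψ + s * t) '' Ioo (-x) z)
      (isPreconnected_Ioo.image _ hcont.continuousOn) (by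
        rintro _ ⟨t, ht, rfl⟩
        exact hgap t ht.1 ht.2)
      ⟨0, ⟨by linarith, by linarith⟩, hψ0⟩ ⟨t, ht, rfl⟩ hown
  have hside : OwnsSide O p δ ε s (ψ + s * (-x)) q := by
    filter_upwards [Ioo_mem_nhdsGT (show (0 : ℝ) < x + z by linarith)] with τ hτ
    have := hownI (-x + τ) ⟨by linarith [hτ.1], by linarith [hτ.2]⟩
    rwa [mul_add, ← add_assoc] at this
  -- At an angle of `π`, `q` would be a second contact point on the line of the spoke to `q'`;
  -- beyond `π`, a direction inside the gap would be opposite to its owner.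
  have hxz : x + z < π := by
    by_contra hcon
    push Not at hcon
    rcases hcon.eq_or_lt with h | h
    · obtain ⟨ρ, g0, g1⟩ := exists_between (lt_min P.ε_pos hc)
      have g2 := g1.trans_le (min_le_right _ _)
      have h3 := P.mem_foot_of_ownsSide hside hq' hc hq'c g0 (g1.trans_le (min_le_left _ _)) g2
        hown.1
      have he : p + ρ • unitVec (ψ + s * (-x)) = p + (ρ / c) • (q' - p) := by
        rw [hq'c, smul_smul, div_mul_cancel₀ _ hc.ne']
      rw [he] at h3
      refine cross_ne_zero_of_second_contact (rad_pos T.closed T.nonempty hpO) hq'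
        (div_pos g0 hc) ((div_lt_one hc).2 g2) h3 (hne hc hq'c).symm ?_
      have hqq : q - p = -(R • unitVec (ψ + s * (-x))) := by
        rw [hq, ← smul_neg, ← unitVec_add_pi]
        congr 1
        rcases hs with rfl | rfl
        · exact unitVec_eq_iff.2 ⟨0, by push_cast; linarith⟩
        · exact unitVec_eq_iff.2 ⟨-1, by push_cast; linarith⟩
      rw [← sub_sub, hqq, hq'c]
      simp
    · refine P.not_opposite (hgap (z - π) (by linarith) (by linarith))
        (hownI (z - π) ⟨by linarith, by linarith⟩) hR ?_
      rw [hq, ← smul_neg, ← unitVec_add_pi]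
      congr 1
      rcases hs with rfl | rfl
      · exact unitVec_eq_iff.2 ⟨0, by push_cast; ring⟩
      · exact unitVec_eq_iff.2 ⟨-1, by push_cast; ring⟩
  filter_upwards [Ioo_mem_nhdsGT (lt_min he0 hc)] with ρ hρ
  have hρ0 : 0 < ρ := hρ.1
  have hρe : ρ < e := hρ.2.trans_le (min_le_left _ _)
  have hρc : ρ < c := hρ.2.trans_le (min_le_right _ _)
  set a := ψ + s * (-x) with ha
  have hfoot := P.mem_foot_of_ownsSide hside hq' hc hq'c hρ0 (hρe.trans_le heε) hρc hown.1
  have hyV : p + ρ • unitVec a ∉ V := fun h =>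
    add_unitVec_ne hρ0 (hVe _ (dist_add_unitVec_lt hρ0.le hρe) h)
  have hyO : p + ρ • unitVec a ∉ O := hb (dist_add_unitVec_lt hρ0.le hρe)
  have hyseg : p + ρ • unitVec a ∈ segment ℝ p q' := by
    have h := add_smul_mem_segment (p := p) (v := unitVec a) hρ0.le hc hρc.le
    rwa [← hq'c, add_sub_cancel] at h
  obtain ⟨ε', hε', hb', hl'⟩ := St.exists_ball T (s := (p, q')) ((St.mem_iff _).2 ⟨hp, hq'⟩)
    hyseg hyO hyV
  dsimp only at hl'
  have hq'y : q' - (p + ρ • unitVec a) = (c - ρ) • unitVec a := by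
    rw [← sub_sub, hq'c]; module
  -- Oriented so that the side of the gap is positive: the direction `a + s * t` has determinant
  -- `sin t` with `w`.
  set w : Plane := (-s) • unitVec a with hw
  have hcr : ∀ t : ℝ, cross (unitVec (a + s * t)) w = sin t := by
    intro t
    rw [hw, cross_smul_right, cross_unitVec, show a - (a + s * t) = -(s * t) by ring, sin_neg]
    rcases hs with rfl | rfl
    · rw [one_mul]; ring
    · rw [neg_one_mul, sin_neg]; ring
  have hca : cross (unitVec a) w = 0 := by rw [hw]; simp
  have hhalf : halfBall (p + ρ • unitVec a) ε' w ⊆ Oᶜ \ carrier S := by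
    refine IsStar.halfBall_subset hb' fun v hv hvS => ?_
    have := hl' v hv hvS
    rw [hq'y, cross_smul_right] at this
    rw [hw, cross_smul_right, (mul_eq_zero.1 this).resolve_left (by linarith), mul_zero]
  have hhC : halfBall (p + ρ • unitVec a) ε' w ⊆ C := by
    refine hC.subset_of_isPreconnected (isPreconnected_halfBall _ _ _) hhalf ?_
    have ht : Tendsto (fun τ : ℝ => p + ρ • unitVec (a + s * τ)) (𝓝[>] 0)
        (𝓝 (p + ρ • unitVec a)) := by
      have hcont : Continuous fun τ : ℝ => p + ρ • unitVec (a + s * τ) := by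
        have := continuous_unitVec
        fun_prop
      have := hcont.tendsto 0
      rw [mul_zero, add_zero] at this
      exact this.mono_left nhdsWithin_le_nhds
    obtain ⟨τ, g1, g2⟩ := ((ht.eventually (Metric.ball_mem_nhds _ hε')).and
      (Ioo_mem_nhdsGT (show (0 : ℝ) < x + z by linarith))).exists
    refine ⟨p + ρ • unitVec (a + s * τ), ⟨g1, ?_⟩, hsector (mem_sector hρ0 hρe
      ⟨-x + τ, ⟨by linarith [g2.1], by linarith [g2.2]⟩, ?_⟩)⟩
    · rw [add_sub_add_left_eq_sub, ← smul_sub, cross_smul_left, cross_sub_left, hcr, hca, sub_zero]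
      exact mul_pos hρ0 (sin_pos_of_pos_of_lt_pi g2.1 (by linarith [g2.2]))
    · rw [ha]; ring
  refine ⟨q, hfoot, (eventually_mem_halfBall (y := p + ρ • unitVec a) (z := p + ρ • unitVec a)
    (Metric.mem_ball_self hε') (by simp [cross]) ?_).mono fun η hη => hhC hη⟩
  rw [← sub_sub, hq, show ψ + s * z = a + s * (x + z) by rw [ha]; ring, cross_sub_left,
    cross_smul_left, cross_smul_left, hca, mul_zero, sub_zero, hcr]
  exact mul_pos hR (sin_pos_of_pos_of_lt_pi (by linarith) hxz)

/-- A point of `C` near `p` can be rotated slightly off the branches, as `C` is open. The gap around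
its direction is reflected if the owner is on the negative side; the owner is not in the direction
itself, which carries no spoke. -/
theorem exists_leading_angle {p : Plane} (hp : p ∈ V) {C : Set Plane}
    (hC : IsCell (Oᶜ \ carrier S) C) (hpC : p ∈ closure C) :
    ∃ a ∈ angles (medialAxis O) p, ∀ᶠ ρ in 𝓝[>] (0 : ℝ), Leads O C (p + ρ • unitVec a) := by
  have hpM := St.mem_medialAxis T hp
  obtain ⟨δ, ε, P⟩ := T.exists_localPicture hG hpM
  obtain ⟨ε₁, hε₁, hcS⟩ := (exists_conicAt_biUnion S id p).1
  obtain ⟨ε₂, hε₂, hV⟩ := Metric.isOpen_iff.1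
    ((V.finite_toSet.sdiff (t := {p})).isClosed.isOpen_compl) p (by simp)
  set e := min ε (min ε₁ ε₂)
  have he0 : 0 < e := lt_min P.ε_pos (lt_min hε₁ hε₂)
  have hcS : ConicAt (carrier S) p e := ConicAt.mono hcS ((min_le_right _ _).trans (min_le_left _ _))
  have hVe : ∀ x ∈ Metric.ball p e, x ∈ V → x = p := by
    intro x hx hxV
    by_contra hne
    exact hV (Metric.ball_subset_ball ((min_le_right _ _).trans (min_le_right _ _)) hx)
      ⟨hxV, hne⟩
  have hCo := hC.isOpen (isOpen_compl_carrier T)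
  obtain ⟨x, hx, hxC⟩ := mem_closure_iff.1 hpC _ Metric.isOpen_ball
    (Metric.mem_ball_self (half_pos he0))
  obtain ⟨ρ, ψ₀, h0, h1, rfl⟩ := exists_polar_ball hx (by
    rintro rfl
    exact (hC.subset hxC).2 (St.mem_carrier_self T hp))
  have ht : Tendsto (fun τ : ℝ => p + ρ • unitVec (ψ₀ + 1 * τ)) (𝓝[>] 0)
      (𝓝 (p + ρ • unitVec ψ₀)) := by
    have hcont : Continuous fun τ : ℝ => p + ρ • unitVec (ψ₀ + 1 * τ) := by
      have := continuous_unitVec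
      fun_prop
    have := hcont.tendsto 0
    rw [mul_zero, add_zero] at this
    exact this.mono_left nhdsWithin_le_nhds
  obtain ⟨τ, g1, g2⟩ := ((ht.eventually (hCo.mem_nhds hxC)).and
    (P.per.eventually_notMem ψ₀ (.inl rfl))).exists
  set ψ := ψ₀ + 1 * τ
  have hψB : ψ ∉ angles (carrier S) p := fun h => (hC.subset g1).2 ((hcS ρ h0 h1 ψ).2 h)
  have hD := P.per.union (perFin_angles_carrier S p)
  have hne : (angles (medialAxis O) p ∪ angles (carrier S) p).Nonempty :=
    (St.angles_nonempty T hp).mono subset_union_right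
  have hψD : ψ ∉ angles (medialAxis O) p ∪ angles (carrier S) p := fun h => h.elim g2 hψB
  obtain ⟨b, hb, hψb, -, hgb⟩ := hD.exists_succ hne ψ
  obtain ⟨a, ha, haψ, -, hga⟩ := hD.exists_pred hne ψ
  have hgap : ∀ θ, a < θ → θ < b → θ ∉ angles (medialAxis O) p ∪ angles (carrier S) p := by
    intro θ h2 h3
    rcases lt_trichotomy θ ψ with h | h | h
    exacts [hga θ h2 h, h ▸ hψD, hgb θ h h3]
  obtain ⟨q, hq⟩ := P.exists_ownsDir g2
  obtain ⟨φ, R, hR, hφ, hlt, hbet⟩ := P.exists_angle_of_owner g2 hq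
  obtain ⟨l1, l2⟩ := abs_lt.1 hlt
  have hφψ : φ ≠ ψ := by
    rintro rfl
    exact hψB (St.mem_angles_of_foot hp hq.1 hR hφ)
  rcases hφψ.lt_or_gt with h | h
  · refine St.exists_leading_angle_of_gap T hG hp P he0 (min_le_left _ _) hcS hVe hC (s := -1)
      (x := b - ψ) (y := ψ - a) (z := ψ - φ) (ψ := ψ) (.inr rfl) (by linarith) (by linarith) ?_ ?_
      (by rwa [show ψ + -1 * -(b - ψ) = b by ring]) (by rwa [show ψ + -1 * (ψ - a) = a by ring]) hq
      hR (by rwa [show ψ + -1 * (ψ - φ) = φ by ring]) (by linarith) (by linarith) ?_ h0 h1 g1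
    · exact fun t k1 k2 hA => hgap _ (by linarith) (by linarith) (.inl hA)
    · exact fun t k1 k2 hA => hgap _ (by linarith) (by linarith) (.inr hA)
    · exact fun t k1 k2 => hbet _ (.inr ⟨by linarith, by linarith⟩)
  · refine St.exists_leading_angle_of_gap T hG hp P he0 (min_le_left _ _) hcS hVe hC (s := 1)
      (x := ψ - a) (y := b - ψ) (z := φ - ψ) (ψ := ψ) (.inl rfl) (by linarith) (by linarith) ?_ ?_
      (by rwa [show ψ + 1 * -(ψ - a) = a by ring]) (by rwa [show ψ + 1 * (b - ψ) = b by ring]) hq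
      hR (by rwa [show ψ + 1 * (φ - ψ) = φ by ring]) (by linarith) (by linarith) ?_ h0 h1 g1
    · exact fun t k1 k2 hA => hgap _ (by linarith) (by linarith) (.inl hA)
    · exact fun t k1 k2 hA => hgap _ (by linarith) (by linarith) (.inr hA)
    · exact fun t k1 k2 => hbet _ (.inl ⟨by linarith, by linarith⟩)

end IsBranchStar
end Corridor
end

/-! ### Degree counts and parity -/

noncomputable section
open Set Filter Topology Real
namespace Corridor

/-! ### Counting -/

variable {H : Finset (Plane × Plane)}

open Classical in
/-- The endpoints of the segments. -/
def endpoints (H : Finset (Plane × Plane)) : Finset Plane := H.image Prod.fst ∪ H.image Prod.snd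

theorem fst_mem_endpoints {s : Plane × Plane} (hs : s ∈ H) : s.1 ∈ endpoints H :=
  Finset.mem_union_left _ (Finset.mem_image_of_mem _ hs)

theorem snd_mem_endpoints {s : Plane × Plane} (hs : s ∈ H) : s.2 ∈ endpoints H :=
  Finset.mem_union_right _ (Finset.mem_image_of_mem _ hs)

theorem mem_endpoints_iff {p : Plane} : p ∈ endpoints H ↔ degree H p ≠ 0 := by
  classical
  unfold endpoints degree
  rw [Finset.card_ne_zero]
  constructor
  · intro h
    rcases Finset.mem_union.1 h with h | h <;> obtain ⟨s, hs, rfl⟩ := Finset.mem_image.1 h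
    · exact ⟨s, Finset.mem_filter.2 ⟨hs, .inl rfl⟩⟩
    · exact ⟨s, Finset.mem_filter.2 ⟨hs, .inr rfl⟩⟩
  · rintro ⟨s, hs⟩
    obtain ⟨hs', rfl | rfl⟩ := Finset.mem_filter.1 hs
    exacts [fst_mem_endpoints hs', snd_mem_endpoints hs']

theorem mem_carrier_of_mem_endpoints {p : Plane} (hp : p ∈ endpoints H) : p ∈ carrier H := by
  classical
  rcases Finset.mem_union.1 hp with h | h <;> obtain ⟨s, hs, rfl⟩ := Finset.mem_image.1 h
  · exact mem_iUnion₂.2 ⟨s, hs, left_mem_segment _ _ _⟩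
  · exact mem_iUnion₂.2 ⟨s, hs, right_mem_segment _ _ _⟩

theorem sum_degree (hH : IsSegmentComplex H) {K : Finset (Plane × Plane)} (hK : K ⊆ H) :
    ∑ p ∈ endpoints H, degree K p = 2 * K.card := by
  classical
  unfold degree
  simp only [Finset.card_filter]
  rw [Finset.sum_comm, mul_comm, ← smul_eq_mul, ← Finset.sum_const]
  refine Finset.sum_congr rfl fun s hs => ?_
  rw [← Finset.card_filter, ← Finset.card_pair (hH.1 s (hK hs))]
  congr 1
  ext p
  simp only [Finset.mem_filter, Finset.mem_insert, Finset.mem_singleton, and_iff_right_iff_imp]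
  rintro (rfl | rfl)
  exacts [fst_mem_endpoints (hK hs), snd_mem_endpoints (hK hs)]

/-- Few branch points, with few branches, in a graph with few independent cycles. -/
theorem card_le_of_cycles {m : ℕ} (hH : IsSegmentComplex H) (hdeg : ∀ p, degree H p ≠ 1)
    (hm : H.card + 1 ≤ (endpoints H).card + m) {V : Finset Plane}
    (hV : ∀ p, p ∈ V ↔ 3 ≤ degree H p) :
    V.card + 2 ≤ 2 * m ∧ ∑ p ∈ V, degree H p + 6 ≤ 6 * m := by
  classical
  have hsub : V ⊆ endpoints H := fun p hp => mem_endpoints_iff.2 (by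
    have := (hV p).1 hp
    omega)
  have h1 := sum_degree hH subset_rfl
  rw [← Finset.sum_sdiff hsub] at h1
  have h2 : ∑ p ∈ endpoints H \ V, degree H p = (endpoints H \ V).card * 2 := by
    rw [Finset.sum_const_nat]
    intro p hp
    obtain ⟨hp, hpV⟩ := Finset.mem_sdiff.1 hp
    have h3 := mem_endpoints_iff.1 hp
    have h4 := hdeg p
    have h5 := mt (hV p).2 hpV
    omega
  have h3 : V.card * 3 ≤ ∑ p ∈ V, degree H p := by
    rw [← smul_eq_mul, ← Finset.sum_const]
    exact Finset.sum_le_sum fun p hp => (hV p).1 hp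
  -- With `v` branch points, `e` endpoints and degree sum `D` over `V`: `D + 2(e - v) = 2|H| ≤ 2(e +
  -- m - 1)` and `3v ≤ D`, hence `v ≤ 2m - 2` and `D ≤ 6m - 6`.
  have h4 := Finset.card_sdiff_add_card_eq_card hsub
  omega

variable {O : Set Plane} {Vt : Finset Plane} {L : Finset (ℝ × ℝ × ℝ)}
  {V : Finset Plane} {S G : Finset (Plane × Plane)}

namespace IsBranchStar
variable (St : IsBranchStar O V S) (T : Tame O Vt L) (hG : carrier G = closure (medialAxis O))
  (hH : IsSegmentComplex H) (hHM : carrier H ⊆ medialAxis O)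
  (hV : ∀ p, p ∈ V ↔ 3 ≤ degree H p)
include St T hG hH hHM hV

/-- Points of `V` can only be endpoints of the segment, so it remains connected without them, and
the cell led into is unique and locally constant. -/
theorem exists_leads_segment {s : Plane × Plane} (hs : s ∈ H) :
    ∃ C, IsCell (Oᶜ \ carrier S) C ∧ ∀ y ∈ segment ℝ s.1 s.2, y ∉ V → Leads O C y := by
  have hopen : openSegment ℝ s.1 s.2 ⊆ segment ℝ s.1 s.2 \ V := by
    intro y hy
    refine ⟨openSegment_subset_segment ℝ _ _ hy, fun hyV => ?_⟩
    have hd : degree H y ≠ 0 := by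
      have := (hV y).1 hyV
      omega
    rcases hH.eq_endpoint hd hs (openSegment_subset_segment ℝ _ _ hy) with rfl | rfl
    · exact hH.1 s hs (left_mem_openSegment_iff.1 hy)
    · exact hH.1 s hs (right_mem_openSegment_iff.1 hy)
  have hX : IsPreconnected (segment ℝ s.1 s.2 \ V) := by
    refine (convex_openSegment s.1 s.2).isPreconnected.subset_closure hopen ?_
    rw [closure_openSegment]
    exact sdiff_subset
  have hM : ∀ y ∈ segment ℝ s.1 s.2 \ V, y ∈ medialAxis O ∧ y ∉ V := fun y hy =>
    ⟨hHM (mem_iUnion₂.2 ⟨s, hs, hy.1⟩), hy.2⟩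
  have hmid := hopen ⟨1 / 2, 1 / 2, by norm_num, by norm_num, by norm_num, rfl⟩
  set y₀ := (1 / 2 : ℝ) • s.1 + (1 / 2 : ℝ) • s.2
  obtain ⟨C, hC, hCy⟩ := St.exists_leads T hG (hM _ hmid).1 (hM _ hmid).2
  refine ⟨C, hC, fun y hy hyV => ?_⟩
  refine (hX.induction₂ (fun x y => ∀ C, IsCell (Oᶜ \ carrier S) C → (Leads O C x ↔ Leads O C y))
    ?_ ?_ ?_ hmid ⟨hy, hyV⟩ C hC).1 hCy
  · intro x hx
    obtain ⟨C₀, hC₀, hx₀⟩ := St.exists_leads T hG (hM x hx).1 (hM x hx).2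
    filter_upwards [nhdsWithin_le_nhds (St.eventually_leads T hG (hM x hx).1 (hM x hx).2 hC₀ hx₀),
      self_mem_nhdsWithin] with y h1 h2 C hC
    have h1 := h1 (hM y h2).1
    constructor
    · intro h
      rwa [St.leads_unique T hG (hM x hx).1 (hM x hx).2 hC hC₀ h hx₀]
    · intro h
      rwa [St.leads_unique T hG (hM y h2).1 (hM y h2).2 hC hC₀ h h1]
  · exact fun x y z _ _ _ h1 h2 C hC => (h1 C hC).trans (h2 C hC)
  · exact fun x y _ _ h C hC => (h C hC).symm

-- A branch that leads into `C` leaves some point of `V`; by `hang` it belongs to `H` and was not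
-- pruned.
omit hHM in
theorem exists_half_edge (hF : IsPreconnected Oᶜ)
    (hang : ∀ p ∈ V, angles (carrier H) p = angles (medialAxis O) p) (hne : V.Nonempty)
    {C : Set Plane} (hC : IsCell (Oᶜ \ carrier S) C) : ∃ p ∈ V, ∃ s ∈ H, (p = s.1 ∨ p = s.2) ∧
      ∃ y ∈ segment ℝ s.1 s.2, y ∉ V ∧ Leads O C y := by
  obtain ⟨p, hp, hpC⟩ := St.exists_mem_closure T hF hne hC
  obtain ⟨a, ha, hev⟩ := St.exists_leading_angle T hG hp hC hpC
  rw [← hang p hp] at ha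
  obtain ⟨s, hs, hps, hnear⟩ := exists_segment_of_mem_angles ha
  obtain ⟨ε₂, hε₂, hVe⟩ := Metric.isOpen_iff.1
    ((V.finite_toSet.sdiff (t := {p})).isClosed.isOpen_compl) p (by simp)
  obtain ⟨η, hη, hη'⟩ := mem_nhdsGT_iff_exists_Ioo_subset.1 hev
  have hη : 0 < η := hη
  obtain ⟨ρ, h0, h1, hρ⟩ := hnear (min η ε₂) (lt_min hη hε₂)
  refine ⟨p, hp, s, hs, hH.eq_endpoint ?_ hs hps, _, hρ, fun hyV => ?_,
    hη' ⟨h0, h1.trans_le (min_le_left _ _)⟩⟩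
  · have := (hV p).1 hp
    omega
  · exact hVe (dist_add_unitVec_lt h0.le (h1.trans_le (min_le_right _ _)))
      ⟨hyV, add_unitVec_ne h0⟩

/-- Every cell begins at two or more branches. -/
theorem two_mul_ncard_cells_le (hF : IsPreconnected Oᶜ)
    (hang : ∀ p ∈ V, angles (carrier H) p = angles (medialAxis O) p) (hne : V.Nonempty)
    (hdeg : ∀ p, degree H p ≠ 1) :
    2 * {C | IsCell (Oᶜ \ carrier S) C}.ncard ≤ ∑ p ∈ V, degree H p := by
  classical
  have hfin := (St.finite_cells T hF hne).1
  have h : ∀ s : Plane × Plane, ∃ C, s ∈ H → IsCell (Oᶜ \ carrier S) C ∧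
      ∀ y ∈ segment ℝ s.1 s.2, y ∉ V → Leads O C y := by
    intro s
    by_cases hs : s ∈ H
    · obtain ⟨C, hC⟩ := St.exists_leads_segment T hG hH hHM hV hs
      exact ⟨C, fun _ => hC⟩
    · exact ⟨∅, fun h => absurd h hs⟩
  choose κ hκ using h
  have hM : ∀ {s : Plane × Plane}, s ∈ H → segment ℝ s.1 s.2 ⊆ medialAxis O := fun hs =>
    (subset_biUnion_of_mem (u := fun s : Plane × Plane => segment ℝ s.1 s.2) hs).trans hHM
  set F : Set Plane → Finset (Plane × Plane) := fun C => H.filter fun s => κ s = C with hFd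
  have hsub : V ⊆ endpoints H := fun p hp => mem_endpoints_iff.2 (by
    have := (hV p).1 hp
    omega)
  -- Off `V` vertices of `H` have degree two. Both segments lead into the cell of the common vertex,
  -- so the degree in the subgraph of `C` is 0 or 2.
  have hdegF : ∀ C, ∀ p ∈ endpoints H \ V, Even (degree (F C) p) := by
    intro C p hp
    obtain ⟨hp, hpV⟩ := Finset.mem_sdiff.1 hp
    by_cases h0 : degree (F C) p = 0
    · rw [h0]; exact Even.zero
    have heq : degree (F C) p = degree H p := by
      obtain ⟨s, hs⟩ := Finset.card_ne_zero.1 h0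
      obtain ⟨hs, hps⟩ := Finset.mem_filter.1 hs
      obtain ⟨hsH, hsC⟩ := Finset.mem_filter.1 hs
      have hps : p ∈ segment ℝ s.1 s.2 := by
        rcases hps with rfl | rfl
        exacts [left_mem_segment _ _ _, right_mem_segment _ _ _]
      refine le_antisymm (degree_mono (Finset.filter_subset _ _) p) (Finset.card_le_card ?_)
      intro t ht
      obtain ⟨htH, hpt⟩ := Finset.mem_filter.1 ht
      refine Finset.mem_filter.2 ⟨Finset.mem_filter.2 ⟨htH, ?_⟩, hpt⟩
      have hpt : p ∈ segment ℝ t.1 t.2 := by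
        rcases hpt with rfl | rfl
        exacts [left_mem_segment _ _ _, right_mem_segment _ _ _]
      rw [← hsC]
      exact St.leads_unique T hG (hM hsH hps) hpV (hκ t htH).1 (hκ s hsH).1
        ((hκ t htH).2 p hpt hpV) ((hκ s hsH).2 p hps hpV)
    have h3 := mem_endpoints_iff.1 hp
    have h4 := hdeg p
    have h5 := mt (hV p).2 hpV
    rw [heq, show degree H p = 2 by omega]
    exact even_two
  -- The total degree in the subgraph of `C` is even, hence so is the part at `V`, which is not
  -- zero.
  have htwo : ∀ C, IsCell (Oᶜ \ carrier S) C → 2 ≤ ∑ p ∈ V, degree (F C) p := by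
    intro C hC
    have h1 := sum_degree hH (Finset.filter_subset (fun s => κ s = C) H)
    rw [← Finset.sum_sdiff hsub] at h1
    have h2 : Even (∑ p ∈ endpoints H \ V, degree (F C) p) := Finset.even_sum _ (hdegF C)
    have h3 : 1 ≤ ∑ p ∈ V, degree (F C) p := by
      obtain ⟨p, hp, s, hs, hps, y, hy, hyV, hCy⟩ :=
        St.exists_half_edge T hG hH hV hF hang hne hC
      have hsF : s ∈ F C := Finset.mem_filter.2 ⟨hs,
        St.leads_unique T hG (hM hs hy) hyV (hκ s hs).1 hC ((hκ s hs).2 y hy hyV) hCy⟩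
      have h4 : 1 ≤ degree (F C) p := Finset.card_pos.2 ⟨s, Finset.mem_filter.2 ⟨hsF, hps⟩⟩
      exact h4.trans (Finset.single_le_sum (f := fun p => degree (F C) p) (fun _ _ => Nat.zero_le _)
        hp)
    obtain ⟨k, hk⟩ := h2
    change _ + ∑ p ∈ V, degree (F C) p = 2 * _ at h1
    rw [hk] at h1
    omega
  rw [Set.ncard_eq_toFinset_card _ hfin, mul_comm, ← smul_eq_mul, ← Finset.sum_const]
  calc ∑ C ∈ hfin.toFinset, 2 ≤ ∑ C ∈ hfin.toFinset, ∑ p ∈ V, degree (F C) p :=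
        Finset.sum_le_sum fun C hC => htwo C (hfin.mem_toFinset.1 hC)
    _ = ∑ p ∈ V, ∑ C ∈ hfin.toFinset, degree (F C) p := Finset.sum_comm
    _ = ∑ p ∈ V, degree H p := by
      refine Finset.sum_congr rfl fun p _ => ?_
      unfold degree
      rw [Finset.card_eq_sum_card_fiberwise (f := κ) (t := hfin.toFinset) fun s hs =>
        Finset.mem_coe.2 (hfin.mem_toFinset.2 (hκ s (Finset.mem_filter.1 hs).1).1)]
      refine Finset.sum_congr rfl fun C _ => ?_
      rw [hFd, Finset.filter_filter, Finset.filter_filter]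
      simp only [and_comm]

end IsBranchStar
end Corridor
end

/-! ### The axis at the obstacles, and why pruning detaches it -/

noncomputable section
open Set Filter Topology Real
namespace Corridor

/-! ### Ends of the medial axis -/

variable {O : Set Plane} {Vt : Finset Plane} {L : Finset (ℝ × ℝ × ℝ)} {G : Finset (Plane × Plane)}

/-- The open segments of the complex from `Tame.exists_complex` belong to the axis, so only their
endpoints can be in `O`. -/
theorem Tame.finite_closure_inter (T : Tame O Vt L) : (closure (medialAxis O) ∩ O).Finite := by
  obtain ⟨G, -, hG, hM⟩ := T.exists_complex
  refine (endpoints G).finite_toSet.subset ?_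
  rintro x ⟨hx, hxO⟩
  rw [← hG] at hx
  obtain ⟨s, hs, hxs⟩ := mem_iUnion₂.1 hx
  by_cases h1 : s.1 = x
  · exact h1 ▸ fst_mem_endpoints hs
  by_cases h2 : s.2 = x
  · exact h2 ▸ snd_mem_endpoints hs
  exact absurd hxO (medialAxis_subset_compl (hM s hs (mem_openSegment_of_ne_left_right h1 h2 hxs)))

/-- Near `y`, all contact points lie on two rays from `y` that belong to the obstacles. -/
structure RayPair (O : Set Plane) (y : Plane) (δ : ℝ) (f₁ f₂ : Plane) : Prop where
  pos : 0 < δ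
  ne₁ : f₁.1 ≠ 0 ∧ f₁.2 ≠ 0
  ne₂ : f₂.1 ≠ 0 ∧ f₂.2 ≠ 0
  contact : ∀ x ∉ O, ∀ c ∈ foot O x, c ∈ Metric.ball y δ → ∃ t : ℝ, 0 ≤ t ∧
    (c = y + t • f₁ ∨ c = y + t • f₂)
  ray₁ : ∀ t : ℝ, 0 ≤ t → y + t • f₁ ∈ Metric.ball y δ → y + t • f₁ ∈ O
  ray₂ : ∀ t : ℝ, 0 ≤ t → y + t • f₂ ∈ Metric.ball y δ → y + t • f₂ ∈ O

theorem RayPair.mono {y : Plane} {δ δ' : ℝ} {f₁ f₂ : Plane} (h : RayPair O y δ f₁ f₂)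
    (h0 : 0 < δ') (hle : δ' ≤ δ) : RayPair O y δ' f₁ f₂ :=
  have hb := Metric.ball_subset_ball (x := y) hle
  ⟨h0, h.ne₁, h.ne₂, fun x hx c hc hcy => h.contact x hx c hc (hb hcy),
    fun t ht hty => h.ray₁ t ht (hb hty), fun t ht hty => h.ray₂ t ht (hb hty)⟩

/-- The midpoint is in the closed square, and in `O` only if it is on the boundary; then both points
are on the same side of the square. -/
theorem fst_eq_or_snd_eq_of_midpoint_mem {x a b : Plane} (ha : a ∈ foot O x) (hb : b ∈ foot O x)
    (hm : (1 / 2 : ℝ) • a + (1 / 2 : ℝ) • b ∈ O) : a.1 = b.1 ∨ a.2 = b.2 := by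
  have h := rad_le_dist (p := x) hm
  have ha' := (mem_foot.1 ha).1
  have hb' := (mem_foot.1 hb).1
  have a1 := abs_le.1 ((abs_fst_le x a).trans_eq ha')
  have a2 := abs_le.1 ((abs_snd_le x a).trans_eq ha')
  have b1 := abs_le.1 ((abs_fst_le x b).trans_eq hb')
  have b2 := abs_le.1 ((abs_snd_le x b).trans_eq hb')
  rw [dist_eq_max, le_max_iff] at h
  simp only [Prod.fst_add, Prod.snd_add, Prod.smul_fst, Prod.smul_snd, smul_eq_mul, le_abs] at h
  rcases h with (h | h) | (h | h)
  · left; linarith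
  · left; linarith
  · right; linarith
  · right; linarith

/-- A line within `O` through a corner must not enter the square, so one component of its direction
points outwards and the other inwards. -/
theorem Tame.exists_corner_dir (T : Tame O Vt L) {x a f : Plane} (hx : x ∉ O) (ha : a ∈ foot O x)
    (hv : a ∉ Vt) (hf : f.1 ≠ 0 ∧ f.2 ≠ 0) (hO : ∀ᶠ τ in 𝓝 (0 : ℝ), a + τ • f ∈ O) :
    ∃ κ ∈ diagDirs, a = x + rad O x • κ ∧ (f.1 * κ.1) * (f.2 * κ.2) < 0 := by
  obtain ⟨κ, hκ, hax, -⟩ := T.corner hx ha hv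
  refine ⟨κ, hκ, hax, ?_⟩
  obtain ⟨k1, k2⟩ := mem_diagDirs.1 hκ
  have hr := rad_pos T.closed T.nonempty hx
  by_contra hcon
  push Not at hcon
  have k1' : κ.1 * κ.1 = 1 := by rcases k1 with h | h <;> rw [h] <;> norm_num
  have k2' : κ.2 * κ.2 = 1 := by rcases k2 with h | h <;> rw [h] <;> norm_num
  have hne : (f.1 * κ.1) * (f.2 * κ.2) ≠ 0 := by
    have h1 : κ.1 ≠ 0 := fun h => by rw [h] at k1'; norm_num at k1'
    have h2 : κ.2 ≠ 0 := fun h => by rw [h] at k2'; norm_num at k2'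
    exact mul_ne_zero (mul_ne_zero hf.1 h1) (mul_ne_zero hf.2 h2)
  have hpos := hcon.lt_of_ne hne.symm
  have ht : Tendsto (fun η : ℝ => η * -(f.1 * κ.1)) (𝓝[>] 0) (𝓝 0) := by
    have : Tendsto (fun η : ℝ => η * -(f.1 * κ.1)) (𝓝 0) (𝓝 (0 * -(f.1 * κ.1))) :=
      (by fun_prop : Continuous fun η : ℝ => η * -(f.1 * κ.1)).tendsto 0
    rw [zero_mul] at this
    exact this.mono_left nhdsWithin_le_nhds
  obtain ⟨η, ⟨⟨g1, g2⟩, g3⟩, g0⟩ := (((ht.eventually hO).and (eventually_mul_lt (f.1 * f.1) hr)).and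
    (eventually_mul_lt ((f.1 * κ.1) * (f.2 * κ.2)) hr)).and self_mem_nhdsWithin |>.exists
  have g0 : 0 < η := g0
  have h := rad_le_dist (p := x) g1
  rw [dist_eq_max, le_max_iff, hax] at h
  simp only [Prod.fst_add, Prod.snd_add, Prod.smul_fst, Prod.smul_snd, smul_eq_mul] at h
  have e1 : x.1 - (x.1 + rad O x * κ.1 + η * -(f.1 * κ.1) * f.1) =
      -κ.1 * (rad O x - η * (f.1 * f.1)) := by ring
  have e2 : x.2 - (x.2 + rad O x * κ.2 + η * -(f.1 * κ.1) * f.2) =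
      -κ.2 * (rad O x - η * ((f.1 * κ.1) * (f.2 * κ.2))) := by
    have : -κ.2 * (rad O x - η * ((f.1 * κ.1) * (f.2 * κ.2))) =
      -κ.2 * rad O x + η * (f.1 * κ.1) * f.2 * (κ.2 * κ.2) := by ring
    rw [this, k2']; ring
  have habs : ∀ κ : ℝ, κ = 1 ∨ κ = -1 → |-κ| = 1 := by
    rintro κ (rfl | rfl) <;> norm_num
  rw [e1, e2, abs_mul, abs_mul, habs _ k1, habs _ k2, one_mul, one_mul,
    abs_of_pos (by linarith), abs_of_pos (by linarith)] at h
  have p1 : 0 < η * (f.1 * f.1) := mul_pos g0 (mul_self_pos.2 hf.1)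
  have p2 := mul_pos g0 hpos
  rcases h with h | h <;> linarith

/-- A square with corner `x + r • κ` on a line with direction `f` lies on one side of it. -/
theorem cross_mul_cross_nonpos {x b f κ : Plane} {r : ℝ} (hκ : κ ∈ diagDirs)
    (h : (f.1 * κ.1) * (f.2 * κ.2) < 0) (hb : dist x b ≤ r) :
    cross f (b - (x + r • κ)) * cross f κ ≤ 0 := by
  obtain ⟨k1, k2⟩ := mem_diagDirs.1 hκ
  have b1 := abs_le.1 ((abs_fst_le x b).trans hb)
  have b2 := abs_le.1 ((abs_snd_le x b).trans hb)
  have k1' : κ.1 * κ.1 = 1 := by rcases k1 with h | h <;> rw [h] <;> norm_num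
  have k2' : κ.2 * κ.2 = 1 := by rcases k2 with h | h <;> rw [h] <;> norm_num
  have hu : κ.2 * (b.2 - x.2) - r ≤ 0 := by rcases k2 with h | h <;> rw [h] <;> linarith
  have hv : κ.1 * (b.1 - x.1) - r ≤ 0 := by rcases k1 with h | h <;> rw [h] <;> linarith
  have hAB : 0 < (f.1 * κ.2) * (-(f.2 * κ.1)) := by linarith
  have e1 : cross f (b - (x + r • κ)) = (f.1 * κ.2) * (κ.2 * (b.2 - x.2) - r) +
      (-(f.2 * κ.1)) * (κ.1 * (b.1 - x.1) - r) := by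
    have : (f.1 * κ.2) * (κ.2 * (b.2 - x.2) - r) + (-(f.2 * κ.1)) * (κ.1 * (b.1 - x.1) - r) =
      f.1 * ((κ.2 * κ.2) * (b.2 - x.2) - r * κ.2) -
        f.2 * ((κ.1 * κ.1) * (b.1 - x.1) - r * κ.1) := by ring
    rw [this, k1', k2']
    unfold cross
    simp only [Prod.fst_sub, Prod.snd_sub, Prod.fst_add, Prod.snd_add, Prod.smul_fst,
      Prod.smul_snd, smul_eq_mul]
    ring
  have e2 : cross f κ = f.1 * κ.2 + -(f.2 * κ.1) := by unfold cross; ring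
  rw [e1, e2]
  set A := f.1 * κ.2
  set B := -(f.2 * κ.1)
  set u := κ.2 * (b.2 - x.2) - r
  set v := κ.1 * (b.1 - x.1) - r
  nlinarith [mul_nonneg (sq_nonneg A) (neg_nonneg.2 hu), mul_nonneg (sq_nonneg B) (neg_nonneg.2 hv),
    mul_nonneg hAB.le (neg_nonneg.2 hu), mul_nonneg hAB.le (neg_nonneg.2 hv)]

/-- The sign condition leaves two opposite corner directions; the side of the line on which the
square lies selects one. -/
theorem eq_of_cross_neg {f κ κ' : Plane} {c : ℝ} (hκ : κ ∈ diagDirs) (hκ' : κ' ∈ diagDirs)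
    (h : (f.1 * κ.1) * (f.2 * κ.2) < 0) (h' : (f.1 * κ'.1) * (f.2 * κ'.2) < 0)
    (hc : cross f κ * c < 0) (hc' : cross f κ' * c < 0) : κ = κ' := by
  have key : ∀ κ : Plane, (f.1 * κ.1) * (f.2 * κ.2) < 0 → cross f κ * c < 0 →
      κ.2 * (f.1 * c) < 0 ∧ 0 < κ.1 * (f.2 * c) := by
    intro κ h hc
    have hAB : 0 < (f.1 * κ.2) * (-(f.2 * κ.1)) := by linarith
    have e2 : cross f κ = f.1 * κ.2 + -(f.2 * κ.1) := by unfold cross; ring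
    rw [e2] at hc
    have hA : (f.1 * κ.2) * c < 0 := by
      rcases pos_and_pos_or_neg_and_neg_of_mul_pos hAB with ⟨p, q⟩ | ⟨p, q⟩
      · exact mul_neg_of_pos_of_neg p (by
          by_contra hcc
          push Not at hcc
          nlinarith)
      · exact mul_neg_of_neg_of_pos p (by
          by_contra hcc
          push Not at hcc
          nlinarith)
    have hB : (-(f.2 * κ.1)) * c < 0 := by
      rcases pos_and_pos_or_neg_and_neg_of_mul_pos hAB with ⟨p, q⟩ | ⟨p, q⟩
      · exact mul_neg_of_pos_of_neg q (by
          by_contra hcc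
          push Not at hcc
          nlinarith)
      · exact mul_neg_of_neg_of_pos q (by
          by_contra hcc
          push Not at hcc
          nlinarith)
    constructor <;> linarith
  obtain ⟨a1, a2⟩ := key κ h hc
  obtain ⟨b1, b2⟩ := key κ' h' hc'
  obtain ⟨k1, k2⟩ := mem_diagDirs.1 hκ
  obtain ⟨k1', k2'⟩ := mem_diagDirs.1 hκ'
  ext
  · rcases k1 with k1 | k1 <;> rcases k1' with k1' | k1' <;> rw [k1] at a2 ⊢ <;> rw [k1'] at b2 ⊢ <;>
      linarith
  · rcases k2 with k2 | k2 <;> rcases k2' with k2' | k2' <;> rw [k2] at a1 ⊢ <;> rw [k2'] at b1 ⊢ <;>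
      linarith

/-- The shape of a critical square close to `y`, in terms of the two rays. -/
structure Wedge (f₁ f₂ v : Plane) (r t₁ t₂ : ℝ) (κ₁ κ₂ : Plane) : Prop where
  r_pos : 0 < r
  diag₁ : κ₁ ∈ diagDirs
  diag₂ : κ₂ ∈ diagDirs
  eq₁ : v + r • κ₁ = t₁ • f₁
  eq₂ : v + r • κ₂ = t₂ • f₂
  sign₁ : (f₁.1 * κ₁.1) * (f₁.2 * κ₁.2) < 0
  sign₂ : (f₂.1 * κ₂.1) * (f₂.2 * κ₂.2) < 0
  cross_ne : cross f₁ f₂ ≠ 0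
  cross₁ : cross f₁ κ₁ * cross f₁ f₂ < 0
  cross₂ : cross f₂ κ₂ * cross f₁ f₂ > 0

/-- Two contact points on the same ray are impossible: their midpoint is in `O`, so they would share
a coordinate on a line that is not axis-parallel. So there is one on each ray, neither at `y`; both
are corners, and each ray supports the square on the side of the other. -/
theorem Tame.exists_wedge (T : Tame O Vt L) {y x : Plane} {δ : ℝ} {f₁ f₂ : Plane}
    (h : RayPair O y δ f₁ f₂) (hVt : ∀ v ∈ Vt, v ∈ Metric.ball y δ → v = y) (hy : y ∈ O)
    (hx : x ∈ medialAxis O) (hxy : dist x y < δ / 2) :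
    ∃ (r t₁ t₂ : ℝ) (κ₁ κ₂ : Plane), Wedge f₁ f₂ (x - y) r t₁ t₂ κ₁ κ₂ := by
  obtain ⟨hxO, a, ha, b, hb, hab⟩ := (Corridor.mem_medialAxis T.closed T.nonempty).1 hx
  have hr := rad_pos T.closed T.nonempty hxO
  have hball : ∀ c ∈ foot O x, c ∈ Metric.ball y δ := by
    intro c hc
    have h1 := rad_le_dist (p := x) hy
    have h2 := (mem_foot.1 hc).1
    have h3 := dist_triangle_left c y x
    rw [Metric.mem_ball]
    linarith
  have hmid : ∀ {f : Plane} {s t : ℝ}, f.1 ≠ 0 ∧ f.2 ≠ 0 → ∀ {a b : Plane}, a ∈ foot O x →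
      b ∈ foot O x → a = y + s • f → b = y + t • f →
      y + ((s + t) / 2) • f ∈ O → a = b := by
    rintro f s t hf a b ha hb rfl rfl hO
    have := fst_eq_or_snd_eq_of_midpoint_mem ha hb (by
      rwa [show (1 / 2 : ℝ) • (y + s • f) + (1 / 2 : ℝ) • (y + t • f) =
        y + ((s + t) / 2) • f by module])
    simp only [Prod.fst_add, Prod.snd_add, Prod.smul_fst, Prod.smul_snd, smul_eq_mul,
      add_right_inj, mul_eq_mul_right_iff] at this
    rcases this with (h | h) | (h | h)
    · rw [h]
    · exact absurd h hf.1
    · rw [h]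
    · exact absurd h hf.2
  have hmball : ∀ {a b m : Plane}, a ∈ foot O x → b ∈ foot O x →
      m = (1 / 2 : ℝ) • a + (1 / 2 : ℝ) • b → m ∈ Metric.ball y δ := by
    rintro a b m ha hb rfl
    exact convex_ball y δ (hball a ha) (hball b hb) (by norm_num) (by norm_num) (by norm_num)
  have hsame : ∀ {f : Plane}, f.1 ≠ 0 ∧ f.2 ≠ 0 →
      (∀ t : ℝ, 0 ≤ t → y + t • f ∈ Metric.ball y δ → y + t • f ∈ O) → ∀ {a b : Plane} {s t : ℝ},
      a ∈ foot O x → b ∈ foot O x → 0 ≤ s → 0 ≤ t → a = y + s • f → b = y + t • f → a = b := by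
    intro f hf hray a b s t ha hb hs ht h1 h2
    refine hmid hf ha hb h1 h2 (hray _ (by positivity) (hmball ha hb ?_))
    rw [h1, h2]; module
  obtain ⟨a, b, t₁, t₂, ha, hb, hab, ht1, ht2, h1, h2⟩ : ∃ (a b : Plane) (t₁ t₂ : ℝ),
      a ∈ foot O x ∧ b ∈ foot O x ∧ a ≠ b ∧ 0 ≤ t₁ ∧ 0 ≤ t₂ ∧ a = y + t₁ • f₁ ∧
        b = y + t₂ • f₂ := by
    obtain ⟨s, hs, h1⟩ := h.contact x hxO a ha (hball a ha)
    obtain ⟨t, ht, h2⟩ := h.contact x hxO b hb (hball b hb)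
    rcases h1 with h1 | h1 <;> rcases h2 with h2 | h2
    · exact absurd (hsame h.ne₁ h.ray₁ ha hb hs ht h1 h2) hab
    · exact ⟨a, b, s, t, ha, hb, hab, hs, ht, h1, h2⟩
    · exact ⟨b, a, t, s, hb, ha, hab.symm, ht, hs, h2, h1⟩
    · exact absurd (hsame h.ne₂ h.ray₂ ha hb hs ht h1 h2) hab
  have hcorner : ∀ {f a : Plane} {t : ℝ}, f.1 ≠ 0 ∧ f.2 ≠ 0 →
      (∀ t : ℝ, 0 ≤ t → y + t • f ∈ Metric.ball y δ → y + t • f ∈ O) → a ∈ foot O x → 0 < t →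
      a = y + t • f → ∃ κ ∈ diagDirs, a = x + rad O x • κ ∧ (f.1 * κ.1) * (f.2 * κ.2) < 0 := by
    intro f a t hf hray ha ht hat
    refine T.exists_corner_dir hxO ha (fun hv => ?_) hf ?_
    · have := hVt a hv (hball a ha)
      rw [hat, add_eq_left, smul_eq_zero] at this
      rcases this with h | h
      · exact ht.ne' h
      · exact hf.1 (by rw [h]; rfl)
    · have ht' : Tendsto (fun τ : ℝ => a + τ • f) (𝓝 0) (𝓝 a) := by
        have : Tendsto (fun τ : ℝ => a + τ • f) (𝓝 0) (𝓝 (a + (0 : ℝ) • f)) :=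
          (by fun_prop : Continuous fun τ : ℝ => a + τ • f).tendsto 0
        rwa [zero_smul, add_zero] at this
      filter_upwards [ht'.eventually (Metric.isOpen_ball.mem_nhds (hball a ha)),
        Ioi_mem_nhds (show -t < 0 by linarith)] with τ g1 g2
      have g2 : -t < τ := g2
      have e : a + τ • f = y + (t + τ) • f := by rw [hat]; module
      rw [e] at g1 ⊢
      exact hray _ (by linarith) g1
  have ht1 : 0 < t₁ := ht1.lt_of_ne (by
    rintro rfl
    refine hab (hsame h.ne₂ h.ray₂ ha hb le_rfl ht2 ?_ h2)
    rw [h1, zero_smul, zero_smul])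
  have ht2 : 0 < t₂ := ht2.lt_of_ne (by
    rintro rfl
    refine hab (hsame h.ne₁ h.ray₁ ha hb ht1.le le_rfl h1 ?_)
    rw [h2, zero_smul, zero_smul])
  -- If the rays were collinear, the midpoint would be on one of them.
  have hcne : cross f₁ f₂ ≠ 0 := by
    intro hc
    have hf1 : f₁ ≠ 0 := fun h0 => h.ne₁.1 (by rw [h0]; rfl)
    obtain ⟨c, hc'⟩ := exists_smul_of_cross_eq_zero hf1
      (show cross f₂ f₁ = 0 by unfold cross at hc ⊢; linarith)
    have hc0 : c ≠ 0 := by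
      rintro rfl
      exact h.ne₂.1 (by rw [hc', zero_smul]; rfl)
    have h2' : b = y + (t₂ * c) • f₁ := by rw [h2, hc', smul_smul]
    refine hab (hmid h.ne₁ ha hb h1 h2' ?_)
    have hm := hmball (m := y + ((t₁ + t₂ * c) / 2) • f₁) ha hb (by rw [h1, h2']; module)
    rcases le_total 0 (t₁ + t₂ * c) with h0 | h0
    · exact h.ray₁ _ (by positivity) hm
    · have e : y + ((t₁ + t₂ * c) / 2) • f₁ = y + ((t₁ / c + t₂) / 2) • f₂ := by
        rw [hc', smul_smul]; congr 2; field_simp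
      rw [e] at hm ⊢
      have hcn : c < 0 := by
        by_contra hcp
        push Not at hcp
        nlinarith
      refine h.ray₂ _ ?_ hm
      have : (t₁ + t₂ * c) / c = t₁ / c + t₂ := by field_simp
      rw [← this]
      have := div_nonneg_of_nonpos h0 hcn.le
      positivity
  obtain ⟨κ₁, hκ1, e1, s1⟩ := hcorner h.ne₁ h.ray₁ ha ht1 h1
  obtain ⟨κ₂, hκ2, e2, s2⟩ := hcorner h.ne₂ h.ray₂ hb ht2 h2
  have hcκ : ∀ {f κ : Plane}, (f.1 * κ.1) * (f.2 * κ.2) < 0 → cross f κ ≠ 0 := by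
    intro f κ hs h0
    unfold cross at h0
    have : (f.1 * κ.1) * (f.2 * κ.2) = (f.1 * κ.2) * (f.1 * κ.2) := by
      linear_combination (-(f.1 * κ.2)) * h0
    nlinarith [mul_self_nonneg (f.1 * κ.2)]
  have l1 : cross f₁ (b - a) = t₂ * cross f₁ f₂ := by
    rw [h1, h2]
    unfold cross
    simp only [Prod.fst_sub, Prod.snd_sub, Prod.fst_add, Prod.snd_add, Prod.smul_fst,
      Prod.smul_snd, smul_eq_mul]
    ring
  have l2 : cross f₂ (a - b) = -(t₁ * cross f₁ f₂) := by
    rw [h1, h2]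
    unfold cross
    simp only [Prod.fst_sub, Prod.snd_sub, Prod.fst_add, Prod.snd_add, Prod.smul_fst,
      Prod.smul_snd, smul_eq_mul]
    ring
  have m1 := cross_mul_cross_nonpos (b := b) hκ1 s1 (mem_foot.1 hb).1.le
  have m2 := cross_mul_cross_nonpos (b := a) hκ2 s2 (mem_foot.1 ha).1.le
  rw [← e1, l1] at m1
  rw [← e2, l2] at m2
  refine ⟨rad O x, t₁, t₂, κ₁, κ₂, hr, hκ1, hκ2, ?_, ?_, s1, s2, hcne, ?_, ?_⟩
  · rw [sub_add_eq_add_sub, ← e1, h1]; abel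
  · rw [sub_add_eq_add_sub, ← e2, h2]; abel
  · refine lt_of_le_of_ne ?_ (mul_ne_zero (hcκ s1) hcne)
    by_contra hcon
    push Not at hcon
    nlinarith
  · refine lt_of_le_of_ne ?_ (mul_ne_zero (hcκ s2) hcne).symm
    by_contra hcon
    push Not at hcon
    nlinarith

/-- Both squares touch the rays with the same corners. For fixed corners the conditions are
homogeneous in centre and radius, and the radius determines the centre because the rays are
independent. So the squares are homothetic from `y`. -/
theorem Wedge.smul_eq {f₁ f₂ v v' : Plane} {r t₁ t₂ r' t₁' t₂' : ℝ} {κ₁ κ₂ κ₁' κ₂' : Plane}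
    (h : Wedge f₁ f₂ v r t₁ t₂ κ₁ κ₂) (h' : Wedge f₁ f₂ v' r' t₁' t₂' κ₁' κ₂') :
    r' • v = r • v' := by
  obtain rfl := eq_of_cross_neg h.diag₁ h'.diag₁ h.sign₁ h'.sign₁ h.cross₁ h'.cross₁
  obtain rfl := eq_of_cross_neg (c := -cross f₁ f₂) h.diag₂ h'.diag₂ h.sign₂ h'.sign₂
    (by linarith [h.cross₂]) (by linarith [h'.cross₂])
  have e1 : (r' * t₁ - r * t₁') • f₁ = (r' * t₂ - r * t₂') • f₂ := by
    have a1 : (r' * t₁ - r * t₁') • f₁ = r' • v - r • v' := by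
      rw [sub_smul, mul_smul, mul_smul, ← h.eq₁, ← h'.eq₁]; module
    have a2 : (r' * t₂ - r * t₂') • f₂ = r' • v - r • v' := by
      rw [sub_smul, mul_smul, mul_smul, ← h.eq₂, ← h'.eq₂]; module
    rw [a1, a2]
  have e2 : (r' * t₁ - r * t₁') * cross f₁ f₂ = 0 := by
    rw [← cross_smul_left, e1, cross_smul_left, cross_self, mul_zero]
  have e3 := (mul_eq_zero.1 e2).resolve_right h.cross_ne
  have a1 : (r' * t₁ - r * t₁') • f₁ = r' • v - r • v' := by
    rw [sub_smul, mul_smul, mul_smul, ← h.eq₁, ← h'.eq₁]; module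
  rw [e3, zero_smul] at a1
  exact sub_eq_zero.1 a1.symm

/-- The medial axis reaches a point of the obstacles in at most one direction. -/
theorem Tame.unitVec_eq_of_mem_angles (T : Tame O Vt L) (hG : carrier G = closure (medialAxis O))
    {y : Plane} (hy : y ∈ O) {δ : ℝ} {f₁ f₂ : Plane} (h : RayPair O y δ f₁ f₂) {θ θ' : ℝ}
    (hθ : θ ∈ angles (carrier G) y) (hθ' : θ' ∈ angles (carrier G) y) :
    unitVec θ = unitVec θ' := by
  obtain ⟨δ₁, hδ₁, hV⟩ := Metric.isOpen_iff.1
    ((Vt.finite_toSet.sdiff (t := {y})).isClosed.isOpen_compl) y (by simp)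
  have hδ' : 0 < min δ δ₁ := lt_min h.pos hδ₁
  have hVt : ∀ v ∈ Vt, v ∈ Metric.ball y (min δ δ₁) → v = y := by
    intro v hv hvb
    by_contra hne
    exact hV (Metric.ball_subset_ball (min_le_right _ _) hvb) ⟨hv, hne⟩
  have hnear : ∀ θ ∈ angles (carrier G) y, ∃ ρ : ℝ, 0 < ρ ∧ ∃ (r t₁ t₂ : ℝ) (κ₁ κ₂ : Plane),
      Wedge f₁ f₂ (ρ • unitVec θ) r t₁ t₂ κ₁ κ₂ := by
    intro θ hθ
    have hev : ∀ᶠ ρ in 𝓝[>] (0 : ℝ), y + ρ • unitVec θ ∉ closure (medialAxis O) ∩ O := by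
      obtain ⟨η, hη, hb⟩ := Metric.isOpen_iff.1
        ((T.finite_closure_inter.sdiff (t := {y})).isClosed.isOpen_compl) y (by simp)
      filter_upwards [Ioo_mem_nhdsGT (show (0 : ℝ) < η from hη)] with ρ hρ hmem
      exact hb (dist_add_unitVec_lt hρ.1.le hρ.2) ⟨hmem, add_unitVec_ne hρ.1⟩
    obtain ⟨ρ, ⟨g1, g2⟩, g3⟩ := (((mem_angles.1 hθ).and hev).and
      (Ioo_mem_nhdsGT (half_pos hδ'))).exists
    rw [hG] at g1
    have hO : y + ρ • unitVec θ ∉ O := fun h => g2 ⟨g1, h⟩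
    have := T.exists_wedge (h.mono hδ' (min_le_left _ _)) hVt hy (T.closure_medialAxis hO g1)
      (dist_add_unitVec_lt g3.1.le g3.2)
    rw [add_sub_cancel_left] at this
    exact ⟨ρ, g3.1, this⟩
  obtain ⟨ρ, hρ, r, _, _, _, _, hw⟩ := hnear θ hθ
  obtain ⟨ρ', hρ', r', _, _, _, _, hw'⟩ := hnear θ' hθ'
  have := hw.smul_eq hw'
  rw [smul_smul, smul_smul] at this
  exact eq_of_smul_unitVec (mul_pos hw'.r_pos hρ) (mul_pos hw.r_pos hρ') this

theorem degree_reduce_ne_one (G : Finset (Plane × Plane)) (p : Plane) :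
    degree (reduce G) p ≠ 1 := by
  classical
  intro h
  obtain ⟨s, hs⟩ := Finset.card_eq_one.1 h
  have hsm : s ∈ (reduce G).filter fun s => p = s.1 ∨ p = s.2 := by rw [hs]; simp
  obtain ⟨hsG, hps⟩ := Finset.mem_filter.1 hsm
  rw [← prune_reduce] at hsG
  obtain ⟨-, h1, h2⟩ := Finset.mem_filter.1 hsG
  rcases hps with rfl | rfl
  exacts [h1 h, h2 h]

/-- The reduced medial axis does not meet the obstacles. -/
theorem Tame.carrier_reduce_subset (T : Tame O Vt L) (hGc : IsSegmentComplex G)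
    (hG : carrier G = closure (medialAxis O))
    (hrays : ∀ y ∈ closure (medialAxis O), y ∈ O → ∃ δ f₁ f₂, RayPair O y δ f₁ f₂) :
    carrier (reduce G) ⊆ medialAxis O := by
  intro y hy
  have hyG := carrier_mono (reduce_subset G) hy
  refine T.closure_medialAxis (fun hyO => ?_) (hG ▸ hyG)
  obtain ⟨s, hs, hys⟩ := mem_iUnion₂.1 hy
  obtain ⟨δ, f₁, f₂, h⟩ := hrays y (hG ▸ hyG) hyO
  have huniq : ∀ {θ θ' : ℝ}, θ ∈ angles (carrier G) y → θ' ∈ angles (carrier G) y →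
      unitVec θ = unitVec θ' := T.unitVec_eq_of_mem_angles hG hyO h
  -- Each segment that ends at `y` needs a direction of its own, and there is at most one direction.
  have hd : degree (reduce G) y ≤ 1 := by
    refine (degree_mono (reduce_subset G) y).trans ((degree_le_ncard_angles hGc y).trans ?_)
    rw [Set.ncard_le_one_iff (perFin_angles_carrier G y).fin]
    exact fun hθ hθ' => eq_of_unitVec_eq hθ.2 hθ'.2 (huniq hθ.1 hθ'.1)
  by_cases hends : y = s.1 ∨ y = s.2
  · have h0 : degree (reduce G) y ≠ 0 := by
      rw [← mem_endpoints_iff]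
      rcases hends with rfl | rfl
      exacts [fst_mem_endpoints hs, snd_mem_endpoints hs]
    exact degree_reduce_ne_one G y (by omega)
  -- Inside a segment there would be two opposite directions.
  · push Not at hends
    have hdir : ∀ z ∈ segment ℝ s.1 s.2, z ≠ y → ∃ R θ : ℝ, 0 < R ∧ z - y = R • unitVec θ ∧
        θ ∈ angles (carrier G) y := by
      intro z hz hne
      obtain ⟨R, hR, θ, h⟩ := exists_polar (sub_ne_zero.2 hne)
      refine ⟨R, θ, hR, h, angles_mono ?_ y (mem_angles_segment hR)⟩
      rw [← h, add_sub_cancel]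
      exact ((convex_segment s.1 s.2).segment_subset hys hz).trans
        (subset_biUnion_of_mem (u := fun s : Plane × Plane => segment ℝ s.1 s.2)
          (reduce_subset G hs))
    obtain ⟨R₁, θ₁, hR₁, h1, hθ₁⟩ := hdir s.1 (left_mem_segment _ _ _) hends.1.symm
    obtain ⟨R₂, θ₂, hR₂, h2, hθ₂⟩ := hdir s.2 (right_mem_segment _ _ _) hends.2.symm
    rw [huniq hθ₂ hθ₁] at h2
    obtain ⟨a, b, ha, hb, hab, hy'⟩ := hys
    have h3 : (a * R₁ + b * R₂) • unitVec θ₁ = 0 := by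
      rw [add_smul, mul_smul, mul_smul, ← h1, ← h2, smul_sub, smul_sub]
      calc a • s.1 - a • y + (b • s.2 - b • y) = (a • s.1 + b • s.2) - (a + b) • y := by module
        _ = 0 := by rw [hy', hab, one_smul, sub_self]
    have h4 := (smul_eq_zero.1 h3).resolve_right (unitVec_ne_zero _)
    have h5 : 0 < a * R₁ + b * R₂ := by
      rcases ha.lt_or_eq with h | rfl
      · exact add_pos_of_pos_of_nonneg (mul_pos h hR₁) (mul_nonneg hb hR₂.le)
      · rw [zero_add] at hab
        rw [hab]; linarith
    exact h5.ne' h4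

end Corridor
end

/-! ### Circulations, winding functions and the cycle rank -/

noncomputable section
open Set Filter Topology Real
namespace Corridor

/-! ### Winding functions of cycles -/

/-- The plane as the complex plane. -/
def toC (p : Plane) : ℂ := ⟨p.1, p.2⟩

theorem continuous_toC : Continuous toC := Complex.equivRealProdCLM.symm.continuous

theorem toC_injective : Function.Injective toC := Complex.equivRealProdCLM.symm.injective

@[simp] theorem toC_add (p q : Plane) : toC (p + q) = toC p + toC q := rfl

@[simp] theorem toC_sub (p q : Plane) : toC (p - q) = toC p - toC q := rfl

@[simp] theorem toC_smul (r : ℝ) (p : Plane) : toC (r • p) = r * toC p := by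
  apply Complex.ext <;> simp [toC]

theorem tendsto_toC_cobounded : Tendsto toC (Bornology.cobounded Plane) (Bornology.cobounded ℂ) := by
  rw [← tendsto_norm_atTop_iff_cobounded]
  refine tendsto_atTop_mono (fun p => ?_) tendsto_norm_cobounded_atTop
  rw [Prod.norm_def]
  exact max_le (Complex.abs_re_le_norm (toC p)) (Complex.abs_im_le_norm (toC p))

/-- The angle under which `x` sees the segment from `a` to `b`. -/
def subtend (a b x : Plane) : ℝ := Complex.arg ((toC b - toC x) / (toC a - toC x))

theorem toC_sub_ne_zero {p q : Plane} (h : p ≠ q) : toC p - toC q ≠ 0 :=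
  sub_ne_zero.2 fun h' => h (toC_injective h')

theorem ne_of_notMem_segment {a b x : Plane} (h : x ∉ segment ℝ a b) : a ≠ x ∧ b ≠ x :=
  ⟨fun h' => h (h' ▸ left_mem_segment _ _ _), fun h' => h (h' ▸ right_mem_segment _ _ _)⟩

/-- The quotient is a nonpositive real number only if `x` is between `a` and `b`; so the subtended
angle is continuous off the segment. -/
theorem div_mem_slitPlane {a b x : Plane} (h : x ∉ segment ℝ a b) :
    (toC b - toC x) / (toC a - toC x) ∈ Complex.slitPlane := by
  have ha := toC_sub_ne_zero (ne_of_notMem_segment h).1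
  rw [Complex.mem_slitPlane_iff]
  by_contra hcon
  push Not at hcon
  obtain ⟨hre, him⟩ := hcon
  set u := (toC b - toC x) / (toC a - toC x) with hu
  set l := -u.re
  have hl : 0 ≤ l := by linarith
  have hul : u = ((-l : ℝ) : ℂ) := Complex.ext (by simp [l]) (by simpa using him)
  have e : toC b - toC x = ((-l : ℝ) : ℂ) * (toC a - toC x) := by
    rw [← hul, hu, div_mul_cancel₀ _ ha]
  rw [← toC_sub, ← toC_sub, ← toC_smul] at e
  have e := toC_injective e
  apply h
  have hl1 : 0 < 1 + l := by linarith
  refine ⟨l / (1 + l), 1 / (1 + l), by positivity, by positivity, by field_simp; ring, ?_⟩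
  have e2 : (1 + l) • x = l • a + b := by
    calc (1 + l) • x = x + l • a + -l • (a - x) := by module
      _ = x + l • a + (b - x) := by rw [e]
      _ = l • a + b := by abel
  calc (l / (1 + l)) • a + (1 / (1 + l)) • b = (1 / (1 + l)) • (l • a + b) := by
        rw [smul_add, smul_smul]; congr 2; ring
    _ = x := by rw [← e2, smul_smul, one_div_mul_cancel hl1.ne', one_smul]

theorem continuousAt_div (a b : Plane) {x : Plane} (h : a ≠ x) :
    ContinuousAt (fun x => (toC b - toC x) / (toC a - toC x)) x :=
  ContinuousAt.div (continuous_const.sub continuous_toC).continuousAt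
    (continuous_const.sub continuous_toC).continuousAt (toC_sub_ne_zero h)

theorem continuousAt_subtend {a b x : Plane} (h : x ∉ segment ℝ a b) :
    ContinuousAt (subtend a b) x :=
  ContinuousAt.comp (g := Complex.arg) (Complex.continuousAt_arg (div_mem_slitPlane h))
    (continuousAt_div a b (ne_of_notMem_segment h).1)

/-- The change of direction of `v` when the viewpoint moves from `x₀` to `x`. -/
def turn (v x₀ x : Plane) : ℝ := Complex.arg ((toC v - toC x) / (toC v - toC x₀))

theorem turn_self {v x₀ : Plane} (h : v ≠ x₀) : turn v x₀ x₀ = 0 := by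
  unfold turn
  rw [div_self (toC_sub_ne_zero h), Complex.arg_one]

theorem continuousAt_turn {v x₀ : Plane} (h : v ≠ x₀) : ContinuousAt (turn v x₀) x₀ := by
  refine ContinuousAt.comp (g := Complex.arg) (Complex.continuousAt_arg ?_)
    (ContinuousAt.div_const (continuous_const.sub continuous_toC).continuousAt _)
  rw [div_self (toC_sub_ne_zero h)]
  exact Complex.one_mem_slitPlane

/-- The two sides agree modulo full turns, and both are continuous and vanish at `x₀`. The
right-hand side is a difference of terms of the two ends, which cancel in a flow without sources. -/
theorem eventually_subtend_sub {a b x₀ : Plane} (h : x₀ ∉ segment ℝ a b) :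
    ∀ᶠ x in 𝓝 x₀, subtend a b x - subtend a b x₀ = turn b x₀ x - turn a x₀ x := by
  obtain ⟨ha, hb⟩ := ne_of_notMem_segment h
  have hcont : ContinuousAt (fun x => subtend a b x - subtend a b x₀ -
      (turn b x₀ x - turn a x₀ x)) x₀ :=
    ((continuousAt_subtend h).sub continuousAt_const).sub
      ((continuousAt_turn hb).sub (continuousAt_turn ha))
  have h0 : Tendsto (fun x => subtend a b x - subtend a b x₀ -
      (turn b x₀ x - turn a x₀ x)) (𝓝 x₀) (𝓝 0) := by
    have := hcont.tendsto
    rwa [turn_self ha, turn_self hb, sub_self, sub_self, sub_self] at this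
  have hp : (0 : ℝ) < 2 * π := by positivity
  filter_upwards [h0.eventually (Metric.ball_mem_nhds 0 hp), isOpen_ne.mem_nhds ha.symm,
    isOpen_ne.mem_nhds hb.symm] with x hx hxa hxb
  have ha' := toC_sub_ne_zero (Ne.symm hxa)
  have hb' := toC_sub_ne_zero (Ne.symm hxb)
  have ha0 := toC_sub_ne_zero ha
  have hb0 := toC_sub_ne_zero hb
  have hang : ((subtend a b x - subtend a b x₀ - (turn b x₀ x - turn a x₀ x) : ℝ) : Real.Angle)
      = 0 := by
    unfold subtend turn
    rw [Real.Angle.coe_sub, Real.Angle.coe_sub, Real.Angle.coe_sub, Complex.arg_div_coe_angle hb' ha', Complex.arg_div_coe_angle hb0 ha0,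
      Complex.arg_div_coe_angle hb' hb0, Complex.arg_div_coe_angle ha' ha0]
    abel
  rw [← Real.Angle.coe_zero, Real.Angle.angle_eq_iff_two_pi_dvd_sub] at hang
  obtain ⟨k, hk⟩ := hang
  rw [sub_zero] at hk
  rw [dist_zero_right, Real.norm_eq_abs, hk, abs_mul, abs_of_pos hp] at hx
  have hk1 : |(k : ℝ)| < 1 := by nlinarith
  have hk0 : k = 0 := by
    rw [← Int.cast_abs] at hk1
    have : |k| < 1 := by exact_mod_cast hk1
    exact Int.abs_lt_one_iff.1 this
  rw [hk0, Int.cast_zero, mul_zero] at hk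
  linarith

theorem tendsto_subtend_cobounded (a b : Plane) :
    Tendsto (subtend a b) (Bornology.cobounded Plane) (𝓝 0) := by
  have h1 : Tendsto (fun x => toC a - toC x) (Bornology.cobounded Plane)
      (Bornology.cobounded ℂ) := by
    have := tendsto_toC_cobounded
    rw [← tendsto_norm_atTop_iff_cobounded] at this ⊢
    refine tendsto_atTop_mono (fun x => ?_) (tendsto_atTop_add_const_right _ (-‖toC a‖) this)
    have := norm_sub_norm_le (toC x) (toC a)
    rw [norm_sub_rev] at this
    linarith
  have h2 : Tendsto (fun x => 1 + (toC b - toC a) * (toC a - toC x)⁻¹) (Bornology.cobounded Plane)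
      (𝓝 1) := by
    have := ((tendsto_inv₀_cobounded.comp h1).const_mul (toC b - toC a)).const_add 1
    simpa using this
  have h3 : Tendsto (fun x => (toC b - toC x) / (toC a - toC x)) (Bornology.cobounded Plane)
      (𝓝 1) := by
    refine h2.congr' ?_
    have hne : ∀ᶠ x in Bornology.cobounded Plane, toC a - toC x ≠ 0 :=
      h1.eventually ((tendsto_norm_cobounded_atTop.eventually_gt_atTop 0).mono
        fun w hw => norm_pos_iff.1 hw)
    filter_upwards [hne] with x hx
    field_simp
    ring
  have h4 := (Complex.continuousAt_arg Complex.one_mem_slitPlane).tendsto.comp h3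
  rwa [Complex.arg_one] at h4

/-- The angle jumps by a full turn across the segment. -/
theorem subtend_beside (c h : Plane) (hh : h ≠ 0) (η : ℝ) :
    subtend (c - h) (c + h) (c + η • (-h.2, h.1)) =
      Complex.arg ⟨(η ^ 2 - 1) / (1 + η ^ 2), 2 * η / (1 + η ^ 2)⟩ := by
  unfold subtend
  congr 1
  have e : toC (-h.2, h.1) = Complex.I * toC h := by
    apply Complex.ext <;> simp [toC]
  have hh' : toC h ≠ 0 := fun h0 => hh (toC_injective (h0.trans (by rfl)))
  have hη : (0 : ℝ) < 1 + η ^ 2 := by positivity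
  have hd : toC (c - h) - toC (c + η • (-h.2, h.1)) = -(1 + η * Complex.I) * toC h := by
    rw [toC_add, toC_smul, e, toC_sub]; ring
  have hn : toC (c + h) - toC (c + η • (-h.2, h.1)) = (1 - η * Complex.I) * toC h := by
    rw [toC_add, toC_add, toC_smul, e]; ring
  have hne : -(1 + η * Complex.I) ≠ 0 := by
    intro h0
    have := congrArg Complex.re h0
    simp at this
  rw [hd, hn, mul_div_mul_right _ _ hh', div_eq_iff hne]
  apply Complex.ext
  · simp
    field_simp
    ring
  · simp
    field_simp
    ring

theorem tendsto_subtend_left (c h : Plane) (hh : h ≠ 0) :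
    Tendsto (fun η : ℝ => subtend (c - h) (c + h) (c + η • (-h.2, h.1))) (𝓝[>] 0) (𝓝 π) := by
  simp only [subtend_beside c h hh]
  refine (Complex.tendsto_arg_nhdsWithin_im_nonneg_of_re_neg_of_im_zero (z := -1) (by simp)
    (by simp)).comp (tendsto_nhdsWithin_iff.2 ⟨?_, ?_⟩)
  · have : Continuous fun η : ℝ => (⟨(η ^ 2 - 1) / (1 + η ^ 2), 2 * η / (1 + η ^ 2)⟩ : ℂ) := by
      refine Complex.equivRealProdCLM.symm.continuous.comp (Continuous.prodMk ?_ ?_)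
      · exact Continuous.div (by fun_prop) (by fun_prop) fun η => by positivity
      · exact Continuous.div (by fun_prop) (by fun_prop) fun η => by positivity
    have h0 := this.tendsto 0
    have e : (⟨((0 : ℝ) ^ 2 - 1) / (1 + 0 ^ 2), 2 * 0 / (1 + 0 ^ 2)⟩ : ℂ) = -1 := by
      apply Complex.ext <;> simp
    rw [e] at h0
    exact h0.mono_left nhdsWithin_le_nhds
  · filter_upwards [self_mem_nhdsWithin] with η hη
    have hη : 0 < η := hη
    change 0 ≤ 2 * η / (1 + η ^ 2)
    positivity

theorem tendsto_subtend_right (c h : Plane) (hh : h ≠ 0) :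
    Tendsto (fun η : ℝ => subtend (c - h) (c + h) (c + η • (-h.2, h.1))) (𝓝[<] 0) (𝓝 (-π)) := by
  simp only [subtend_beside c h hh]
  refine (Complex.tendsto_arg_nhdsWithin_im_neg_of_re_neg_of_im_zero (z := -1) (by simp)
    (by simp)).comp (tendsto_nhdsWithin_iff.2 ⟨?_, ?_⟩)
  · have : Continuous fun η : ℝ => (⟨(η ^ 2 - 1) / (1 + η ^ 2), 2 * η / (1 + η ^ 2)⟩ : ℂ) := by
      refine Complex.equivRealProdCLM.symm.continuous.comp (Continuous.prodMk ?_ ?_)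
      · exact Continuous.div (by fun_prop) (by fun_prop) fun η => by positivity
      · exact Continuous.div (by fun_prop) (by fun_prop) fun η => by positivity
    have h0 := this.tendsto 0
    have e : (⟨((0 : ℝ) ^ 2 - 1) / (1 + 0 ^ 2), 2 * 0 / (1 + 0 ^ 2)⟩ : ℂ) = -1 := by
      apply Complex.ext <;> simp
    rw [e] at h0
    exact h0.mono_left nhdsWithin_le_nhds
  · filter_upwards [self_mem_nhdsWithin] with η hη
    have hη : η < 0 := hη
    change 2 * η / (1 + η ^ 2) < 0
    exact div_neg_of_neg_of_pos (by linarith) (by positivity)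

variable {H : Finset (Plane × Plane)} {z : Plane × Plane → ℝ}

/-- The winding function of a flow on the segments. -/
def winding (H : Finset (Plane × Plane)) (z : Plane × Plane → ℝ) (x : Plane) : ℝ :=
  ∑ s ∈ H, z s * subtend s.1 s.2 x

open Classical in
/-- The net flow into a vertex. -/
def flux (H : Finset (Plane × Plane)) (z : Plane × Plane → ℝ) (v : Plane) : ℝ :=
  ∑ s ∈ H, z s * ((if s.2 = v then 1 else 0) - if s.1 = v then 1 else 0)

theorem notMem_segment_of_notMem_carrier {x : Plane} (hx : x ∉ carrier H) {s : Plane × Plane}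
    (hs : s ∈ H) : x ∉ segment ℝ s.1 s.2 := fun h => hx (mem_iUnion₂.2 ⟨s, hs, h⟩)

/-- Summation by parts, used for the change of direction of each vertex and for the constant 1. -/
theorem sum_flux (H : Finset (Plane × Plane)) (z : Plane × Plane → ℝ) (A : Plane → ℝ) :
    ∑ v ∈ endpoints H, A v * flux H z v = ∑ s ∈ H, z s * (A s.2 - A s.1) := by
  classical
  unfold flux
  simp only [Finset.mul_sum]
  rw [Finset.sum_comm]
  refine Finset.sum_congr rfl fun s hs => ?_
  have e : ∀ v, A v * (z s * ((if s.2 = v then 1 else 0) - if s.1 = v then 1 else 0)) =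
      z s * ((if s.2 = v then A v else 0) - if s.1 = v then A v else 0) := by
    intro v
    split_ifs <;> ring
  simp only [e]
  rw [← Finset.mul_sum, Finset.sum_sub_distrib, Finset.sum_ite_eq, Finset.sum_ite_eq,
    if_pos (snd_mem_endpoints hs), if_pos (fst_mem_endpoints hs)]

/-- A small move of the viewpoint changes each subtended angle by a difference of turns at the ends;
weighted by a circulation, the differences sum to zero. -/
theorem eventually_winding_eq (hz : ∀ v ∈ endpoints H, flux H z v = 0) {x₀ : Plane}
    (hx : x₀ ∉ carrier H) : ∀ᶠ x in 𝓝 x₀, winding H z x = winding H z x₀ := by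
  have hev := (H.eventually_all (l := 𝓝 x₀)).2 fun s hs =>
    eventually_subtend_sub (notMem_segment_of_notMem_carrier hx hs)
  filter_upwards [hev] with x h
  rw [← sub_eq_zero]
  unfold winding
  rw [← Finset.sum_sub_distrib]
  calc ∑ s ∈ H, (z s * subtend s.1 s.2 x - z s * subtend s.1 s.2 x₀)
      = ∑ s ∈ H, z s * (turn s.2 x₀ x - turn s.1 x₀ x) :=
        Finset.sum_congr rfl fun s hs => by rw [← mul_sub, h s hs]
    _ = 0 := by
      rw [← sum_flux H z fun v => turn v x₀ x]
      exact Finset.sum_eq_zero fun v hv => by rw [hz v hv, mul_zero]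

theorem winding_eq_of_isPreconnected (hz : ∀ v ∈ endpoints H, flux H z v = 0) {A : Set Plane}
    (hA : IsPreconnected A) (hAH : ∀ x ∈ A, x ∉ carrier H) {x y : Plane} (hx : x ∈ A) (hy : y ∈ A) :
    winding H z x = winding H z y := by
  refine hA.induction₂ (fun x y => winding H z x = winding H z y) (fun x hx => ?_)
    (fun x y z _ _ _ h1 h2 => h1.trans h2) (fun x y _ _ h => h.symm) hx hy
  exact nhdsWithin_le_nhds ((eventually_winding_eq hz (hAH x hx)).mono fun _ h => h.symm)

theorem winding_eq_zero_of_unbounded (hz : ∀ v ∈ endpoints H, flux H z v = 0) {A : Set Plane}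
    (hA : IsPreconnected A) (hAH : ∀ x ∈ A, x ∉ carrier H) (hb : ¬ Bornology.IsBounded A)
    {x : Plane} (hx : x ∈ A) : winding H z x = 0 := by
  have ht : Tendsto (winding H z) (Bornology.cobounded Plane) (𝓝 0) := by
    have := tendsto_finsetSum H fun s _ => (tendsto_subtend_cobounded s.1 s.2).const_mul (z s)
    simp only [mul_zero, Finset.sum_const_zero] at this
    exact this
  have hfr : ∃ᶠ y in Bornology.cobounded Plane, winding H z y = winding H z x := by
    intro h
    apply hb
    rw [Bornology.isBounded_def]
    filter_upwards [h] with y hy hyA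
    exact hy (winding_eq_of_isPreconnected hz hA hAH hyA hx)
  by_contra hne
  exact hfr ((ht.eventually (isOpen_ne.mem_nhds (Ne.symm hne))).mono fun y hy => hy)

variable {O : Set Plane} {Vt : Finset Plane} {L : Finset (ℝ × ℝ × ℝ)}
  {G : Finset (Plane × Plane)}

/-- A flow without sources on the medial axis, whose winding function vanishes on the obstacles,
vanishes. -/
theorem Tame.eq_zero_of_winding_eq_zero (T : Tame O Vt L) (hGc : IsSegmentComplex G)
    (hG : carrier G = closure (medialAxis O)) (hHG : H ⊆ G) (hHM : carrier H ⊆ medialAxis O)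
    (hz : ∀ v ∈ endpoints H, flux H z v = 0) (hO : ∀ q ∈ O, winding H z q = 0) :
    ∀ s ∈ H, z s = 0 := by
  classical
  -- The only contact point of `x` can be reached along a segment that avoids the axis.
  have hoff : ∀ x, x ∉ O → x ∉ medialAxis O → winding H z x = 0 := by
    intro x hxO hxM
    obtain ⟨q, hq⟩ := exists_foot_eq_singleton T.closed T.nonempty hxO hxM
    have hqf : q ∈ foot O x := hq ▸ rfl
    rw [winding_eq_of_isPreconnected hz (convex_segment x q).isPreconnected ?_
      (left_mem_segment _ _ _) (right_mem_segment _ _ _)]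
    · exact hO q (foot_subset _ _ hqf)
    · intro y hy hyH
      rw [segment_eq_image'] at hy
      obtain ⟨t, ⟨h0, h1⟩, rfl⟩ := hy
      refine notMem_medialAxis_of_subset_singleton (c := q) T.closed T.nonempty ?_ (hHM hyH)
      exact (foot_walk_subset hqf h0 h1).trans hq.le
  intro e he
  set c : Plane := (1 / 2 : ℝ) • e.1 + (1 / 2 : ℝ) • e.2
  set h : Plane := (1 / 2 : ℝ) • (e.2 - e.1)
  have hne := hGc.1 e (hHG he)
  have hh : h ≠ 0 := smul_ne_zero (by norm_num) (sub_ne_zero.2 hne.symm)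
  have e1 : c - h = e.1 := by simp only [c, h]; module
  have e2 : c + h = e.2 := by simp only [c, h]; module
  have hce : c ∈ openSegment ℝ e.1 e.2 :=
    ⟨1 / 2, 1 / 2, by norm_num, by norm_num, by norm_num, rfl⟩
  have hce' := openSegment_subset_segment ℝ _ _ hce
  have hother : ∀ s ∈ G, s ≠ e → c ∉ segment ℝ s.1 s.2 := by
    intro s hs hse hcs
    rcases (hGc.2 s hs e (hHG he) hse ⟨hcs, hce'⟩).2 with hc | hc
    · rw [hc] at hce
      exact hne (left_mem_openSegment_iff.1 hce)
    · rw [hc] at hce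
      exact hne (right_mem_openSegment_iff.1 hce)
  set γ : ℝ → Plane := fun η => c + η • (-h.2, h.1)
  have hγ : Tendsto γ (𝓝 0) (𝓝 c) := by
    have hc : Continuous γ := by fun_prop
    have := hc.tendsto 0
    simp only [γ, zero_smul, add_zero] at this
    exact this
  have hcM : c ∈ medialAxis O := hHM (mem_iUnion₂.2 ⟨e, he, hce'⟩)
  -- close to the middle of `e`, off `e`, the winding function vanishes
  have hzero : ∀ᶠ η in 𝓝 (0 : ℝ), η ≠ 0 → winding H z (γ η) = 0 := by
    have hG' := (G.eventually_all (l := 𝓝 (0 : ℝ))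
      (p := fun s η => s ≠ e → γ η ∉ segment ℝ s.1 s.2)).2 fun s hs => by
        by_cases hse : s = e
        · exact Eventually.of_forall fun η h => absurd hse h
        · exact (hγ.eventually ((isClosed_segment s.1 s.2).isOpen_compl.mem_nhds
            (hother s hs hse))).mono fun η h _ => h
    filter_upwards [hG', hγ.eventually (T.closed.isOpen_compl.mem_nhds
      (medialAxis_subset_compl hcM))] with η h1 h2 hη
    refine hoff _ h2 fun hM => ?_
    have := subset_closure hM
    rw [← hG] at this
    obtain ⟨s, hs, hsγ⟩ := mem_iUnion₂.1 this
    by_cases hse : s = e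
    · rw [hse, ← e1, ← e2, segment_eq_image'] at hsγ
      obtain ⟨t, -, ht⟩ := hsγ
      have h3 : (2 * t - 1) • h = η • ((-h.2, h.1) : Plane) := by
        have h4 : c - h + t • (c + h - (c - h)) = c + (2 * t - 1) • h := by module
        dsimp only at ht
        rw [h4] at ht
        exact add_left_cancel ht
      have h5 := congrArg (fun v => cross v h) h3
      simp only [cross_smul_left, cross_self, mul_zero] at h5
      have h6 : cross (-h.2, h.1) h ≠ 0 := by
        intro h0
        simp only [cross] at h0
        apply hh
        ext
        · simp only [Prod.fst_zero]; nlinarith [sq_nonneg h.1, sq_nonneg h.2]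
        · simp only [Prod.snd_zero]; nlinarith [sq_nonneg h.1, sq_nonneg h.2]
      exact (mul_ne_zero hη h6) h5.symm
    · exact h1 s hs hse hsγ
  -- the other segments contribute continuously
  set R : Plane → ℝ := fun x => ∑ s ∈ H.erase e, z s * subtend s.1 s.2 x
  have hR : Tendsto (fun η => R (γ η)) (𝓝 0) (𝓝 (R c)) := by
    refine tendsto_finsetSum _ fun s hs => ?_
    obtain ⟨hse, hs⟩ := Finset.mem_erase.1 hs
    exact ((continuousAt_subtend (hother s (hHG hs) hse)).tendsto.comp hγ).const_mul (z s)
  have hsplit : ∀ x, winding H z x = z e * subtend (c - h) (c + h) x + R x := by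
    intro x
    rw [e1, e2]
    exact (Finset.add_sum_erase H (fun s => z s * subtend s.1 s.2 x) he).symm
  -- The one-sided limits at the middle of `e` are both zero, while the term of `e` tends to `π` and
  -- `-π` times its flow.
  have hleft : z e * π + R c = 0 := by
    refine tendsto_nhds_unique (((tendsto_subtend_left c h hh).const_mul (z e)).add
      (hR.mono_left nhdsWithin_le_nhds)) ?_
    refine tendsto_const_nhds.congr' ?_
    filter_upwards [nhdsWithin_le_nhds hzero, self_mem_nhdsWithin] with η g1 g2
    rw [← hsplit]
    exact (g1 (ne_of_gt g2)).symm
  have hright : z e * -π + R c = 0 := by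
    refine tendsto_nhds_unique (((tendsto_subtend_right c h hh).const_mul (z e)).add
      (hR.mono_left nhdsWithin_le_nhds)) ?_
    refine tendsto_const_nhds.congr' ?_
    filter_upwards [nhdsWithin_le_nhds hzero, self_mem_nhdsWithin] with η g1 g2
    rw [← hsplit]
    exact (g1 (ne_of_lt g2)).symm
  have : z e * π = 0 := by linarith
  exact (mul_eq_zero.1 this).resolve_right pi_ne_zero

/-- The medial axis of obstacles with at most `m` bounded pieces has at most `m` independent
cycles. -/
theorem Tame.card_add_one_le (T : Tame O Vt L) (hGc : IsSegmentComplex G)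
    (hG : carrier G = closure (medialAxis O)) (hHG : H ⊆ G) (hHM : carrier H ⊆ medialAxis O)
    {m : ℕ} (hm : 1 ≤ m) (x : Fin m → Plane)
    (hO : ∀ q ∈ O, ∃ A ⊆ O, IsPreconnected A ∧ q ∈ A ∧
      (¬ Bornology.IsBounded A ∨ ∃ i, x i ∈ A)) :
    H.card + 1 ≤ (endpoints H).card + m := by
  classical
  rcases H.eq_empty_or_nonempty with rfl | ⟨s₀, hs₀⟩
  · simp only [Finset.card_empty]; omega
  have hv₀ := fst_mem_endpoints hs₀
  set v₀ := s₀.1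
  set ext : (H → ℝ) → Plane × Plane → ℝ := fun z s => if h : s ∈ H then z ⟨s, h⟩ else 0 with hext
  have hlin : ∀ (f : Plane × Plane → ℝ), ∃ φ : (H → ℝ) →ₗ[ℝ] ℝ,
      ∀ z, φ z = ∑ s ∈ H, ext z s * f s := by
    intro f
    refine ⟨∑ s : H, f s • LinearMap.proj s, fun z => ?_⟩
    rw [← Finset.sum_coe_sort H fun s => ext z s * f s]
    simp only [LinearMap.sum_apply, LinearMap.smul_apply, LinearMap.proj_apply, smul_eq_mul]
    exact Finset.sum_congr rfl fun s _ => by simp [hext, mul_comm]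
  choose φ hφ using fun v : Plane => hlin fun s =>
    ((if s.2 = v then 1 else 0) - if s.1 = v then 1 else 0)
  choose ψ hψ using fun i : Fin m => hlin fun s => subtend s.1 s.2 (x i)
  -- Fluxes and the winding numbers around the `m` pieces. One vertex may be omitted because all
  -- fluxes sum to zero; this yields the `+ 1`.
  set Φ : (H → ℝ) →ₗ[ℝ] (((endpoints H).erase v₀ : Finset Plane) → ℝ) × (Fin m → ℝ) :=
    (LinearMap.pi fun v : ((endpoints H).erase v₀ : Finset Plane) => φ (v : Plane)).prod (LinearMap.pi ψ)
  have hinj : Function.Injective Φ := by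
    rw [← LinearMap.ker_eq_bot, LinearMap.ker_eq_bot']
    intro z hz
    have hflux' : ∀ v ∈ (endpoints H).erase v₀, flux H (ext z) v = 0 := by
      intro v hv
      have := congrFun (congrArg Prod.fst hz) ⟨v, hv⟩
      exact (hφ v z).symm.trans this
    have hflux : ∀ v ∈ endpoints H, flux H (ext z) v = 0 := by
      intro v hv
      by_cases hvv : v = v₀
      · have h1 := sum_flux H (ext z) fun _ => 1
        simp only [one_mul, sub_self, mul_zero, Finset.sum_const_zero] at h1
        rw [← Finset.add_sum_erase _ _ hv₀, Finset.sum_eq_zero hflux', add_zero] at h1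
        rw [hvv, h1]
      · exact hflux' v (Finset.mem_erase.2 ⟨hvv, hv⟩)
    have hx : ∀ i, winding H (ext z) (x i) = 0 := by
      intro i
      have := congrFun (congrArg Prod.snd hz) i
      exact (hψ i z).symm.trans this
    have h0 := T.eq_zero_of_winding_eq_zero hGc hG hHG hHM hflux fun q hq => by
      obtain ⟨A, hAO, hA, hqA, h⟩ := hO q hq
      have hAH : ∀ y ∈ A, y ∉ carrier H := fun y hy h => medialAxis_subset_compl (hHM h) (hAO hy)
      rcases h with h | ⟨i, hi⟩
      · exact winding_eq_zero_of_unbounded hflux hA hAH h hqA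
      · rw [winding_eq_of_isPreconnected hflux hA hAH hqA hi, hx i]
    funext s
    have := h0 s s.2
    simpa [hext] using this
  have hle := LinearMap.finrank_le_finrank_of_injective hinj
  rw [Module.finrank_prod, Module.finrank_pi, Module.finrank_pi, Module.finrank_pi,
    Fintype.card_coe, Fintype.card_coe, Fintype.card_fin, Finset.card_erase_of_mem hv₀] at hle
  have := Finset.card_pos.2 ⟨v₀, hv₀⟩
  omega

end Corridor
end

/-! ### Connectedness of the free space -/

noncomputable section
open Set Filter Topology Real
namespace Corridor

/-! ### Complements of disjoint unions -/

theorem exists_continuous_lift {g : Plane → AddCircle (1 : ℝ)} (hg : Continuous g) :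
    ∃ h : Plane → ℝ, Continuous h ∧ ∀ x, (h x : AddCircle (1 : ℝ)) = g x := by
  obtain ⟨e₀, he⟩ := QuotientAddGroup.mk_surjective (g 0)
  obtain ⟨F, ⟨-, hF⟩, -⟩ := (AddCircle.isCoveringMap_coe (1 : ℝ)).existsUnique_continuousMap_lifts
    (f := ⟨g, hg⟩) (a₀ := (0 : Plane)) (e₀ := e₀) he
  exact ⟨F, F.continuous, fun x => congrFun hF x⟩

theorem exists_int_eq_of_coe_eq {x y : ℝ} (h : (x : AddCircle (1 : ℝ)) = y) :
    ∃ k : ℤ, x - y = k := by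
  have h' : ((x - y : ℝ) : AddCircle (1 : ℝ)) = 0 := by
    rw [AddCircle.coe_sub, h, sub_self]
  obtain ⟨k, hk⟩ := (AddCircle.coe_eq_zero_iff (1 : ℝ)).1 h'
  exact ⟨k, by rw [← hk]; simp⟩

/-- On a preconnected set a continuous function with integral values is constant. -/
theorem eq_of_isPreconnected_of_int {f : Plane → ℝ} {U : Set Plane} (hU : IsPreconnected U)
    (hf : ContinuousOn f U) (hint : ∀ x ∈ U, ∃ k : ℤ, f x = k) {x y : Plane} (hx : x ∈ U)
    (hy : y ∈ U) : f x = f y := by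
  refine hU.induction₂ (fun x y => f x = f y) (fun x hx => ?_)
    (fun x y z _ _ _ h1 h2 => h1.trans h2) (fun x y _ _ h => h.symm) hx hy
  filter_upwards [(hf x hx).eventually (Metric.ball_mem_nhds (f x) one_pos),
    self_mem_nhdsWithin] with y hy hyU
  obtain ⟨k, hk⟩ := hint x hx
  obtain ⟨l, hl⟩ := hint y hyU
  rw [hk, hl, Real.dist_eq] at hy
  have : |l - k| < 1 := by exact_mod_cast hy
  have := Int.abs_lt_one_iff.1 this
  rw [hk, hl]
  exact_mod_cast (sub_eq_zero.1 this).symm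

/-- The plane is unicoherent: if two disjoint closed sets do not separate it, then neither does
their union. -/
theorem isPreconnected_compl_union {A B : Set Plane} (hA : IsClosed A) (hB : IsClosed B)
    (hAB : Disjoint A B) (hA' : IsPreconnected Aᶜ) (hB' : IsPreconnected Bᶜ) :
    IsPreconnected (A ∪ B)ᶜ := by
  classical
  have hopen : IsOpen (A ∪ B)ᶜ := (hA.union hB).isOpen_compl
  rw [isPreconnected_iff_subset_of_disjoint]
  intro U₀ V₀ hU₀ hV₀ hsub hdisj
  by_contra hcon
  push Not at hcon
  obtain ⟨⟨b, hb, hbU⟩, ⟨a, ha, haV⟩⟩ : (∃ b ∈ (A ∪ B)ᶜ, b ∉ U₀) ∧ ∃ a ∈ (A ∪ B)ᶜ, a ∉ V₀ :=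
    ⟨not_subset.1 hcon.1, not_subset.1 hcon.2⟩
  set W := (A ∪ B)ᶜ ∩ U₀
  have hW : IsOpen W := hopen.inter hU₀
  have hW' : IsOpen ((A ∪ B)ᶜ ∩ V₀) := hopen.inter hV₀
  have hcov : ∀ x ∉ A ∪ B, x ∉ W → x ∈ (A ∪ B)ᶜ ∩ V₀ := fun x hx hxW =>
    ⟨hx, (hsub hx).resolve_left fun h => hxW ⟨hx, h⟩⟩
  have hdis : ∀ x ∈ (A ∪ B)ᶜ ∩ V₀, x ∉ W := fun x hx hxW => by
    have : x ∈ (A ∪ B)ᶜ ∩ (U₀ ∩ V₀) := ⟨hx.1, hxW.2, hx.2⟩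
    rw [hdisj] at this
    exact this
  have haW : a ∈ W := ⟨ha, (hsub ha).resolve_right haV⟩
  have hbW : b ∉ W := fun h => hbU h.2
  obtain ⟨f, hfA, hfB, -⟩ := exists_continuous_zero_one_of_isClosed hA hB hAB
  have hfc : Continuous f := f.continuous
  -- `j` is locally `f` or `i` off the set on which `f = i`
  have key : ∀ (Y : Type) [TopologicalSpace Y] (i : ℝ) (j : ℝ → Y), Continuous j →
      ∀ x, (x ∉ A ∪ B ∨ j (f x) = j i) →
      ContinuousAt (fun x => if x ∈ W then j (f x) else j i) x := by
    intro Y _ i j hj x hx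
    by_cases hxAB : x ∈ A ∪ B
    · have hxi := hx.resolve_left (not_not.2 hxAB)
      have hval : (if x ∈ W then j (f x) else j i) = j i := if_neg fun h => h.1 hxAB
      intro N hN
      dsimp only at hN
      rw [hval] at hN
      have h1 : ∀ᶠ y in 𝓝 x, j (f y) ∈ N :=
        (hj.comp hfc).continuousAt (by rw [Function.comp_apply, hxi]; exact hN)
      refine h1.mono fun y hy => ?_
      change (if y ∈ W then j (f y) else j i) ∈ N
      split_ifs
      · exact hy
      · exact mem_of_mem_nhds hN
    · by_cases hxW : x ∈ W
      · refine ((hj.comp hfc).continuousAt (x := x)).congr ?_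
        filter_upwards [hW.mem_nhds hxW] with y hy
        exact (if_pos hy).symm
      · refine (continuousAt_const (y := j i)).congr ?_
        filter_upwards [hW'.mem_nhds (hcov x hxAB hxW)] with y hy
        exact (if_neg (hdis y hy)).symm
  have h01 : ((0 : ℝ) : AddCircle (1 : ℝ)) = ((1 : ℝ) : AddCircle (1 : ℝ)) := by
    rw [AddCircle.coe_period, AddCircle.coe_zero]
  -- Here `f` is a Urysohn function and `W` one part of a supposed separation. Modulo 1, the
  -- function `f` on `W` and 0 elsewhere is continuous, since `f` is an integer on `A ∪ B`. A real
  -- lift `h` differs by a constant from `f` on `W`, 0 elsewhere, on the complement of `B`, and from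
  -- `f` on `W`, 1 elsewhere, on that of `A`. Evaluated at `a ∈ W` and `b ∉ W`, this is
  -- contradictory.
  obtain ⟨h, hc, hh⟩ := exists_continuous_lift
    (g := fun x => if x ∈ W then ((f x : ℝ) : AddCircle (1 : ℝ)) else ((0 : ℝ) : AddCircle (1 : ℝ)))
    (continuous_iff_continuousAt.2 fun x =>
      key _ 0 (fun t => (t : AddCircle (1 : ℝ))) (AddCircle.continuous_mk' 1) x (by
        by_cases hx : x ∈ A ∪ B
        · right
          rcases hx with hx | hx
          · rw [hfA hx]; rfl
          · rw [hfB hx]; exact h01.symm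
        · exact .inl hx))
  have h1 : h a - f a = h b - 0 := by
    have := eq_of_isPreconnected_of_int (f := fun x => h x - if x ∈ W then f x else 0) hB'
      (fun x hx => (hc.continuousAt.sub (key ℝ 0 id continuous_id x (by
        by_cases hxA : x ∈ A
        · exact .inr (hfA hxA)
        · exact .inl fun h => h.elim hxA hx))).continuousWithinAt)
      (fun x hx => exists_int_eq_of_coe_eq (by rw [hh]; split_ifs <;> rfl))
      (fun h => haW.1 (.inr h)) (fun h => hb (.inr h)) (x := a) (y := b)
    rwa [if_pos haW, if_neg hbW] at this
  have h2 : h a - f a = h b - 1 := by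
    have := eq_of_isPreconnected_of_int (f := fun x => h x - if x ∈ W then f x else 1) hA'
      (fun x hx => (hc.continuousAt.sub (key ℝ 1 id continuous_id x (by
        by_cases hxB : x ∈ B
        · exact .inr (hfB hxB)
        · exact .inl fun h => h.elim hx hxB))).continuousWithinAt)
      (fun x hx => exists_int_eq_of_coe_eq (by rw [hh]; split_ifs <;> [rfl; exact h01]))
      (fun h => haW.1 (.inl h)) (fun h => hb (.inl h)) (x := a) (y := b)
    rwa [if_pos haW, if_neg hbW] at this
  linarith

theorem isPreconnected_compl_biUnion {ι : Type*} (s : Finset ι) {A : Set Plane} {B : ι → Set Plane}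
    (hA : IsClosed A) (hA' : IsPreconnected Aᶜ) (hB : ∀ i, IsClosed (B i))
    (hB' : ∀ i, IsPreconnected (B i)ᶜ) (hAB : ∀ i, Disjoint A (B i))
    (hBB : ∀ i j, i ≠ j → Disjoint (B i) (B j)) : IsPreconnected (A ∪ ⋃ i ∈ s, B i)ᶜ := by
  classical
  induction s using Finset.induction_on with
  | empty => simpa using hA'
  | insert i s his ih =>
    rw [Finset.set_biUnion_insert, union_left_comm, union_comm]
    refine isPreconnected_compl_union
      (hA.union (s.finite_toSet.isClosed_biUnion fun j _ => hB j)) (hB i) ?_ ih (hB' i)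
    refine disjoint_union_left.2 ⟨hAB i, disjoint_iUnion₂_left.2 fun j hj => hBB j i ?_⟩
    rintro rfl
    exact his hj

/-! ### Polygonal regions -/

theorem isPreconnected_compl_closedBall (r : ℝ) :
    IsPreconnected (Metric.closedBall (0 : Plane) r)ᶜ := by
  have e : (Metric.closedBall (0 : Plane) r)ᶜ =
      (({x : Plane | r < x.1} ∪ {x | r < x.2}) ∪ {x | x.1 < -r}) ∪ {x | x.2 < -r} := by
    ext x
    simp only [mem_compl_iff, Metric.mem_closedBall, dist_zero_right, Prod.norm_def, max_le_iff,
      Real.norm_eq_abs, not_and_or, not_le, lt_abs, mem_union, mem_ofPred_eq]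
    constructor
    · rintro ((h | h) | (h | h))
      · exact .inl (.inl (.inl h))
      · exact .inl (.inr (by linarith))
      · exact .inl (.inl (.inr h))
      · exact .inr (by linarith)
    · rintro (((h | h) | h) | h)
      · exact .inl (.inl h)
      · exact .inr (.inl h)
      · exact .inl (.inr (by linarith))
      · exact .inr (.inr (by linarith))
  have h1 : IsPreconnected {x : Plane | r < x.1} :=
    (convex_halfSpace_gt (f := fun x : Plane => x.1) ⟨fun _ _ => rfl, fun _ _ => rfl⟩ r).isPreconnected
  have h2 : IsPreconnected {x : Plane | r < x.2} :=
    (convex_halfSpace_gt (f := fun x : Plane => x.2) ⟨fun _ _ => rfl, fun _ _ => rfl⟩ r).isPreconnected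
  have h3 : IsPreconnected {x : Plane | x.1 < -r} :=
    (convex_halfSpace_lt (f := fun x : Plane => x.1) ⟨fun _ _ => rfl, fun _ _ => rfl⟩
      (-r)).isPreconnected
  have h4 : IsPreconnected {x : Plane | x.2 < -r} :=
    (convex_halfSpace_lt (f := fun x : Plane => x.2) ⟨fun _ _ => rfl, fun _ _ => rfl⟩
      (-r)).isPreconnected
  have g1 : r < r + 1 := by linarith
  have g2 : -r - 1 < -r := by linarith
  rw [e]
  refine IsPreconnected.union (-r - 1, -r - 1) (.inr g2) g2
    (IsPreconnected.union (-r - 1, r + 1) (.inr g1) g2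
      (IsPreconnected.union (r + 1, r + 1) g1 g1 h1 h2) h3) h4

/-- A bounded set together with the bounded components of its complement does not separate the
plane. -/
theorem isPreconnected_unbounded {B : Set Plane} (hb : Bornology.IsBounded B) :
    IsPreconnected {x | x ∈ B ∨ Bornology.IsBounded (connectedComponentIn Bᶜ x)}ᶜ := by
  obtain ⟨r, hr⟩ := hb.subset_closedBall 0
  have hout : (Metric.closedBall (0 : Plane) r)ᶜ ⊆ Bᶜ := compl_subset_compl.2 hr
  by_cases hne : {x | x ∈ B ∨ Bornology.IsBounded (connectedComponentIn Bᶜ x)}ᶜ = ∅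
  · rw [hne]; exact isPreconnected_empty
  obtain ⟨x, hx⟩ := nonempty_iff_ne_empty.2 hne
  -- every unbounded component contains the outside of a large ball
  have hmem : ∀ y, y ∉ B → ¬ Bornology.IsBounded (connectedComponentIn Bᶜ y) →
      (Metric.closedBall (0 : Plane) r)ᶜ ⊆ connectedComponentIn Bᶜ y := by
    intro y hy hyb
    obtain ⟨w, hw, hwr⟩ := not_subset.1 fun h => hyb (Metric.isBounded_closedBall.subset h)
    rw [connectedComponentIn_eq hw]
    exact (isPreconnected_compl_closedBall r).subset_connectedComponentIn hwr hout
  have hx1 : x ∉ B := fun h => hx (.inl h)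
  have hx2 : ¬ Bornology.IsBounded (connectedComponentIn Bᶜ x) := fun h => hx (.inr h)
  have e : {x | x ∈ B ∨ Bornology.IsBounded (connectedComponentIn Bᶜ x)}ᶜ =
      connectedComponentIn Bᶜ x := by
    apply Subset.antisymm
    · intro y hy
      have hy1 : y ∉ B := fun h => hy (.inl h)
      have hy2 : ¬ Bornology.IsBounded (connectedComponentIn Bᶜ y) := fun h => hy (.inr h)
      obtain ⟨w, hw, hwr⟩ := not_subset.1 fun h => hy2 (Metric.isBounded_closedBall.subset h)
      have h1 := connectedComponentIn_eq hw
      have h2 := connectedComponentIn_eq (hmem x hx1 hx2 hwr)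
      rw [h2, ← h1]
      exact mem_connectedComponentIn hy1
    · intro y hy hyR
      rcases hyR with h | h
      · exact connectedComponentIn_subset _ _ hy h
      · rw [← connectedComponentIn_eq hy] at h
        exact hx2 h
  rw [e]
  exact isPreconnected_connectedComponentIn

end Corridor
end

/-! ### Topology of the frame and of polygonal regions -/

noncomputable section
open Set Filter Topology Real
namespace Corridor

/-! ### The frame -/

section Frame
variable {c d x : Plane}

/-- The first coordinate in the frame with origin `c` and first basis vector `d`. -/
def frameFst (c d x : Plane) : ℝ := (d.1 * (x.1 - c.1) + d.2 * (x.2 - c.2)) / (d.1 ^ 2 + d.2 ^ 2)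

/-- The second coordinate in the frame with origin `c` and first basis vector `d`. -/
def frameSnd (c d x : Plane) : ℝ := (d.1 * (x.2 - c.2) - d.2 * (x.1 - c.1)) / (d.1 ^ 2 + d.2 ^ 2)

theorem continuous_frameFst (c d : Plane) : Continuous (frameFst c d) := by
  unfold frameFst
  fun_prop

theorem continuous_frameSnd (c d : Plane) : Continuous (frameSnd c d) := by
  unfold frameSnd
  fun_prop

variable (hd : d.1 ≠ 0)
include hd

theorem frame_norm_pos : 0 < d.1 ^ 2 + d.2 ^ 2 := by positivity

theorem frame_repr (c x : Plane) :
    x = c + frameFst c d x • d + frameSnd c d x • ((-d.2, d.1) : Plane) := by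
  have := (frame_norm_pos hd).ne'
  unfold frameFst frameSnd
  ext
  · simp only [Prod.fst_add, Prod.smul_fst, smul_eq_mul]
    field_simp
    ring
  · simp only [Prod.snd_add, Prod.smul_snd, smul_eq_mul]
    field_simp
    ring

theorem frameFst_add (c x : Plane) (s t : ℝ) :
    frameFst c d (x + s • d + t • ((-d.2, d.1) : Plane)) = frameFst c d x + s := by
  have := (frame_norm_pos hd).ne'
  simp only [frameFst, Prod.fst_add, Prod.smul_fst, Prod.snd_add, Prod.smul_snd, smul_eq_mul]
  field_simp
  ring

theorem frameSnd_add (c x : Plane) (s t : ℝ) :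
    frameSnd c d (x + s • d + t • ((-d.2, d.1) : Plane)) = frameSnd c d x + t := by
  have := (frame_norm_pos hd).ne'
  simp only [frameSnd, Prod.fst_add, Prod.smul_fst, Prod.snd_add, Prod.smul_snd, smul_eq_mul]
  field_simp
  ring

theorem frameSnd_add_smul (c x : Plane) (s : ℝ) : frameSnd c d (x + s • d) = frameSnd c d x := by
  have := frameSnd_add hd c x s 0
  rwa [zero_smul, add_zero, add_zero] at this

theorem frameFst_add_smul_perp (c x : Plane) (t : ℝ) :
    frameFst c d (x + t • ((-d.2, d.1) : Plane)) = frameFst c d x := by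
  have := frameFst_add hd c x 0 t
  rwa [zero_smul, add_zero, add_zero] at this

theorem mem_openSquare : x ∈ openSquare c d ↔ |frameFst c d x| < 1 ∧ |frameSnd c d x| < 1 := by
  constructor
  · rintro ⟨s, t, hs, ht, rfl⟩
    have h1 : frameFst c d c = 0 := by simp [frameFst]
    have h2 : frameSnd c d c = 0 := by simp [frameSnd]
    rw [frameFst_add hd, frameSnd_add hd, h1, h2, zero_add, zero_add]
    exact ⟨hs, ht⟩
  · rintro ⟨h1, h2⟩
    exact ⟨_, _, h1, h2, frame_repr hd c x⟩

theorem isOpen_openSquare (c : Plane) : IsOpen (openSquare c d) := by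
  have : openSquare c d = {x | |frameFst c d x| < 1} ∩ {x | |frameSnd c d x| < 1} := by
    ext x
    exact mem_openSquare hd
  rw [this]
  exact (isOpen_lt (continuous_frameFst c d).abs continuous_const).inter
    (isOpen_lt (continuous_frameSnd c d).abs continuous_const)

omit hd in
theorem convex_openSquare (c d : Plane) : Convex ℝ (openSquare c d) := by
  rintro _ ⟨s, t, hs, ht, rfl⟩ _ ⟨s', t', hs', ht', rfl⟩ a b ha hb hab
  have key : ∀ {u v : ℝ}, |u| < 1 → |v| < 1 → |a * u + b * v| < 1 := by
    intro u v hu hv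
    have := convex_ball (0 : ℝ) 1 (x := u) (by simpa using hu) (y := v) (by simpa using hv) ha hb hab
    simpa using this
  refine ⟨a * s + b * s', a * t + b * t', key hs hs', key ht ht', ?_⟩
  obtain rfl : b = 1 - a := by linarith
  module

omit hd in
theorem isBounded_openSquare (c d : Plane) : Bornology.IsBounded (openSquare c d) := by
  refine Metric.isBounded_iff_subset_closedBall c |>.2 ⟨‖d‖ + ‖((-d.2, d.1) : Plane)‖, ?_⟩
  rintro _ ⟨s, t, hs, ht, rfl⟩
  rw [Metric.mem_closedBall, dist_eq_norm]
  have e : c + s • d + t • ((-d.2, d.1) : Plane) - c = s • d + t • ((-d.2, d.1) : Plane) := by abel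
  rw [e]
  refine (norm_add_le _ _).trans (add_le_add ?_ ?_)
  · rw [norm_smul, Real.norm_eq_abs]
    exact mul_le_of_le_one_left (norm_nonneg _) hs.le
  · rw [norm_smul, Real.norm_eq_abs]
    exact mul_le_of_le_one_left (norm_nonneg _) ht.le

theorem center_mem_openSquare (c : Plane) : c ∈ openSquare c d :=
  (mem_openSquare hd).2 (by simp [frameFst, frameSnd])

/-- A point outside the square lies on a ray outside the square. -/
theorem exists_unbounded_of_notMem_openSquare (hx : x ∉ openSquare c d) :
    ∃ A ⊆ (openSquare c d)ᶜ, IsPreconnected A ∧ x ∈ A ∧ ¬ Bornology.IsBounded A := by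
  have hxc : x - c ≠ 0 := fun h => hx (sub_eq_zero.1 h ▸ center_mem_openSquare hd c)
  refine ⟨(fun t : ℝ => c + t • (x - c)) '' Ici 1, ?_, ?_, ⟨1, self_mem_Ici, by simp⟩, ?_⟩
  · rintro _ ⟨t, ht, rfl⟩ hmem
    have ht : 1 ≤ t := ht
    have ht0 : 0 < t := by linarith
    apply hx
    have := convex_openSquare c d (center_mem_openSquare hd c) hmem
      (a := 1 - 1 / t) (b := 1 / t) (by
        rw [sub_nonneg, div_le_one ht0]; exact ht) (by positivity) (by ring)
    have e : (1 - 1 / t) • c + (1 / t) • (c + t • (x - c)) = x := by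
      rw [smul_add, smul_smul, one_div_mul_cancel ht0.ne']
      module
    rwa [e] at this
  · exact isPreconnected_Ici.image _ (by fun_prop)
  · intro hb
    obtain ⟨r, hr⟩ := hb.subset_closedBall c
    have hpos := norm_pos_iff.2 hxc
    have h1 := hr ⟨|r| / ‖x - c‖ + 1, by
      change 1 ≤ |r| / ‖x - c‖ + 1
      have : 0 ≤ |r| / ‖x - c‖ := by positivity
      linarith, rfl⟩
    have h2 : 0 ≤ |r| / ‖x - c‖ := by positivity
    rw [Metric.mem_closedBall, dist_eq_norm, add_sub_cancel_left, norm_smul, Real.norm_eq_abs,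
      abs_of_nonneg (by linarith), add_mul, div_mul_cancel₀ _ hpos.ne', one_mul] at h1
    linarith [le_abs_self r]

end Frame

/-! ### Polygons -/

section Polygon
variable {n : ℕ} (P : Polygon Plane n)

theorem edgeSet_eq_segment (k : Fin n) : P.edgeSet ℝ k = segment ℝ (P k) (P (finRotate n k)) :=
  affineSegment_eq_segment ℝ _ _

theorem edgeSet_subset_boundary (k : Fin n) : P.edgeSet ℝ k ⊆ P.boundary ℝ :=
  subset_iUnion (fun k => P.edgeSet ℝ k) k

theorem isClosed_edgeSet (k : Fin n) : IsClosed (P.edgeSet ℝ k) := by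
  rw [edgeSet_eq_segment]
  exact isClosed_segment _ _

theorem isCompact_boundary : IsCompact (P.boundary ℝ) := by
  refine isCompact_iUnion fun k => ?_
  rw [edgeSet_eq_segment, segment_eq_image']
  exact isCompact_Icc.image (by fun_prop)

theorem vertex_mem_edgeSet (k : Fin n) : P k ∈ P.edgeSet ℝ k := by
  rw [edgeSet_eq_segment]
  exact left_mem_segment _ _ _

theorem isPreconnected_boundary : IsPreconnected (P.boundary ℝ) := by
  rcases n with _ | n
  · have : P.boundary ℝ = ∅ := iUnion_of_empty _
    rw [this]
    exact isPreconnected_empty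
  refine IsPreconnected.iUnion_of_chain (fun k => ?_) fun k => ?_
  · rw [edgeSet_eq_segment]
    exact (convex_segment _ _).isPreconnected
  -- The last index is its own successor, so the chain condition is trivial there.
  · rcases eq_or_ne k (Fin.last n) with rfl | hk
    · have : Order.succ (Fin.last n) = Fin.last n := Order.succ_eq_iff_isMax.2 fun x _ => Fin.le_last x
      rw [this, inter_self]
      exact ⟨_, vertex_mem_edgeSet P _⟩
    · have : Order.succ k = finRotate (n + 1) k := by
        refine CovBy.succ_eq (Fin.covBy_iff.2 ?_)
        rw [coe_finRotate_of_ne_last hk]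
        exact Order.covBy_add_one _
      refine ⟨P (Order.succ k), ?_, vertex_mem_edgeSet P _⟩
      rw [edgeSet_eq_segment, this]
      exact right_mem_segment _ _ _

theorem isOpen_component (x : Plane) : IsOpen (connectedComponentIn (P.boundary ℝ)ᶜ x) :=
  (isCompact_boundary P).isClosed.isOpen_compl.connectedComponentIn

theorem boundary_subset_region : P.boundary ℝ ⊆ region P := fun _ h => .inl h

theorem component_subset_region {x : Plane}
    (hb : Bornology.IsBounded (connectedComponentIn (P.boundary ℝ)ᶜ x)) :
    connectedComponentIn (P.boundary ℝ)ᶜ x ⊆ region P := fun y hy => by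
  right
  rwa [← connectedComponentIn_eq hy]

theorem mem_interior_region {x : Plane} (hx : x ∈ region P) (hxb : x ∉ P.boundary ℝ) :
    x ∈ interior (region P) :=
  mem_interior.2 ⟨_, component_subset_region P (hx.resolve_left hxb), isOpen_component P x,
    mem_connectedComponentIn hxb⟩

theorem isClosed_region : IsClosed (region P) := by
  rw [← isOpen_compl_iff, isOpen_iff_mem_nhds]
  intro x hx
  have hxb : x ∉ P.boundary ℝ := fun h => hx (.inl h)
  refine mem_of_superset ((isOpen_component P x).mem_nhds (mem_connectedComponentIn hxb)) ?_
  rintro y hy (h | h)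
  · exact connectedComponentIn_subset _ _ hy h
  · rw [← connectedComponentIn_eq hy] at h
    exact hx (.inr h)

theorem isPreconnected_compl_region : IsPreconnected (region P)ᶜ :=
  isPreconnected_unbounded (isCompact_boundary P).isBounded

/-- A bounded component off the chain is not the whole plane, so it has a frontier point, which is
on the chain; its closure together with the chain is connected. -/
theorem exists_isPreconnected_of_mem_region {x : Plane} (hx : x ∈ region P) (k : Fin n) :
    ∃ A ⊆ region P, IsPreconnected A ∧ x ∈ A ∧ P k ∈ A := by
  have hk : P k ∈ P.boundary ℝ := edgeSet_subset_boundary P k (vertex_mem_edgeSet P k)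
  by_cases hxb : x ∈ P.boundary ℝ
  · exact ⟨_, boundary_subset_region P, isPreconnected_boundary P, hxb, hk⟩
  have hb := hx.resolve_left hxb
  set C := connectedComponentIn (P.boundary ℝ)ᶜ x with hC
  have hxC : x ∈ C := mem_connectedComponentIn hxb
  have hfr : (frontier C).Nonempty := by
    rw [nonempty_frontier_iff]
    refine ⟨⟨x, hxC⟩, fun h => ?_⟩
    rw [h] at hb
    exact NormedSpace.noncompactSpace ℝ Plane |>.noncompact_univ
      (Metric.isCompact_of_isClosed_isBounded isClosed_univ hb)
  obtain ⟨p, hp⟩ := hfr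
  have hcl : closure C ⊆ C ∪ P.boundary ℝ := by
    intro y hy
    by_cases hyb : y ∈ P.boundary ℝ
    · exact .inr hyb
    · left
      obtain ⟨w, hw, hwC⟩ := mem_closure_iff.1 hy _ (isOpen_component P y)
        (mem_connectedComponentIn hyb)
      rw [hC, connectedComponentIn_eq hwC, ← connectedComponentIn_eq hw]
      exact mem_connectedComponentIn hyb
  have hpb : p ∈ P.boundary ℝ :=
    (hcl (frontier_subset_closure hp)).resolve_left fun h =>
      hp.2 ((isOpen_component P x).interior_eq.symm ▸ h)
  refine ⟨closure C ∪ P.boundary ℝ, ?_, ?_, .inl (subset_closure hxC), .inr hk⟩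
  · refine union_subset (hcl.trans (union_subset (component_subset_region P hb) ?_)) ?_
    all_goals exact boundary_subset_region P
  · exact IsPreconnected.union p (frontier_subset_closure hp) hpb
      isPreconnected_connectedComponentIn.closure (isPreconnected_boundary P)

end Polygon

end Corridor
end

/-! ### Polygonal scenes satisfy the abstract hypotheses -/

noncomputable section
open Set Filter Topology Real
namespace Corridor

/-! ### Polygonal obstacles -/

/-- Disjoint simple polygons in the interior of a frame, in general position. -/
structure IsScene (c d : Plane) {m : ℕ} {n : Fin m → ℕ} (P : ∀ i, Polygon Plane (n i)) : Prop where
  simple : ∀ i, IsSimple (P i)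
  disjoint : ∀ i j, i ≠ j → Disjoint (region (P i)) (region (P j))
  fst_ne : d.1 ≠ 0
  snd_ne : d.2 ≠ 0
  inside : ∀ i, region (P i) ⊆ openSquare c d
  inj_fst : Function.Injective fun v : Σ i, Fin (n i) => (P v.1 v.2).1
  inj_snd : Function.Injective fun v : Σ i, Fin (n i) => (P v.1 v.2).2

/-- Points slightly before `q` on the way from `x` are closer to `x`, hence not in `O`. -/
theorem notMem_interior_of_mem_foot {O : Set Plane} {x q : Plane} (hx : x ∉ O) (hq : q ∈ foot O x) :
    q ∉ interior O := by
  intro hi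
  have hc : Tendsto (fun t : ℝ => x + t • (q - x)) (𝓝[<] 1) (𝓝 q) := by
    have : Continuous fun t : ℝ => x + t • (q - x) := by fun_prop
    have := this.tendsto 1
    rw [one_smul, add_sub_cancel] at this
    exact this.mono_left nhdsWithin_le_nhds
  obtain ⟨t, ht, h0, h1⟩ := ((hc.eventually (mem_interior_iff_mem_nhds.1 hi)).and
    (Ioo_mem_nhdsLT (zero_lt_one (α := ℝ)))).exists
  have hpos : 0 < dist x q := dist_pos.2 fun h => hx (h ▸ foot_subset _ _ hq)
  have h2 := rad_le_dist (p := x) ht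
  rw [← (mem_foot.1 hq).1, dist_comm x (x + _), dist_eq_norm (x + _), add_sub_cancel_left, norm_smul,
    Real.norm_eq_abs, abs_of_pos h0, ← dist_eq_norm, dist_comm q x] at h2
  nlinarith

/-- Two segments of the boundary of `O` that end at `y`, and no other boundary near `y`. -/
theorem exists_rayPair {O : Set Plane} {y a b : Plane} (ha₁ : a.1 ≠ y.1) (ha₂ : a.2 ≠ y.2)
    (hb₁ : b.1 ≠ y.1) (hb₂ : b.2 ≠ y.2) (ha : segment ℝ y a ⊆ O) (hb : segment ℝ y b ⊆ O)
    (h : ∀ᶠ q in 𝓝 y, q ∈ O → q ∉ interior O → q ∈ segment ℝ y a ∪ segment ℝ y b) :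
    ∃ δ f₁ f₂, RayPair O y δ f₁ f₂ := by
  obtain ⟨δ, hδ, hball⟩ := Metric.eventually_nhds_iff_ball.1 h
  have hay : 0 < dist a y := dist_pos.2 fun e => ha₁ (congrArg Prod.fst e)
  have hby : 0 < dist b y := dist_pos.2 fun e => hb₁ (congrArg Prod.fst e)
  have hray : ∀ {e : Plane}, segment ℝ y e ⊆ O → ∀ {δ' : ℝ}, δ' ≤ dist e y → ∀ t : ℝ, 0 ≤ t →
      y + t • (e - y) ∈ Metric.ball y δ' → y + t • (e - y) ∈ O := by
    intro e he δ' hδ' t ht hmem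
    apply he
    rw [segment_eq_image']
    refine ⟨t, ⟨ht, ?_⟩, rfl⟩
    rw [Metric.mem_ball, dist_eq_norm, add_sub_cancel_left, norm_smul, Real.norm_eq_abs,
      abs_of_nonneg ht, ← dist_eq_norm] at hmem
    by_contra hcon
    push Not at hcon
    nlinarith [dist_nonneg (x := e) (y := y)]
  refine ⟨min δ (min (dist a y) (dist b y)), a - y, b - y, lt_min hδ (lt_min hay hby),
    ⟨sub_ne_zero.2 ha₁, sub_ne_zero.2 ha₂⟩, ⟨sub_ne_zero.2 hb₁, sub_ne_zero.2 hb₂⟩, ?_,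
    hray ha ((min_le_right _ _).trans (min_le_left _ _)),
    hray hb ((min_le_right _ _).trans (min_le_right _ _))⟩
  intro x hx q hq hqy
  have := hball q (Metric.ball_subset_ball (min_le_left _ _) hqy) (foot_subset _ _ hq)
    (notMem_interior_of_mem_foot hx hq)
  rw [segment_eq_image', segment_eq_image'] at this
  rcases this with ⟨t, ht, rfl⟩ | ⟨t, ht, rfl⟩
  · exact ⟨t, ht.1, .inl rfl⟩
  · exact ⟨t, ht.1, .inr rfl⟩

/-- The line through two points. -/
def lineThrough (a b : Plane) : ℝ × ℝ × ℝ :=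
  (b.2 - a.2, a.1 - b.1, (b.2 - a.2) * a.1 + (a.1 - b.1) * a.2)

theorem onLine_of_mem_segment {a b x : Plane} (hx : x ∈ segment ℝ a b) :
    OnLine (lineThrough a b) x := by
  rw [segment_eq_image'] at hx
  obtain ⟨t, -, rfl⟩ := hx
  simp only [OnLine, lineThrough, Prod.fst_add, Prod.snd_add, Prod.smul_fst, Prod.smul_snd,
    Prod.fst_sub, Prod.snd_sub, smul_eq_mul]
  ring

theorem eventually_mem_segment_of_onLine {a b x : Plane} (h : a.1 ≠ b.1)
    (hx : x ∈ openSegment ℝ a b) :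
    ∀ᶠ y in 𝓝 x, OnLine (lineThrough a b) y → y ∈ segment ℝ a b := by
  rw [openSegment_eq_image'] at hx
  obtain ⟨t, ht, rfl⟩ := hx
  have hne : b.1 - a.1 ≠ 0 := sub_ne_zero.2 h.symm
  have hc : Continuous fun y : Plane => (y.1 - a.1) / (b.1 - a.1) := by fun_prop
  have hct := hc.tendsto (a + t • (b - a))
  have e : ((a + t • (b - a)).1 - a.1) / (b.1 - a.1) = t := by
    simp only [Prod.fst_add, Prod.smul_fst, Prod.fst_sub, smul_eq_mul]
    field_simp
    ring
  rw [e] at hct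
  filter_upwards [hct.eventually (Icc_mem_nhds ht.1 ht.2)] with y hy hl
  rw [segment_eq_image']
  refine ⟨_, hy, ?_⟩
  simp only [OnLine, lineThrough] at hl
  ext
  · simp only [Prod.fst_add, Prod.smul_fst, Prod.fst_sub, smul_eq_mul]
    field_simp
    ring
  · simp only [Prod.snd_add, Prod.smul_snd, Prod.snd_sub, smul_eq_mul]
    field_simp
    linarith

namespace IsScene
variable {c d : Plane} {m : ℕ} {n : Fin m → ℕ} {P : ∀ i, Polygon Plane (n i)}
  (S : IsScene c d P)
include S

omit S in
theorem region_subset (i : Fin m) : region (P i) ⊆ obstacles c d P :=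
  fun _ h => .inr (mem_iUnion.2 ⟨i, h⟩)

omit S in
theorem edgeSet_subset (i : Fin m) (k : Fin (n i)) : (P i).edgeSet ℝ k ⊆ obstacles c d P :=
  (edgeSet_subset_boundary _ k).trans ((boundary_subset_region _).trans (region_subset i))

theorem isClosed_obstacles : IsClosed (obstacles c d P) :=
  (isOpen_openSquare S.fst_ne c).isClosed_compl.union
    (isClosed_iUnion_of_finite fun i => isClosed_region (P i))

omit S in
theorem compl_subset : (obstacles c d P)ᶜ ⊆ openSquare c d := by
  intro x hx
  by_contra h
  exact hx (.inl h)

theorem isPreconnected_compl : IsPreconnected (obstacles c d P)ᶜ := by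
  have := isPreconnected_compl_biUnion Finset.univ
    (isOpen_openSquare S.fst_ne c).isClosed_compl
    (by rw [compl_compl]; exact (convex_openSquare c d).isPreconnected)
    (fun i => isClosed_region (P i)) (fun i => isPreconnected_compl_region (P i))
    (fun i => (disjoint_compl_left_iff_subset.2 (S.inside i))) S.disjoint
  simp only [Finset.mem_univ, iUnion_true] at this
  exact this

theorem vertex_fst_ne (i : Fin m) {j k : Fin (n i)} (h : j ≠ k) : (P i j).1 ≠ (P i k).1 := by
  intro e
  have := S.inj_fst (a₁ := ⟨i, j⟩) (a₂ := ⟨i, k⟩) e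
  simp only [Sigma.mk.injEq, heq_eq_eq, true_and] at this
  exact h this

theorem vertex_snd_ne (i : Fin m) {j k : Fin (n i)} (h : j ≠ k) : (P i j).2 ≠ (P i k).2 := by
  intro e
  have := S.inj_snd (a₁ := ⟨i, j⟩) (a₂ := ⟨i, k⟩) e
  simp only [Sigma.mk.injEq, heq_eq_eq, true_and] at this
  exact h this

theorem finRotate_ne (i : Fin m) (k : Fin (n i)) : finRotate (n i) k ≠ k := by
  have h3 := (S.simple i).1
  obtain ⟨l, hl⟩ : ∃ l, n i = l + 2 := ⟨n i - 2, by omega⟩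
  revert k
  rw [hl]
  intro k h
  have hs : k ∈ (finRotate (l + 2)).support := by
    rw [support_finRotate]
    exact Finset.mem_univ k
  exact Equiv.Perm.mem_support.1 hs h

/-- Boundary points of the obstacles lie on a polygon or on the frame. -/
theorem frontier_cases {y : Plane} (hy : y ∈ obstacles c d P)
    (hi : y ∉ interior (obstacles c d P)) :
    (∃ i, y ∈ (P i).boundary ℝ) ∨
      y ∉ openSquare c d ∧ |frameFst c d y| ≤ 1 ∧ |frameSnd c d y| ≤ 1 := by
  rcases hy with hy | hy
  · right
    refine ⟨hy, ?_⟩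
    by_contra hcon
    rw [not_and_or, not_le, not_le] at hcon
    apply hi
    rw [mem_interior_iff_mem_nhds]
    rcases hcon with h | h
    · filter_upwards [(continuous_frameFst c d).abs.continuousAt.eventually (lt_mem_nhds h)] with z hz
      exact .inl fun hm => absurd ((mem_openSquare S.fst_ne).1 hm).1 (not_lt.2 hz.le)
    · filter_upwards [(continuous_frameSnd c d).abs.continuousAt.eventually (lt_mem_nhds h)] with z hz
      exact .inl fun hm => absurd ((mem_openSquare S.fst_ne).1 hm).2 (not_lt.2 hz.le)
  · obtain ⟨i, hyi⟩ := mem_iUnion.1 hy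
    refine .inl ⟨i, ?_⟩
    by_contra hb
    exact hi (interior_mono (region_subset i) (mem_interior_region (P i) hyi hb))

/-- At a vertex the rays run along the two edges that meet there; inside an edge they are its two
halves. -/
theorem exists_rayPair_of_mem_boundary {i : Fin m} {y : Plane} (hy : y ∈ (P i).boundary ℝ) :
    ∃ δ f₁ f₂, RayPair (obstacles c d P) y δ f₁ f₂ := by
  -- near `y`, the boundary consists of the edges through `y`
  have hyr := boundary_subset_region _ hy
  have hnear : ∀ᶠ q in 𝓝 y, q ∈ obstacles c d P → q ∉ interior (obstacles c d P) →
      ∃ k, y ∈ (P i).edgeSet ℝ k ∧ q ∈ (P i).edgeSet ℝ k := by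
    have h1 : ∀ᶠ q in 𝓝 y, ∀ j, j ≠ i → q ∉ region (P j) := by
      rw [eventually_all]
      intro j
      by_cases hj : j = i
      · exact Eventually.of_forall fun q h => absurd hj h
      · filter_upwards [(isClosed_region (P j)).isOpen_compl.mem_nhds fun h =>
          disjoint_left.1 (S.disjoint j i hj) h hyr] with q hq _
        exact hq
    have h2 : ∀ᶠ q in 𝓝 y, ∀ k, y ∉ (P i).edgeSet ℝ k → q ∉ (P i).edgeSet ℝ k := by
      rw [eventually_all]
      intro k
      by_cases hk : y ∈ (P i).edgeSet ℝ k
      · exact Eventually.of_forall fun q h => absurd hk h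
      · filter_upwards [(isClosed_edgeSet (P i) k).isOpen_compl.mem_nhds hk] with q hq _
        exact hq
    filter_upwards [h1, h2, (isOpen_openSquare S.fst_ne c).mem_nhds (S.inside i hyr)]
      with q g1 g2 g3 hqO hqi
    rcases S.frontier_cases hqO hqi with ⟨j, hj⟩ | h
    · have hji : j = i := by
        by_contra hji
        exact g1 j hji (boundary_subset_region _ hj)
      subst hji
      obtain ⟨k, hk⟩ := mem_iUnion.1 hj
      exact ⟨k, by_contra fun h => g2 k h hk, hk⟩
    · exact absurd g3 h.1
  have hrot := S.finRotate_ne i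
  by_cases hv : ∃ k, y = P i k
  · obtain ⟨k, rfl⟩ := hv
    set k' := (finRotate (n i)).symm k
    have hk' : finRotate (n i) k' = k := Equiv.apply_symm_apply _ _
    have hkk' : k' ≠ k := fun h => hrot k' (hk'.trans h.symm)
    have e1 := edgeSet_eq_segment (P i) k
    have e2 := edgeSet_eq_segment (P i) k'
    rw [hk', segment_symm] at e2
    refine exists_rayPair (a := P i (finRotate (n i) k)) (b := P i k')
      (S.vertex_fst_ne i (hrot k)) (S.vertex_snd_ne i (hrot k))
      (S.vertex_fst_ne i hkk') (S.vertex_snd_ne i hkk')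
      (e1 ▸ edgeSet_subset i k) (e2 ▸ edgeSet_subset i k') ?_
    filter_upwards [hnear] with q hq hqO hqi
    obtain ⟨j, hyj, hqj⟩ := hq hqO hqi
    by_cases hjk : j = k
    · left
      rwa [← e1, ← hjk]
    · right
      rw [← e2]
      have := ((S.simple i).2.2 j k hjk ⟨hyj, vertex_mem_edgeSet (P i) k⟩).1
      rcases this with h | h
      · exact absurd ((S.simple i).2.1 h).symm hjk
      · have : k = finRotate (n i) j := (S.simple i).2.1 h
        have hj : j = k' := (finRotate (n i)).injective (by rw [hk', this])
        rwa [← hj]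
  · obtain ⟨k, hk⟩ := mem_iUnion.1 hy
    have e := edgeSet_eq_segment (P i) k
    have hyk := hk
    rw [e] at hyk
    have hopen : y ∈ openSegment ℝ (P i k) (P i (finRotate (n i) k)) :=
      mem_openSegment_of_ne_left_right (fun h => hv ⟨_, h.symm⟩) (fun h => hv ⟨_, h.symm⟩) hyk
    have h1 := S.vertex_fst_ne i (hrot k)
    have h2 := S.vertex_snd_ne i (hrot k)
    have hsubL : segment ℝ y (P i k) ⊆ (P i).edgeSet ℝ k := by
      rw [e]
      exact (convex_segment _ _).segment_subset hyk (left_mem_segment _ _ _)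
    have hsubR : segment ℝ y (P i (finRotate (n i) k)) ⊆ (P i).edgeSet ℝ k := by
      rw [e]
      exact (convex_segment _ _).segment_subset hyk (right_mem_segment _ _ _)
    rw [openSegment_eq_image'] at hopen
    obtain ⟨t, ⟨ht0, ht1⟩, hty⟩ := hopen
    have hy1 : y.1 = (P i k).1 + t * ((P i (finRotate (n i) k)).1 - (P i k).1) := by
      rw [← hty]; rfl
    have hy2 : y.2 = (P i k).2 + t * ((P i (finRotate (n i) k)).2 - (P i k).2) := by
      rw [← hty]; rfl
    have key : ∀ {u v w : ℝ}, v ≠ u → w = u + t * (v - u) → u ≠ w ∧ v ≠ w := by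
      intro u v w huv hw
      constructor
      · intro h
        have : t * (v - u) = 0 := by linarith
        exact (mul_ne_zero ht0.ne' (sub_ne_zero.2 huv)) this
      · intro h
        have : (1 - t) * (v - u) = 0 := by rw [← h] at hw; linarith
        exact (mul_ne_zero (by linarith) (sub_ne_zero.2 huv)) this
    refine exists_rayPair (key h1 hy1).1 (key h2 hy2).1 (key h1 hy1).2 (key h2 hy2).2
      (hsubL.trans (edgeSet_subset i k)) (hsubR.trans (edgeSet_subset i k)) ?_
    filter_upwards [hnear] with q hq hqO hqi
    obtain ⟨j, hyj, hqj⟩ := hq hqO hqi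
    have hjk : j = k := by
      by_contra hjk
      rcases ((S.simple i).2.2 j k hjk ⟨hyj, hk⟩).1 with h | h
      · exact hv ⟨_, h⟩
      · exact hv ⟨_, h⟩
    rw [hjk, e, segment_eq_image'] at hqj
    obtain ⟨s, ⟨hs0, hs1⟩, rfl⟩ := hqj
    rw [← hty]
    rcases le_total s t with hst | hst
    · left
      refine ⟨s / t, 1 - s / t, by positivity, ?_, by ring, ?_⟩
      · rw [sub_nonneg, div_le_one ht0]
        exact hst
      · have : s / t * t = s := div_mul_cancel₀ _ ht0.ne'
        calc _ = P i k + (s / t * t) • (P i (finRotate (n i) k) - P i k) := by module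
          _ = _ := by rw [this]
    · right
      have ht1' : 0 < 1 - t := by linarith
      refine ⟨(1 - s) / (1 - t), 1 - (1 - s) / (1 - t), div_nonneg (by linarith) ht1'.le, ?_,
        by ring, ?_⟩
      · rw [sub_nonneg, div_le_one ht1']
        linarith
      · have : 1 - (1 - s) / (1 - t) * (1 - t) = s := by rw [div_mul_cancel₀ _ ht1'.ne']; ring
        calc _ = P i k + (1 - (1 - s) / (1 - t) * (1 - t)) •
              (P i (finRotate (n i) k) - P i k) := by module
          _ = _ := by rw [this]

/-- On a side of the frame the rays are the two directions of the side; at a corner they run along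
the two sides. -/
theorem exists_rayPair_of_notMem_openSquare {y : Plane} (hy : y ∉ openSquare c d)
    (h1 : |frameFst c d y| ≤ 1) (h2 : |frameSnd c d y| ≤ 1) :
    ∃ δ f₁ f₂, RayPair (obstacles c d P) y δ f₁ f₂ := by
  have hd := S.fst_ne
  have hne : ∀ r : ℝ, r ≠ 0 → (r • d).1 ≠ 0 ∧ (r • d).2 ≠ 0 := fun r hr =>
    ⟨mul_ne_zero hr hd, mul_ne_zero hr S.snd_ne⟩
  have hne' : ∀ r : ℝ, r ≠ 0 → (r • ((-d.2, d.1) : Plane)).1 ≠ 0 ∧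
      (r • ((-d.2, d.1) : Plane)).2 ≠ 0 := fun r hr =>
    ⟨mul_ne_zero hr (neg_ne_zero.2 S.snd_ne), mul_ne_zero hr hd⟩
  -- the frame near `y`
  have hnear : ∃ δ > 0, ∀ x ∉ obstacles c d P, ∀ q ∈ foot (obstacles c d P) x,
      q ∈ Metric.ball y δ → |frameFst c d q - frameFst c d y| < 1 ∧
        |frameSnd c d q - frameSnd c d y| < 1 ∧
        (|frameFst c d y| < 1 → |frameFst c d q| < 1) ∧
        (|frameSnd c d y| < 1 → |frameSnd c d q| < 1) ∧
        (|frameFst c d q| = 1 ∧ |frameSnd c d q| ≤ 1 ∨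
          |frameFst c d q| ≤ 1 ∧ |frameSnd c d q| = 1) := by
    have hF := (continuous_frameFst c d).tendsto y
    have hS := (continuous_frameSnd c d).tendsto y
    have g1 : ∀ᶠ q in 𝓝 y, |frameFst c d y| < 1 → |frameFst c d q| < 1 := by
      by_cases h : |frameFst c d y| < 1
      · exact (hF.abs.eventually (gt_mem_nhds h)).mono fun q hq _ => hq
      · exact Eventually.of_forall fun q h' => absurd h' h
    have g2 : ∀ᶠ q in 𝓝 y, |frameSnd c d y| < 1 → |frameSnd c d q| < 1 := by
      by_cases h : |frameSnd c d y| < 1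
      · exact (hS.abs.eventually (gt_mem_nhds h)).mono fun q hq _ => hq
      · exact Eventually.of_forall fun q h' => absurd h' h
    have g3 : ∀ᶠ q in 𝓝 y, ∀ i, q ∉ region (P i) := by
      rw [eventually_all]
      exact fun i => (isClosed_region (P i)).isOpen_compl.mem_nhds fun h => hy (S.inside i h)
    obtain ⟨δ, hδ, hball⟩ := Metric.eventually_nhds_iff_ball.1
      ((((hF.eventually (Metric.ball_mem_nhds _ one_pos)).and
        (hS.eventually (Metric.ball_mem_nhds _ one_pos))).and (g1.and g2)).and g3)
    refine ⟨δ, hδ, fun x hx q hq hqy => ?_⟩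
    obtain ⟨⟨⟨b1, b2⟩, b3, b4⟩, b5⟩ := hball q hqy
    refine ⟨b1, b2, b3, b4, ?_⟩
    rcases S.frontier_cases (foot_subset _ _ hq) (notMem_interior_of_mem_foot hx hq) with
      ⟨i, hi⟩ | ⟨h, h', h''⟩
    · exact absurd (boundary_subset_region _ hi) (b5 i)
    · rw [mem_openSquare hd, not_and_or, not_lt, not_lt] at h
      rcases h with h | h
      · exact .inl ⟨le_antisymm h' h, h''⟩
      · exact .inr ⟨h', le_antisymm h'' h⟩
  obtain ⟨δ, hδ, hnear⟩ := hnear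
  have hsign : ∀ {u v : ℝ}, |u| = 1 → |v| = 1 → |u - v| < 1 → u = v := by
    intro u v hu hv huv
    rcases eq_or_eq_neg_of_abs_eq hu with rfl | rfl <;>
      rcases eq_or_eq_neg_of_abs_eq hv with rfl | rfl <;>
        first | rfl | norm_num at huv
  have hrepr : ∀ q, q = y + (frameFst c d q - frameFst c d y) • d +
      (frameSnd c d q - frameSnd c d y) • ((-d.2, d.1) : Plane) := by
    intro q
    conv_lhs => rw [frame_repr hd c q]
    conv_rhs => rw [frame_repr hd c y]
    simp only [frameFst_add hd, frameSnd_add hd]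
    have e1 : frameFst c d c = 0 := by simp [frameFst]
    have e2 : frameSnd c d c = 0 := by simp [frameSnd]
    rw [e1, e2]
    module
  have hout1 : |frameFst c d y| = 1 → ∀ s : ℝ,
      y + s • ((-d.2, d.1) : Plane) ∈ obstacles c d P := by
    intro h s
    left
    intro hm
    have := ((mem_openSquare hd).1 hm).1
    rw [frameFst_add_smul_perp hd, h] at this
    exact lt_irrefl _ this
  have hout2 : |frameSnd c d y| = 1 → ∀ s : ℝ, y + s • d ∈ obstacles c d P := by
    intro h s
    left
    intro hm
    have := ((mem_openSquare hd).1 hm).2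
    rw [frameSnd_add_smul hd, h] at this
    exact lt_irrefl _ this
  rcases h1.lt_or_eq with h1' | h1' <;> rcases h2.lt_or_eq with h2' | h2'
  · exact absurd ((mem_openSquare hd).2 ⟨h1', h2'⟩) hy
  · refine ⟨δ, (1 : ℝ) • d, (-1 : ℝ) • d, hδ, hne 1 (by norm_num), hne (-1) (by norm_num), ?_, ?_, ?_⟩
    · intro x hx q hq hqy
      obtain ⟨-, b2, b3, -, b5⟩ := hnear x hx q hq hqy
      have hq2 : |frameSnd c d q| = 1 := by
        rcases b5 with b5 | b5
        · exact absurd (b3 h1') (by rw [b5.1]; exact lt_irrefl _)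
        · exact b5.2
      have e := hrepr q
      rw [hsign hq2 h2' b2, sub_self, zero_smul, add_zero] at e
      rcases le_total 0 (frameFst c d q - frameFst c d y) with h | h
      · exact ⟨_, h, .inl (by rw [one_smul]; exact e)⟩
      · refine ⟨_, neg_nonneg.2 h, .inr ?_⟩
        rw [smul_smul, neg_mul_neg, mul_one]
        exact e
    · intro t _ _
      rw [one_smul]
      exact hout2 h2' t
    · intro t _ _
      rw [smul_smul]
      exact hout2 h2' _
  · refine ⟨δ, (1 : ℝ) • ((-d.2, d.1) : Plane), (-1 : ℝ) • ((-d.2, d.1) : Plane), hδ,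
      hne' 1 (by norm_num), hne' (-1) (by norm_num), ?_, ?_, ?_⟩
    · intro x hx q hq hqy
      obtain ⟨b1, -, -, b4, b5⟩ := hnear x hx q hq hqy
      have hq1 : |frameFst c d q| = 1 := by
        rcases b5 with b5 | b5
        · exact b5.1
        · exact absurd (b4 h2') (by rw [b5.2]; exact lt_irrefl _)
      have e := hrepr q
      rw [hsign hq1 h1' b1, sub_self, zero_smul, add_zero] at e
      rcases le_total 0 (frameSnd c d q - frameSnd c d y) with h | h
      · exact ⟨_, h, .inl (by rw [one_smul]; exact e)⟩
      · refine ⟨_, neg_nonneg.2 h, .inr ?_⟩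
        rw [smul_smul, neg_mul_neg, mul_one]
        exact e
    · intro t _ _
      rw [one_smul]
      exact hout1 h1' t
    · intro t _ _
      rw [smul_smul]
      exact hout1 h1' _
  · -- a corner of the frame
    set u := frameFst c d y
    set v := frameSnd c d y
    have hu : u * u = 1 := by rw [← abs_mul_abs_self, h1', one_mul]
    have hv : v * v = 1 := by rw [← abs_mul_abs_self, h2', one_mul]
    have hu0 : -u ≠ 0 := fun h => by rw [neg_eq_zero.1 h] at hu; norm_num at hu
    have hv0 : -v ≠ 0 := fun h => by rw [neg_eq_zero.1 h] at hv; norm_num at hv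
    refine ⟨δ, (-u) • d, (-v) • ((-d.2, d.1) : Plane), hδ, hne _ hu0, hne' _ hv0, ?_, ?_, ?_⟩
    · intro x hx q hq hqy
      obtain ⟨b1, b2, -, -, b5⟩ := hnear x hx q hq hqy
      have e := hrepr q
      have key : ∀ {w z : ℝ}, z * z = 1 → |z| = 1 → |w| ≤ 1 →
          0 ≤ -z * (w - z) := by
        intro w z hz hz1 hw
        have : z * w ≤ 1 := (le_abs_self _).trans (by rw [abs_mul, hz1, one_mul]; exact hw)
        nlinarith
      rcases b5 with ⟨b5, b6⟩ | ⟨b6, b5⟩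
      · rw [hsign b5 h1' b1, sub_self, zero_smul, add_zero] at e
        refine ⟨_, key hv h2' b6, .inr ?_⟩
        rw [smul_smul]
        have : -v * (frameSnd c d q - v) * -v = frameSnd c d q - v := by
          linear_combination (frameSnd c d q - v) * hv
        rw [this]
        exact e
      · rw [hsign b5 h2' b2, sub_self, zero_smul, add_zero] at e
        refine ⟨_, key hu h1' b6, .inl ?_⟩
        rw [smul_smul]
        have : -u * (frameFst c d q - u) * -u = frameFst c d q - u := by
          linear_combination (frameFst c d q - u) * hu
        rw [this]
        exact e
    · intro t _ _
      rw [smul_smul]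
      exact hout2 h2' _
    · intro t _ _
      rw [smul_smul]
      exact hout1 h1' _

theorem exists_rayPair {y : Plane} (hy : y ∈ obstacles c d P)
    (hcl : y ∈ closure (medialAxis (obstacles c d P))) :
    ∃ δ f₁ f₂, RayPair (obstacles c d P) y δ f₁ f₂ := by
  have hi : y ∉ interior (obstacles c d P) := by
    intro hi
    obtain ⟨w, hw, hwM⟩ := mem_closure_iff.1 hcl _ isOpen_interior hi
    exact medialAxis_subset_compl hwM (interior_subset hw)
  rcases S.frontier_cases hy hi with ⟨i, hi⟩ | ⟨h, h1, h2⟩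
  · exact S.exists_rayPair_of_mem_boundary hi
  · exact S.exists_rayPair_of_notMem_openSquare h h1 h2

/-- The obstacles are made up of finitely many vertices and edges in general position. -/
theorem exists_tame : ∃ Vt L, Tame (obstacles c d P) Vt L := by
  classical
  have hd := S.fst_ne
  set N := d.1 ^ 2 + d.2 ^ 2
  have hN : N ≠ 0 := (frame_norm_pos hd).ne'
  set Vt : Finset Plane := Finset.univ.image fun v : Σ i, Fin (n i) => P v.1 v.2
  -- The lines on which a frame coordinate equals `e`; for `e = ±1` they carry the sides of the
  -- frame.
  set lF : ℝ → ℝ × ℝ × ℝ := fun e => (d.1, d.2, d.1 * c.1 + d.2 * c.2 + e * N)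
  set lS : ℝ → ℝ × ℝ × ℝ := fun e => (-d.2, d.1, -d.2 * c.1 + d.1 * c.2 + e * N)
  have hlF : ∀ e x, OnLine (lF e) x ↔ frameFst c d x = e := by
    intro e x
    simp only [OnLine, lF, frameFst]
    rw [div_eq_iff hN]
    constructor <;> intro h <;> linarith
  have hlS : ∀ e x, OnLine (lS e) x ↔ frameSnd c d x = e := by
    intro e x
    simp only [OnLine, lS, frameSnd]
    rw [div_eq_iff hN]
    constructor <;> intro h <;> linarith
  refine ⟨Vt, (Finset.univ.image fun v : Σ i, Fin (n i) =>
    lineThrough (P v.1 v.2) (P v.1 (finRotate (n v.1) v.2))) ∪ {lF 1, lF (-1), lS 1, lS (-1)},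
    S.isClosed_obstacles, ?_, (isBounded_openSquare c d).subset compl_subset, ?_, ?_, ?_, ?_⟩
  · by_contra h
    rw [not_nonempty_iff_eq_empty] at h
    have := (isBounded_openSquare c d).subset (compl_subset (P := P))
    rw [h, compl_empty] at this
    exact NormedSpace.noncompactSpace ℝ Plane |>.noncompact_univ
      (Metric.isCompact_of_isClosed_isBounded isClosed_univ this)
  · intro x hx y hy hxy
    simp only [Vt, Finset.coe_image, Finset.coe_univ, image_univ, mem_range] at hx hy
    obtain ⟨v, rfl⟩ := hx
    obtain ⟨w, rfl⟩ := hy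
    rw [S.inj_fst hxy]
  · intro x hx y hy hxy
    simp only [Vt, Finset.coe_image, Finset.coe_univ, image_univ, mem_range] at hx hy
    obtain ⟨v, rfl⟩ := hx
    obtain ⟨w, rfl⟩ := hy
    rw [S.inj_snd hxy]
  · intro l hl
    simp only [Finset.mem_union, Finset.mem_image, Finset.mem_univ, true_and, Finset.mem_insert,
      Finset.mem_singleton] at hl
    rcases hl with ⟨v, rfl⟩ | rfl | rfl | rfl | rfl
    · have := S.finRotate_ne v.1 v.2
      exact ⟨sub_ne_zero.2 (S.vertex_snd_ne v.1 this), sub_ne_zero.2 (S.vertex_fst_ne v.1 this.symm)⟩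
    · exact ⟨hd, S.snd_ne⟩
    · exact ⟨hd, S.snd_ne⟩
    · exact ⟨neg_ne_zero.2 S.snd_ne, hd⟩
    · exact ⟨neg_ne_zero.2 S.snd_ne, hd⟩
  · intro x q hx hq
    -- The whole line of a side is outside the open square. So corners of the frame count as
    -- interior points of an edge, and no general position is needed for them.
    have houtF : ∀ z, |frameFst c d z| = 1 → z ∈ obstacles c d P := fun z hz =>
      .inl fun hm => absurd ((mem_openSquare hd).1 hm).1 (by rw [hz]; exact lt_irrefl _)
    have houtS : ∀ z, |frameSnd c d z| = 1 → z ∈ obstacles c d P := fun z hz =>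
      .inl fun hm => absurd ((mem_openSquare hd).1 hm).2 (by rw [hz]; exact lt_irrefl _)
    rcases S.frontier_cases (foot_subset _ _ hq) (notMem_interior_of_mem_foot hx hq) with
      ⟨i, hi⟩ | ⟨h, h1, h2⟩
    · obtain ⟨k, hk⟩ := mem_iUnion.1 hi
      have e := edgeSet_eq_segment (P i) k
      have hqk := hk
      rw [e] at hqk
      by_cases hv : ∃ j, q = P i j
      · obtain ⟨j, rfl⟩ := hv
        exact .inl (Finset.mem_image.2 ⟨⟨i, j⟩, Finset.mem_univ _, rfl⟩)
      · right
        refine ⟨lineThrough (P i k) (P i (finRotate (n i) k)), Finset.mem_union_left _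
          (Finset.mem_image.2 ⟨⟨i, k⟩, Finset.mem_univ _, rfl⟩), onLine_of_mem_segment hqk, ?_⟩
        have hopen : q ∈ openSegment ℝ (P i k) (P i (finRotate (n i) k)) :=
          mem_openSegment_of_ne_left_right (fun h => hv ⟨_, h.symm⟩) (fun h => hv ⟨_, h.symm⟩) hqk
        filter_upwards [eventually_mem_segment_of_onLine
          (S.vertex_fst_ne i (S.finRotate_ne i k).symm) hopen] with z hz hzl
        exact edgeSet_subset i k (e ▸ hz hzl)
    · right
      rw [mem_openSquare hd, not_and_or, not_lt, not_lt] at h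
      rcases h with h | h
      · have h' := le_antisymm h1 h
        rcases eq_or_eq_neg_of_abs_eq h' with h'' | h''
        · exact ⟨lF 1, by simp, (hlF _ _).2 h'', Eventually.of_forall fun z hz =>
            houtF z (by rw [(hlF _ _).1 hz]; norm_num)⟩
        · exact ⟨lF (-1), by simp, (hlF _ _).2 h'', Eventually.of_forall fun z hz =>
            houtF z (by rw [(hlF _ _).1 hz]; norm_num)⟩
      · have h' := le_antisymm h2 h
        rcases eq_or_eq_neg_of_abs_eq h' with h'' | h''
        · exact ⟨lS 1, by simp, (hlS _ _).2 h'', Eventually.of_forall fun z hz =>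
            houtS z (by rw [(hlS _ _).1 hz]; norm_num)⟩
        · exact ⟨lS (-1), by simp, (hlS _ _).2 h'', Eventually.of_forall fun z hz =>
            houtS z (by rw [(hlS _ _).1 hz]; norm_num)⟩

/-- Every point of the obstacles is connected, within the obstacles, to infinity or to the polygon
it belongs to. -/
theorem exists_pieces : ∃ x : Fin m → Plane, ∀ q ∈ obstacles c d P, ∃ A ⊆ obstacles c d P,
    IsPreconnected A ∧ q ∈ A ∧ (¬ Bornology.IsBounded A ∨ ∃ i, x i ∈ A) := by
  have hpos : ∀ i, 0 < n i := fun i => by have := (S.simple i).1; omega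
  refine ⟨fun i => P i ⟨0, hpos i⟩, fun q hq => ?_⟩
  rcases hq with hq | hq
  · obtain ⟨A, h1, h2, h3, h4⟩ := exists_unbounded_of_notMem_openSquare S.fst_ne hq
    exact ⟨A, h1.trans subset_union_left, h2, h3, .inl h4⟩
  · obtain ⟨i, hi⟩ := mem_iUnion.1 hq
    obtain ⟨A, h1, h2, h3, h4⟩ := exists_isPreconnected_of_mem_region (P i) hi ⟨0, hpos i⟩
    exact ⟨A, h1.trans (region_subset i), h2, h3, .inr ⟨i, h4⟩⟩

end IsScene
end Corridor
end

/-! ### Assembling the bounds -/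

noncomputable section
open Set Filter Topology Real
namespace Corridor

theorem IsStar.carrier_eq_spokes {O : Set Plane} {G : Finset (Plane × Plane)} {V : Finset Plane}
    {S : Finset (Plane × Plane)} (St : IsStar O V S) (hV : ∀ p, p ∈ V ↔ p ∈ branchVertices G)
    (hM : ∀ p ∈ V, p ∈ medialAxis O) : carrier S = spokes O G := by
  ext x
  simp only [carrier, spokes, mem_iUnion]
  constructor
  · rintro ⟨s, hs, hx⟩
    obtain ⟨h1, h2⟩ := (St.mem_iff s).1 hs
    exact ⟨s.1, (hV _).1 h1, s.2, (contacts_eq_foot (hM _ h1)).symm ▸ h2, hx⟩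
  · rintro ⟨p, hp, q, hq, hx⟩
    have hp := (hV p).2 hp
    exact ⟨(p, q), (St.mem_iff _).2 ⟨hp, contacts_eq_foot (hM p hp) ▸ hq⟩, hx⟩

theorem corridors_eq (O : Set Plane) (G : Finset (Plane × Plane)) :
    corridors O G = {C | IsCell (Oᶜ \ spokes O G) C} := rfl

/-- The corridor decomposition of obstacles with at most `m` bounded pieces. -/
theorem Tame.corridors_le {O : Set Plane} {Vt : Finset Plane} {L : Finset (ℝ × ℝ × ℝ)}
    (T : Tame O Vt L) {G : Finset (Plane × Plane)} (hGc : IsSegmentComplex G)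
    (hG : carrier G = closure (medialAxis O)) (hF : IsPreconnected Oᶜ)
    (hrays : ∀ y ∈ closure (medialAxis O), y ∈ O → ∃ δ f₁ f₂, RayPair O y δ f₁ f₂)
    {m : ℕ} (hm : 1 ≤ m) (x : Fin m → Plane)
    (hO : ∀ q ∈ O, ∃ A ⊆ O, IsPreconnected A ∧ q ∈ A ∧
      (¬ Bornology.IsBounded A ∨ ∃ i, x i ∈ A)) :
    (corridors O G).Finite ∧ (corridors O G).ncard ≤ 32 * m ∧
      (2 ≤ m → (∀ p ∈ branchVertices G, (contacts O p).encard ≤ (degree (reduce G) p : ℕ∞)) →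
        (corridors O G).ncard ≤ 3 * m - 3) := by
  classical
  set H := reduce G
  have hHG : H ⊆ G := reduce_subset G
  have hH : IsSegmentComplex H := hGc.mono hHG
  have hHM : carrier H ⊆ medialAxis O := T.carrier_reduce_subset hGc hG hrays
  have hdeg : ∀ p, degree H p ≠ 1 := degree_reduce_ne_one G
  set V : Finset Plane := (endpoints H).filter fun p => 3 ≤ degree H p
  have hV : ∀ p, p ∈ V ↔ 3 ≤ degree H p := fun p => by
    simp only [V, Finset.mem_filter, and_iff_right_iff_imp, mem_endpoints_iff]
    omega
  have hVM : ∀ p ∈ V, p ∈ medialAxis O := fun p hp =>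
    hHM (mem_carrier_of_mem_endpoints (Finset.mem_filter.1 hp).1)
  obtain ⟨S, St⟩ := T.exists_isStar fun p hp => medialAxis_subset_compl (hVM p hp)
  have hsp := St.carrier_eq_spokes (G := G) hV hVM
  obtain ⟨hcard, hsum⟩ := card_le_of_cycles hH hdeg
    (T.card_add_one_le hGc hG hHG hHM hm x hO) hV
  rw [corridors_eq, ← hsp]
  rcases V.eq_empty_or_nonempty with hV0 | hVne
  -- Without branch points there are no spokes and at most one cell; `1 ≤ 3 * m - 3` is where `m ≥
  -- 2` matters.
  · have hS : carrier S = ∅ := by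
      rw [hsp, spokes]
      refine iUnion_eq_empty.2 fun p => iUnion_eq_empty.2 fun hp => ?_
      exact absurd ((hV p).2 hp) (by rw [hV0]; exact Finset.notMem_empty p)
    rw [hS, sdiff_empty]
    obtain ⟨h1, h2⟩ := finite_cells_of_isPreconnected hF
    exact ⟨h1, by omega, fun _ _ => by omega⟩
  · obtain ⟨h1, h2⟩ := St.finite_cells T hF hVne
    -- The linear bound is `16 * V.card` with `V.card + 2 ≤ 2 * m`.
    refine ⟨h1, by omega, fun hm2 hcon => ?_⟩
    have key := fun p (hp : p ∈ V) =>
      T.angles_eq_of_encard_le hGc hG hHG (hVM p hp) (hcon p ((hV p).1 hp))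
    have Sb : IsBranchStar O V S := ⟨St, fun p hp => by
      rw [← (key p hp).2.2, ← (key p hp).2.1]
      exact (hV p).1 hp, fun p hp => (key p hp).2.2⟩
    have := Sb.two_mul_ncard_cells_le T hG hH hHM hV hF (fun p hp => (key p hp).1) hVne hdeg
    omega

end Corridor
end

theorem mainTheorem4 :
    ∃ K : ℕ, ∀ (m : ℕ), 1 ≤ m →
      ∀ (n : Fin m → ℕ) (P : ∀ i, Polygon Corridor.Plane (n i)) (c d : Corridor.Plane),
        -- the polygons are simple and disjoint
        (∀ i, Corridor.IsSimple (P i)) →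
        (∀ i j, i ≠ j → Disjoint (Corridor.region (P i)) (Corridor.region (P j))) →
        -- the frame is a square without axis-parallel sides, with the polygons in its interior
        d.1 ≠ 0 → d.2 ≠ 0 →
        (∀ i, Corridor.region (P i) ⊆ Corridor.openSquare c d) →
        -- no two vertices of the polygons lie on a common vertical or horizontal line
        Function.Injective (fun v : Σ i, Fin (n i) => (P v.1 v.2).1) →
        Function.Injective (fun v : Σ i, Fin (n i) => (P v.1 v.2).2) →
        -- the medial axis (with its limit points) is a collection of interior disjoint segments
        (∃ G : Finset (Corridor.Plane × Corridor.Plane), Corridor.IsSegmentComplex G ∧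
          Corridor.carrier G = closure (Corridor.medialAxis (Corridor.obstacles c d P))) ∧
        -- and for every such collection the corridor decomposition has few cells
        ∀ G : Finset (Corridor.Plane × Corridor.Plane), Corridor.IsSegmentComplex G →
          Corridor.carrier G = closure (Corridor.medialAxis (Corridor.obstacles c d P)) →
          (Corridor.corridors (Corridor.obstacles c d P) G).Finite ∧
          (Corridor.corridors (Corridor.obstacles c d P) G).ncard ≤ K * m ∧
          (2 ≤ m →
            (∀ p ∈ Corridor.branchVertices G,
              (Corridor.contacts (Corridor.obstacles c d P) p).encard ≤
                (Corridor.degree (Corridor.reduce G) p : ℕ∞)) →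
            (Corridor.corridors (Corridor.obstacles c d P) G).ncard ≤ 3 * m - 3) := by
  -- At most 16 cells at each of fewer than `2 * m` branch points.
  refine ⟨32, fun m hm n P c d hsimple hdisj hd₁ hd₂ hin hinj₁ hinj₂ => ?_⟩
  have S : Corridor.IsScene c d P := ⟨hsimple, hdisj, hd₁, hd₂, hin, hinj₁, hinj₂⟩
  obtain ⟨Vt, L, T⟩ := S.exists_tame
  obtain ⟨G, hGc, hG, -⟩ := T.exists_complex
  obtain ⟨x, hx⟩ := S.exists_pieces
  exact ⟨⟨G, hGc, hG⟩, fun G hGc hG => T.corridors_le hGc hG S.isPreconnected_compl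
    (fun y hcl hy => S.exists_rayPair hy hcl) hm x hx⟩
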